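/- Let $T>0$, $\lambda>0$, $m\ge 1$, let $\mathbb T=\mathbb R/\mathbb Z$, and let $\mathcal M(\mathbb T)$ be the space of finite non-negative measures on $\mathbb T$ with the weak topology. For each $N$ let $\{1,\dots,N\}=I_1^N\cup\dots\cup I_m^N$ be a partition into $m$ color classes with $\lim_{N\to\infty}|I_c^N|/N=\bar\rho_c>0$ for every $c$. Let $\rho^0$ be a bounded probability density on $\mathbb T$, let $x_1^N,\dots,x_N^N$ be i.i.d. with density $\rho^0$, and suppose that the initial empirical densities of colors $$\tilde\mu^N(0)=\Big(\tfrac1N\sum_{i\in I_c^N}\delta_{x_i^N}\Big)_{1\le c\le m}\in\mathcal M(\mathbb T)^m$$ satisfy the large deviation principle with scale $N$ and (lower semicontinuous) rate function $I_{init}^m:\mathcal M(\mathbb T)^m\to[0,\infty]$. For $\tilde\rho=(\rho_1,\dots,\rho_m)^\dagger$ put $\rho=\sum_c\rho_c$ and $$D(\tilde\rho)_{ij}=\frac{\delta_{ij}\lambda+\rho_i}{\lambda+\rho},\qquad A(\tilde\rho)_{ij}=\frac{\delta_{ij}\lambda\rho_j+\rho_i\rho_j}{\lambda+\rho},\qquad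 \chi(\tilde\rho)=\mathrm{diag}(1/\rho_1,\dots,1/\rho_m).$$ Let $\mathscr D_{color}^m$ be the set of paths $\tilde\mu\in C([0,T],\mathcal M(\mathbb T)^m)$ such that $\tilde\mu(t)=\tilde\rho(t,x)\,dx$ with $\rho_c\ge 0$ and $\int_{\mathbb T}\rho_c(t,x)\,dx=\bar\rho_c$ for all $t\in[0,T]$ and all $c$, such that every $\rho_c$ is weakly differentiable in $x$ with $$\int_0^T\!\!\int_{\mathbb T}\nabla\tilde\rho^\dagger\,\chi A\chi(\tilde\rho)\,\nabla\tilde\rho\,dx\,dt=\int_0^T\!\!\int_{\mathbb T}\Big[\frac{(\nabla\rho)^2}{\lambda+\rho}+\sum_{c=1}^m\frac{\lambda(\nabla\rho_c)^2}{(\lambda+\rho)\rho_c}\Big]dx\,dt<\infty$$ (with $0/0=0$), and such that $\int_{\mathbb T}\rho(0,x)\log\rho(0,x)\,dx<\infty$. For $\tilde\mu=\tilde\rho\,dx\in\mathscr D_{color}^m$ let $$I_{dyn}^m(\tilde\mu)=\sup_{\phi\in C^\infty([0,T]\times\mathbb T)^m}\Big\{\int_{\mathbb T}\phi^\dagger\tilde\rho(T,x)\,dx-\int_{\mathbb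 T}\phi^\dagger\tilde\rho(0,x)\,dx+\int_0^T\!\!\int_{\mathbb T}\Big[-\partial_t\phi^\dagger\tilde\rho+\tfrac12\nabla\phi^\dagger D(\tilde\rho)\nabla\tilde\rho-\tfrac12\nabla\phi^\dagger A(\tilde\rho)\nabla\phi\Big]dx\,dt\Big\},$$ and let $I_{dyn}^m(\tilde\mu)=\infty$ for $\tilde\mu\notin\mathscr D_{color}^m$. Finally let $I_{color}^m(\tilde\mu)=I_{init}^m(\tilde\mu(0))+I_{dyn}^m(\tilde\mu)$. Theorem. The functional $I_{color}^m$ is lower semicontinuous on $C([0,T],\mathcal M(\mathbb T)^m)$ with the topology of uniform convergence. -/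

import Mathlib

open MeasureTheory Filter Topology
open scoped NNReal ENNReal Matrix

noncomputable section

namespace ColorLDP

/-- The one-dimensional torus `𝕋 = ℝ / ℤ`; its `volume` is Lebesgue measure, of total mass `1`. -/
abbrev Torus : Type := UnitAddCircle

/-- `ℳ(𝕋)^m`: vectors of `m` finite non-negative measures on the torus, with the (product of the)
topology of weak convergence. -/
abbrev ColorMeasure (m : ℕ) : Type := Fin m → FiniteMeasure Torus

/-- The path space `C([0,T], ℳ(𝕋)^m)`, with the topology of uniform convergence
(the compact-open topology, `[0,T]` being compact). -/
abbrev ColorPath (m : ℕ) (T : ℝ) : Type := C(Set.Icc (0 : ℝ) T, ColorMeasure m)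

/-! ### The large deviation principle and the initial configuration -/

/-- The laws of the random elements `Y N` (defined on the probability spaces `(Ω N, P N)`) satisfy
the large deviation principle with rate function `I` and scale `N`. A rate function is a lower
semicontinuous function with values in `[0, ∞]`. -/
structure SatisfiesLDP {X : Type*} [TopologicalSpace X] {Ω : ℕ → Type*}
    [∀ N, MeasurableSpace (Ω N)] (P : ∀ N, Measure (Ω N)) (Y : ∀ N, Ω N → X)
    (I : X → ℝ≥0∞) : Prop where
  lowerSemicontinuous : LowerSemicontinuous I
  lower_bound : ∀ G : Set X, IsOpen G →
    -(⨅ x ∈ G, (I x : EReal)) ≤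
      liminf (fun N : ℕ => (((N : ℝ)⁻¹ : ℝ) : EReal) * ENNReal.log (P N (Y N ⁻¹' G))) atTop
  upper_bound : ∀ F : Set X, IsClosed F →
    limsup (fun N : ℕ => (((N : ℝ)⁻¹ : ℝ) : EReal) * ENNReal.log (P N (Y N ⁻¹' F))) atTop ≤
      -(⨅ x ∈ F, (I x : EReal))

/-- The law on `𝕋^N` of `N` i.i.d. particles with probability density `ρ₀`. -/
def initialLaw (ρ₀ : Torus → ℝ) (N : ℕ) : Measure (Fin N → Torus) :=
  Measure.pi fun _ => volume.withDensity fun x => ENNReal.ofReal (ρ₀ x)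

/-- The empirical density of colors of a configuration `x` of `N` particles, in which particle `i`
has color `color i`: its `c`-th component is `(1/N) ∑_{i : color i = c} δ_{x i}`. -/
def empiricalColor {m N : ℕ} (color : Fin N → Fin m) (x : Fin N → Torus) : ColorMeasure m :=
  fun c => (N : ℝ≥0)⁻¹ •
    ∑ i ∈ Finset.univ.filter (fun i => color i = c), (diracProba (x i)).toFiniteMeasure

/-! ### Coefficients -/

/-- The diffusion matrix `D(ρ)_{ij} = (δ_{ij} λ + ρ_i) / (λ + ∑_c ρ_c)`. -/
def diffusionMatrix {m : ℕ} (lam : ℝ) (r : Fin m → ℝ) : Matrix (Fin m) (Fin m) ℝ :=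
  Matrix.of fun i j => ((if i = j then lam else 0) + r i) / (lam + ∑ c, r c)

/-- The mobility matrix `A(ρ)_{ij} = (δ_{ij} λ ρ_j + ρ_i ρ_j) / (λ + ∑_c ρ_c)`. -/
def mobilityMatrix {m : ℕ} (lam : ℝ) (r : Fin m → ℝ) : Matrix (Fin m) (Fin m) ℝ :=
  Matrix.of fun i j => ((if i = j then lam * r j else 0) + r i * r j) / (lam + ∑ c, r c)

/-- The quadratic form `vᵀ χ A χ v` at densities `r`, where `χ = diag (1/r_1, …, 1/r_m)`, `A` is
the mobility matrix and `v` stands for the vector of the gradients. Written out, it equals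
`(∑_c v_c)² / (λ + ∑_c r_c) + ∑_c λ v_c² / ((λ + ∑_c r_c) r_c)`. In the extended non-negative reals
`a / 0 = ∞` for `a ≠ 0` and `0 / 0 = 0`, which is the right convention where `r_c = 0`. -/
def energyDensity {m : ℕ} (lam : ℝ) (r v : Fin m → ℝ) : ℝ≥0∞ :=
  ENNReal.ofReal ((∑ c, v c) ^ 2) / ENNReal.ofReal (lam + ∑ c, r c) +
    ∑ c, ENNReal.ofReal (lam * v c ^ 2) / ENNReal.ofReal ((lam + ∑ c', r c') * r c)

/-! ### Test functions and weak gradients -/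

/-- Smooth real functions `φ (t, x)` of time and of a point of the torus, where smoothness is that
of the lift to `ℝ × ℝ`. Their restrictions to `[0,T] × 𝕋` are exactly the elements of
`C^∞([0,T] × 𝕋)`. -/
structure TestFunction where
  toFun : ℝ → Torus → ℝ
  smooth : ContDiff ℝ (⊤ : ℕ∞) fun p : ℝ × ℝ => toFun p.1 (p.2 : Torus)

/-- The time derivative of a test function. -/
def TestFunction.dt (φ : TestFunction) (t : ℝ) (x : Torus) : ℝ :=
  deriv (fun s : ℝ => φ.toFun s x) t

/-- The space derivative of a test function. -/
def TestFunction.dx (φ : TestFunction) (t : ℝ) (x : Torus) : ℝ :=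
  deriv (fun h : ℝ => φ.toFun t (x + (h : Torus))) 0

/-- Lebesgue measure on `[0,T] × 𝕋`. -/
def spaceTime (T : ℝ) : Measure (ℝ × Torus) :=
  (volume.restrict (Set.Icc (0 : ℝ) T)).prod volume

/-- `v` is the weak derivative of `u` in the space variable, on `[0,T] × 𝕋`. -/
structure IsWeakGradient (T : ℝ) (u v : ℝ → Torus → ℝ) : Prop where
  integrable : Integrable (fun p : ℝ × Torus => u p.1 p.2) (spaceTime T)
  integrable_gradient : Integrable (fun p : ℝ × Torus => v p.1 p.2) (spaceTime T)
  integral_by_parts : ∀ φ : TestFunction,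
    ∫ p, u p.1 p.2 * φ.dx p.1 p.2 ∂(spaceTime T) =
      -∫ p, v p.1 p.2 * φ.toFun p.1 p.2 ∂(spaceTime T)

/-! ### The rate function -/

/-- The path `μ` belongs to the domain `𝒟_color^m` of the dynamic rate function, and there it has
the density `ρ` with the weak gradient `v`: at all times `μ_c(t) = ρ_c(t,x) dx` has mass `rbar c`,
`∫∫ ∇ρᵀ χ A χ(ρ) ∇ρ dx dt < ∞`, and the initial entropy of the total density is finite. -/
structure IsRegularDensity {m : ℕ} {T : ℝ} (lam : ℝ) (rbar : Fin m → ℝ) (μ : ColorPath m T)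
    (ρ v : Fin m → ℝ → Torus → ℝ) : Prop where
  measurable : ∀ c, Measurable fun p : ℝ × Torus => ρ c p.1 p.2
  nonneg : ∀ c t x, 0 ≤ ρ c t x
  density : ∀ (t : Set.Icc (0 : ℝ) T) (c : Fin m),
    (μ t c : Measure Torus) = volume.withDensity fun x => ENNReal.ofReal (ρ c t x)
  mass : ∀ (t : Set.Icc (0 : ℝ) T) (c : Fin m), ((μ t c).mass : ℝ) = rbar c
  weak_gradient : ∀ c, IsWeakGradient T (ρ c) (v c)
  energy_lt_top :
    ∫⁻ p, energyDensity lam (fun c => ρ c p.1 p.2) (fun c => v c p.1 p.2) ∂(spaceTime T) < ∞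
  entropy : Integrable (fun x : Torus => (∑ c, ρ c 0 x) * Real.log (∑ c, ρ c 0 x)) volume

/-- The functional
`Λ_φ(ρ) = ∫ φᵀρ(T,x) dx - ∫ φᵀρ(0,x) dx
  + ∫₀ᵀ∫ [-∂_tφᵀ ρ + ½ ∇φᵀ D(ρ) ∇ρ - ½ ∇φᵀ A(ρ) ∇φ] dx dt`,
where `v` is the weak gradient of `ρ`. -/
def dynFunctional {m : ℕ} (T lam : ℝ) (ρ v : Fin m → ℝ → Torus → ℝ)
    (φ : Fin m → TestFunction) : ℝ :=
  (∫ x, ∑ c, (φ c).toFun T x * ρ c T x) - (∫ x, ∑ c, (φ c).toFun 0 x * ρ c 0 x) +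
    ∫ p : ℝ × Torus,
      (-(∑ c, (φ c).dt p.1 p.2 * ρ c p.1 p.2)
        + (1 / 2 : ℝ) * ((fun c => (φ c).dx p.1 p.2) ⬝ᵥ
            (diffusionMatrix lam (fun c => ρ c p.1 p.2) *ᵥ fun c => v c p.1 p.2))
        - (1 / 2 : ℝ) * ((fun c => (φ c).dx p.1 p.2) ⬝ᵥ
            (mobilityMatrix lam (fun c => ρ c p.1 p.2) *ᵥ fun c => (φ c).dx p.1 p.2)))
      ∂(spaceTime T)

/-- The dynamic rate function: `sup_φ Λ_φ(ρ)` if `μ = ρ dx` is in the domain `𝒟_color^m`, and `∞`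
otherwise. The density and its weak gradient are unique up to null sets, so that the supremum is
the same for all choices of `ρ` and `v`; the infimum over these choices picks this common value,
and it is `∞` (the empty infimum) outside the domain. -/
def dynRate {m : ℕ} {T : ℝ} (lam : ℝ) (rbar : Fin m → ℝ) (μ : ColorPath m T) : EReal :=
  ⨅ (ρ : Fin m → ℝ → Torus → ℝ) (v : Fin m → ℝ → Torus → ℝ)
    (_ : IsRegularDensity lam rbar μ ρ v),
    ⨆ φ : Fin m → TestFunction, ((dynFunctional T lam ρ v φ : ℝ) : EReal)

/-- The rate function `I_color = I_init(μ(0)) + I_dyn(μ)` of the empirical density of colors. -/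
def colorRate {m : ℕ} {T : ℝ} (hT : 0 < T) (lam : ℝ) (rbar : Fin m → ℝ)
    (Iinit : ColorMeasure m → ℝ≥0∞) (μ : ColorPath m T) : EReal :=
  (Iinit (μ ⟨0, Set.left_mem_Icc.mpr hT.le⟩) : EReal) + dynRate lam rbar μ

end ColorLDP

end

open MeasureTheory Filter Topology
open scoped NNReal ENNReal Matrix
open Real (exp log norm_eq_abs sq_sqrt norm_of_nonneg exp_pos le_sqrt_of_sq_le exp_log log_nonneg
  sqrt_nonneg)
open ENNReal (ofReal ofReal_le_ofReal toReal_ofReal ofReal_lt_top tendsto_ofReal ofReal_add)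
open Finset (measurable_fun_sum mul_sum sum_congr sum_add_distrib sum_nonneg mem_univ univ sum_div
  single_le_sum sum_mul sum_le_sum sum_sub_distrib)
open Set (Icc Ioc uIcc_of_le uIcc indicator_of_mem indicator_of_notMem uIoc_of_le left_mem_Icc
  Icc_subset_Icc_right mem_ofPred_eq)
open intervalIntegral (integral_add_adjacent_intervals integral_of_le
  integral_eq_sub_of_hasDerivAt integral_symm integral_mono_interval integral_hasDerivAt_right)
open QuotientAddGroup (mk_surjective)

/-! The initial rate is lower semicontinuous by hypothesis, so everything rests on one closedness
statement (`dynRate_le_of_tendsto`): if paths converge weakly at every time, with initial rates at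
most `k` and dynamic rates at most `b`, then the limit lies in the domain and has dynamic rate at
most `b`. The coefficients `D` and `A` are nonlinear and the domain asks for finite energy `∫∫
∇ρᵀχAχ∇ρ`. What is needed is therefore an energy bound that depends on `k` and `b` only; finiteness
of the energy of each path is known, but no rate.

Initial entropy. For i.i.d. particles with density at most `C`, Chernoff's bound and the lower bound
of the large deviation principle show that an initial rate at most `k` forces the entropy of the
total initial density, in dual form, to be at most `k + log C` (`pairing_le`).

Controls. The dynamic functional is a linear form in `φ` minus half the squared norm of `A^{1/2}∇φ`.
If it is bounded by `b`, Riesz representation yields controls of squared norm at most `2b` such that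
each color satisfies `∂_t ρ_i + ∂_x J_i = 0`, where `J_i` is `-½ (D∇ρ)_i` plus a control term
(`Reg.exists_controlled`).

Energy bound. With `R = ∑ ρ_c`, the energy density splits into `(∂_x R)² / R` and terms that are
quadratic in `∂_x (ρ_i / R)` (`energyR_eq`). The first part is the Fisher information of the total
density, which solves a controlled heat equation; it is bounded by dissipation of entropy
(`Tot.lintegral_fisher_le`). The second part is dissipated by the entropy of each color relative to
the total density. With `p = ρ_i / R` and `J = ∑ J_c`, the formal identity is that `∫ R β(p) dx` has
time derivative `∫ β''(p) ∂_x p (J_i - p J) dx`, where `J_i - p J` is `-½ λ R ∂_x p / (λ + R)` plus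
a control term.

The chain rule for the ratio `p` is the hard point, as mollification in `x` does not respect ratios.
In the Lagrangian coordinate `y` with `y_x = R` and `y_t = -J`, the measure `R dx` becomes `dy` and
`p` solves the linear conservation law `∂_t p + ∂_y (J_i - p J) = 0`, which can be mollified in `y`
(`Pair.star`). The mollification is removed by a pointwise limit (`Slice.lagB_tendsto`), a
domination by the energy (`Slice.sq_mul_lagB_le`) and a Vitali theorem. The result, for a
regularization of `s log s`, is `Pair.lintegral_color_le`.

Compactness. Bounded energy bounds the space gradients in `L¹`, so that weak convergence at all
times becomes strong convergence in space-time (`LimitData.tendsto_L1`). The gradients are square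
integrable against weights that converge in `L¹`; hence they converge weakly, also against bounded
coefficients that converge almost everywhere (`GradSeq.tendsto_of_ae`), and each `Λ_φ` passes to the
limit along a subsequence (`LimitData.exists_gradient`). The entropy bound, which propagates in
time, gives the limit measures densities (`exists_density`) and a finite initial entropy. -/

namespace ColorLDP

/-- Space and time. -/
notation "𝕏" => ℝ × Torus

/-- Lebesgue measure on the part of space and time up to a given time. -/
notation "Ω" => spaceTime

/-- Functions on the torus. -/
notation "𝕊" => Torus → ℝ

/-- Functions of time and space. -/
notation "𝔽" => ℝ → Torus → ℝ

/-- Lebesgue measure on the times up to a given time. -/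
notation:max "𝓛" T:max => Measure.restrict volume (Icc 0 T)

/-- The values of all components at a point of space and time. -/
notation:max f "⟪" p "⟫" => fun c => f c (Prod.fst p) (Prod.snd p)

/-- The flux of one component relative to another. -/
notation:max "𝔯" r:max j:max J:max q:max p:max =>
  r (Prod.fst p) (Prod.snd p) * j (Prod.fst p) (Prod.snd p) -
    J (Prod.fst p) (Prod.snd p) * q (Prod.fst p) (Prod.snd p)

lemma measurable_usum {α ι : Type*} [MeasurableSpace α] [Fintype ι] {f : ι → α → ℝ}
    (h : ∀ c, Measurable (f c)) : Measurable fun a => ∑ c, f c a :=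
  measurable_fun_sum _ fun c _ => h c

/-! ### Calculus on the torus -/

/-- `f'` is the derivative of `f : 𝕋 → ℝ`. -/
def HasTD (f f' : 𝕊) : Prop := ∀ s : ℝ, HasDerivAt (fun s : ℝ => f (s : Torus)) (f' s) s

lemma continuous_of_comp_coe {f : 𝕊} (h : Continuous fun s : ℝ => f (s : Torus)) : Continuous f :=
  (QuotientAddGroup.isQuotientMap_mk (N := AddSubgroup.zmultiples (1 : ℝ))).continuous_iff.2 h

lemma HasTD.continuous {f f' : 𝕊} (h : HasTD f f') : Continuous f :=
  continuous_of_comp_coe (continuous_iff_continuousAt.2 fun s => (h s).continuousAt)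

lemma torus_integrable {f : 𝕊} (h : Continuous f) : Integrable f :=
  h.integrable_of_hasCompactSupport (HasCompactSupport.of_compactSpace f)

lemma torus_bound {f : 𝕊} (h : Continuous f) : ∃ C, 0 ≤ C ∧ ∀ x, |f x| ≤ C := by
  obtain ⟨C, hC⟩ := isCompact_univ.exists_bound_of_continuousOn h.continuousOn
  exact ⟨max C 0, le_max_right _ _, fun x => (hC x (Set.mem_univ x)).trans (le_max_left _ _)⟩

lemma HasTD.integral_eq_zero {f f' : 𝕊} (h : HasTD f f') (hc : Continuous f') : ∫ x, f' x = 0 := by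
  rw [← UnitAddCircle.intervalIntegral_preimage 0, integral_eq_sub_of_hasDerivAt (fun s _ => h s)]
  · have := AddCircle.coe_add_period (1 : ℝ) 0
    rw [this, sub_self]
  · exact (hc.comp (AddCircle.continuous_mk' 1)).intervalIntegrable _ _

lemma HasTD.mul {f f' g g' : 𝕊} (hf : HasTD f f') (hg : HasTD g g') :
    HasTD (fun x => f x * g x) (fun x => f' x * g x + f x * g' x) := fun s => (hf s).mul (hg s)

lemma HasTD.comp_real {f f' : 𝕊} {F F' : ℝ → ℝ} (hf : HasTD f f')
    (hF : ∀ x, HasDerivAt F (F' (f x)) (f x)) : HasTD (fun x => F (f x)) (fun x => F' (f x) * f' x) :=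
  fun s => (hF s).comp s (hf s)

lemma HasTD.add {f f' g g' : 𝕊} (hf : HasTD f f') (hg : HasTD g g') :
    HasTD (fun x => f x + g x) (fun x => f' x + g' x) := fun s => (hf s).add (hg s)

lemma HasTD.const_mul {f f' : 𝕊} (c : ℝ) (hf : HasTD f f') :
    HasTD (fun x => c * f x) (fun x => c * f' x) := fun s => (hf s).const_mul c

lemma HasTD.comp_sub_left {f f' : 𝕊} (hf : HasTD f f') (x : Torus) :
    HasTD (fun z => f (x - z)) (fun z => -f' (x - z)) := by
  intro s
  obtain ⟨a, rfl⟩ := mk_surjective x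
  exact (hf (a - s)).comp_const_sub a s

lemma HasTD.comp_sub_right {f f' : 𝕊} (hf : HasTD f f') (x : Torus) :
    HasTD (fun z => f (z - x)) (fun z => f' (z - x)) := by
  intro s
  obtain ⟨a, rfl⟩ := mk_surjective x
  exact (hf (s - a)).comp_sub_const s a

lemma HasTD.integral_mul_deriv {f f' g g' : 𝕊} (hf : HasTD f f') (hg : HasTD g g')
    (hf' : Continuous f') (hg' : Continuous g') : ∫ x, f x * g' x = -∫ x, f' x * g x := by
  have h := (hf.mul hg).integral_eq_zero ((hf'.mul hg.continuous).add (hf.continuous.mul hg'))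
  have h2 := integral_add (torus_integrable (hf'.mul hg.continuous))
    (torus_integrable (hf.continuous.mul hg'))
  simp only [Pi.mul_apply] at h2
  linarith

lemma HasTD.sub_eq_integral {f f' : 𝕊} (hf : HasTD f f') (hf' : Continuous f') (a b : ℝ) :
    f b - f a = ∫ s in a..b, f' s :=
  (integral_eq_sub_of_hasDerivAt (fun s _ => hf s)
    ((hf'.comp (AddCircle.continuous_mk' 1)).intervalIntegrable _ _)).symm

/-- `f : 𝕋 → ℝ` is smooth. -/
def SmoothT (f : 𝕊) : Prop := ContDiff ℝ (⊤ : ℕ∞) fun s : ℝ => f (s : Torus)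

/-! ### Periodization -/

/-- The representative in `(-1/2, 1/2]` of a point of the torus. -/
noncomputable def rep (z : Torus) : ℝ := (AddCircle.equivIoc (1 : ℝ) (-1 / 2) z : ℝ)

lemma coe_rep (z : Torus) : ((rep z : ℝ) : Torus) = z := AddCircle.coe_equivIoc

lemma rep_mem (z : Torus) : rep z ∈ Ioc (-1 / 2 : ℝ) (-1 / 2 + 1) :=
  (AddCircle.equivIoc (1 : ℝ) (-1 / 2) z).2

lemma rep_coe {s : ℝ} (h : s ∈ Ioc (-1 / 2 : ℝ) (-1 / 2 + 1)) : rep (s : Torus) = s := by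
  have := AddCircle.equivIoc_coe_eq (p := (1 : ℝ)) h
  exact congrArg Subtype.val this

lemma measurable_rep : Measurable rep :=
  measurable_subtype_coe.comp (AddCircle.measurableEquivIoc (1 : ℝ) (-1 / 2)).measurable

lemma coe_sub_int (s : ℝ) (n : ℤ) : ((s - n : ℝ) : Torus) = s := by simp

lemma abs_rep (z : Torus) : |rep z| = ‖z‖ := by
  have h := rep_mem z
  conv_rhs => rw [← coe_rep z]
  refine ((AddCircle.norm_coe_eq_abs_iff (1 : ℝ) one_ne_zero).2 ?_).symm
  rw [abs_one, abs_le]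
  constructor <;> linarith [h.1, h.2]

lemma exists_int_sub_rep (s : ℝ) : ∃ n : ℤ, rep (s : Torus) = s - n := by
  have h : ((s - rep (s : Torus) : ℝ) : Torus) = 0 := by rw [AddCircle.coe_sub, coe_rep, sub_self]
  obtain ⟨n, hn⟩ := (AddCircle.coe_eq_zero_iff (1 : ℝ)).1 h
  refine ⟨n, ?_⟩
  simp only [zsmul_eq_mul, mul_one] at hn
  linarith

/-- The periodization of a function on `ℝ` which is supported in `[-1/4, 1/4]`. -/
noncomputable def per (f : ℝ → ℝ) (z : Torus) : ℝ := f (rep z)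

/-- If the representative of `s` belongs to another translate than `n`, then both arguments have
absolute value at least `1/4`, where `f` vanishes. As `3/4` exceeds `1/2`, a single translate serves
on a neighbourhood of every point, which makes the periodization smooth also across the cut at
`1/2`. -/
lemma per_coe {f : ℝ → ℝ} (hf : ∀ s, 1 / 4 ≤ |s| → f s = 0) {s : ℝ} {n : ℤ}
    (h : |s - n| ≤ 3 / 4) : per f (s : Torus) = f (s - n) := by
  unfold per
  obtain ⟨k, hk⟩ := exists_int_sub_rep s
  have hm := rep_mem (s : Torus)
  rw [hk] at hm ⊢
  by_cases hkn : k = n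
  · rw [hkn]
  · have h1 : (1 : ℝ) ≤ |((k - n : ℤ) : ℝ)| := by
      rw [← Int.cast_abs]
      exact_mod_cast Int.one_le_abs (sub_ne_zero.2 hkn)
    push_cast at h1
    have hm1 := hm.1
    have hm2 := hm.2
    rw [hf _, hf _]
    · rcases abs_cases (s - n) with ⟨h2, _⟩ | ⟨h2, _⟩ <;>
        rcases abs_cases ((k : ℝ) - n) with ⟨h3, _⟩ | ⟨h3, _⟩ <;> linarith
    · rw [abs_le] at h
      rcases abs_cases (s - k) with ⟨h2, _⟩ | ⟨h2, _⟩ <;>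
        rcases abs_cases ((k : ℝ) - n) with ⟨h3, _⟩ | ⟨h3, _⟩ <;> linarith

lemma per_eventuallyEq {f : ℝ → ℝ} (hf : ∀ s, 1 / 4 ≤ |s| → f s = 0) (s : ℝ) :
    (fun u : ℝ => per f (u : Torus)) =ᶠ[𝓝 s] fun u => f (u - round s) := by
  have h : |s - round s| < 3 / 4 := (abs_sub_round s).trans_lt (by norm_num)
  have h2 : ∀ᶠ u : ℝ in 𝓝 s, |u - round s| < 3 / 4 :=
    ((continuous_id.sub (continuous_const (y := (round s : ℝ)))).abs.tendsto s).eventually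
      (gt_mem_nhds h)
  filter_upwards [h2] with u hu using per_coe hf hu.le

lemma per_smooth {f : ℝ → ℝ} (hf : ∀ s, 1 / 4 ≤ |s| → f s = 0) (hs : ContDiff ℝ (⊤ : ℕ∞) f) :
    SmoothT (per f) := by
  refine contDiff_iff_contDiffAt.2 fun s => ContDiffAt.congr_of_eventuallyEq ?_
    (per_eventuallyEq hf s)
  exact (hs.comp (contDiff_id.sub contDiff_const)).contDiffAt

lemma per_hasTD {f f' : ℝ → ℝ} (hf : ∀ s, 1 / 4 ≤ |s| → f s = 0)
    (hf' : ∀ s, 1 / 4 ≤ |s| → f' s = 0) (hs : ∀ s, HasDerivAt f (f' s) s) :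
    HasTD (per f) (per f') := by
  intro s
  have h : |s - round s| ≤ 3 / 4 := (abs_sub_round s).trans (by norm_num)
  rw [per_coe hf' h]
  refine HasDerivAt.congr_of_eventuallyEq ?_ (per_eventuallyEq hf s)
  exact (hs (s - round s)).comp_sub_const s _

lemma integral_torus_eq (F : 𝕊) : ∫ z, F z = ∫ s in (-1 / 2 : ℝ)..1 / 2, F (s : Torus) := by
  rw [← UnitAddCircle.intervalIntegral_preimage (-1 / 2)]
  norm_num

lemma integral_per_mul {f : ℝ → ℝ} (hf : ∀ s, 1 / 4 ≤ |s| → f s = 0) (F : 𝕊) :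
    ∫ z, per f z * F z = ∫ s, f s * F (s : Torus) := by
  rw [integral_torus_eq, integral_of_le (by norm_num), ← integral_indicator measurableSet_Ioc]
  congr 1 with s
  by_cases hs : s ∈ Ioc (-1 / 2 : ℝ) (1 / 2)
  · rw [indicator_of_mem hs, per, rep_coe ⟨hs.1, by linarith [hs.2]⟩]
  · rw [indicator_of_notMem hs, hf, zero_mul]
    by_contra hcon
    push Not at hcon
    rw [abs_lt] at hcon
    exact hs ⟨by linarith [hcon.1], by linarith [hcon.2]⟩


/-! ### Mollifiers -/

/-- A fixed even mollifier on `ℝ`, supported in `[-1, 1]`. -/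
noncomputable def stdBump : ContDiffBump (0 : ℝ) := ⟨1 / 2, 1, by norm_num, by norm_num⟩

/-- The normalized bump function. -/
noncomputable def kap : ℝ → ℝ := stdBump.normed volume

lemma kap_contDiff : ContDiff ℝ (⊤ : ℕ∞) kap := stdBump.contDiff_normed

lemma kap_nonneg (s : ℝ) : 0 ≤ kap s := stdBump.nonneg_normed s

lemma kap_eq_zero {s : ℝ} (h : 1 ≤ |s|) : kap s = 0 := by
  have h1 := stdBump.support_normed_eq (μ := (volume : Measure ℝ))
  by_contra hne
  have : s ∈ Function.support (stdBump.normed volume) := hne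
  rw [h1] at this
  simp [stdBump] at this
  linarith

lemma kap_neg (s : ℝ) : kap (-s) = kap s := stdBump.normed_neg s

lemma integral_kap : ∫ s, kap s = 1 := stdBump.integral_normed

/-- Zeros of a nonnegative function are minima; this also covers the end points of the support. -/
lemma deriv_kap_eq_zero {s : ℝ} (h : 1 ≤ |s|) : deriv kap s = 0 := by
  have h0 : kap s = 0 := kap_eq_zero h
  refine IsLocalMin.deriv_eq_zero (.of_forall fun u => ?_)
  rw [h0]
  exact kap_nonneg u

lemma hasDerivAt_kap (s : ℝ) : HasDerivAt kap (deriv kap s) s :=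
  (kap_contDiff.differentiable (by simp)).differentiableAt.hasDerivAt

lemma deriv_kap_contDiff : ContDiff ℝ (⊤ : ℕ∞) (deriv kap) := by
  have := (contDiff_infty_iff_deriv (𝕜 := ℝ)).1 kap_contDiff
  exact this.2

lemma exists_kap_bound : ∃ C, 1 ≤ C ∧ (∀ s, kap s ≤ C) ∧ ∀ s, |deriv kap s| ≤ C := by
  obtain ⟨C1, h1⟩ := (isCompact_Icc (a := (-1 : ℝ)) (b := 1)).exists_bound_of_continuousOn
    kap_contDiff.continuous.continuousOn
  obtain ⟨C2, h2⟩ := (isCompact_Icc (a := (-1 : ℝ)) (b := 1)).exists_bound_of_continuousOn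
    deriv_kap_contDiff.continuous.continuousOn
  refine ⟨max 1 (max C1 C2), le_max_left _ _, fun s => ?_, fun s => ?_⟩
  · by_cases hs : |s| ≤ 1
    · exact ((le_abs_self _).trans (h1 s (abs_le.1 hs))).trans
        ((le_max_left _ _).trans (le_max_right _ _))
    · rw [kap_eq_zero (not_le.1 hs).le]
      exact zero_le_one.trans (le_max_left _ _)
  · by_cases hs : |s| ≤ 1
    · exact (h2 s (abs_le.1 hs)).trans ((le_max_right _ _).trans (le_max_right _ _))
    · rw [deriv_kap_eq_zero (not_le.1 hs).le, abs_zero]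
      exact zero_le_one.trans (le_max_left _ _)

/-- A common bound for the mollifier and its derivative. -/
noncomputable def kapC : ℝ := exists_kap_bound.choose

lemma one_le_kapC : 1 ≤ kapC := exists_kap_bound.choose_spec.1

lemma deriv_kap_le (s : ℝ) : |deriv kap s| ≤ kapC := exists_kap_bound.choose_spec.2.2 s

/-- The mollifier of width `ε` on the torus. -/
noncomputable def K (ε : ℝ) : 𝕊 := per fun s => ε⁻¹ * kap (s / ε)

/-- The derivative of the mollifier of width `ε` on the torus. -/
noncomputable def K1 (ε : ℝ) : 𝕊 := per fun s => ε⁻¹ * (deriv kap (s / ε) * ε⁻¹)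

section
variable {ε : ℝ} (h0 : 0 < ε) (h1 : ε ≤ 1 / 8)
-- Evenness makes convolution with the kernel self-adjoint, which is how a mollifier is moved onto a
-- test function.
lemma K_neg (z : Torus) : K ε (-z) = K ε z := by
  have h : ∀ z : Torus, K ε z = ε⁻¹ * kap (‖z‖ / ε) := fun z => by
    rw [K, per, ← abs_rep]
    rcases abs_choice (rep z) with h | h <;> rw [h]
    rw [neg_div, kap_neg]
  rw [h, h, norm_neg]

lemma kap_scaled_hasDerivAt (s : ℝ) :
    HasDerivAt (fun s => ε⁻¹ * kap (s / ε)) (ε⁻¹ * (deriv kap (s / ε) * ε⁻¹)) s := by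
  have h := (hasDerivAt_kap (s / ε)).comp s ((hasDerivAt_id s).div_const ε)
  rw [one_div] at h
  exact h.const_mul ε⁻¹

include h0

lemma one_le_abs_div {s : ℝ} (hs : ε ≤ |s|) : 1 ≤ |s / ε| := by
  rw [abs_div, abs_of_pos h0, le_div_iff₀ h0]
  linarith

lemma K_eq_zero {z : Torus} (hz : ε ≤ ‖z‖) : K ε z = 0 := by
  rw [K, per, kap_eq_zero (one_le_abs_div h0 (by rwa [abs_rep])), mul_zero]

lemma K1_eq_zero {z : Torus} (hz : ε ≤ ‖z‖) : K1 ε z = 0 := by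
  rw [K1, per, deriv_kap_eq_zero (one_le_abs_div h0 (by rwa [abs_rep])), zero_mul, mul_zero]

lemma K_nonneg (z : Torus) : 0 ≤ K ε z := mul_nonneg (inv_pos.2 h0).le (kap_nonneg _)

lemma K1_le (z : Torus) : |K1 ε z| ≤ kapC / ε ^ 2 := by
  rw [K1, per, abs_mul, abs_mul, abs_of_pos (inv_pos.2 h0)]
  have : ε⁻¹ * (|deriv kap (rep z / ε)| * ε⁻¹) ≤ ε⁻¹ * (kapC * ε⁻¹) := by
    have := deriv_kap_le (rep z / ε)
    gcongr
  refine this.trans (le_of_eq ?_)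
  field_simp

include h1

lemma kap_scaled_eq_zero (s : ℝ) (hs : 1 / 4 ≤ |s|) : ε⁻¹ * kap (s / ε) = 0 := by
  rw [kap_eq_zero (one_le_abs_div h0 (by linarith)), mul_zero]

lemma deriv_kap_scaled_eq_zero (s : ℝ) (hs : 1 / 4 ≤ |s|) :
    ε⁻¹ * (deriv kap (s / ε) * ε⁻¹) = 0 := by
  rw [deriv_kap_eq_zero (one_le_abs_div h0 (by linarith)), zero_mul, mul_zero]

lemma K_smooth : SmoothT (K ε) :=
  per_smooth (kap_scaled_eq_zero h0 h1)
    (contDiff_const.mul (kap_contDiff.comp (contDiff_id.div_const ε)))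

lemma K1_smooth : SmoothT (K1 ε) :=
  per_smooth (deriv_kap_scaled_eq_zero h0 h1)
    (contDiff_const.mul ((deriv_kap_contDiff.comp (contDiff_id.div_const ε)).mul contDiff_const))

lemma K_hasTD : HasTD (K ε) (K1 ε) :=
  per_hasTD (kap_scaled_eq_zero h0 h1) (deriv_kap_scaled_eq_zero h0 h1) kap_scaled_hasDerivAt

lemma K_continuous : Continuous (K ε) := (K_hasTD h0 h1).continuous

lemma K1_continuous : Continuous (K1 ε) := continuous_of_comp_coe (K1_smooth h0 h1).continuous

lemma integral_K : ∫ z, K ε z = 1 := by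
  have h := integral_per_mul (kap_scaled_eq_zero h0 h1) (fun _ => 1)
  simp only [mul_one] at h
  rw [K, h, integral_const_mul, Measure.integral_comp_div (fun s => kap s), integral_kap,
    abs_of_pos h0, smul_eq_mul, mul_one, inv_mul_cancel₀ h0.ne']

lemma integral_K_sub (x : Torus) : ∫ z, K ε (x - z) = 1 := by
  rw [integral_sub_left_eq_self (fun z => K ε z), integral_K h0 h1]

lemma integral_K1 : ∫ z, K1 ε z = 0 := (K_hasTD h0 h1).integral_eq_zero (K1_continuous h0 h1)

end

/-! ### Convolution on the torus -/

instance : IsProbabilityMeasure (volume : Measure Torus) := ⟨UnitAddCircle.measure_univ⟩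

/-- Convolution on the torus. -/
noncomputable def cv (f g : 𝕊) (x : Torus) : ℝ := ∫ z, f (x - z) * g z

lemma cv_integrand {f g : 𝕊} (hf : Continuous f) (hg : Integrable g) (x : Torus) :
    Integrable fun z => f (x - z) * g z := by
  obtain ⟨C, hC, h⟩ := torus_bound hf
  exact hg.bdd_mul (hf.comp (continuous_const.sub continuous_id)).aestronglyMeasurable
    (.of_forall fun z => h (x - z))

lemma abs_cv_le {f g : 𝕊} {C : ℝ} (hf : Continuous f) (hC : ∀ x, |f x| ≤ C)
    (hg : Integrable g) (x : Torus) : |cv f g x| ≤ C * ∫ z, |g z| := by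
  rw [cv, ← integral_const_mul]
  refine (abs_integral_le_integral_abs).trans (integral_mono (cv_integrand hf hg x).abs
    (hg.abs.const_mul C) fun z => ?_)
  simp only [abs_mul]
  exact mul_le_mul_of_nonneg_right (hC _) (abs_nonneg _)

lemma cv_continuous {f g : 𝕊} (hf : Continuous f) (hg : Integrable g) : Continuous (cv f g) := by
  obtain ⟨C, hC, h⟩ := torus_bound hf
  refine continuous_of_dominated (bound := fun z => C * |g z|)
    (fun x => (cv_integrand hf hg x).aestronglyMeasurable) (fun x => .of_forall fun z => ?_)
    (hg.abs.const_mul C) (.of_forall fun z => ?_)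
  · rw [norm_eq_abs, abs_mul]
    exact mul_le_mul_of_nonneg_right (h _) (abs_nonneg _)
  · exact (hf.comp (continuous_id.sub continuous_const)).mul continuous_const

lemma cv_hasTD {f f' g : 𝕊} (hf : HasTD f f') (hf' : Continuous f') (hg : Integrable g) :
    HasTD (cv f g) (cv f' g) := by
  intro s
  obtain ⟨C, hC, h⟩ := torus_bound hf'
  refine (hasDerivAt_integral_of_dominated_loc_of_deriv_le (s := Set.univ)
    (F := fun (s : ℝ) z => f (s - z) * g z)
    (F' := fun (s : ℝ) z => f' (s - z) * g z) (bound := fun z => C * |g z|) univ_mem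
    (.of_forall fun s => (cv_integrand hf.continuous hg s).aestronglyMeasurable)
    (cv_integrand hf.continuous hg s) (cv_integrand hf' hg s).aestronglyMeasurable
    (.of_forall fun z s _ => ?_) (hg.abs.const_mul C)
    (.of_forall fun z s _ => ?_)).2
  · rw [norm_eq_abs, abs_mul]
    exact mul_le_mul_of_nonneg_right (h _) (abs_nonneg _)
  · exact (hf.comp_sub_right z s).mul_const (g z)

lemma cv_prod_integrable {f g h : 𝕊} (hf : Continuous f) (hg : Integrable g) (hh : Integrable h) :
    Integrable (fun p : Torus × Torus => h p.1 * (f (p.1 - p.2) * g p.2)) := by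
  obtain ⟨C, hC, hb⟩ := torus_bound hf
  have h1 : Integrable (fun p : Torus × Torus => f (p.1 - p.2) * (h p.1 * g p.2)) :=
    (hh.mul_prod hg).bdd_mul (hf.comp (continuous_fst.sub continuous_snd)).aestronglyMeasurable
      (.of_forall fun p => hb (p.1 - p.2))
  exact h1.congr (.of_forall fun p => by simp only; ring)

lemma integral_mul_cv {f g h : 𝕊} (hf : Continuous f) (hg : Integrable g) (hh : Integrable h) :
    ∫ x, h x * cv f g x = ∫ z, (∫ x, h x * f (x - z)) * g z := by
  have h1 := integral_integral_swap (f := fun x z => h x * (f (x - z) * g z))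
    (cv_prod_integrable hf hg hh)
  simp_rw [integral_const_mul] at h1
  rw [show (∫ x, h x * cv f g x) = ∫ x, h x * ∫ z, f (x - z) * g z from rfl, h1]
  congr 1 with z
  rw [← integral_mul_const]
  congr 1 with x
  ring

lemma integral_mul_cv_even {f g h : 𝕊} (hf : Continuous f) (hev : ∀ x, f (-x) = f x)
    (hg : Integrable g) (hh : Integrable h) :
    ∫ x, h x * cv f g x = ∫ z, cv f h z * g z := by
  rw [integral_mul_cv hf hg hh]
  congr 1 with z
  congr 1
  rw [cv]
  congr 1 with x
  rw [← hev, neg_sub, mul_comm]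

lemma integral_cv {f g : 𝕊} (hf : Continuous f) (hg : Integrable g) :
    ∫ x, cv f g x = (∫ x, f x) * ∫ x, g x := by
  have h := integral_mul_cv hf hg (integrable_const (1 : ℝ))
  simp only [one_mul] at h
  rw [h, ← integral_const_mul]
  congr 1 with z
  rw [integral_sub_right_eq_self (fun x => f x)]

lemma cv_nonneg {f g : 𝕊} (hf : ∀ x, 0 ≤ f x) (hg : ∀ x, 0 ≤ g x) (x : Torus) :
    0 ≤ cv f g x := integral_nonneg fun z => mul_nonneg (hf _) (hg _)

lemma cv_mono {f g h : 𝕊} (hf : Continuous f) (h0 : ∀ x, 0 ≤ f x) (hg : Integrable g)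
    (hh : Integrable h) (hgh : ∀ᵐ x, g x ≤ h x) (x : Torus) : cv f g x ≤ cv f h x := by
  refine integral_mono_ae (cv_integrand hf hg x) (cv_integrand hf hh x) ?_
  filter_upwards [hgh] with z hz using mul_le_mul_of_nonneg_left hz (h0 _)

lemma cv_add {f g h : 𝕊} (hf : Continuous f) (hg : Integrable g)
    (hh : Integrable h) (x : Torus) : cv f (fun z => g z + h z) x = cv f g x + cv f h x := by
  simp only [cv, mul_add]
  exact integral_add (cv_integrand hf hg x) (cv_integrand hf hh x)

lemma cv_sub {f g h : 𝕊} (hf : Continuous f) (hg : Integrable g)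
    (hh : Integrable h) (x : Torus) : cv f (fun z => g z - h z) x = cv f g x - cv f h x := by
  simp only [cv, mul_sub]
  exact integral_sub (cv_integrand hf hg x) (cv_integrand hf hh x)

lemma cv_const_mul (c : ℝ) (f g : 𝕊) (x : Torus) : cv f (fun z => c * g z) x = c * cv f g x := by
  simp only [cv]
  rw [← integral_const_mul]
  congr 1 with z
  ring

/-- Cauchy-Schwarz in the form of a nonpositive discriminant: the quadratic polynomial `s ↦ ∫ w (a
s² + 2 c s + b)` is nonnegative because its integrand is. -/
lemma sq_integral_le {α : Type*} [MeasurableSpace α] {μ : Measure α} {w a b c : α → ℝ}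
    (hw : ∀ᵐ z ∂μ, 0 ≤ w z) (ha : ∀ᵐ z ∂μ, 0 ≤ a z) (hb : ∀ᵐ z ∂μ, 0 ≤ b z)
    (hac : ∀ᵐ z ∂μ, c z ^ 2 ≤ a z * b z)
    (hia : Integrable (fun z => w z * a z) μ) (hib : Integrable (fun z => w z * b z) μ) :
    (∫ z, w z * c z ∂μ) ^ 2 ≤ (∫ z, w z * a z ∂μ) * ∫ z, w z * b z ∂μ := by
  -- A mixed term that is not integrable has integral `0` by convention, and the claim is then
  -- trivial.
  by_cases hic : Integrable (fun z => w z * c z) μ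
  swap
  · rw [integral_undef hic, zero_pow two_ne_zero]
    refine mul_nonneg (integral_nonneg_of_ae ?_) (integral_nonneg_of_ae ?_)
    · filter_upwards [hw, ha] with z h1 h2 using mul_nonneg h1 h2
    · filter_upwards [hw, hb] with z h1 h2 using mul_nonneg h1 h2
  have key : ∀ s : ℝ, 0 ≤ (∫ z, w z * a z ∂μ) * (s * s) + (2 * ∫ z, w z * c z ∂μ) * s
      + ∫ z, w z * b z ∂μ := by
    intro s
    have h : (∫ z, w z * a z ∂μ) * (s * s) + (2 * ∫ z, w z * c z ∂μ) * s + ∫ z, w z * b z ∂μ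
        = ∫ z, ((s * s) * (w z * a z) + (2 * s) * (w z * c z)) + w z * b z ∂μ := by
      have i1 : Integrable (fun z => (s * s) * (w z * a z) + (2 * s) * (w z * c z)) μ := by fun_prop
      rw [integral_add i1 hib, integral_add (hia.const_mul _) (hic.const_mul _),
        integral_const_mul, integral_const_mul]
      ring
    rw [h]
    refine integral_nonneg_of_ae ?_
    filter_upwards [hw, ha, hb, hac] with z h1 h2 h3 h4
    have h5 : 0 ≤ a z * (s * s) + 2 * s * c z + b z := by
      by_cases h6 : a z = 0
      · rw [h6, zero_mul] at h4
        have : c z = 0 := pow_eq_zero_iff two_ne_zero |>.1 (le_antisymm h4 (sq_nonneg _))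
        rw [h6, this]
        linarith
      · have h7 : 0 < a z := lt_of_le_of_ne h2 (Ne.symm h6)
        have h8 : 0 ≤ a z * (a z * (s * s) + 2 * s * c z + b z) := by
          nlinarith [sq_nonneg (a z * s + c z)]
        exact nonneg_of_mul_nonneg_right h8 h7
    have h9 := mul_nonneg h1 h5
    simp only [Pi.zero_apply]
    linarith
  have h := discrim_le_zero key
  rw [discrim] at h
  nlinarith

/-- Averaging against a nonnegative kernel preserves `c² ≤ a b`. Quadratic bounds of fluxes by
densities thus survive mollification without error terms. -/
lemma cv_sq_le {f a b c : 𝕊} (hf : Continuous f) (h0 : ∀ x, 0 ≤ f x) (ha : Integrable a)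
    (hb : Integrable b) (ha0 : ∀ x, 0 ≤ a x) (hb0 : ∀ x, 0 ≤ b x)
    (hc : ∀ᵐ x, c x ^ 2 ≤ a x * b x) (x : Torus) : cv f c x ^ 2 ≤ cv f a x * cv f b x :=
  sq_integral_le (.of_forall fun _ => h0 _) (.of_forall ha0)
    (.of_forall hb0) hc (cv_integrand hf ha x) (cv_integrand hf hb x)

/-- The widths of the mollifiers that are used in limits. -/
noncomputable def wid (n : ℕ) : ℝ := 1 / (n + 8)

/-- Convolution with the mollifier of index `n`. -/
notation:max "cw" n:max => cv (K (wid n))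

lemma wid_pos (n : ℕ) : 0 < wid n := by unfold wid; positivity

lemma wid_le (n : ℕ) : wid n ≤ 1 / 8 :=
  one_div_le_one_div_of_le (by norm_num) (by linarith [(Nat.cast_nonneg n : (0 : ℝ) ≤ n)])

lemma Kw_nonneg (n : ℕ) (z : Torus) : 0 ≤ K (wid n) z := K_nonneg (wid_pos n) z

lemma Kw_hasTD (n : ℕ) : HasTD (K (wid n)) (K1 (wid n)) := K_hasTD (wid_pos n) (wid_le n)

lemma Kw_continuous (n : ℕ) : Continuous (K (wid n)) := (Kw_hasTD n).continuous

lemma K1w_continuous (n : ℕ) : Continuous (K1 (wid n)) := K1_continuous (wid_pos n) (wid_le n)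

lemma integral_Kw (n : ℕ) : ∫ z, K (wid n) z = 1 := integral_K (wid_pos n) (wid_le n)

lemma wid_props (n : ℕ) :
    0 < wid n ∧ wid n ≤ 1 / 8 ∧ Continuous (K (wid n)) ∧ Continuous (K1 (wid n)) :=
  ⟨wid_pos n, wid_le n, Kw_continuous n, K1w_continuous n⟩

lemma wid_tendsto : Tendsto wid atTop (𝓝 0) :=
  tendsto_const_nhds.div_atTop (tendsto_atTop_add_const_right _ _ tendsto_natCast_atTop_atTop)

lemma cv_K_sub {g : 𝕊} {ε : ℝ} (h0 : 0 < ε) (h1 : ε ≤ 1 / 8) (hg : Integrable g)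
    (x : Torus) (c : ℝ) : cv (K ε) g x - c = ∫ z, K ε (x - z) * (g z - c) := by
  simp only [mul_sub]
  have i1 : Integrable fun z => K ε (x - z) * c := (torus_integrable
    ((K_continuous h0 h1).comp (continuous_const.sub continuous_id))).mul_const c
  rw [integral_sub (cv_integrand (K_continuous h0 h1) hg x) i1, integral_mul_const,
    integral_K_sub h0 h1, one_mul]
  rfl

/-- If `g` is close to `c` near `x`, then so is its mollification at `x`. -/
lemma abs_cv_K_sub_le {g : 𝕊} {ε : ℝ} (h0 : 0 < ε) (h1 : ε ≤ 1 / 8) (hg : Integrable g)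
    (x : Torus) (c η : ℝ) (h : ∀ z, ‖x - z‖ < ε → |g z - c| ≤ η) : |cv (K ε) g x - c| ≤ η := by
  rw [cv_K_sub h0 h1 hg]
  have hK : Integrable fun z => K ε (x - z) := torus_integrable
    ((K_continuous h0 h1).comp (continuous_const.sub continuous_id))
  calc |∫ z, K ε (x - z) * (g z - c)| ≤ ∫ z, K ε (x - z) * η := by
        refine (abs_integral_le_integral_abs).trans (integral_mono_of_nonneg
          (.of_forall fun z => abs_nonneg _) (hK.mul_const η)
          (.of_forall fun z => ?_))
        simp only [abs_mul, abs_of_nonneg (K_nonneg h0 (x - z))]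
        by_cases hz : ‖x - z‖ < ε
        · exact mul_le_mul_of_nonneg_left (h z hz) (K_nonneg h0 _)
        · rw [K_eq_zero h0 (not_lt.1 hz), zero_mul, zero_mul]
    _ = η := by rw [integral_mul_const, integral_K_sub h0 h1, one_mul]

lemma cv_K_tendstoUniformly {g : 𝕊} (hg : Continuous g) (η : ℝ) (hη : 0 < η) :
    ∀ᶠ n in atTop, ∀ x, |cw n g x - g x| ≤ η := by
  have huc := CompactSpace.uniformContinuous_of_continuous hg
  obtain ⟨d, hd, h⟩ := Metric.uniformContinuous_iff.1 huc η hη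
  filter_upwards [(tendsto_order.1 wid_tendsto).2 d hd] with n hn x
  refine abs_cv_K_sub_le (wid_pos n) (wid_le n) (torus_integrable hg) x _ _ fun z hz => ?_
  have := h (a := z) (b := x) (by rw [dist_eq_norm, ← norm_neg, neg_sub]; linarith)
  rw [Real.dist_eq] at this
  exact this.le

lemma integral_abs_cv_K_le {g : 𝕊} {ε : ℝ} (h0 : 0 < ε) (h1 : ε ≤ 1 / 8)
    (hg : Integrable g) : ∫ x, |cv (K ε) g x| ≤ ∫ x, |g x| := by
  have h : ∫ x, cv (K ε) (fun z => |g z|) x = ∫ x, |g x| := by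
    rw [integral_cv (K_continuous h0 h1) hg.abs, integral_K h0 h1, one_mul]
  rw [← h]
  refine integral_mono (torus_integrable (cv_continuous (K_continuous h0 h1) hg).abs)
    (torus_integrable (cv_continuous (K_continuous h0 h1) hg.abs)) fun x => ?_
  refine (abs_integral_le_integral_abs).trans (le_of_eq ?_)
  simp only [abs_mul, abs_of_nonneg (K_nonneg h0 _)]
  rfl

/-- Continuous functions are dense in `L¹`, mollification contracts `L¹`, and for continuous
functions the convergence is uniform. -/
lemma cv_K_tendsto_L1 {g : 𝕊} (hg : Integrable g) :
    Tendsto (fun n => ∫ x, |cw n g x - g x|) atTop (𝓝 0) := by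
  rw [Metric.tendsto_atTop']
  intro η hη
  obtain ⟨h, _, h2, hcont, hint⟩ := hg.exists_hasCompactSupport_integral_sub_le
    (ε := η / 4) (by positivity)
  obtain ⟨N, hN⟩ := eventually_atTop.1 (cv_K_tendstoUniformly hcont (η / 4) (by positivity))
  refine ⟨N, fun n hn => ?_⟩
  have h0 := wid_pos n
  have h1 := wid_le n
  have hKc := K_continuous h0 h1
  have hI : Integrable (fun x => g x - h x) := hg.sub hint
  have e1 := integral_abs_cv_K_le h0 h1 hI
  have e2 : ∫ x, |cw n h x - h x| ≤ η / 4 := by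
    refine (integral_mono (torus_integrable
      ((cv_continuous hKc hint).sub hcont).abs) (integrable_const (η / 4))
      (fun x => hN n hn.le x)).trans ?_
    simp
  have e3 : ∫ x, |cw n g x - g x| ≤ (∫ x, |cw n (fun x => g x - h x) x|) +
      (∫ x, |cw n h x - h x|) + ∫ x, |g x - h x| := by
    have i1 : Integrable (fun x => |cw n (fun x => g x - h x) x|) :=
      torus_integrable (cv_continuous hKc hI).abs
    have i2 : Integrable (fun x => |cw n h x - h x|) :=
      torus_integrable ((cv_continuous hKc hint).sub hcont).abs
    have i3 : Integrable (fun x => |cw n (fun x => g x - h x) x| +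
      |cw n h x - h x|) := i1.add i2
    rw [← integral_add i1 i2, ← integral_add i3 hI.abs]
    refine integral_mono ((torus_integrable (cv_continuous hKc hg)).sub hg).abs
      (i3.add hI.abs) fun x => ?_
    simp only [Pi.add_apply]
    rw [cv_sub hKc hg hint]
    have := abs_add_three (cw n g x - cw n h x) (cw n h x - h x) (-(g x - h x))
    rw [abs_neg] at this
    refine le_trans (le_of_eq ?_) this
    congr 1
    ring
  have e4 : ∫ x, |g x - h x| ≤ η / 4 := h2
  rw [Real.dist_eq, sub_zero, abs_of_nonneg (integral_nonneg fun x => abs_nonneg _)]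
  linarith


/-! ### Weak derivatives on the torus -/

lemma exists_subseq_tendsto_ae {α : Type*} [MeasurableSpace α] {μ : Measure α} {f : ℕ → α → ℝ}
    {g : α → ℝ} (hf : ∀ n, Integrable (f n) μ) (hg : Integrable g μ)
    (h : Tendsto (fun n => ∫ x, |f n x - g x| ∂μ) atTop (𝓝 0)) :
    ∃ ns : ℕ → ℕ, StrictMono ns ∧ ∀ᵐ x ∂μ, Tendsto (fun i => f (ns i) x) atTop (𝓝 (g x)) := by
  refine (tendstoInMeasure_of_tendsto_eLpNorm (p := 1) one_ne_zero
    (fun n => (hf n).aestronglyMeasurable) hg.aestronglyMeasurable ?_).exists_seq_tendsto_ae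
  have h2 : ∀ n, eLpNorm (f n - g) 1 μ = ofReal (∫ x, |f n x - g x| ∂μ) := fun n => by
    rw [eLpNorm_one_eq_lintegral_enorm, ← ofReal_integral_norm_eq_lintegral_enorm ((hf n).sub hg)]
    rfl
  simp_rw [h2]
  simpa using tendsto_ofReal h

lemma lift_intervalIntegrable {f : 𝕊} (hf : Integrable f) (a b : ℝ) :
    IntervalIntegrable (fun s : ℝ => f (s : Torus)) volume a b := by
  have hp : Function.Periodic (fun s : ℝ => f (s : Torus)) 1 := fun s => by simp
  refine hp.intervalIntegrable₀ one_ne_zero ?_ a b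
  have h1 : IntegrableOn (fun s : ℝ => f (s : Torus)) (Ioc 0 (0 + 1)) :=
    (UnitAddCircle.measurePreserving_mk 0).integrable_comp_of_integrable hf
  rw [intervalIntegrable_iff, uIoc_of_le zero_le_one]
  simpa using h1

lemma abs_intervalIntegral_le_torus {f : 𝕊} (hf : Integrable f) {a b : ℝ}
    (hab : |b - a| ≤ 1) : |∫ s in a..b, f (s : Torus)| ≤ ∫ x, |f x| := by
  wlog h : a ≤ b generalizing a b
  · rw [integral_symm, abs_neg]
    exact this (by rwa [abs_sub_comm]) (not_le.1 h).le
  refine (intervalIntegral.abs_integral_le_integral_abs h).trans ?_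
  rw [← UnitAddCircle.intervalIntegral_preimage a]
  refine integral_mono_interval le_rfl h (by linarith [le_abs_self (b - a)])
    (.of_forall fun s => abs_nonneg _) ?_
  exact lift_intervalIntegrable hf.abs a (a + 1)

/-- `v` is the weak derivative of `u` on the torus. -/
structure WD (u v : 𝕊) : Prop where
  int : Integrable u
  int' : Integrable v
  -- Testing against translates of countably many kernels suffices: other test functions follow by
  -- mollification (`WD.ibp`), and the condition can be verified at almost every time
  -- (`IsWeakGradient.ae_WD`).
  eq : ∀ n x, cv (K1 (wid n)) u x = cw n v x

lemma WD.hasTD {u v : 𝕊} (h : WD u v) (n : ℕ) : HasTD (cw n u) (cw n v) := by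
  rw [← funext (h.eq n)]
  exact cv_hasTD (Kw_hasTD n) (K1w_continuous n) h.int

lemma cv_wid_continuous {g : 𝕊} (hg : Integrable g) (n : ℕ) :
    Continuous (cw n g) := cv_continuous (Kw_continuous n) hg

lemma cv_wid_integrable {g : 𝕊} (hg : Integrable g) (n : ℕ) :
    Integrable (cw n g) := torus_integrable (cv_wid_continuous hg n)

lemma tendsto_integral_of_L1 {α : Type*} [MeasurableSpace α] {μ : Measure α} {f : ℕ → α → ℝ}
    {g : α → ℝ} (hf : ∀ n, Integrable (f n) μ) (hg : Integrable g μ)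
    (h : Tendsto (fun n => ∫ x, |f n x - g x| ∂μ) atTop (𝓝 0)) :
    Tendsto (fun n => ∫ x, f n x ∂μ) atTop (𝓝 (∫ x, g x ∂μ)) := by
  rw [tendsto_iff_dist_tendsto_zero]
  refine squeeze_zero (fun _ => dist_nonneg) (fun n => ?_) h
  rw [Real.dist_eq, ← integral_sub (hf n) hg]
  exact abs_integral_le_integral_abs

lemma tendsto_integral_mul_of_L1 {α : Type*} [MeasurableSpace α] {μ : Measure α} {f : ℕ → α → ℝ}
    {g b : α → ℝ} {C : ℝ} (hb : AEStronglyMeasurable b μ) (hC : ∀ᵐ x ∂μ, |b x| ≤ C)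
    (hf : ∀ n, Integrable (f n) μ) (hg : Integrable g μ)
    (h : Tendsto (fun n => ∫ x, |f n x - g x| ∂μ) atTop (𝓝 0)) :
    Tendsto (fun n => ∫ x, b x * f n x ∂μ) atTop (𝓝 (∫ x, b x * g x ∂μ)) := by
  refine tendsto_integral_of_L1 (fun n => (hf n).bdd_mul hb hC) (hg.bdd_mul hb hC) ?_
  have h2 := h.const_mul C
  rw [mul_zero] at h2
  refine squeeze_zero (fun _ => integral_nonneg fun _ => abs_nonneg _) (fun n => ?_) h2
  rw [← integral_const_mul]
  refine integral_mono_ae (((hf n).bdd_mul hb hC).sub (hg.bdd_mul hb hC)).abs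
    (((hf n).sub hg).abs.const_mul C) ?_
  filter_upwards [hC] with x hx
  rw [← mul_sub, abs_mul]
  exact mul_le_mul_of_nonneg_right hx (abs_nonneg _)

lemma WD.ibp {u v ξ ξ' : 𝕊} (h : WD u v) (hξ : HasTD ξ ξ') (hc : Continuous ξ') :
    ∫ x, ξ' x * u x = -∫ x, ξ x * v x := by
  obtain ⟨C1, _, h1⟩ := torus_bound hc
  obtain ⟨C2, _, h2⟩ := torus_bound hξ.continuous
  have t1 := tendsto_integral_mul_of_L1 hc.aestronglyMeasurable (.of_forall h1)
    (cv_wid_integrable h.int) h.int (cv_K_tendsto_L1 h.int)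
  have t2 := (tendsto_integral_mul_of_L1 hξ.continuous.aestronglyMeasurable
    (.of_forall h2) (cv_wid_integrable h.int') h.int' (cv_K_tendsto_L1 h.int')).neg
  refine tendsto_nhds_unique t1 (t2.congr fun n => ?_)
  have := hξ.integral_mul_deriv (h.hasTD n) hc (cv_wid_continuous h.int' n)
  linarith

lemma WD.integral_eq_zero {u v : 𝕊} (h : WD u v) : ∫ x, v x = 0 := by
  have h1 := (h.hasTD 0).integral_eq_zero (cv_wid_continuous h.int' 0)
  rwa [integral_cv (K_continuous (wid_pos 0) (wid_le 0)) h.int', integral_K (wid_pos 0) (wid_le 0),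
    one_mul] at h1

/-- A function on the torus with weak derivative `v` agrees almost everywhere with a primitive
of `v`. -/
lemma WD.exists_rep {u v : 𝕊} (h : WD u v) : ∃ w : 𝕊, Continuous w ∧
    (∀ᵐ x, u x = w x) ∧ ∀ a b : ℝ, w b - w a = ∫ s in a..b, v (s : Torus) := by
  obtain ⟨ns, hns, hae⟩ := exists_subseq_tendsto_ae (cv_wid_integrable h.int) h.int
    (cv_K_tendsto_L1 h.int)
  obtain ⟨x0, hx0⟩ := hae.exists
  obtain ⟨s0, rfl⟩ := mk_surjective x0
  change Tendsto (fun i => cw (ns i) u (s0 : Torus)) atTop (𝓝 (u (s0 : Torus))) at hx0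
  have hII := lift_intervalIntegrable h.int'
  -- The weak derivative has mean zero, so the primitive closes up after one period and descends to
  -- the torus. Its constant is fixed at a point where the mollifications of `u` converge.
  have hper : Function.Periodic (fun s => u (s0 : Torus) + ∫ r in s0..s, v (r : Torus)) (1 : ℝ) := by
    intro s
    simp only
    rw [← integral_add_adjacent_intervals (hII s0 s) (hII s (s + 1)),
      UnitAddCircle.intervalIntegral_preimage s v, h.integral_eq_zero, add_zero]
  refine ⟨hper.lift, ?_, ?_, ?_⟩
  · refine continuous_of_comp_coe ?_
    simp only [Function.Periodic.lift_coe]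
    exact continuous_const.add (intervalIntegral.continuous_primitive hII s0)
  · filter_upwards [hae] with x hx
    obtain ⟨b, ⟨hb1, hb2⟩, rfl⟩ := (AddCircle.coe_image_Ico_eq (1 : ℝ) s0).ge (Set.mem_univ x)
    rw [Function.Periodic.lift_coe]
    have hsub : |b - s0| ≤ 1 := by rw [abs_le]; constructor <;> linarith
    have hlim : Tendsto (fun i => cw (ns i) u (s0 : Torus) +
        ∫ r in s0..b, cw (ns i) v (r : Torus)) atTop
        (𝓝 (u (s0 : Torus) + ∫ r in s0..b, v (r : Torus))) := by
      refine hx0.add ?_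
      rw [tendsto_iff_dist_tendsto_zero]
      refine squeeze_zero (fun _ => dist_nonneg) (fun i => ?_)
        ((cv_K_tendsto_L1 h.int').comp hns.tendsto_atTop)
      rw [Real.dist_eq, ← intervalIntegral.integral_sub
        (lift_intervalIntegrable (cv_wid_integrable h.int' _) _ _) (hII _ _)]
      exact abs_intervalIntegral_le_torus ((cv_wid_integrable h.int' _).sub h.int') hsub
    refine tendsto_nhds_unique hx (hlim.congr fun i => ?_)
    rw [← (h.hasTD (ns i)).sub_eq_integral (cv_wid_continuous h.int' _)]
    ring
  · intro a b
    rw [Function.Periodic.lift_coe, Function.Periodic.lift_coe,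
      ← integral_add_adjacent_intervals (hII s0 a) (hII a b)]
    ring

/-- Both derivatives have the same mollifications, and these converge to each of them in `L¹`. -/
lemma WD.unique {u v v' : 𝕊} (h : WD u v) (h' : WD u v') : ∀ᵐ x, v x = v' x := by
  have hi : Integrable fun x => v x - v' x := h.int'.sub h'.int'
  have h1 := cv_K_tendsto_L1 hi
  have h2 : ∀ n x, cw n (fun x => v x - v' x) x = 0 := fun n x => by
    rw [cv_sub (Kw_continuous n) h.int' h'.int', ← h.eq, ← h'.eq, sub_self]
  simp only [h2, zero_sub, abs_neg] at h1
  have h3 : ∫ x, |v x - v' x| = 0 := tendsto_nhds_unique tendsto_const_nhds h1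
  rw [integral_eq_zero_iff_of_nonneg (fun x => abs_nonneg _) hi.abs] at h3
  filter_upwards [h3] with x hx
  simpa [sub_eq_zero] using hx

lemma WD.add {u v u' v' : 𝕊} (h : WD u v) (h' : WD u' v') :
    WD (fun x => u x + u' x) (fun x => v x + v' x) := by
  refine ⟨h.int.add h'.int, h.int'.add h'.int', fun n x => ?_⟩
  rw [cv_add (K1w_continuous n) h.int h'.int, cv_add (Kw_continuous n) h.int' h'.int', h.eq, h'.eq]

lemma WD.zero : WD (fun _ => 0) (fun _ => 0) := by
  refine ⟨integrable_zero _ _ _, integrable_zero _ _ _, fun n x => ?_⟩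
  simp [cv]

lemma WD.sum {ι : Type*} (s : Finset ι) {u v : ι → Torus → ℝ} (h : ∀ i, WD (u i) (v i)) :
    WD (fun x => ∑ i ∈ s, u i x) (fun x => ∑ i ∈ s, v i x) := by
  classical
  induction s using Finset.induction_on with
  | empty => simpa using WD.zero
  | insert i s hi ih => simpa only [Finset.sum_insert hi] using (h i).add ih

/-- The continuous representative oscillates by at most `∫ |v|`; averaging the comparison point over
the torus replaces its value by the mean. This is the source of all bounds that are uniform in
space. -/
lemma WD.le {u v : 𝕊} (h : WD u v) : ∀ᵐ x, u x ≤ (∫ z, u z) + ∫ z, |v z| := by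
  obtain ⟨w, hw, hae, hinc⟩ := h.exists_rep
  have hle : ∀ x z, w x ≤ w z + ∫ z, |v z| := by
    intro x z
    obtain ⟨a, rfl⟩ := mk_surjective z
    obtain ⟨b, ⟨hb1, hb2⟩, rfl⟩ := (AddCircle.coe_image_Ico_eq (1 : ℝ) a).ge (Set.mem_univ x)
    have h1 := (le_abs_self _).trans (abs_intervalIntegral_le_torus h.int' (a := a) (b := b)
      (by rw [abs_le]; constructor <;> linarith))
    rw [← hinc a b] at h1
    change w b ≤ w (a : Torus) + _
    linarith
  filter_upwards [hae] with x hx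
  rw [hx]
  have h2 : ∫ z, u z = ∫ z, w z := integral_congr_ae hae
  have h3 := integral_mono (integrable_const (w x)) ((torus_integrable hw).add
    (integrable_const (∫ z, |v z|))) (fun z => hle x z)
  simp only [Pi.add_apply] at h3
  rw [integral_add (torus_integrable hw) (integrable_const _)] at h3
  simpa [h2] using h3

/-- The mollification error in `L¹` is controlled by the weak derivative. -/
lemma WD.integral_abs_cv_sub_le {u v : 𝕊} (h : WD u v) (n : ℕ) :
    ∫ x, |cw n u x - u x| ≤ 2 * wid n * ∫ x, |v x| := by
  obtain ⟨w, hw, hae, hinc⟩ := h.exists_rep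
  have h0 := wid_pos n
  have h1 := wid_le n
  set d := wid n
  have hcv : ∀ x, cv (K d) u x = cv (K d) w x := fun x => by
    refine integral_congr_ae ?_
    filter_upwards [hae] with z hz
    rw [hz]
  have hwi := torus_integrable hw
  -- Joint integrability holds because the shear `(s, x) ↦ (s, x + s)` preserves the product
  -- measure.
  have hvm : Integrable (fun p : Torus × ℝ => |v (p.1 + (p.2 : Torus))|)
      ((volume : Measure Torus).prod (volume.restrict (Ioc (-d) d))) := by
    have hq : MeasurePreserving (fun p : 𝕏 => (p.1, p.2 + (p.1 : Torus)))
        ((volume.restrict (Ioc (-d) d)).prod (volume : Measure Torus))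
        ((volume.restrict (Ioc (-d) d)).prod (volume : Measure Torus)) :=
      MeasurePreserving.skew_product (g := fun (s : ℝ) (x : Torus) => x + (s : Torus))
        (MeasurePreserving.id _)
        (measurable_snd.add (AddCircle.measurable_mk'.comp measurable_fst))
        (.of_forall fun s => map_add_right_eq_self _ _)
    have h2 : Integrable (fun p : 𝕏 => |v p.2|)
        ((volume.restrict (Ioc (-d) d)).prod (volume : Measure Torus)) := by
      have := (integrable_const (μ := volume.restrict (Ioc (-d) d)) (1 : ℝ)).mul_prod h.int'.abs
      simpa using this
    exact (hq.integrable_comp_of_integrable h2).swap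
  -- The kernel averages values of `w` within distance `d` of `x`, and each differs from `w x` by at
  -- most the integral of `|v|` over that neighbourhood. Integration over `x` and Fubini then give
  -- the factor `2 d`.
  have hpt : ∀ x : Torus, |cv (K d) w x - w x| ≤ ∫ s in Ioc (-d) d, |v (x + (s : Torus))| := by
    intro x
    refine abs_cv_K_sub_le h0 h1 hwi x _ _ fun z hz => ?_
    obtain ⟨a, rfl⟩ := mk_surjective x
    change ‖(a : Torus) - z‖ < d at hz
    change |w z - w (a : Torus)| ≤ ∫ s in Ioc (-d) d, |v ((a : Torus) + (s : Torus))|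
    have hz' : |rep (z - (a : Torus))| < d := by rwa [abs_rep, ← norm_neg, neg_sub]
    have hze : ((a + rep (z - (a : Torus)) : ℝ) : Torus) = z := by
      rw [AddCircle.coe_add, coe_rep]
      abel
    rw [abs_lt] at hz'
    rw [← hze, hinc]
    set b := rep (z - (a : Torus))
    have e1 : ∫ s in a..a + b, v (s : Torus) = ∫ s in (0 : ℝ)..b, v ((a : Torus) + (s : Torus)) := by
      have := intervalIntegral.integral_comp_add_left (fun s : ℝ => v (s : Torus)) a
        (a := (0 : ℝ)) (b := b)
      rw [add_zero] at this
      rw [← this]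
      rfl
    rw [e1, ← integral_of_le (by linarith)]
    have hii : ∀ p q : ℝ, IntervalIntegrable (fun s : ℝ => v ((a : Torus) + (s : Torus))) volume p q :=
      fun p q => lift_intervalIntegrable (h.int'.comp_add_left (a : Torus)) p q
    rcases le_total 0 b with hb | hb
    · exact (intervalIntegral.abs_integral_le_integral_abs hb).trans
        (integral_mono_interval (by linarith) hb (by linarith)
          (.of_forall fun s => abs_nonneg _) (hii _ _).abs)
    · rw [integral_symm, abs_neg]
      exact (intervalIntegral.abs_integral_le_integral_abs hb).trans
        (integral_mono_interval (by linarith) hb (by linarith)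
          (.of_forall fun s => abs_nonneg _) (hii _ _).abs)
  have e0 : ∫ x, |cv (K d) u x - u x| = ∫ x, |cv (K d) w x - w x| := by
    refine integral_congr_ae ?_
    filter_upwards [hae] with x hx
    rw [hcv, hx]
  rw [e0]
  calc ∫ x, |cv (K d) w x - w x|
      ≤ ∫ x : Torus, ∫ s in Ioc (-d) d, |v (x + (s : Torus))| :=
        integral_mono (torus_integrable
          ((cv_continuous (K_continuous h0 h1) hwi).sub hw).abs) hvm.integral_prod_left hpt
    _ = ∫ s in Ioc (-d) d, ∫ x : Torus, |v (x + (s : Torus))| := integral_integral_swap hvm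
    _ = ∫ s in Ioc (-d) d, ∫ x : Torus, |v x| := by
        congr 1 with s
        exact integral_add_right_eq_self (fun x => |v x|) (s : Torus)
    _ = 2 * d * ∫ x, |v x| := by
        rw [setIntegral_const, Measure.real, Real.volume_Ioc, toReal_ofReal (by linarith),
          smul_eq_mul]
        ring


/-! ### Test functions -/

lemma continuous_of_comp_coe_prod {f : 𝕏 → ℝ}
    (h : Continuous fun p : ℝ × ℝ => f (p.1, (p.2 : Torus))) : Continuous f := by
  have hq : IsOpenQuotientMap (Prod.map (id : ℝ → ℝ) (fun s : ℝ => (s : Torus))) :=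
    IsOpenQuotientMap.id.prodMap
      (QuotientAddGroup.isOpenQuotientMap_mk (N := AddSubgroup.zmultiples (1 : ℝ)))
  exact hq.isQuotientMap.continuous_iff.2 h

namespace TestFunction
variable (φ : TestFunction)

/-- The lift of a test function to `ℝ × ℝ`. -/
def lift (p : ℝ × ℝ) : ℝ := φ.toFun p.1 (p.2 : Torus)

lemma lift_hasFDerivAt (p : ℝ × ℝ) : HasFDerivAt φ.lift (fderiv ℝ φ.lift p) p :=
  ((φ.smooth.differentiable (by simp)) p).hasFDerivAt

lemma hasTD (t : ℝ) (a : ℝ) :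
    HasDerivAt (fun s : ℝ => φ.toFun t (s : Torus)) (fderiv ℝ φ.lift (t, a) (0, 1)) a := by
  have h : HasDerivAt (fun s : ℝ => (t, s)) ((0 : ℝ), (1 : ℝ)) a :=
    (hasDerivAt_const a t).prodMk (hasDerivAt_id a)
  exact (φ.lift_hasFDerivAt (t, a)).comp_hasDerivAt a h

lemma dx_coe (t a : ℝ) : φ.dx t (a : Torus) = fderiv ℝ φ.lift (t, a) (0, 1) := by
  have h : HasDerivAt (fun h : ℝ => φ.toFun t ((a + h : ℝ) : Torus))
      (fderiv ℝ φ.lift (t, a) (0, 1)) 0 := by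
    have h1 := φ.hasTD t (a + 0)
    rw [add_zero] at h1
    exact HasDerivAt.comp_const_add a 0 (by rw [add_zero]; exact h1)
  exact h.deriv

lemma hasTD_dx (t : ℝ) : HasTD (φ.toFun t) (φ.dx t) := fun s => by
  rw [dx_coe]
  exact φ.hasTD t s

lemma hasDerivAt_dt (t : ℝ) (x : Torus) : HasDerivAt (fun s => φ.toFun s x) (φ.dt t x) t := by
  obtain ⟨a, rfl⟩ := mk_surjective x
  have h : HasDerivAt (fun s : ℝ => (s, a)) ((1 : ℝ), (0 : ℝ)) t :=
    (hasDerivAt_id t).prodMk (hasDerivAt_const t a)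
  have h2 := (φ.lift_hasFDerivAt (t, a)).comp_hasDerivAt t h
  exact (HasDerivAt.differentiableAt h2).hasDerivAt

lemma dt_coe (t a : ℝ) : φ.dt t (a : Torus) = fderiv ℝ φ.lift (t, a) (1, 0) := by
  have h : HasDerivAt (fun s : ℝ => (s, a)) ((1 : ℝ), (0 : ℝ)) t :=
    (hasDerivAt_id t).prodMk (hasDerivAt_const t a)
  exact ((φ.lift_hasFDerivAt (t, a)).comp_hasDerivAt t h).deriv

lemma continuous_fderiv_lift : Continuous (fderiv ℝ φ.lift) :=
  ContDiff.continuous_fderiv φ.smooth (by simp)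

lemma continuous_toFun : Continuous fun p : 𝕏 => φ.toFun p.1 p.2 :=
  continuous_of_comp_coe_prod φ.smooth.continuous

lemma continuous_dx : Continuous fun p : 𝕏 => φ.dx p.1 p.2 := by
  refine continuous_of_comp_coe_prod ?_
  simp only [dx_coe]
  exact φ.continuous_fderiv_lift.clm_apply continuous_const

lemma continuous_dt : Continuous fun p : 𝕏 => φ.dt p.1 p.2 := by
  refine continuous_of_comp_coe_prod ?_
  simp only [dt_coe]
  exact φ.continuous_fderiv_lift.clm_apply continuous_const

end TestFunction

/-- The test function `θ(t) ξ(x)`. -/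
def sepTest (θ : ℝ → ℝ) (ξ : 𝕊) (hθ : ContDiff ℝ (⊤ : ℕ∞) θ) (hξ : SmoothT ξ) : TestFunction where
  toFun t x := θ t * ξ x
  smooth := (hθ.comp contDiff_fst).mul (ContDiff.comp (g := fun s : ℝ => ξ (s : Torus)) hξ
    contDiff_snd)

lemma HasTD.unique {f f' f'' : 𝕊} (h : HasTD f f') (h' : HasTD f f'') (x : Torus) :
    f' x = f'' x := by
  obtain ⟨a, rfl⟩ := mk_surjective x
  exact (h a).unique (h' a)

lemma sepTest_dx {θ : ℝ → ℝ} {ξ ξ' : 𝕊} (hθ : ContDiff ℝ (⊤ : ℕ∞) θ) (hξ : SmoothT ξ)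
    (h : HasTD ξ ξ') (t : ℝ) (x : Torus) : (sepTest θ ξ hθ hξ).dx t x = θ t * ξ' x :=
  ((sepTest θ ξ hθ hξ).hasTD_dx t).unique (h.const_mul (θ t)) x

lemma sepTest_dt {θ θ' : ℝ → ℝ} {ξ : 𝕊} (hθ : ContDiff ℝ (⊤ : ℕ∞) θ) (hξ : SmoothT ξ)
    (h : ∀ t, HasDerivAt θ (θ' t) t) (t : ℝ) (x : Torus) :
    (sepTest θ ξ hθ hξ).dt t x = θ' t * ξ x :=
  ((sepTest θ ξ hθ hξ).hasDerivAt_dt t x).unique ((h t).mul_const (ξ x))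

/-! ### Space-time -/

instance (T : ℝ) : IsFiniteMeasure (Ω T) := by unfold spaceTime; infer_instance

lemma spaceTime_bound {f : 𝕏 → ℝ} (hf : Continuous f) (T : ℝ) :
    ∃ C, 0 ≤ C ∧ (∀ t ∈ Icc 0 T, ∀ x, |f (t, x)| ≤ C) ∧ ∀ᵐ p ∂Ω T, |f p| ≤ C := by
  obtain ⟨C, hC⟩ := ((isCompact_Icc (a := (0 : ℝ)) (b := T)).prod
    (isCompact_univ (X := Torus))).exists_bound_of_continuousOn hf.continuousOn
  have h1 : ∀ t ∈ Icc 0 T, ∀ x, |f (t, x)| ≤ max C 0 := fun t ht x =>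
    (hC (t, x) ⟨ht, Set.mem_univ x⟩).trans (le_max_left _ _)
  refine ⟨max C 0, le_max_right _ _, h1, ?_⟩
  have h2 : ∀ᵐ p ∂Ω T, p.1 ∈ Icc 0 T := by
    unfold spaceTime
    exact Measure.quasiMeasurePreserving_fst.ae (ae_restrict_mem measurableSet_Icc)
  filter_upwards [h2] with p hp using h1 p.1 hp p.2

lemma ae_spaceTime_mem (T : ℝ) : ∀ᵐ p ∂Ω T, p.1 ∈ Icc 0 T := by
  unfold spaceTime
  exact Measure.quasiMeasurePreserving_fst.ae (ae_restrict_mem measurableSet_Icc)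

lemma spaceTime_slices {T : ℝ} {f : 𝕏 → ℝ} (hf : Integrable f (Ω T)) :
    ∀ᵐ t ∂𝓛 T, Integrable fun x => f (t, x) := hf.prod_right_ae

lemma integral_spaceTime {T : ℝ} {f : 𝕏 → ℝ} (hf : Integrable f (Ω T)) :
    ∫ p, f p ∂Ω T = ∫ t in Icc 0 T, ∫ x, f (t, x) := integral_prod f hf

lemma slice_integral {T : ℝ} {f : 𝕏 → ℝ} (hf : Integrable f (Ω T)) :
    Integrable (fun t => ∫ x, f (t, x)) 𝓛 T := hf.integral_prod_left

/-- For almost every time, a weak gradient is a weak derivative on the torus. -/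
lemma IsWeakGradient.ae_WD {T : ℝ} {u v : 𝔽} (h : IsWeakGradient T u v) :
    ∀ᵐ t ∂𝓛 T, WD (u t) (v t) := by
  -- For one kernel and one centre `q`, the product of a smooth function of time and the translated
  -- kernel is a test function. Hence the difference of the two convolutions is orthogonal to all
  -- smooth compactly supported functions of time.
  have key : ∀ n : ℕ, ∀ q : Torus, ∀ᵐ t ∂𝓛 T, cv (K1 (wid n)) (u t) q = cw n (v t) q := by
    intro n q
    have h0 := wid_pos n
    have h1 := wid_le n
    obtain ⟨C, hC, hKb⟩ := torus_bound (K_continuous h0 h1)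
    obtain ⟨C1, hC1, hKb1⟩ := torus_bound (K1_continuous h0 h1)
    have hsm : SmoothT fun x => K (wid n) (q - x) := by
      obtain ⟨a, rfl⟩ := mk_surjective q
      exact (K_smooth h0 h1).comp (contDiff_const.sub contDiff_id : ContDiff ℝ _ fun s : ℝ => a - s)
    have hTD := (K_hasTD h0 h1).comp_sub_left q
    have i1 : Integrable (fun p : 𝕏 => K1 (wid n) (q - p.2) * u p.1 p.2) (Ω T) :=
      h.integrable.bdd_mul ((K1_continuous h0 h1).comp
        (continuous_const.sub continuous_snd)).aestronglyMeasurable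
        (.of_forall fun p => hKb1 _)
    have i2 : Integrable (fun p : 𝕏 => K (wid n) (q - p.2) * v p.1 p.2) (Ω T) :=
      h.integrable_gradient.bdd_mul ((K_continuous h0 h1).comp
        (continuous_const.sub continuous_snd)).aestronglyMeasurable
        (.of_forall fun p => hKb _)
    have hint : Integrable (fun t => cv (K1 (wid n)) (u t) q - cw n (v t) q) 𝓛 T :=
      (slice_integral i1).sub (slice_integral i2)
    refine (ae_eq_zero_of_integral_contDiff_smul_eq_zero hint.locallyIntegrable
      fun θ hθ hcs => ?_).mono fun t ht => sub_eq_zero.1 ht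
    have hφ := h.integral_by_parts (sepTest θ _ hθ hsm)
    obtain ⟨Cθ, hCθ⟩ := hcs.exists_bound_of_continuous hθ.continuous
    have j1 : Integrable (fun p : 𝕏 => θ p.1 * (K1 (wid n) (q - p.2) * u p.1 p.2))
        (Ω T) := i1.bdd_mul (hθ.continuous.comp continuous_fst).aestronglyMeasurable
          (.of_forall fun p => hCθ _)
    have j2 : Integrable (fun p : 𝕏 => θ p.1 * (K (wid n) (q - p.2) * v p.1 p.2))
        (Ω T) := i2.bdd_mul (hθ.continuous.comp continuous_fst).aestronglyMeasurable
          (.of_forall fun p => hCθ _)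
    have e1 : ∫ p, u p.1 p.2 * (sepTest θ _ hθ hsm).dx p.1 p.2 ∂Ω T
        = -∫ t in Icc 0 T, θ t * cv (K1 (wid n)) (u t) q := by
      have : ∀ p : 𝕏, u p.1 p.2 * (sepTest θ _ hθ hsm).dx p.1 p.2
          = -(θ p.1 * (K1 (wid n) (q - p.2) * u p.1 p.2)) := fun p => by
        rw [sepTest_dx hθ hsm hTD]
        ring
      simp_rw [this]
      rw [integral_neg, integral_spaceTime j1]
      simp only [integral_const_mul]
      rfl
    have e2 : ∫ p, v p.1 p.2 * (sepTest θ _ hθ hsm).toFun p.1 p.2 ∂Ω T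
        = ∫ t in Icc 0 T, θ t * cw n (v t) q := by
      have : ∀ p : 𝕏, v p.1 p.2 * (sepTest θ _ hθ hsm).toFun p.1 p.2
          = θ p.1 * (K (wid n) (q - p.2) * v p.1 p.2) := fun p => by
        simp only [sepTest]
        ring
      simp_rw [this]
      rw [integral_spaceTime j2]
      simp only [integral_const_mul]
      rfl
    rw [e1, e2] at hφ
    simp only [smul_eq_mul, mul_sub]
    have k1 := slice_integral j1
    have k2 := slice_integral j2
    simp only [integral_const_mul] at k1 k2
    have k3 := integral_sub k1 k2
    change ∫ t in Icc 0 T, (θ t * cv (K1 (wid n)) (u t) q - θ t * cw n (v t) q) =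
      (∫ t in Icc 0 T, θ t * cv (K1 (wid n)) (u t) q) - ∫ t in Icc 0 T, θ t * cw n (v t) q at k3
    rw [k3]
    linarith
  -- Countably many kernels and a countable dense set of centres leave a single null set of times;
  -- continuity in the centre gives the remaining points.
  have key2 : ∀ᵐ t ∂𝓛 T, ∀ n k : ℕ, cv (K1 (wid n)) (u t) (TopologicalSpace.denseSeq Torus k)
        = cw n (v t) (TopologicalSpace.denseSeq Torus k) :=
    ae_all_iff.2 fun n => ae_all_iff.2 fun k => key n _
  filter_upwards [key2, spaceTime_slices h.integrable, spaceTime_slices h.integrable_gradient]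
    with t ht hu hv
  refine ⟨hu, hv, fun n => congrFun (Continuous.ext_on (TopologicalSpace.denseRange_denseSeq Torus)
    (cv_continuous (K1w_continuous n) hu) (cv_wid_continuous hv n) ?_)⟩
  rintro _ ⟨k, rfl⟩
  exact ht n k

lemma cv_measurable {f : 𝕊} (hf : Measurable f) {g : 𝔽} (hg : Measurable fun p : 𝕏 => g p.1 p.2) :
    Measurable fun p : 𝕏 => cv f (g p.1) p.2 := by
  have h : StronglyMeasurable fun q : (𝕏) × Torus => f (q.1.2 - q.2) * g q.1.1 q.2 := by fun_prop
  exact (StronglyMeasurable.integral_prod_right h).measurable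


/-! ### Absolutely continuous functions of time -/

/-- `u` is absolutely continuous on `[0, T]` with derivative `g`. -/
structure ACD (T : ℝ) (u g : ℝ → ℝ) : Prop where
  ac : AbsolutelyContinuousOnInterval u 0 T
  der : ∀ᵐ s, s ∈ uIcc 0 T → HasDerivAt u (g s) s

lemma ACD.sub_eq {T : ℝ} {u g : ℝ → ℝ} (h : ACD T u g) : u T - u 0 = ∫ s in (0 : ℝ)..T, g s := by
  rw [← h.ac.integral_deriv_eq_sub]
  refine intervalIntegral.integral_congr_ae ?_
  filter_upwards [h.der] with s hs hs2 using (hs (Set.uIoc_subset_uIcc hs2)).deriv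

lemma ACD.intervalIntegrable {T : ℝ} {u g : ℝ → ℝ} (h : ACD T u g) :
    IntervalIntegrable g volume 0 T := by
  refine h.ac.intervalIntegrable_deriv.congr_ae ?_
  rw [EventuallyEq, ae_restrict_iff' measurableSet_uIoc]
  filter_upwards [h.der] with s hs hs2 using (hs (Set.uIoc_subset_uIcc hs2)).deriv

lemma ACD.mul {T : ℝ} {u g u' g' : ℝ → ℝ} (h : ACD T u g) (h' : ACD T u' g') :
    ACD T (fun s => u s * u' s) (fun s => g s * u' s + u s * g' s) := by
  refine ⟨h.ac.mul h'.ac, ?_⟩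
  filter_upwards [h.der, h'.der] with s h1 h2 h3 using (h1 h3).mul (h2 h3)

/-- On the compact range of `u` the function `F` is Lipschitz, and Lipschitz maps preserve absolute
continuity. -/
lemma ACD.comp {T : ℝ} {u g F F' : ℝ → ℝ} (h : ACD T u g) (hF : ∀ x, HasDerivAt F (F' x) x)
    (hF' : Continuous F') : ACD T (fun s => F (u s)) (fun s => F' (u s) * g s) := by
  constructor
  · have hK : IsCompact (u '' uIcc 0 T) := isCompact_uIcc.image_of_continuousOn h.ac.continuousOn
    obtain ⟨R, hR⟩ := hK.isBounded.subset_closedBall 0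
    obtain ⟨C, hC⟩ := (isCompact_closedBall (0 : ℝ) R).exists_bound_of_continuousOn hF'.continuousOn
    have hlip : ∀ x ∈ Metric.closedBall (0 : ℝ) R, ∀ y ∈ Metric.closedBall (0 : ℝ) R,
        dist (F x) (F y) ≤ max C 1 * dist x y := by
      intro x hx y hy
      rw [dist_eq_norm, dist_eq_norm]
      exact (convex_closedBall (0 : ℝ) R).norm_image_sub_le_of_norm_hasDerivWithin_le
        (fun z _ => (hF z).hasDerivWithinAt) (fun z hz => (hC z hz).trans (le_max_left _ _)) hy hx
    rw [absolutelyContinuousOnInterval_iff]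
    have hac := (absolutelyContinuousOnInterval_iff u 0 T).1 h.ac
    intro η hη
    have hM : 0 < max C 1 := lt_of_lt_of_le one_pos (le_max_right _ _)
    obtain ⟨d, hd, hd2⟩ := hac (η / max C 1) (div_pos hη hM)
    refine ⟨d, hd, fun E hE hlen => ?_⟩
    have h2 := hd2 E hE hlen
    rw [lt_div_iff₀ hM, mul_comm, mul_sum] at h2
    refine lt_of_le_of_lt (sum_le_sum fun i hi => ?_) h2
    have h3 := hE.1 i hi
    exact hlip _ (hR (Set.mem_image_of_mem u h3.1)) _ (hR (Set.mem_image_of_mem u h3.2))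
  · filter_upwards [h.der] with s h1 h2 using (hF (u s)).comp s (h1 h2)

lemma ACD.of_primitive {T : ℝ} (hT : 0 ≤ T) {u g : ℝ → ℝ} (hg : IntervalIntegrable g volume 0 T)
    (hu : ∀ t ∈ Icc 0 T, u t = u 0 + ∫ s in (0 : ℝ)..t, g s) : ACD T u g := by
  have h1 : AbsolutelyContinuousOnInterval (fun t => u 0 + ∫ s in (0 : ℝ)..t, g s) 0 T := by
    have h2 := hg.absolutelyContinuousOnInterval_intervalIntegral (c := 0) (by simp)
    have h3 : AbsolutelyContinuousOnInterval (fun _ : ℝ => u 0) 0 T :=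
      (contDiff_const.contDiffOn (n := 1)).absolutelyContinuousOnInterval
    exact h3.add h2
  constructor
  · rw [absolutelyContinuousOnInterval_iff] at h1 ⊢
    intro η hη
    obtain ⟨d, hd, hd2⟩ := h1 η hη
    refine ⟨d, hd, fun E hE hlen => lt_of_le_of_lt (le_of_eq ?_) (hd2 E hE hlen)⟩
    refine sum_congr rfl fun i hi => ?_
    have h3 := hE.1 i hi
    rw [uIcc_of_le hT] at h3
    rw [hu _ h3.1, hu _ h3.2]
  -- The end points are discarded because the formula for `u` is known on `[0, T]` only and a
  -- two-sided derivative requires a neighbourhood.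
  · have e0 : ∀ᵐ s : ℝ, s ≠ 0 := by simp [ae_iff, measure_singleton]
    have eT : ∀ᵐ s : ℝ, s ≠ T := by simp [ae_iff, measure_singleton]
    filter_upwards [hg.ae_hasDerivAt_integral, e0, eT] with s hs h0 hsT hmem
    have h2 := (hs hmem 0 (by simp)).const_add (u 0)
    rw [uIcc_of_le hT] at hmem
    refine h2.congr_of_eventuallyEq ?_
    filter_upwards [Icc_mem_nhds (lt_of_le_of_ne hmem.1 h0.symm) (lt_of_le_of_ne hmem.2 hsT)]
      with t ht using hu t ht

lemma ACD.sub {T : ℝ} {u g u' g' : ℝ → ℝ} (h : ACD T u g) (h' : ACD T u' g') :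
    ACD T (fun s => u s - u' s) (fun s => g s - g' s) := by
  refine ⟨h.ac.sub h'.ac, ?_⟩
  filter_upwards [h.der, h'.der] with s h1 h2 h3 using (h1 h3).sub (h2 h3)

lemma ACD.congr {T : ℝ} (hT : 0 ≤ T) {u g g' : ℝ → ℝ} (h : ACD T u g)
    (hg : ∀ᵐ s ∂𝓛 T, g s = g' s) : ACD T u g' := by
  refine ⟨h.ac, ?_⟩
  rw [ae_restrict_iff' measurableSet_Icc] at hg
  filter_upwards [h.der, hg] with s h1 h2 h3
  rw [← h2 (by rwa [uIcc_of_le hT] at h3)]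
  exact h1 h3

lemma ACD.mono {T t : ℝ} {u g : ℝ → ℝ} (h : ACD T u g) (ht : t ∈ Icc 0 T) : ACD t u g := by
  have hsub : uIcc 0 t ⊆ uIcc 0 T := by
    rw [uIcc_of_le ht.1, uIcc_of_le (ht.1.trans ht.2)]
    exact Icc_subset_Icc_right ht.2
  refine ⟨h.ac.mono hsub, ?_⟩
  filter_upwards [h.der] with s hs hs2 using hs (hsub hs2)

/-! ### Continuity equations -/

/-- The continuity equation `∂_t q + ∂_x j = 0` on `[0,T] × 𝕋`, in weak form. -/
structure Transport (T : ℝ) (q j : 𝔽) : Prop where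
  meas : Measurable fun p : 𝕏 => q p.1 p.2
  meas' : Measurable fun p : 𝕏 => j p.1 p.2
  int : ∀ t ∈ Icc 0 T, Integrable (q t)
  int' : Integrable (fun p : 𝕏 => j p.1 p.2) (Ω T)
  eq : ∀ ξ ξ' : 𝕊, SmoothT ξ → HasTD ξ ξ' → ∀ t ∈ Icc 0 T,
    ∫ x, ξ x * q t x = (∫ x, ξ x * q 0 x) + ∫ s in (0 : ℝ)..t, ∫ x, ξ' x * j s x

lemma SmoothT.exists_hasTD {ξ : 𝕊} (h : SmoothT ξ) : ∃ ξ', HasTD ξ ξ' ∧ SmoothT ξ' := by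
  have hper : Function.Periodic (deriv fun s : ℝ => ξ (s : Torus)) 1 := fun s => by
    rw [← deriv_comp_add_const]
    simp only [AddCircle.coe_add_period]
  refine ⟨hper.lift, fun s => ?_, ?_⟩
  · rw [Function.Periodic.lift_coe]
    exact ((ContDiff.differentiable h (by simp)) s).hasDerivAt
  · simp only [SmoothT, Function.Periodic.lift_coe]
    exact ((contDiff_infty_iff_deriv (𝕜 := ℝ)).1 h).2

lemma SmoothT.continuous_deriv {ξ ξ' : 𝕊} (h : SmoothT ξ) (hξ : HasTD ξ ξ') : Continuous ξ' := by
  obtain ⟨ξ'', h1, h2⟩ := h.exists_hasTD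
  rw [funext (hξ.unique h1)]
  exact continuous_of_comp_coe h2.continuous

lemma SmoothT.comp_sub_left {ξ : 𝕊} (h : SmoothT ξ) (x : Torus) : SmoothT fun z => ξ (x - z) := by
  obtain ⟨a, rfl⟩ := mk_surjective x
  exact ContDiff.comp (g := fun s : ℝ => ξ (s : Torus)) h
    (contDiff_const.sub contDiff_id : ContDiff ℝ _ fun s : ℝ => a - s)

lemma integrable_mul_slice {T : ℝ} {j : 𝔽} {ξ : 𝕊}
    (hj : Integrable (fun p : 𝕏 => j p.1 p.2) (Ω T)) (hξ : Continuous ξ) :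
    Integrable (fun p : 𝕏 => ξ p.2 * j p.1 p.2) (Ω T) := by
  obtain ⟨C, _, hb⟩ := torus_bound hξ
  exact hj.bdd_mul (hξ.comp continuous_snd).aestronglyMeasurable (.of_forall fun p => hb p.2)

lemma intervalIntegrable_slice {T : ℝ} (hT : 0 ≤ T) {f : 𝕏 → ℝ} (hf : Integrable f (Ω T)) :
    IntervalIntegrable (fun t => ∫ x, f (t, x)) volume 0 T := by
  rw [intervalIntegrable_iff_integrableOn_Icc_of_le hT]
  exact slice_integral hf

lemma integral_Icc_eq {T : ℝ} (hT : 0 ≤ T) (f : ℝ → ℝ) :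
    ∫ t in Icc 0 T, f t = ∫ t in (0 : ℝ)..T, f t := by
  rw [integral_Icc_eq_integral_Ioc, integral_of_le hT]

/-- The weak form with the test function `z ↦ ξ (x - z)` turns the continuity equation into an
honest equation in time at every single point `x`; the sign comes from differentiating in `z`. -/
lemma Transport.acd {T : ℝ} {q j : 𝔽} (h : Transport T q j) (hT : 0 ≤ T)
    {ξ ξ' : 𝕊} (hs : SmoothT ξ) (hξ : HasTD ξ ξ') (x : Torus) :
    ACD T (fun t => cv ξ (q t) x) (fun t => -cv ξ' (j t) x) := by
  have h1 := h.eq _ _ (hs.comp_sub_left x) (hξ.comp_sub_left x)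
  have h2 : ∀ s, ∫ z, -ξ' (x - z) * j s z = -cv ξ' (j s) x := fun s => by
    rw [cv, ← integral_neg]
    congr 1 with z
    ring
  simp only [h2] at h1
  refine ACD.of_primitive hT ?_ h1
  have h3 := intervalIntegrable_slice hT (integrable_mul_slice h.int'
    ((hs.continuous_deriv hξ).comp (continuous_const.sub continuous_id) :
      Continuous fun z => ξ' (x - z)))
  exact h3.neg


/-! ### The periodic primitive -/

/-- The smooth function on the torus whose derivative is `K (wid n) - 1`. -/
noncomputable def sig (n : ℕ) (z : Torus) : ℝ :=
  ∫ s in (0 : ℝ)..rep z, (K (wid n) (s : Torus) - 1)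

/-- The limit of `sig n`. -/
noncomputable def sigLim (z : Torus) : ℝ :=
  if 0 < rep z then 1 / 2 - rep z else if rep z < 0 then -1 / 2 - rep z else 0

lemma K_wid_sub_one_integrable (n : ℕ) : Integrable fun z => K (wid n) z - 1 :=
  (torus_integrable (Kw_continuous n)).sub (integrable_const _)

/-- The integrand has mean zero, so the primitive does not depend on the representative of the
point. -/
lemma sig_coe (n : ℕ) (s : ℝ) : sig n (s : Torus) = ∫ u in (0 : ℝ)..s, (K (wid n) (u : Torus) - 1) := by
  obtain ⟨k, hk⟩ := exists_int_sub_rep s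
  have hp : Function.Periodic (fun u : ℝ => K (wid n) (u : Torus) - 1) 1 := fun u => by simp
  have hI := lift_intervalIntegrable (K_wid_sub_one_integrable n)
  have h0 : ∫ u in (0 : ℝ)..(0 + 1), (K (wid n) (u : Torus) - 1) = 0 := by
    rw [UnitAddCircle.intervalIntegral_preimage 0 (fun z => K (wid n) z - 1), integral_sub
      (torus_integrable (Kw_continuous n)) (integrable_const _),
      integral_Kw n]
    simp
  have h1 := hp.intervalIntegral_add_zsmul_eq k (s - k)
  have h2 := integral_add_adjacent_intervals (hI 0 (s - k)) (hI (s - k) s)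
  rw [show s - k + k • (1 : ℝ) = s by simp, hp.intervalIntegral_add_eq (s - k) 0, h0, smul_zero] at h1
  rw [sig, hk, ← h2, h1 hI, add_zero]

lemma sig_hasTD (n : ℕ) : HasTD (sig n) (fun z => K (wid n) z - 1) := by
  intro s
  have hc : Continuous fun u : ℝ => K (wid n) (u : Torus) - 1 :=
    ((Kw_continuous n).comp (AddCircle.continuous_mk' 1)).sub continuous_const
  rw [funext (sig_coe n)]
  exact integral_hasDerivAt_right (hc.intervalIntegrable _ _)
    (hc.stronglyMeasurableAtFilter _ _) hc.continuousAt

lemma sig_smooth (n : ℕ) : SmoothT (sig n) := by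
  refine contDiff_infty_iff_deriv.2 ⟨fun s => (sig_hasTD n s).differentiableAt, ?_⟩
  rw [funext fun s => (sig_hasTD n s).deriv]
  exact ContDiff.sub (K_smooth (wid_pos n) (wid_le n)) contDiff_const

lemma sig_continuous (n : ℕ) : Continuous (sig n) := (sig_hasTD n).continuous

lemma sig_le (n : ℕ) (z : Torus) : |sig n z| ≤ 2 := by
  have hm := rep_mem z
  refine (abs_intervalIntegral_le_torus (K_wid_sub_one_integrable n)
    (by rw [abs_le]; constructor <;> linarith [hm.1, hm.2])).trans ?_
  have hK := torus_integrable (Kw_continuous n)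
  have h1 : ∫ z, |K (wid n) z - 1| ≤ ∫ z, (K (wid n) z + 1) := by
    refine integral_mono (K_wid_sub_one_integrable n).abs (hK.add (integrable_const _)) fun z => ?_
    have := Kw_nonneg n z
    simp only
    rw [abs_le]
    constructor <;> linarith
  refine h1.trans ?_
  rw [integral_add hK (integrable_const _), integral_Kw n]
  simp
  norm_num

/-- The kernel is even with total mass one, and nothing is left beyond its width: half of the mass
lies on each side of the origin. -/
lemma integral_K_half (n : ℕ) {s : ℝ} (h : wid n ≤ s) (h2 : s ≤ 1 / 2) :
    (∫ u in (0 : ℝ)..s, K (wid n) (u : Torus)) = 1 / 2 ∧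
      (∫ u in (0 : ℝ)..(-s), K (wid n) (u : Torus)) = -(1 / 2) := by
  have h0 := wid_pos n
  have hc : Continuous fun u : ℝ => K (wid n) (u : Torus) :=
    (K_continuous h0 (wid_le n)).comp (AddCircle.continuous_mk' 1)
  have hev : ∀ u : ℝ, K (wid n) ((-u : ℝ) : Torus) = K (wid n) (u : Torus) := fun u => by
    rw [AddCircle.coe_neg, K_neg]
  have hI : ∀ a b, IntervalIntegrable (fun u : ℝ => K (wid n) (u : Torus)) volume a b :=
    fun a b => hc.intervalIntegrable a b
  have e1 : ∫ u in (0 : ℝ)..(-s), K (wid n) (u : Torus) = -∫ u in (0 : ℝ)..s, K (wid n) (u : Torus) := by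
    rw [integral_symm]
    congr 1
    have := intervalIntegral.integral_comp_neg (a := (0 : ℝ)) (b := s)
      (fun u : ℝ => K (wid n) (u : Torus))
    simp only [hev, neg_zero] at this
    exact this.symm
  have e2 : ∀ a b : ℝ, a ≤ b → (∀ u ∈ Ioc a b, wid n ≤ |u| ∧ |u| ≤ 1 / 2) →
      ∫ u in a..b, K (wid n) (u : Torus) = 0 := by
    intro a b hab hu
    rw [integral_of_le hab]
    refine setIntegral_eq_zero_of_forall_eq_zero fun u hu2 => K_eq_zero h0 ?_
    have h3 := hu u hu2
    rw [(AddCircle.norm_coe_eq_abs_iff (1 : ℝ) one_ne_zero).2 (by rw [abs_one]; exact h3.2)]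
    exact h3.1
  have e3 : ∫ u in (-1 / 2 : ℝ)..1 / 2, K (wid n) (u : Torus) = 1 := by
    rw [← integral_torus_eq, integral_K h0 (wid_le n)]
  have e4 : ∫ u in (-1 / 2 : ℝ)..(-s), K (wid n) (u : Torus) = 0 := by grind
  have e5 : ∫ u in s..(1 / 2), K (wid n) (u : Torus) = 0 := by grind
  have a1 := integral_add_adjacent_intervals (hI (-1 / 2) (-s)) (hI (-s) (1 / 2))
  have a2 := integral_add_adjacent_intervals (hI (-s) 0) (hI 0 (1 / 2))
  have a3 := integral_add_adjacent_intervals (hI 0 s) (hI s (1 / 2))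
  rw [integral_symm] at a2
  constructor <;> linarith

/-- At each point the sequence is eventually constant: once the width is below `|rep z|`, exactly
half of the kernel lies between `0` and `z`. The limit is a sawtooth with a jump at `0`. -/
lemma sig_tendsto (z : Torus) : Tendsto (fun n => sig n z) atTop (𝓝 (sigLim z)) := by
  have hm := rep_mem z
  have hsub : ∀ (n : ℕ) (s : ℝ), ∫ u in (0 : ℝ)..s, (K (wid n) (u : Torus) - 1)
      = (∫ u in (0 : ℝ)..s, K (wid n) (u : Torus)) - s := fun n s => by
    rw [intervalIntegral.integral_sub (lift_intervalIntegrable (torus_integrable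
      (Kw_continuous n)) _ _) (by simp)]
    simp
  refine tendsto_const_nhds.congr' ?_
  unfold sigLim
  rcases lt_trichotomy (rep z) 0 with h | h | h
  · filter_upwards [(tendsto_order.1 wid_tendsto).2 (-rep z) (by linarith)] with n hn
    rw [if_neg (by linarith), if_pos h, sig, hsub]
    have := (integral_K_half n hn.le (by linarith [hm.1])).2
    rw [neg_neg] at this
    rw [this]
    ring
  · refine .of_forall fun n => ?_
    simp [sig, h]
  · filter_upwards [(tendsto_order.1 wid_tendsto).2 (rep z) h] with n hn
    rw [if_pos h, sig, hsub, (integral_K_half n hn.le (by linarith [hm.2])).1]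

lemma sigLim_measurable : Measurable sigLim := by
  unfold sigLim
  refine Measurable.ite (measurableSet_lt measurable_const measurable_rep)
    (measurable_const.sub measurable_rep) ?_
  exact Measurable.ite (measurableSet_lt measurable_rep measurable_const)
    (measurable_const.sub measurable_rep) measurable_const

lemma cv_sig_tendsto {g : 𝕊} (hg : Integrable g) (x : Torus) :
    Tendsto (fun n => cv (sig n) g x) atTop (𝓝 (cv sigLim g x)) := by
  refine tendsto_integral_of_dominated_convergence (fun z => 2 * |g z|)
    (fun n => (cv_integrand (sig_continuous n) hg x).aestronglyMeasurable) (hg.abs.const_mul 2)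
    (fun n => .of_forall fun z => ?_)
    (.of_forall fun z => (sig_tendsto _).mul_const _)
  rw [norm_eq_abs, abs_mul]
  exact mul_le_mul_of_nonneg_right (sig_le n _) (abs_nonneg _)

lemma cv_sub_one {g : 𝕊} (hg : Integrable g) (n : ℕ) (x : Torus) :
    cv (fun z => K (wid n) z - 1) g x = cw n g x - ∫ z, g z := by
  simp only [cv, sub_mul, one_mul]
  exact integral_sub (cv_integrand (Kw_continuous n) hg x) hg

/-! ### The Lagrangian coordinate -/

/-- The total flux up to time `t`. -/
noncomputable def cumFlux (T : ℝ) (J : 𝔽) (t : ℝ) : ℝ :=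
  -- The cutoff makes the primitive continuous on the whole real line, hence the displacement
  -- measurable without restriction on the time.
  ∫ s in (0 : ℝ)..t, (Icc 0 T).indicator (fun s => ∫ x, J s x) s

/-- The mollified displacement between the Lagrangian and the Eulerian coordinate. -/
noncomputable def dispN (T : ℝ) (r J : 𝔽) (n : ℕ) (t : ℝ) (x : Torus) : ℝ :=
  cv (sig n) (r t) x - cumFlux T J t

/-- The displacement between the Lagrangian and the Eulerian coordinate. -/
noncomputable def disp (T : ℝ) (r J : 𝔽) (t : ℝ) (x : Torus) : ℝ :=
  cv sigLim (r t) x - cumFlux T J t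

section
variable {T : ℝ} {r J : 𝔽} (hT : 0 < T) (h : Transport T r J)
include h

lemma Transport.indicator_integrable : Integrable ((Icc 0 T).indicator fun s => ∫ x, J s x) := by
  rw [integrable_indicator_iff measurableSet_Icc]
  exact slice_integral h.int'

lemma cumFlux_continuous : Continuous (cumFlux T J) :=
  intervalIntegral.continuous_primitive (fun _ _ => h.indicator_integrable.intervalIntegrable) 0

lemma dispN_measurable (n : ℕ) : Measurable fun p : 𝕏 => dispN T r J n p.1 p.2 :=
  (cv_measurable (sig_continuous n).measurable h.meas).sub
    ((cumFlux_continuous h).measurable.comp measurable_fst)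

lemma disp_measurable : Measurable fun p : 𝕏 => disp T r J p.1 p.2 :=
  (cv_measurable sigLim_measurable h.meas).sub
    ((cumFlux_continuous h).measurable.comp measurable_fst)

lemma dispN_tendsto {t : ℝ} (ht : t ∈ Icc 0 T) (x : Torus) :
    Tendsto (fun n => dispN T r J n t x) atTop (𝓝 (disp T r J t x)) :=
  (cv_sig_tendsto (h.int t ht) x).sub_const _

/-- The derivative of `sig n` is `K (wid n) - 1` and the density has mass one. So `x + W(x)` has
derivative `cw n (r t)`, the mollified density: it is the Lagrangian coordinate of the mollified
flow. -/
lemma dispN_hasTD (hm : ∀ t ∈ Icc 0 T, ∫ x, r t x = 1) (n : ℕ) {t : ℝ} (ht : t ∈ Icc 0 T) :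
    HasTD (dispN T r J n t) (fun x => cw n (r t) x - 1) := by
  intro s
  have h1 := cv_hasTD (sig_hasTD n) ((Kw_continuous n).sub continuous_const) (h.int t ht) s
  rw [cv_sub_one (h.int t ht), hm t ht] at h1
  exact h1.sub_const _

lemma disp_sub (hm : ∀ t ∈ Icc 0 T, ∫ x, r t x = 1) {t : ℝ} (ht : t ∈ Icc 0 T) (a b : ℝ) :
    disp T r J t b - disp T r J t a = (∫ s in a..b, r t (s : Torus)) - (b - a) := by
  have hi := h.int t ht
  have h1 : ∀ n, dispN T r J n t b - dispN T r J n t a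
      = (∫ s in a..b, cw n (r t) (s : Torus)) - (b - a) := fun n => by
    rw [(dispN_hasTD h hm n ht).sub_eq_integral ((cv_wid_continuous hi n).sub continuous_const),
      intervalIntegral.integral_sub (lift_intervalIntegrable (cv_wid_integrable hi n) _ _)
        (by simp)]
    simp
  have h2 := (dispN_tendsto h ht (b : Torus)).sub (dispN_tendsto h ht (a : Torus))
  refine tendsto_nhds_unique h2 (Tendsto.congr (fun n => (h1 n).symm) (Tendsto.sub_const ?_ _))
  have key : ∀ a b : ℝ, |b - a| ≤ 1 → Tendsto (fun n => ∫ s in a..b, cw n (r t) (s : Torus))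
      atTop (𝓝 (∫ s in a..b, r t (s : Torus))) := by
    intro a b hab
    rw [tendsto_iff_dist_tendsto_zero]
    refine squeeze_zero (fun _ => dist_nonneg) (fun i => ?_) (cv_K_tendsto_L1 hi)
    rw [Real.dist_eq, ← intervalIntegral.integral_sub
      (lift_intervalIntegrable (cv_wid_integrable hi _) _ _)
      (lift_intervalIntegrable hi _ _)]
    exact abs_intervalIntegral_le_torus ((cv_wid_integrable hi _).sub hi) hab
  -- The `L¹` norm on the torus controls integrals over at most one period; longer intervals are cut
  -- into pieces of length at most one.
  have key2 : ∀ (m : ℕ) (a b : ℝ), |b - a| ≤ m →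
      Tendsto (fun n => ∫ s in a..b, cw n (r t) (s : Torus))
        atTop (𝓝 (∫ s in a..b, r t (s : Torus))) := by
    intro m
    induction m with
    | zero =>
      intro a b hab
      refine key a b (hab.trans ?_)
      simp
    | succ m ih =>
      intro a b hab
      push_cast at hab
      obtain ⟨c, h1, h2⟩ : ∃ c, |c - a| ≤ m ∧ |b - c| ≤ 1 := by
        refine ⟨a + (m / (m + 1)) * (b - a), ?_, ?_⟩
        · rw [add_sub_cancel_left, abs_mul, abs_of_nonneg (by positivity)]
          calc (m : ℝ) / (m + 1) * |b - a| ≤ m / (m + 1) * (m + 1) := by gcongr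
            _ = m := by field_simp
        · have : b - (a + (m : ℝ) / (m + 1) * (b - a)) = 1 / (m + 1) * (b - a) := by
            field_simp
            ring
          rw [this, abs_mul, abs_of_nonneg (by positivity)]
          calc (1 : ℝ) / (m + 1) * |b - a| ≤ 1 / (m + 1) * (m + 1) := by gcongr
            _ = 1 := by field_simp
      have h3 := (ih a c h1).add (key c b h2)
      rw [integral_add_adjacent_intervals (lift_intervalIntegrable hi _ _)
        (lift_intervalIntegrable hi _ _)] at h3
      refine h3.congr fun n => ?_
      exact integral_add_adjacent_intervals (lift_intervalIntegrable (cv_wid_integrable hi _) _ _)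
        (lift_intervalIntegrable (cv_wid_integrable hi _) _ _)
  exact key2 ⌈|b - a|⌉₊ a b (Nat.le_ceil _)

include hT

/-- Differentiating the convolution in time produces `-(cw n J - ∫ J)`; subtracting the cumulated
flux removes the mean. The mollified displacement thus satisfies `W_t = -J_n` and `W_x = r_n - 1`
exactly. -/
lemma dispN_acd (n : ℕ) (x : Torus) :
    ACD T (fun t => dispN T r J n t x) (fun t => -cw n (J t) x) := by
  have h1 := h.acd hT.le (sig_smooth n) (sig_hasTD n) x
  have h2 : ACD T (cumFlux T J) (fun t => ∫ x, J t x) := by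
    refine ACD.of_primitive hT.le (intervalIntegrable_slice hT.le h.int') fun t ht => ?_
    rw [cumFlux, cumFlux, intervalIntegral.integral_same, zero_add]
    refine intervalIntegral.integral_congr fun s hs => ?_
    rw [uIcc_of_le ht.1] at hs
    exact (indicator_of_mem (show s ∈ Icc 0 T from ⟨hs.1, hs.2.trans ht.2⟩) fun s => ∫ x, J s x)
  refine (h1.sub h2).congr hT.le ?_
  filter_upwards [spaceTime_slices h.int'] with t ht
  rw [cv_sub_one ht]
  ring

end


/-! ### Change of variables to the Lagrangian coordinate -/

/-- Split `b_n f_n - c g` into `b_n (f_n - g)`, which is small since `b_n` is bounded, and `(b_n -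
c) g`, which is handled by dominated convergence. -/
lemma tendsto_integral_mul_of_L1_of_ae {α : Type*} [MeasurableSpace α] {μ : Measure α}
    {f b : ℕ → α → ℝ} {g c : α → ℝ} {C : ℝ} (hb : ∀ n, AEStronglyMeasurable (b n) μ)
    (hC : ∀ n, ∀ᵐ x ∂μ, |b n x| ≤ C) (hbc : ∀ᵐ x ∂μ, Tendsto (fun n => b n x) atTop (𝓝 (c x)))
    (hf : ∀ n, Integrable (f n) μ) (hg : Integrable g μ)
    (h : Tendsto (fun n => ∫ x, |f n x - g x| ∂μ) atTop (𝓝 0)) :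
    Tendsto (fun n => ∫ x, b n x * f n x ∂μ) atTop (𝓝 (∫ x, c x * g x ∂μ)) := by
  have h1 : Tendsto (fun n => ∫ x, b n x * g x ∂μ) atTop (𝓝 (∫ x, c x * g x ∂μ)) := by
    refine tendsto_integral_of_dominated_convergence (fun x => C * |g x|)
      (fun n => (hb n).mul hg.aestronglyMeasurable) (hg.abs.const_mul C) (fun n => ?_) ?_
    · filter_upwards [hC n] with x hx
      rw [norm_eq_abs, abs_mul]
      exact mul_le_mul_of_nonneg_right hx (abs_nonneg _)
    · filter_upwards [hbc] with x hx using hx.mul_const _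
  have h2 : Tendsto (fun n => (∫ x, b n x * f n x ∂μ) - ∫ x, b n x * g x ∂μ) atTop (𝓝 0) := by
    have h3 := h.const_mul C
    rw [mul_zero] at h3
    refine squeeze_zero_norm (fun n => ?_) h3
    rw [norm_eq_abs, ← integral_sub ((hf n).bdd_mul (hb n) (hC n))
      (hg.bdd_mul (hb n) (hC n)), ← integral_const_mul]
    refine abs_integral_le_integral_abs.trans (integral_mono_ae
      (((hf n).bdd_mul (hb n) (hC n)).sub (hg.bdd_mul (hb n) (hC n))).abs
      (((hf n).sub hg).abs.const_mul C) ?_)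
    filter_upwards [hC n] with x hx
    rw [← mul_sub, abs_mul]
    exact mul_le_mul_of_nonneg_right hx (abs_nonneg _)
  simpa using h2.add h1

lemma integrable_spaceTime_of_le {T : ℝ} {f : 𝕏 → ℝ} {G : ℝ → ℝ} (hf : Measurable f)
    (hG : Integrable G 𝓛 T)
    (h : ∀ᵐ s ∂𝓛 T, ∀ x, |f (s, x)| ≤ G s) :
    Integrable f (Ω T) := by
  have h1 : Integrable (fun p : 𝕏 => G p.1) (Ω T) := hG.comp_fst volume
  refine h1.mono' hf.aestronglyMeasurable ?_
  have h2 : ∀ᵐ p ∂Ω T, ∀ x, |f (p.1, x)| ≤ G p.1 := by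
    unfold spaceTime
    exact Measure.quasiMeasurePreserving_fst.ae h
  filter_upwards [h2] with p hp using hp p.2

lemma ACD.integral {T : ℝ} (hT : 0 ≤ T) {F g : 𝔽}
    (hF : ∀ t ∈ Icc 0 T, Integrable (F t)) (h : ∀ x, ACD T (fun t => F t x) (fun t => g t x))
    (hg : Integrable (fun p : 𝕏 => g p.1 p.2) (Ω T)) :
    ACD T (fun t => ∫ x, F t x) (fun t => ∫ x, g t x) := by
  refine ACD.of_primitive hT (intervalIntegrable_slice hT hg) fun t ht => ?_
  have h1 : ∀ x, F t x - F 0 x = ∫ s in Ioc 0 t, g s x := fun x => by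
    rw [((h x).mono ht).sub_eq, integral_of_le ht.1]
  have h2 : Integrable (fun p : 𝕏 => g p.1 p.2) ((volume.restrict (Ioc 0 t)).prod volume) := by
    refine hg.mono_measure ?_
    unfold spaceTime
    exact Measure.prod_mono (Measure.restrict_mono (Set.Ioc_subset_Icc_self.trans
      (Icc_subset_Icc_right ht.2)) le_rfl) le_rfl
  have h3 := integral_integral_swap (f := fun s x => g s x) h2
  rw [integral_of_le ht.1, h3, ← integral_congr_ae (.of_forall h1),
    integral_sub (hF t ht) (hF 0 ⟨le_rfl, hT⟩)]
  ring

/-- The map `x ↦ x + W(x)` on the torus. -/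
def shift (W : 𝕊) (x : Torus) : Torus := x + ((W x : ℝ) : Torus)

lemma shift_measurable {W : 𝕊} (h : Measurable W) : Measurable (shift W) :=
  measurable_id.add (AddCircle.measurable_mk'.comp h)

lemma shift_continuous {W : 𝕊} (h : Continuous W) : Continuous (shift W) :=
  continuous_id.add ((AddCircle.continuous_mk' 1).comp h)

/-- The lift `s ↦ s + W(s)` has derivative `ρ` and advances by one over a period, so substitution
over one period carries `ρ dx` to Lebesgue measure. No monotonicity is needed. -/
lemma shift_push {W ρ F : 𝕊} (hW : HasTD W fun x => ρ x - 1) (hρ : Continuous ρ)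
    (hF : Continuous F) : ∫ x, F (shift W x) * ρ x = ∫ y, F y := by
  rw [← UnitAddCircle.intervalIntegral_preimage 0]
  have h1 : ∀ s ∈ uIcc (0 : ℝ) (0 + 1), HasDerivAt (fun s : ℝ => s + W (s : Torus)) (ρ s) s := by
    intro s _
    have := (hasDerivAt_id s).add (hW s)
    rw [add_sub_cancel] at this
    exact this
  have h2 := intervalIntegral.integral_comp_mul_deriv (g := fun s : ℝ => F (s : Torus)) h1
    (hρ.comp (AddCircle.continuous_mk' 1)).continuousOn (hF.comp (AddCircle.continuous_mk' 1))
  have h3 : ((0 + 1 : ℝ) : Torus) = ((0 : ℝ) : Torus) := AddCircle.coe_add_period (1 : ℝ) 0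
  rw [h3, add_right_comm, UnitAddCircle.intervalIntegral_preimage] at h2
  rw [← h2]
  refine intervalIntegral.integral_congr fun s _ => ?_
  simp only [shift, Function.comp, AddCircle.coe_add]

/-- The Lagrangian density, mollified with the kernel `k`. -/
noncomputable def lagDens (k : 𝕊) (W q : 𝕊) (y : Torus) : ℝ :=
  ∫ x, k (y - shift W x) * q x

lemma comp_shift_hasTD {k k' W ρ : 𝕊} (hk : HasTD k k') (hW : HasTD W fun x => ρ x - 1)
    (y : Torus) :
    HasTD (fun x => k (y - shift W x)) (fun x => -(k' (y - shift W x) * ρ x)) := by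
  intro s
  obtain ⟨a, rfl⟩ := mk_surjective y
  have h1 : HasDerivAt (fun s : ℝ => a - (s + W (s : Torus))) (-ρ s) s := by
    have h2 := ((hasDerivAt_id s).add (hW s)).const_sub a
    rw [add_sub_cancel] at h2
    exact h2
  have h3 := (hk (a - (s + W (s : Torus)))).comp s h1
  have h4 : ∀ s : ℝ, ((a - (s + W (s : Torus)) : ℝ) : Torus) = (a : Torus) - shift W s := fun s => by bound
  have e1 : (fun s : ℝ => k ((a - (s + W (s : Torus)) : ℝ) : Torus))
      = fun s : ℝ => k ((a : Torus) - shift W s) := funext fun s => by rw [h4]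
  change HasDerivAt (fun s : ℝ => k ((a - (s + W (s : Torus)) : ℝ) : Torus)) _ s at h3
  rw [e1, h4] at h3
  rw [mul_neg] at h3
  exact h3

lemma comp_shift_hasDerivAt {k k' : 𝕊} (hk : HasTD k k') (c : Torus) (w : ℝ) :
    HasDerivAt (fun w : ℝ => k (c - (w : Torus))) (-k' (c - (w : Torus))) w := by
  obtain ⟨a, rfl⟩ := mk_surjective c
  exact (hk (a - w)).comp_const_sub a w

section
variable {T : ℝ} {r J q j : 𝔽} (hT : 0 < T) (hr : Transport T r J)
  (hq : Transport T q j) (hm : ∀ t ∈ Icc 0 T, ∫ x, r t x = 1)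
include hr hm

lemma disp_push {t : ℝ} (ht : t ∈ Icc 0 T) {F : 𝕊} (hF : Continuous F) :
    ∫ x, F (shift (disp T r J t) x) * r t x = ∫ y, F y := by
  obtain ⟨C, _, hC⟩ := torus_bound hF
  have hi := hr.int t ht
  have h1 := tendsto_integral_mul_of_L1_of_ae (b := fun n x => F (shift (dispN T r J n t) x))
    (c := fun x => F (shift (disp T r J t) x)) (C := C)
    (fun n => (hF.comp (shift_continuous (dispN_hasTD hr hm n ht).continuous)).aestronglyMeasurable)
    (fun n => .of_forall fun x => hC _)
    (.of_forall fun x => (hF.tendsto _).comp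
      (((AddCircle.continuous_mk' 1).tendsto _).comp (dispN_tendsto hr ht x) |>.const_add x))
    (cv_wid_integrable hi) hi (cv_K_tendsto_L1 hi)
  refine tendsto_nhds_unique h1 (tendsto_const_nhds.congr fun n => ?_)
  exact (shift_push (dispN_hasTD hr hm n ht) (cv_wid_continuous hi n) hF).symm

include hT hq

/-- Since `W_t = -J_n`, the kernel at the moving point has time derivative `k' J_n`. In the
remaining term `-k ∂_x j_n` an integration by parts meets `W_x = r_n - 1` and leaves `-k' r_n j_n`.
Only the relative flux `r_n j_n - J_n q_n` survives, and the cancellation is exact because all four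
functions are mollified with the same kernel. -/
lemma lagDens_acd {k k' : 𝕊} (hk : HasTD k k') (hk' : Continuous k')
    (hq1 : ∀ t ∈ Icc 0 T, ∫ x, |q t x| ≤ 1) (n : ℕ) (y : Torus) :
    ACD T (fun t => lagDens k (dispN T r J n t) (cw n (q t)) y)
      (fun t => -∫ x, k' (y - shift (dispN T r J n t) x) * (cw n (r t) x * cw n (j t) x -
          cw n (J t) x * cw n (q t) x)) := by
  obtain ⟨h0, h1, hKc, hK1c⟩ := wid_props n
  obtain ⟨C, hC, hKb⟩ := torus_bound hKc
  obtain ⟨C1, hC1, hKb1⟩ := torus_bound hK1c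
  obtain ⟨D, hD, hDb⟩ := torus_bound hk.continuous
  obtain ⟨D1, hD1, hDb1⟩ := torus_bound hk'
  have hKm := hKc.measurable
  have hdm := dispN_measurable hr n
  have hYm : Measurable fun p : 𝕏 => y - shift (dispN T r J n p.1) p.2 :=
    measurable_const.sub (measurable_snd.add (AddCircle.measurable_mk'.comp hdm))
  set g : 𝔽 := fun t x =>
    (-k' (y - shift (dispN T r J n t) x) * (-cw n (J t) x)) * cw n (q t) x +
      k (y - shift (dispN T r J n t) x) * (-cv (K1 (wid n)) (j t) x) with hg
  have hx : ∀ x, ACD T (fun t => k (y - shift (dispN T r J n t) x) * cw n (q t) x)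
      (fun t => g t x) := by
    intro x
    have a1 := (dispN_acd hT hr n x).comp (F := fun w => k (y - x - (w : Torus)))
      (F' := fun w => -k' (y - x - (w : Torus))) (fun w => comp_shift_hasDerivAt hk (y - x) w)
      (hk'.comp (continuous_const.sub (AddCircle.continuous_mk' 1))).neg
    have a2 := a1.mul (hq.acd hT.le (K_smooth h0 h1) (K_hasTD h0 h1) x)
    simp only [sub_sub] at a2
    exact a2
  have hgm : Measurable fun p : 𝕏 => g p.1 p.2 :=
    ((((hk'.measurable.comp hYm).neg).mul (cv_measurable hKm hr.meas').neg).mul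
      (cv_measurable hKm hq.meas)).add ((hk.continuous.measurable.comp hYm).mul
        (cv_measurable hK1c.measurable hq.meas').neg)
  have hcq : ∀ t ∈ Icc 0 T, ∀ x, |cw n (q t) x| ≤ C := fun t ht x =>
    (abs_cv_le hKc hKb (hq.int t ht) x).trans (mul_le_of_le_one_right hC (hq1 t ht))
  have hgi : Integrable (fun p : 𝕏 => g p.1 p.2) (Ω T) := by
    have i1 : Integrable (fun t => D1 * (C * ∫ x, |J t x|) * C + D * (C1 * ∫ x, |j t x|)) 𝓛 T :=
      (((((slice_integral hr.int'.abs).const_mul C).const_mul D1).mul_const C).add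
        (((slice_integral hq.int'.abs).const_mul C1).const_mul D))
    refine integrable_spaceTime_of_le hgm i1 ?_
    filter_upwards [spaceTime_slices hr.int', spaceTime_slices hq.int',
      ae_restrict_mem measurableSet_Icc] with t hJ hj ht x
    have b1 := abs_cv_le hKc hKb hJ x
    have b2 := abs_cv_le hK1c hKb1 hj x
    refine (abs_add_le _ _).trans (add_le_add ?_ ?_)
    · rw [abs_mul, abs_mul, abs_neg, abs_neg]
      exact mul_le_mul (mul_le_mul (hDb1 _) b1 (abs_nonneg _) hD1) (hcq t ht x) (abs_nonneg _)
        (mul_nonneg hD1 ((abs_nonneg _).trans b1))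
    · rw [abs_mul, abs_neg]
      exact mul_le_mul (hDb _) b2 (abs_nonneg _) hD
  have hI : ∀ t ∈ Icc 0 T,
      Integrable fun x => k (y - shift (dispN T r J n t) x) * cw n (q t) x := fun t ht =>
    torus_integrable ((hk.continuous.comp (continuous_const.sub (shift_continuous
      (dispN_hasTD hr hm n ht).continuous))).mul (cv_wid_continuous (hq.int t ht) n))
  refine (ACD.integral hT.le hI hx hgi).congr hT.le ?_
  filter_upwards [spaceTime_slices hr.int', spaceTime_slices hq.int',
    ae_restrict_mem measurableSet_Icc] with t hJ hj ht
  have hWc := (dispN_hasTD hr hm n ht).continuous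
  have hYc : Continuous fun x => y - shift (dispN T r J n t) x :=
    continuous_const.sub (shift_continuous hWc)
  have c1 := hk.continuous.comp hYc
  have c2 := hk'.comp hYc
  have cr := cv_wid_continuous (hr.int t ht) n
  have cq := cv_wid_continuous (hq.int t ht) n
  have cJ := cv_wid_continuous hJ n
  have cj := cv_wid_continuous hj n
  have cj1 := cv_continuous hK1c hj
  have t1 := (comp_shift_hasTD hk (dispN_hasTD hr hm n ht) y).integral_mul_deriv
    (cv_hasTD (K_hasTD h0 h1) hK1c hj) (c2.mul cr).neg cj1
  have t2 : ∫ x, g t x = (∫ x, k' (y - shift (dispN T r J n t) x) * cw n (J t) x *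
      cw n (q t) x) - ∫ x, k (y - shift (dispN T r J n t) x) * cv (K1 (wid n)) (j t) x := by
    have i1 : Integrable fun x => k' (y - shift (dispN T r J n t) x) * cw n (J t) x *
      cw n (q t) x := torus_integrable ((c2.mul cJ).mul cq)
    have i2 : Integrable fun x => k (y - shift (dispN T r J n t) x) * cv (K1 (wid n)) (j t) x :=
      torus_integrable (c1.mul cj1)
    rw [← integral_sub i1 i2]
    refine integral_congr_ae (.of_forall fun x => ?_)
    simp only [hg]
    ring
  have i1 : Integrable fun x => k' (y - shift (dispN T r J n t) x) * cw n (J t) x *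
    cw n (q t) x := torus_integrable ((c2.mul cJ).mul cq)
  have i2 : Integrable fun x => -(-(k' (y - shift (dispN T r J n t) x) * cw n (r t) x) *
    cw n (j t) x) := torus_integrable ((c2.mul cr).neg.mul cj).neg
  rw [t2, t1, ← integral_neg, ← integral_neg, ← integral_sub i1 i2]
  refine integral_congr_ae (.of_forall fun x => ?_)
  simp only
  ring

end


/-! ### A density and a color at a fixed time -/

lemma WD.abs_cv_le {u v : 𝕊} (h : WD u v) (h0 : ∀ x, 0 ≤ u x) (n : ℕ) (x : Torus) :
    |cw n u x| ≤ (∫ z, u z) + ∫ z, |v z| := by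
  rw [abs_of_nonneg (cv_nonneg (Kw_nonneg n) h0 x)]
  have hK := Kw_continuous n
  refine (cv_mono hK (Kw_nonneg n) h.int (integrable_const _) h.le x).trans (le_of_eq ?_)
  rw [cv, integral_mul_const, integral_K_sub (wid_pos n) (wid_le n), one_mul]

/-- In one space dimension `u` has a continuous representative, so its mollifications converge
uniformly. This is why products with a merely integrable `f` converge in `L¹`. -/
lemma WD.tendsto_cv_mul {u v f : 𝕊} (h : WD u v) (h0 : ∀ x, 0 ≤ u x) (hf : Integrable f) :
    Tendsto (fun n => ∫ x, |cw n u x * cw n f x - u x * f x|) atTop (𝓝 0) := by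
  obtain ⟨w, hw, hae, -⟩ := h.exists_rep
  set R := (∫ z, u z) + ∫ z, |v z| with hR
  have hR0 : 0 ≤ R := add_nonneg (integral_nonneg h0) (integral_nonneg fun _ => abs_nonneg _)
  have hcv : ∀ n x, cw n u x = cw n w x := fun n x => by
    refine integral_congr_ae ?_
    filter_upwards [hae] with z hz
    rw [hz]
  rw [Metric.tendsto_atTop']
  intro η hη
  have hA : 0 < (∫ x, |f x|) + 1 := by positivity
  have e1 := cv_K_tendstoUniformly hw (η / 2 / ((∫ x, |f x|) + 1)) (by positivity)
  have e2 := (cv_K_tendsto_L1 hf).const_mul R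
  rw [mul_zero] at e2
  have e3 := (tendsto_order.1 e2).2 (η / 2) (by linarith)
  obtain ⟨N, hN⟩ := eventually_atTop.1 (e1.and e3)
  refine ⟨N, fun n hn => ?_⟩
  obtain ⟨h1, h2⟩ := hN n hn.le
  set δ := η / 2 / ((∫ x, |f x|) + 1) with hδ
  have hδ0 : 0 < δ := by positivity
  rw [dist_zero_right, norm_of_nonneg (integral_nonneg fun _ => abs_nonneg _)]
  have i1 : Integrable fun x => R * |cw n f x - f x| + δ * |f x| :=
    (((cv_wid_integrable hf n).sub hf).abs.const_mul R).add (hf.abs.const_mul δ)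
  have i2 : Integrable fun x => R * |cw n f x - f x| :=
    ((cv_wid_integrable hf n).sub hf).abs.const_mul R
  have hle : ∫ x, |cw n u x * cw n f x - u x * f x| ≤ ∫ x, (R * |cw n f x - f x| + δ * |f x|) := by
    refine integral_mono_of_nonneg (.of_forall fun _ => abs_nonneg _) i1 ?_
    filter_upwards [hae] with x hx
    have : cw n u x * cw n f x - u x * f x =
        cw n u x * (cw n f x - f x) + (cw n u x - u x) * f x := by ring
    rw [this]
    refine (abs_add_le _ _).trans ?_
    rw [abs_mul, abs_mul]
    refine add_le_add (mul_le_mul_of_nonneg_right (h.abs_cv_le h0 n x) (abs_nonneg _))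
      (mul_le_mul_of_nonneg_right ?_ (abs_nonneg _))
    rw [hx, hcv]
    exact h1 x
  refine hle.trans_lt ?_
  rw [integral_add i2 (hf.abs.const_mul δ), integral_const_mul, integral_const_mul]
  have h3 : δ * ∫ x, |f x| ≤ η / 2 := by
    rw [hδ, div_mul_eq_mul_div, div_le_iff₀ hA]
    nlinarith
  linarith

/-- A pair of a total density `r` and the density `q` of one color, with fluxes `J`, `j`, gradients
`V`, `w`, and an energy density `e`, at a fixed time; `W` is the displacement to the Lagrangian
coordinate. -/
structure Slice (lam : ℝ) (r J q j V w e W : 𝕊) : Prop where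
  wdr : WD r V
  wdq : WD q w
  intJ : Integrable J
  intj : Integrable j
  mass : ∫ x, r x = 1
  nonneg : ∀ x, 0 ≤ q x
  le : ∀ x, q x ≤ r x
  e_nonneg : ∀ x, 0 ≤ e x
  e_int : Integrable e
  sqV : ∀ᵐ x, V x ^ 2 ≤ r x * e x
  sqw : ∀ᵐ x, lam * w x ^ 2 ≤ (lam + r x) * (r x * e x)
  sqJ : ∀ᵐ x, J x ^ 2 ≤ r x * e x
  sqj : ∀ᵐ x, j x ^ 2 ≤ r x * e x
  sqN : ∀ᵐ x, (r x * j x - J x * q x) ^ 2 * (lam + r x) ≤ r x ^ 3 * e x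
  disp : ∀ a b : ℝ, W b - W a = (∫ s in a..b, r (s : Torus)) - (b - a)
  push : ∀ F : 𝕊, Continuous F → ∫ x, F (shift W x) * r x = ∫ y, F y
  measW : Measurable W

namespace Slice
variable {lam : ℝ} {r J q j V w e W : 𝕊} (h : Slice lam r J q j V w e W)
include h

lemma r_nonneg (x : Torus) : 0 ≤ r x := (h.nonneg x).trans (h.le x)

lemma integral_abs_le {c : 𝕊} (hc : ∀ᵐ x, c x ^ 2 ≤ r x * e x) : ∫ x, |c x| ≤ √(∫ x, e x) := by
  have h1 := sq_integral_le (μ := (volume : Measure Torus)) (w := fun _ => 1) (a := r) (b := e)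
    (c := fun x => |c x|) (.of_forall fun _ => zero_le_one)
    (.of_forall h.r_nonneg) (.of_forall h.e_nonneg)
    (by filter_upwards [hc] with x hx; rwa [sq_abs])
    (by simpa using h.wdr.int) (by simpa using h.e_int)
  simp only [one_mul, h.mass] at h1
  exact le_sqrt_of_sq_le h1

omit h in
lemma one_le_bound : 1 ≤ 1 + ∫ x, |V x| :=
  le_add_of_nonneg_right (integral_nonneg fun _ => abs_nonneg _)

lemma abs_cv_r_le (n : ℕ) (x : Torus) : |cw n r x| ≤ 1 + ∫ x, |V x| := by
  have := h.wdr.abs_cv_le h.r_nonneg n x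
  rwa [h.mass] at this

lemma abs_cv_q_le (n : ℕ) (x : Torus) : |cw n q x| ≤ 1 + ∫ x, |V x| := by
  refine le_trans ?_ (h.abs_cv_r_le n x)
  rw [abs_of_nonneg (cv_nonneg (Kw_nonneg n) h.nonneg x),
    abs_of_nonneg (cv_nonneg (Kw_nonneg n) h.r_nonneg x)]
  exact cv_mono (Kw_continuous n) (Kw_nonneg n) h.wdq.int h.wdr.int (.of_forall h.le) x

lemma r_le : ∀ᵐ x, r x ≤ 1 + ∫ x, |V x| := by
  have := h.wdr.le
  rwa [h.mass] at this

lemma N_int : Integrable fun x => r x * j x - J x * q x := by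
  have b1 := h.r_le
  refine Integrable.sub (h.intj.bdd_mul (c := 1 + ∫ x, |V x|) h.wdr.int.aestronglyMeasurable ?_)
    (h.intJ.mul_bdd (c := 1 + ∫ x, |V x|) h.wdq.int.aestronglyMeasurable ?_)
  · filter_upwards [b1] with x hx
    rwa [norm_of_nonneg (h.r_nonneg x)]
  · filter_upwards [b1] with x hx
    rw [norm_of_nonneg (h.nonneg x)]
    exact (h.le x).trans hx

lemma Nn_int (n : ℕ) : Integrable fun x => cw n r x * cw n j x - cw n J x * cw n q x :=
  torus_integrable (((cv_wid_continuous h.wdr.int n).mul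
    (cv_wid_continuous h.intj n)).sub ((cv_wid_continuous h.intJ n).mul
    (cv_wid_continuous h.wdq.int n)))

lemma Nn_bound (n : ℕ) : ∫ x, |cw n r x * cw n j x -
    cw n J x * cw n q x| ≤ (1 + ∫ x, |V x|) * ((∫ x, |j x|) + ∫ x, |J x|) := by
  have b1 := integral_abs_cv_K_le (wid_pos n) (wid_le n) h.intj
  have b2 := integral_abs_cv_K_le (wid_pos n) (wid_le n) h.intJ
  have hR := one_le_bound (V := V)
  have i1 : Integrable fun x => (1 + ∫ x, |V x|) * |cw n j x| :=
    (cv_wid_integrable h.intj n).abs.const_mul _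
  have i2 : Integrable fun x => (1 + ∫ x, |V x|) * |cw n J x| :=
    (cv_wid_integrable h.intJ n).abs.const_mul _
  refine (integral_mono_of_nonneg (.of_forall fun _ => abs_nonneg _) (i1.add i2)
    (.of_forall fun x => ?_)).trans (?_ : ∫ x, ((1 + ∫ x, |V x|) * |cw n j x| +
      (1 + ∫ x, |V x|) * |cw n J x|) ≤ _)
  · refine (abs_sub _ _).trans ?_
    rw [abs_mul, abs_mul, mul_comm |cw n J x|]
    exact add_le_add (mul_le_mul_of_nonneg_right (h.abs_cv_r_le n x) (abs_nonneg _))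
      (mul_le_mul_of_nonneg_right (h.abs_cv_q_le n x) (abs_nonneg _))
  · rw [integral_add i1 i2, integral_const_mul, integral_const_mul, ← mul_add]
    exact mul_le_mul_of_nonneg_left (add_le_add b1 b2) (by linarith)

lemma N_bound : ∫ x, |r x * j x - J x * q x| ≤ (1 + ∫ x, |V x|) * ((∫ x, |j x|) + ∫ x, |J x|) := by
  have hR := one_le_bound (V := V)
  have i1 : Integrable fun x => (1 + ∫ x, |V x|) * |j x| := h.intj.abs.const_mul _
  have i2 : Integrable fun x => (1 + ∫ x, |V x|) * |J x| := h.intJ.abs.const_mul _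
  refine (integral_mono_of_nonneg (.of_forall fun _ => abs_nonneg _) (i1.add i2)
    ?_).trans (?_ : ∫ x, ((1 + ∫ x, |V x|) * |j x| + (1 + ∫ x, |V x|) * |J x|) ≤ _)
  · filter_upwards [h.r_le] with x hx
    refine (abs_sub _ _).trans ?_
    rw [abs_mul, abs_mul, mul_comm |J x|, abs_of_nonneg (h.r_nonneg x), abs_of_nonneg (h.nonneg x)]
    exact add_le_add (mul_le_mul_of_nonneg_right hx (abs_nonneg _))
      (mul_le_mul_of_nonneg_right ((h.le x).trans hx) (abs_nonneg _))
  · rw [integral_add i1 i2, integral_const_mul, integral_const_mul, ← mul_add]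

/-- With `s = √(∫ e)`, each of the three `L¹` norms is at most `s`, and `(1 + s) * 2s ≤ 2 + 4s²`.
The bound is therefore integrable in time. -/
lemma bound_le : (1 + ∫ x, |V x|) * ((∫ x, |j x|) + ∫ x, |J x|) ≤ 2 + 4 * ∫ x, e x := by
  have h1 := h.integral_abs_le h.sqV
  have h2 := h.integral_abs_le h.sqj
  have h3 := h.integral_abs_le h.sqJ
  have hE : 0 ≤ ∫ x, e x := integral_nonneg h.e_nonneg
  have h4 := sq_sqrt hE
  have h5 := sqrt_nonneg (∫ x, e x)
  have h6 : 0 ≤ ∫ x, |j x| := integral_nonneg fun _ => abs_nonneg _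
  have h7 : 0 ≤ ∫ x, |J x| := integral_nonneg fun _ => abs_nonneg _
  have h8 : (1 + ∫ x, |V x|) * ((∫ x, |j x|) + ∫ x, |J x|) ≤
      (1 + √(∫ x, e x)) * (√(∫ x, e x) + √(∫ x, e x)) := by gcongr
  nlinarith [sq_nonneg (√(∫ x, e x) - 1)]

lemma Nn_tendsto : Tendsto (fun n => ∫ x, |(cw n r x * cw n j x -
    cw n J x * cw n q x) - (r x * j x - J x * q x)|) atTop (𝓝 0) := by
  have h1 := (h.wdr.tendsto_cv_mul h.r_nonneg h.intj).add (h.wdq.tendsto_cv_mul h.nonneg h.intJ)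
  rw [add_zero] at h1
  refine squeeze_zero (fun _ => integral_nonneg fun _ => abs_nonneg _) (fun n => ?_) h1
  have hb := h.r_le
  have i0 : Integrable fun x => r x * j x := by
    refine h.intj.bdd_mul (c := 1 + ∫ x, |V x|) h.wdr.int.aestronglyMeasurable ?_
    filter_upwards [hb] with x hx
    rwa [norm_of_nonneg (h.r_nonneg x)]
  have i0' : Integrable fun x => q x * J x := by
    refine h.intJ.bdd_mul (c := 1 + ∫ x, |V x|) h.wdq.int.aestronglyMeasurable ?_
    filter_upwards [hb] with x hx
    rw [norm_of_nonneg (h.nonneg x)]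
    exact (h.le x).trans hx
  have i1 : Integrable fun x => |cw n r x * cw n j x - r x * j x| :=
    ((torus_integrable ((cv_wid_continuous h.wdr.int n).mul
      (cv_wid_continuous h.intj n))).sub i0).abs
  have i2 : Integrable fun x => |cw n q x * cw n J x - q x * J x| :=
    ((torus_integrable ((cv_wid_continuous h.wdq.int n).mul
      (cv_wid_continuous h.intJ n))).sub i0').abs
  rw [← integral_add i1 i2]
  refine integral_mono_of_nonneg (.of_forall fun _ => abs_nonneg _) (i1.add i2)
    (.of_forall fun x => ?_)
  have := abs_sub (cw n r x * cw n j x - r x * j x) (cw n q x * cw n J x - q x * J x)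
  refine le_trans (le_of_eq ?_) this
  congr 1
  ring

end Slice

lemma abs_lagDens_le {k W q : 𝕊} {D : ℝ} (hk : ∀ x, |k x| ≤ D)
    (hq : Integrable q) (y : Torus) : |lagDens k W q y| ≤ D * ∫ x, |q x| := by
  rw [← integral_const_mul]
  change ‖∫ x, k (y - shift W x) * q x‖ ≤ _
  refine norm_integral_le_of_norm_le (hq.abs.const_mul D) (.of_forall fun x => ?_)
  rw [norm_eq_abs, abs_mul]
  exact mul_le_mul_of_nonneg_right (hk _) (abs_nonneg _)

lemma lagDens_tendsto {k W q : 𝕊} {Wn qn : ℕ → Torus → ℝ} (hk : Continuous k)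
    (hWm : ∀ n, Measurable (Wn n)) (hW : ∀ x, Tendsto (fun n => Wn n x) atTop (𝓝 (W x)))
    (hqn : ∀ n, Integrable (qn n)) (hq : Integrable q)
    (hL : Tendsto (fun n => ∫ x, |qn n x - q x|) atTop (𝓝 0)) (y : Torus) :
    Tendsto (fun n => lagDens k (Wn n) (qn n) y) atTop (𝓝 (lagDens k W q y)) := by
  obtain ⟨D, _, hD⟩ := torus_bound hk
  exact tendsto_integral_mul_of_L1_of_ae (C := D) (fun n => (hk.measurable.comp
      (measurable_const.sub (shift_measurable (hWm n)))).aestronglyMeasurable)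
    (fun n => .of_forall fun x => hD _)
    (.of_forall fun x => (hk.tendsto _).comp
      (((((AddCircle.continuous_mk' 1).tendsto _).comp (hW x)).const_add x).const_sub y))
    hqn hq hL

lemma measurable_lagDens {k : 𝕊} (hk : Measurable k) {W q : 𝔽}
    (hW : Measurable fun p : 𝕏 => W p.1 p.2)
    (hq : Measurable fun p : 𝕏 => q p.1 p.2) :
    Measurable fun p : 𝕏 => lagDens k (W p.1) (q p.1) p.2 := by
  have m1 : Measurable fun z : (𝕏) × Torus => (z.1.1, z.2) := by fun_prop
  have h : StronglyMeasurable fun z : (𝕏) × Torus =>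
      k (z.1.2 - shift (W z.1.1) z.2) * q z.1.1 z.2 :=
    ((hk.comp ((measurable_snd.comp measurable_fst).sub
      (measurable_snd.add (AddCircle.measurable_mk'.comp (hW.comp m1))))).mul
        (hq.comp m1)).stronglyMeasurable
  exact (StronglyMeasurable.integral_prod_right h).measurable

lemma measurable_lagDens_slice {k : 𝕊} (hk : Measurable k) {W q : 𝕊}
    (hW : Measurable W) (hq : Measurable q) : Measurable (lagDens k W q) := by
  have := (measurable_lagDens hk (W := fun _ => W) (q := fun _ => q) (hW.comp measurable_snd)
    (hq.comp measurable_snd)).comp (measurable_prodMk_left (x := (0 : ℝ)))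
  exact this


/-- The mollified density in the mollified Lagrangian coordinates. -/
notation:max "𝔩" k:max T:max r:max J:max q:max n:max t:max => lagDens k (dispN T r J n t) (cw n (q t))

/-- The mollified flux of one component relative to another. -/
notation:max "𝔠" r:max j:max J:max q:max n:max t:max =>
  fun x => cw n (r t) x * cw n (j t) x - cw n (J t) x * cw n (q t) x

/-! ### The chain rule in Lagrangian coordinates -/

lemma ae_ae_of_ae_spaceTime {T : ℝ} {p : 𝕏 → Prop} (h : ∀ᵐ z ∂Ω T, p z) :
    ∀ᵐ t ∂𝓛 T, ∀ᵐ x, p (t, x) := by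
  unfold spaceTime at h
  exact Measure.ae_ae_of_ae_prod h

/-- A pair of a total density `r` and the density `q` of one color, with fluxes `J`, `j`, weak
gradients `V`, `w`, and an integrable energy density `e`. -/
structure Pair (T lam : ℝ) (r J q j V w e : 𝔽) : Prop where
  hr : Transport T r J
  hq : Transport T q j
  mass : ∀ t ∈ Icc 0 T, ∫ x, r t x = 1
  nonneg : ∀ t x, 0 ≤ q t x
  le : ∀ t x, q t x ≤ r t x
  measV : Measurable fun p : 𝕏 => V p.1 p.2
  measw : Measurable fun p : 𝕏 => w p.1 p.2
  wdr : ∀ᵐ t ∂𝓛 T, WD (r t) (V t)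
  wdq : ∀ᵐ t ∂𝓛 T, WD (q t) (w t)
  mease : Measurable fun p : 𝕏 => e p.1 p.2
  e_nonneg : ∀ t x, 0 ≤ e t x
  e_int : Integrable (fun p : 𝕏 => e p.1 p.2) (Ω T)
  sqV : ∀ᵐ p ∂Ω T, V p.1 p.2 ^ 2 ≤ r p.1 p.2 * e p.1 p.2
  sqw : ∀ᵐ p ∂Ω T, lam * w p.1 p.2 ^ 2 ≤ (lam + r p.1 p.2) * (r p.1 p.2 * e p.1 p.2)
  sqJ : ∀ᵐ p ∂Ω T, J p.1 p.2 ^ 2 ≤ r p.1 p.2 * e p.1 p.2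
  sqj : ∀ᵐ p ∂Ω T, j p.1 p.2 ^ 2 ≤ r p.1 p.2 * e p.1 p.2
  -- The third power of `r` is what makes the relative flux small where the density is small; it
  -- compensates the division by `r²` in the chain rule.
  sqN : ∀ᵐ p ∂Ω T, (𝔯 r j J q p) ^ 2 * (lam + r p.1 p.2) ≤ r p.1 p.2 ^ 3 * e p.1 p.2

lemma exists_bound_comp {F : ℝ → ℝ} (hF : Continuous F) (D : ℝ) :
    ∃ M, 0 ≤ M ∧ ∀ s, |s| ≤ D → |F s| ≤ M := by
  obtain ⟨M, hM⟩ := (isCompact_Icc (a := -D) (b := D)).exists_bound_of_continuousOn hF.continuousOn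
  exact ⟨max M 0, le_max_right _ _, fun s hs => (hM s (abs_le.1 hs)).trans (le_max_left _ _)⟩

lemma dispN_slice_measurable {T : ℝ} {r J : 𝔽} (h : Transport T r J) (n : ℕ) (t : ℝ) :
    Measurable (dispN T r J n t) := by
  have := (dispN_measurable h n).comp (measurable_prodMk_left (x := t))
  exact this

namespace Pair
variable {T lam : ℝ} {r J q j V w e : 𝔽} (h : Pair T lam r J q j V w e)
include h

lemma slice : ∀ᵐ t ∂𝓛 T, Slice lam (r t) (J t) (q t) (j t) (V t) (w t) (e t) (disp T r J t) := by
  filter_upwards [h.wdr, h.wdq, ae_restrict_mem measurableSet_Icc, spaceTime_slices h.hr.int',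
    spaceTime_slices h.hq.int', spaceTime_slices h.e_int, ae_ae_of_ae_spaceTime h.sqV,
    ae_ae_of_ae_spaceTime h.sqw, ae_ae_of_ae_spaceTime h.sqJ, ae_ae_of_ae_spaceTime h.sqj,
    ae_ae_of_ae_spaceTime h.sqN] with t h1 h2 h3 h4 h5 h6 h7 h8 h9 h10 h11
  exact ⟨h1, h2, h4, h5, h.mass t h3, h.nonneg t, h.le t, h.e_nonneg t, h6, h7, h8, h9, h10, h11,
    disp_sub h.hr h.mass h3, fun F hF => disp_push h.hr h.mass h3 hF,
    (disp_measurable h.hr).comp measurable_prodMk_left⟩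

lemma abs_q_le {t : ℝ} (ht : t ∈ Icc 0 T) : ∫ x, |q t x| ≤ 1 := by
  refine le_of_le_of_eq ?_ (h.mass t ht)
  refine integral_mono (h.hq.int t ht).abs (h.hr.int t ht) fun x => ?_
  simp only [abs_of_nonneg (h.nonneg t x)]
  exact h.le t x

lemma integral_abs_cv_q_le {t : ℝ} (ht : t ∈ Icc 0 T) (n : ℕ) : ∫ x, |cw n (q t) x| ≤ 1 :=
  (integral_abs_cv_K_le (wid_pos n) (wid_le n) (h.hq.int t ht)).trans (h.abs_q_le ht)

lemma abs_lagDens_mollified_le {k : 𝕊} {D : ℝ} (hD : 0 ≤ D) (hk : ∀ x, |k x| ≤ D) {t : ℝ}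
    (ht : t ∈ Icc 0 T) (n : ℕ) (y : Torus) : |𝔩 k T r J q n t y| ≤ D :=
  (abs_lagDens_le hk (cv_wid_integrable (h.hq.int t ht) n) y).trans
    (mul_le_of_le_one_right hD (h.integral_abs_cv_q_le ht n))

lemma abs_star_integrand_le {k k' : 𝕊} {D D1 M : ℝ} (hD : 0 ≤ D) (hk : ∀ x, |k x| ≤ D)
    (hD1 : 0 ≤ D1) (hk' : ∀ x, |k' x| ≤ D1) {β1 : ℝ → ℝ} (hMb : ∀ s, |s| ≤ D → |β1 s| ≤ M)
    (hM : 0 ≤ M) {t : ℝ} (ht : t ∈ Icc 0 T) (hs : Slice lam (r t) (J t) (q t) (j t) (V t) (w t)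
      (e t) (disp T r J t)) (n : ℕ) (y : Torus) : ‖β1 (𝔩 k T r J q n t y) *
      -lagDens k' (dispN T r J n t) (𝔠 r j J q n t) y‖ ≤ M * (D1 * (2 + 4 * ∫ x, e t x)) := by
  rw [norm_eq_abs, abs_mul, abs_neg]
  refine mul_le_mul (hMb _ (h.abs_lagDens_mollified_le hD hk ht n y)) ?_ (abs_nonneg _) hM
  exact (abs_lagDens_le hk' (hs.Nn_int n) y).trans
    (mul_le_mul_of_nonneg_left ((hs.Nn_bound n).trans hs.bound_le) hD1)

lemma integral_lagDens_tendsto {k : 𝕊} {β : ℝ → ℝ} (hk : Continuous k)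
    (hβ : Continuous β) {t : ℝ} (ht : t ∈ Icc 0 T) :
    Tendsto (fun n => ∫ y, β (𝔩 k T r J q n t y)) atTop
      (𝓝 (∫ y, β (lagDens k (disp T r J t) (q t) y))) := by
  obtain ⟨D, hD, hDb⟩ := torus_bound hk
  obtain ⟨M, hM, hMb⟩ := exists_bound_comp hβ D
  have hi := h.hq.int t ht
  have hWm : ∀ n, Measurable (dispN T r J n t) := fun n => dispN_slice_measurable h.hr n t
  have h1 : ∀ n, AEStronglyMeasurable (fun y => β (𝔩 k T r J q n t y)) volume := fun n =>
    (Measurable.comp (g := β) hβ.measurable (f := 𝔩 k T r J q n t)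
      (measurable_lagDens_slice hk.measurable (hWm n)
      (cv_wid_continuous hi n).measurable)).aestronglyMeasurable
  have h2 : ∀ n y, ‖β (𝔩 k T r J q n t y)‖ ≤ M := fun n y =>
    hMb _ (h.abs_lagDens_mollified_le hD hDb ht n y)
  have h3 : ∀ y, Tendsto (fun n => β (𝔩 k T r J q n t y)) atTop
      (𝓝 (β (lagDens k (disp T r J t) (q t) y))) := fun y =>
    (hβ.tendsto _).comp (lagDens_tendsto hk hWm (fun x => dispN_tendsto h.hr ht x)
      (cv_wid_integrable hi) hi (cv_K_tendsto_L1 hi) y)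
  exact tendsto_integral_of_dominated_convergence (fun _ => M) h1 (integrable_const _)
    (fun n => .of_forall (h2 n)) (.of_forall h3)

/-- The chain rule for the mollified densities in Lagrangian coordinates. -/
lemma star_mollified (hT : 0 < T) {k k' : 𝕊} (hk : HasTD k k') (hk' : Continuous k')
    {β β1 : ℝ → ℝ} (hβ : ∀ s, HasDerivAt β (β1 s) s) (hβ1 : Continuous β1) (n : ℕ) :
    ACD T (fun t => ∫ y, β (𝔩 k T r J q n t y)) (fun t => ∫ y, β1 (𝔩 k T r J q n t y) *
        -lagDens k' (dispN T r J n t) (𝔠 r j J q n t) y) := by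
  obtain ⟨D, hD, hDb⟩ := torus_bound hk.continuous
  obtain ⟨D1, hD1, hDb1⟩ := torus_bound hk'
  obtain ⟨M, hM, hMb⟩ := exists_bound_comp hβ1 D
  have hβc : Continuous β := continuous_iff_continuousAt.2 fun s => (hβ s).continuousAt
  obtain ⟨M0, hM0, hMb0⟩ := exists_bound_comp hβc D
  have hKm := (Kw_continuous n).measurable
  have hx : ∀ y, ACD T (fun t => β (𝔩 k T r J q n t y)) (fun t => β1 (𝔩 k T r J q n t y) *
        -lagDens k' (dispN T r J n t) (𝔠 r j J q n t) y) := fun y =>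
    (lagDens_acd hT h.hr h.hq h.mass hk hk' (fun t ht => h.abs_q_le ht) n y).comp hβ hβ1
  have hmP := measurable_lagDens hk.continuous.measurable (dispN_measurable h.hr n)
    (q := fun t => cw n (q t)) (cv_measurable hKm h.hq.meas)
  have hmF := measurable_lagDens hk'.measurable (dispN_measurable h.hr n)
    (q := fun t x => cw n (r t) x * cw n (j t) x - cw n (J t) x * cw n (q t) x)
    (((cv_measurable hKm h.hr.meas).mul (cv_measurable hKm h.hq.meas')).sub
      ((cv_measurable hKm h.hr.meas').mul (cv_measurable hKm h.hq.meas)))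
  refine ACD.integral hT.le (fun t ht => ?_) hx ?_
  · refine Integrable.of_bound (C := M0) ?_ (.of_forall fun y =>
      hMb0 _ (h.abs_lagDens_mollified_le hD hDb ht n y))
    exact (hβc.measurable.comp (hmP.comp measurable_prodMk_left)).aestronglyMeasurable
  · refine integrable_spaceTime_of_le (G := fun t => M * (D1 * (2 + 4 * ∫ x, e t x)))
      ((hβ1.measurable.comp hmP).mul hmF.neg) ?_ ?_
    · exact (((integrable_const _).add
        ((slice_integral h.e_int).const_mul 4)).const_mul D1).const_mul M
    · filter_upwards [h.slice, ae_restrict_mem measurableSet_Icc] with t hs ht y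
      exact h.abs_star_integrand_le hD hDb hD1 hDb1 hMb hM ht hs n y

/-- The mollification in `x` is removed while the Lagrangian kernel `k` stays fixed. At almost every
time the mollified relative flux converges in `L¹`, and its norm is dominated by a constant times `2
+ 4 ∫ e`. -/
lemma star_inner (hT : 0 < T) {k k' : 𝕊} (hk : HasTD k k') (hk' : Continuous k')
    {β β1 : ℝ → ℝ} (hβ : ∀ s, HasDerivAt β (β1 s) s) (hβ1 : Continuous β1) :
    (∫ y, β (lagDens k (disp T r J T) (q T) y)) - ∫ y, β (lagDens k (disp T r J 0) (q 0) y) =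
      ∫ t in (0 : ℝ)..T, ∫ y, β1 (lagDens k (disp T r J t) (q t) y) *
        -lagDens k' (disp T r J t) (fun x => r t x * j t x - J t x * q t x) y := by
  have hβc : Continuous β := continuous_iff_continuousAt.2 fun s => (hβ s).continuousAt
  have hl := (h.integral_lagDens_tendsto (β := β) (k := k) (t := T) hk.continuous hβc
    ⟨hT.le, le_rfl⟩).sub (h.integral_lagDens_tendsto (β := β) (k := k) (t := 0) hk.continuous hβc
    ⟨le_rfl, hT.le⟩)
  refine tendsto_nhds_unique hl (Tendsto.congr
    (fun n => (h.star_mollified hT hk hk' hβ hβ1 n).sub_eq.symm) ?_)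
  obtain ⟨D, hD, hDb⟩ := torus_bound hk.continuous
  obtain ⟨D1, hD1, hDb1⟩ := torus_bound hk'
  obtain ⟨M, hM, hMb⟩ := exists_bound_comp hβ1 D
  have hIoc : ∀ p : ℝ → Prop, (∀ᵐ t ∂𝓛 T, p t) → ∀ᵐ t, t ∈ Set.uIoc 0 T → p t := fun p hp => by
    rw [ae_restrict_iff' measurableSet_Icc] at hp
    filter_upwards [hp] with t ht hmem
    rw [uIoc_of_le hT.le] at hmem
    exact ht ⟨hmem.1.le, hmem.2⟩
  have hG : IntervalIntegrable (fun t => M * (D1 * (2 + 4 * ∫ x, e t x))) volume 0 T :=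
    (((intervalIntegrable_const (c := (2 : ℝ))).add
      ((intervalIntegrable_slice hT.le h.e_int).const_mul 4)).const_mul D1).const_mul M
  refine intervalIntegral.tendsto_integral_filter_of_dominated_convergence
    (fun t => M * (D1 * (2 + 4 * ∫ x, e t x))) (.of_forall fun n => ?_)
    (.of_forall fun n => ?_) hG ?_
  · have := (h.star_mollified hT hk hk' hβ hβ1 n).intervalIntegrable.1.aestronglyMeasurable
    rwa [uIoc_of_le hT.le]
  · filter_upwards [hIoc _ h.slice] with t hs hmem
    have ht : t ∈ Icc 0 T := by grind
    have h1 := norm_integral_le_of_norm_le_const (μ := (volume : Measure Torus))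
      (.of_forall (h.abs_star_integrand_le hD hDb hD1 hDb1 hMb hM ht (hs hmem) n))
    simpa using h1
  · filter_upwards [hIoc _ h.slice] with t hs hmem
    have ht : t ∈ Icc 0 T := by grind
    have hs := hs hmem
    have hWm : ∀ n, Measurable (dispN T r J n t) := fun n => dispN_slice_measurable h.hr n t
    have hi := h.hq.int t ht
    have h1 : ∀ n, AEStronglyMeasurable (fun y => β1 (𝔩 k T r J q n t y) *
          -lagDens k' (dispN T r J n t) (𝔠 r j J q n t) y) volume := fun n => by
      have m1 : Measurable (𝔠 r j J q n t) :=
        (((cv_wid_continuous hs.wdr.int n).mul (cv_wid_continuous hs.intj n)).sub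
          ((cv_wid_continuous hs.intJ n).mul (cv_wid_continuous hi n))).measurable
      have m2 := measurable_lagDens_slice hk.continuous.measurable (hWm n)
        (cv_wid_continuous hi n).measurable
      have m3 := measurable_lagDens_slice hk'.measurable (hWm n) m1
      have m4 : Measurable fun y => β1 (𝔩 k T r J q n t y) :=
        hβ1.measurable.comp m2
      exact (m4.mul m3.neg).aestronglyMeasurable
    have h3 : ∀ y, Tendsto (fun n => β1 (𝔩 k T r J q n t y) *
          -lagDens k' (dispN T r J n t) (𝔠 r j J q n t) y) atTop
        (𝓝 (β1 (lagDens k (disp T r J t) (q t) y) *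
          -lagDens k' (disp T r J t) (fun x => r t x * j t x - J t x * q t x) y)) := fun y => by
      have t1 := lagDens_tendsto hk.continuous hWm (fun x => dispN_tendsto h.hr ht x)
        (cv_wid_integrable hi) hi (cv_K_tendsto_L1 hi) y
      have t2 := lagDens_tendsto hk' hWm (fun x => dispN_tendsto h.hr ht x) hs.Nn_int hs.N_int
        hs.Nn_tendsto y
      exact ((hβ1.tendsto _).comp t1).mul t2.neg
    exact tendsto_integral_of_dominated_convergence
      (fun _ => M * (D1 * (2 + 4 * ∫ x, e t x))) h1 (integrable_const _)
      (fun n => .of_forall (h.abs_star_integrand_le hD hDb hD1 hDb1 hMb hM ht hs n)) (.of_forall h3)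

end Pair

/-- The function multiplying the relative flux in the chain rule in Lagrangian coordinates. -/
noncomputable def lagB (k k' : 𝕊) (β1 : ℝ → ℝ) (W q : 𝕊) (x : Torus) : ℝ :=
  ∫ y, β1 (lagDens k W q y) * k' (y - shift W x)

lemma measurable_lagB {k k' : 𝕊} (hk : Measurable k) (hk' : Measurable k') {β1 : ℝ → ℝ}
    (hβ1 : Measurable β1) {W q : 𝔽}
    (hW : Measurable fun p : 𝕏 => W p.1 p.2)
    (hq : Measurable fun p : 𝕏 => q p.1 p.2) :
    Measurable fun p : 𝕏 => lagB k k' β1 (W p.1) (q p.1) p.2 := by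
  have m1 : Measurable fun z : (𝕏) × Torus => (z.1.1, z.2) := by fun_prop
  have h : StronglyMeasurable fun z : (𝕏) × Torus =>
      β1 (lagDens k (W z.1.1) (q z.1.1) z.2) * k' (z.2 - shift (W z.1.1) z.1.2) :=
    ((hβ1.comp ((measurable_lagDens hk hW hq).comp m1)).mul
      (hk'.comp (measurable_snd.sub ((measurable_snd.comp measurable_fst).add
        (AddCircle.measurable_mk'.comp (hW.comp measurable_fst)))))).stronglyMeasurable
  exact (StronglyMeasurable.integral_prod_right h).measurable

/-- Fubini. It isolates the relative flux as a factor, so that its smallness can be weighed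
pointwise against the size of `lagB`. -/
lemma integral_lagDens_mul {k' P W N : 𝕊} (hk' : Continuous k') (hP : Measurable P)
    {M : ℝ} (hM : ∀ y, |P y| ≤ M) (hW : Measurable W) (hN : Integrable N) :
    ∫ y, P y * lagDens k' W N y = ∫ x, N x * ∫ y, P y * k' (y - shift W x) := by
  obtain ⟨D1, hD1, hDb1⟩ := torus_bound hk'
  have hi : Integrable (fun p : Torus × Torus => P p.1 * (k' (p.1 - shift W p.2) * N p.2))
      (volume.prod volume) := by
    have h1 : Integrable (fun p : Torus × Torus => N p.2) (volume.prod volume) := hN.comp_snd _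
    refine (h1.bdd_mul (c := D1) ?_ (.of_forall fun p => hDb1 _)).bdd_mul (c := M) ?_
      (.of_forall fun p => hM _)
    · exact (hk'.measurable.comp (measurable_fst.sub
        ((shift_measurable hW).comp measurable_snd))).aestronglyMeasurable
    · exact (hP.comp measurable_fst).aestronglyMeasurable
  have h1 := integral_integral_swap (f := fun y x => P y * (k' (y - shift W x) * N x)) hi
  simp only [integral_const_mul] at h1
  refine h1.trans (integral_congr_ae (.of_forall fun x => ?_))
  simp only
  rw [← integral_const_mul]
  congr 1 with y
  ring

namespace Pair
variable {T lam : ℝ} {r J q j V w e : 𝔽} (h : Pair T lam r J q j V w e)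
include h

lemma abs_lagB_le {k k' : 𝕊} {D D1 M : ℝ} (hD : 0 ≤ D) (hk : ∀ x, |k x| ≤ D)
    (hk' : ∀ x, |k' x| ≤ D1) {β1 : ℝ → ℝ} (hM : ∀ s, |s| ≤ D → |β1 s| ≤ M) (hM0 : 0 ≤ M)
    {t : ℝ} (ht : t ∈ Icc 0 T) (x : Torus) :
    |lagB k k' β1 (disp T r J t) (q t) x| ≤ M * D1 := by
  have h1 := norm_integral_le_of_norm_le_const (μ := (volume : Measure Torus)) (C := M * D1)
    (f := fun y => β1 (lagDens k (disp T r J t) (q t) y) * k' (y - shift (disp T r J t) x))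
    (.of_forall fun y => ?_)
  · rw [probReal_univ, mul_one] at h1
    exact h1
  · rw [norm_eq_abs, abs_mul]
    exact mul_le_mul (hM _ ((abs_lagDens_le hk (h.hq.int t ht) y).trans
      (mul_le_of_le_one_right hD (h.abs_q_le ht)))) (hk' _) (abs_nonneg _) hM0

/-- The chain rule in Lagrangian coordinates. -/
lemma star (hT : 0 < T) {k k' : 𝕊} (hk : HasTD k k') (hk' : Continuous k')
    {β β1 : ℝ → ℝ} (hβ : ∀ s, HasDerivAt β (β1 s) s) (hβ1 : Continuous β1) :
    Integrable (fun p : 𝕏 => (𝔯 r j J q p) * lagB k k' β1 (disp T r J p.1) (q p.1) p.2) (Ω T) ∧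
    (∫ y, β (lagDens k (disp T r J T) (q T) y)) - ∫ y, β (lagDens k (disp T r J 0) (q 0) y) =
      -∫ p, (𝔯 r j J q p) * lagB k k' β1 (disp T r J p.1) (q p.1) p.2 ∂Ω T := by
  obtain ⟨D, hD, hDb⟩ := torus_bound hk.continuous
  obtain ⟨D1, hD1, hDb1⟩ := torus_bound hk'
  obtain ⟨M, hM, hMb⟩ := exists_bound_comp hβ1 D
  have hNm : Measurable fun p : 𝕏 =>
      𝔯 r j J q p :=
    (h.hr.meas.mul h.hq.meas').sub (h.hr.meas'.mul h.hq.meas)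
  have hNi : Integrable (fun p : 𝕏 =>
      𝔯 r j J q p) (Ω T) := by
    refine (integrable_prod_iff hNm.aestronglyMeasurable).2 ⟨?_, ?_⟩
    · filter_upwards [h.slice] with t hs using hs.N_int
    · have i1 : Integrable (fun t => 2 + 4 * ∫ x, e t x) 𝓛 T :=
        (integrable_const _).add ((slice_integral h.e_int).const_mul 4)
      refine i1.mono' ?_ ?_
      · exact (StronglyMeasurable.integral_prod_right
          (hNm.norm.stronglyMeasurable)).aestronglyMeasurable
      · filter_upwards [h.slice] with t hs
        rw [norm_of_nonneg (integral_nonneg fun _ => norm_nonneg _)]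
        exact hs.N_bound.trans hs.bound_le
  have hBm := measurable_lagB hk.continuous.measurable hk'.measurable hβ1.measurable
    (disp_measurable h.hr) h.hq.meas
  have hi : Integrable (fun p : 𝕏 => (𝔯 r j J q p) *
      lagB k k' β1 (disp T r J p.1) (q p.1) p.2) (Ω T) := by
    refine hNi.mul_bdd (c := M * D1) hBm.aestronglyMeasurable ?_
    filter_upwards [ae_spaceTime_mem T] with p hp
    exact h.abs_lagB_le hD hDb hDb1 hMb hM hp p.2
  refine ⟨hi, ?_⟩
  rw [h.star_inner hT hk hk' hβ hβ1, integral_spaceTime hi, ← integral_neg, ← integral_Icc_eq hT.le]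
  refine integral_congr_ae ?_
  filter_upwards [h.slice, ae_restrict_mem measurableSet_Icc] with t hs ht
  have hP : Measurable (lagDens k (disp T r J t) (q t)) :=
    (measurable_lagDens hk.continuous.measurable (disp_measurable h.hr) h.hq.meas).comp
      measurable_prodMk_left
  have h1 := integral_lagDens_mul hk' (hβ1.measurable.comp hP) (M := M) (fun y => hMb _
    ((abs_lagDens_le hDb (h.hq.int t ht) y).trans (mul_le_of_le_one_right hD (h.abs_q_le ht))))
    hs.measW hs.N_int
  simp only [mul_neg, integral_neg]
  rw [neg_inj]
  exact h1

end Pair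


/-! ### Windows in the Lagrangian coordinate and domination -/

/-- The points whose Lagrangian coordinate is within `ρ` of that of `x`. -/
def win (W : 𝕊) (ρ : ℝ) (x : Torus) : Set Torus := {z | ‖shift W z - shift W x‖ ≤ ρ}

lemma measurableSet_win {W : 𝕊} (hW : Measurable W) (ρ : ℝ) (x : Torus) :
    MeasurableSet (win W ρ x) :=
  measurableSet_le ((shift_measurable hW).sub measurable_const).norm measurable_const

lemma mem_win_comm {W : 𝕊} {ρ : ℝ} {x z : Torus} : z ∈ win W ρ x ↔ x ∈ win W ρ z := by
  simp only [win, Set.mem_setOf_eq, norm_sub_rev]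

lemma shift_coe (W : 𝕊) (s : ℝ) : shift W (s : Torus) = ((s + W s : ℝ) : Torus) := by
  rw [shift, AddCircle.coe_add]

lemma norm_coe_le (s : ℝ) : ‖(s : Torus)‖ ≤ |s| := by
  obtain ⟨n, hn⟩ := exists_int_sub_rep s
  rw [UnitAddCircle.norm_eq]
  exact round_le s 0 |>.trans (by simp)

/-- The oscillation of a function between two points is controlled by its gradient on the points
with nearby Lagrangian coordinate. -/
lemma abs_sub_le_integral_win {W r f g : 𝕊} (hr : Integrable r) (hr0 : ∀ x, 0 ≤ r x)
    (hW : ∀ a b : ℝ, W b - W a = (∫ s in a..b, r (s : Torus)) - (b - a)) (hWm : Measurable W)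
    (hg : Integrable g) (hf : ∀ a b : ℝ, f b - f a = ∫ s in a..b, g (s : Torus)) {ρ : ℝ}
    (hρ : ρ < 1 / 2) {x z : Torus} (hz : z ∈ win W ρ x) : |f z - f x| ≤ ∫ u in win W ρ x, |g u| := by
  obtain ⟨a, rfl⟩ := mk_surjective x
  obtain ⟨b', rfl⟩ := mk_surjective z
  change |f (b' : Torus) - f (a : Torus)| ≤ ∫ u in win W ρ (a : Torus), |g u|
  change ‖shift W (b' : Torus) - shift W (a : Torus)‖ ≤ ρ at hz
  set Φ : ℝ → ℝ := fun s => s + W (s : Torus) with hΦ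
  -- The map `Φ` lifts `shift W` to a nondecreasing function with `Φ (s + 1) = Φ s + 1`.
  have hmono : ∀ s t, s ≤ t → Φ s ≤ Φ t := fun s t hst => by
    have h1 := hW s t
    have h2 : 0 ≤ ∫ u in s..t, r (u : Torus) :=
      intervalIntegral.integral_nonneg hst fun u _ => hr0 _
    simp only [hΦ]
    linarith
  -- Among the lifts of `z`, the one obtained by rounding has `Φ`-value at a distance from `Φ a`
  -- equal to the distance on the torus.
  obtain ⟨b, hb1, hb2⟩ : ∃ b : ℝ, (b : Torus) = (b' : Torus) ∧ |Φ b - Φ a| ≤ ρ := by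
    refine ⟨b' - round (Φ b' - Φ a), coe_sub_int _ _, ?_⟩
    rw [shift_coe, shift_coe, ← AddCircle.coe_sub, UnitAddCircle.norm_eq] at hz
    convert hz using 2
    simp only [hΦ, coe_sub_int]
    ring
  rw [← hb1, hf]
  have hone : ∀ s, Φ (s + 1) = Φ s + 1 := fun s => by
    simp only [hΦ, AddCircle.coe_add_period]
    ring
  -- A gap longer than a period would move `Φ` by at least one, more than `ρ < 1/2` allows.
  have hab : |b - a| ≤ 1 := by
    rw [abs_le] at hb2 ⊢
    constructor
    · by_contra hcon
      have := hmono (b + 1) a (by linarith)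
      rw [hone] at this
      linarith
    · by_contra hcon
      have := hmono (a + 1) b (by linarith)
      rw [hone] at this
      linarith
  -- By monotonicity `Φ` stays between `Φ a` and `Φ b`, so the whole path of integration lies in the
  -- window.
  have hin : ∀ s ∈ uIcc a b, (s : Torus) ∈ win W ρ (a : Torus) := by
    intro s hs
    change ‖shift W (s : Torus) - shift W (a : Torus)‖ ≤ ρ
    rw [shift_coe, shift_coe, ← AddCircle.coe_sub]
    refine (norm_coe_le _).trans (le_trans ?_ hb2)
    rcases le_total a b with h | h
    · rw [uIcc_of_le h] at hs
      have h1 := hmono a s hs.1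
      have h2 := hmono s b hs.2
      rw [abs_of_nonneg (sub_nonneg.2 h1), abs_of_nonneg (by linarith)]
      exact sub_le_sub_right h2 _
    · rw [Set.uIcc_of_ge h] at hs
      have h1 := hmono b s hs.1
      have h2 := hmono s a hs.2
      rw [abs_of_nonpos (sub_nonpos.2 h2), abs_of_nonpos (by linarith)]
      linarith
  have hm := measurableSet_win hWm ρ (a : Torus)
  have h1 : ∫ s in a..b, g (s : Torus) =
      ∫ s in a..b, (win W ρ (a : Torus)).indicator g (s : Torus) :=
    intervalIntegral.integral_congr fun s hs => (indicator_of_mem (hin s hs) g).symm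
  rw [h1]
  refine (abs_intervalIntegral_le_torus (hg.indicator hm) hab).trans (le_of_eq ?_)
  rw [← integral_indicator hm]
  refine integral_congr_ae (.of_forall fun u => ?_)
  by_cases hu : u ∈ win W ρ (a : Torus) <;> simp [hu]

/-- The derivative of the kernel is at most `kapC / ε²` on a ball of length `2 ε`. -/
lemma integral_abs_K1_le {ε : ℝ} (h0 : 0 < ε) (h1 : ε ≤ 1 / 8) (c : Torus) :
    ∫ y, |K1 ε (y - c)| ≤ 2 * kapC / ε := by
  have hk : 0 ≤ kapC / ε ^ 2 := div_nonneg (by linarith [one_le_kapC]) (by positivity)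
  have hle : ∀ y, |K1 ε (y - c)| ≤ (Metric.closedBall c ε).indicator (fun _ => kapC / ε ^ 2) y := by
    intro y
    by_cases hy : y ∈ Metric.closedBall c ε
    · rw [indicator_of_mem hy]
      exact K1_le h0 _
    · rw [indicator_of_notMem hy, K1_eq_zero h0, abs_zero]
      rw [Metric.mem_closedBall, dist_eq_norm, not_le] at hy
      exact hy.le
  refine (integral_mono_of_nonneg (.of_forall fun _ => abs_nonneg _)
    ((integrable_const _).indicator measurableSet_closedBall)
    (.of_forall hle)).trans ?_
  rw [integral_indicator measurableSet_closedBall, setIntegral_const, measureReal_def,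
    AddCircle.volume_closedBall, min_eq_right (by linarith), toReal_ofReal (by linarith),
    smul_eq_mul]
  refine le_of_eq ?_
  field_simp

lemma torus_closedBall_le (c : Torus) {ε : ℝ} (h0 : 0 ≤ ε) :
    (volume (Metric.closedBall c ε)).toReal ≤ 2 * ε := by
  rw [AddCircle.volume_closedBall, toReal_ofReal (le_min zero_le_one (by linarith))]
  exact min_le_right _ _

lemma lagDens_continuous {k W q : 𝕊} (hk : Continuous k) (hW : Measurable W)
    (hq : Integrable q) : Continuous (lagDens k W q) := by
  obtain ⟨D, _, hD⟩ := torus_bound hk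
  refine continuous_of_dominated (bound := fun z => D * |q z|) (fun y => ?_)
    (fun y => .of_forall fun z => ?_) (hq.abs.const_mul D)
    (.of_forall fun z => ?_)
  · exact (hk.measurable.comp (measurable_const.sub
      (shift_measurable hW))).aestronglyMeasurable.mul hq.aestronglyMeasurable
  · rw [norm_eq_abs, abs_mul]
    exact mul_le_mul_of_nonneg_right (hD _) (abs_nonneg _)
  · exact (hk.comp (continuous_id.sub continuous_const)).mul continuous_const

/-- The derivative kernel has mean zero, so a constant may be subtracted from the other factor. This
is how `lagB` measures the oscillation of the color fraction instead of its size. -/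
lemma lagB_eq {ε : ℝ} (h0 : 0 < ε) (h1 : ε ≤ 1 / 8) {β1 : ℝ → ℝ} (hβ : Continuous β1)
    {W q : 𝕊} (hW : Measurable W) (hq : Integrable q) (x : Torus) (c : ℝ) :
    lagB (K ε) (K1 ε) β1 W q x = ∫ y, (β1 (lagDens (K ε) W q y) - β1 c) * K1 ε (y - shift W x) := by
  have hc : Continuous fun y => K1 ε (y - shift W x) :=
    (K1_continuous h0 h1).comp (continuous_id.sub continuous_const)
  have i1 : Integrable fun y => β1 (lagDens (K ε) W q y) * K1 ε (y - shift W x) :=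
    torus_integrable ((hβ.comp (lagDens_continuous (K_continuous h0 h1) hW hq)).mul hc)
  have i2 : Integrable fun y => β1 c * K1 ε (y - shift W x) :=
    torus_integrable (continuous_const.mul hc)
  simp only [sub_mul]
  rw [integral_sub i1 i2, integral_const_mul, integral_sub_right_eq_self (fun y => K1 ε y),
    integral_K1 h0 h1, mul_zero, sub_zero, lagB]

namespace Slice
variable {lam : ℝ} {r J q j V w e W : 𝕊} (h : Slice lam r J q j V w e W)
include h

/-- The window is the preimage of a ball of radius `2 ε` under a map that carries `r dx` to Lebesgue
measure. A continuous cutoff is inserted because the transport identity is available for continuous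
functions; its support lies in a ball of radius `4 ε`, of length at most `8 ε`. -/
lemma integral_win_le {ε : ℝ} (h0 : 0 < ε) (x : Torus) : ∫ z in win W (2 * ε) x, r z ≤ 8 * ε := by
  set F : 𝕊 := fun y => max 0 (min 1 (2 - ‖y - shift W x‖ / (2 * ε))) with hF
  have hFc : Continuous F := by fun_prop
  have hp := h.push F hFc
  have hle : ∀ z, (win W (2 * ε) x).indicator r z ≤ F (shift W z) * r z := by
    intro z
    have hr := h.r_nonneg z
    by_cases hz : z ∈ win W (2 * ε) x
    · rw [indicator_of_mem hz]
      have h1 : 1 ≤ 2 - ‖shift W z - shift W x‖ / (2 * ε) := by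
        have : ‖shift W z - shift W x‖ / (2 * ε) ≤ 1 := by bound
        linarith
      simp only [hF]
      rw [min_eq_left h1, max_eq_right zero_le_one, one_mul]
    · rw [indicator_of_notMem hz]
      exact mul_nonneg (le_max_left _ _) hr
  have hi : Integrable fun z => F (shift W z) * r z := by
    refine h.wdr.int.bdd_mul (c := 1) (hFc.measurable.comp
      (shift_measurable h.measW)).aestronglyMeasurable (.of_forall fun z => ?_)
    rw [norm_of_nonneg (le_max_left _ _)]
    exact max_le zero_le_one (min_le_left _ _)
  have h1 := integral_mono (h.wdr.int.indicator (measurableSet_win h.measW _ x)) hi hle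
  rw [integral_indicator (measurableSet_win h.measW _ x), hp] at h1
  refine h1.trans ?_
  have hle2 : ∀ y, F y ≤ (Metric.closedBall (shift W x) (4 * ε)).indicator (fun _ => (1 : ℝ)) y := by
    intro y
    by_cases hy : y ∈ Metric.closedBall (shift W x) (4 * ε)
    · rw [indicator_of_mem hy]
      exact max_le zero_le_one (min_le_left _ _)
    · rw [indicator_of_notMem hy]
      rw [Metric.mem_closedBall, dist_eq_norm, not_le] at hy
      refine max_le le_rfl ((min_le_right _ _).trans ?_)
      have : 2 ≤ ‖y - shift W x‖ / (2 * ε) := by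
        rw [le_div_iff₀ (by linarith)]
        linarith
      linarith
  have h2 := integral_mono (torus_integrable hFc)
    ((integrable_const _).indicator measurableSet_closedBall) hle2
  rw [integral_indicator measurableSet_closedBall, setIntegral_const, measureReal_def] at h2
  have h3 := torus_closedBall_le (shift W x) (ε := 4 * ε) (by linarith)
  simp only [smul_eq_mul, mul_one] at h2
  linarith

lemma integrable_K_shift {k : 𝕊} (hk : Continuous k) {f : 𝕊} (hf : Integrable f)
    (y : Torus) : Integrable fun z => k (y - shift W z) * f z := by
  obtain ⟨D, _, hD⟩ := torus_bound hk
  exact hf.bdd_mul (c := D) (hk.measurable.comp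
    (measurable_const.sub (shift_measurable h.measW))).aestronglyMeasurable
    (.of_forall fun z => hD _)

lemma lagDens_r {ε : ℝ} (h0 : 0 < ε) (h1 : ε ≤ 1 / 8) (y : Torus) : lagDens (K ε) W r y = 1 := by
  rw [lagDens, h.push (fun u => K ε (y - u))
    ((K_continuous h0 h1).comp (continuous_const.sub continuous_id)), integral_K_sub h0 h1]

/-- If `q` is close to `c r` near `x`, then `lagB` is small. -/
lemma abs_lagB_le {ε : ℝ} (h0 : 0 < ε) (h1 : ε ≤ 1 / 8) {β1 : ℝ → ℝ} {L : ℝ} (hL : 0 ≤ L)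
    (hβ : ∀ s t, |β1 s - β1 t| ≤ L * |s - t|) (x : Torus) {c η : ℝ} (hη : 0 ≤ η)
    (hc : ∀ᵐ z, z ∈ win W (2 * ε) x → |q z - c * r z| ≤ η * r z) :
    |lagB (K ε) (K1 ε) β1 W q x| ≤ 2 * L * kapC / ε * η := by
  have hKc := K_continuous h0 h1
  have hK1c := K1_continuous h0 h1
  have hβc : Continuous β1 := by
    have : LipschitzWith L.toNNReal β1 := LipschitzWith.of_dist_le_mul fun s t => by measurability
    exact this.continuous
  -- Only points `z` of the window of radius `2 ε` contribute, and the kernel times `r` integrates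
  -- to one. So the mollified density inherits the closeness to `c` with the same `η`.
  have hP : ∀ y, ‖y - shift W x‖ < ε → |lagDens (K ε) W q y - c| ≤ η := by
    intro y hy
    have e1 : lagDens (K ε) W q y - c = ∫ z, K ε (y - shift W z) * (q z - c * r z) := by
      have e2 : ∀ z, K ε (y - shift W z) * (q z - c * r z) =
        K ε (y - shift W z) * q z - c * (K ε (y - shift W z) * r z) := fun z => by ring
      simp_rw [e2]
      rw [integral_sub (h.integrable_K_shift hKc h.wdq.int y)
        ((h.integrable_K_shift hKc h.wdr.int y).const_mul c), integral_const_mul]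
      change _ = lagDens (K ε) W q y - c * lagDens (K ε) W r y
      rw [h.lagDens_r h0 h1, mul_one]
    have e3 : ∫ z, η * (K ε (y - shift W z) * r z) = η := by
      rw [integral_const_mul]
      change η * lagDens (K ε) W r y = η
      rw [h.lagDens_r h0 h1, mul_one]
    rw [e1, ← norm_eq_abs]
    refine (norm_integral_le_of_norm_le
      ((h.integrable_K_shift hKc h.wdr.int y).const_mul η) ?_).trans e3.le
    filter_upwards [hc] with z hz
    rw [norm_eq_abs, abs_mul, abs_of_nonneg (K_nonneg h0 _)]
    by_cases hz2 : ε ≤ ‖y - shift W z‖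
    · rw [K_eq_zero h0 hz2]
      simp
    · have hzw : z ∈ win W (2 * ε) x := by
        change ‖shift W z - shift W x‖ ≤ 2 * ε
        have : shift W z - shift W x = (y - shift W x) - (y - shift W z) := by abel
        rw [this]
        refine (norm_sub_le _ _).trans ?_
        linarith [not_le.1 hz2]
      have := mul_le_mul_of_nonneg_left (hz hzw) (K_nonneg h0 (y - shift W z))
      linarith
  have hsub : lagB (K ε) (K1 ε) β1 W q x =
      ∫ y, (β1 (lagDens (K ε) W q y) - β1 c) * K1 ε (y - shift W x) :=
    lagB_eq h0 h1 hβc h.measW h.wdq.int x c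
  have hK1i : Integrable fun y => |K1 ε (y - shift W x)| :=
    (torus_integrable (hK1c.comp (continuous_id.sub continuous_const))).abs
  rw [hsub, ← norm_eq_abs]
  refine (norm_integral_le_of_norm_le (hK1i.const_mul (L * η)) (.of_forall fun y => ?_)).trans ?_
  · rw [norm_eq_abs, abs_mul]
    by_cases hy : ‖y - shift W x‖ < ε
    · exact mul_le_mul_of_nonneg_right ((hβ _ _).trans
        (mul_le_mul_of_nonneg_left (hP y hy) hL)) (abs_nonneg _)
    · rw [K1_eq_zero h0 (not_lt.1 hy)]
      simp
  · rw [integral_const_mul]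
    refine (mul_le_mul_of_nonneg_left (integral_abs_K1_le h0 h1 _) (mul_nonneg hL hη)).trans
      (le_of_eq ?_)
    ring

/-- Cauchy-Schwarz on the window, where the `r`-mass is at most `8 ε`; the gain of `ε` is later
spent against the factor `1 / ε` of the kernel's derivative. -/
lemma integral_win_mul_le {ε : ℝ} (h0 : 0 < ε) (x : Torus) {c : 𝕊} {A : ℝ} (hA : 0 ≤ A)
    (hc : ∀ᵐ z, z ∈ win W (2 * ε) x → c z ^ 2 ≤ r z * (A * e z)) :
    (∫ z in win W (2 * ε) x, |c z|) ^ 2 ≤ 8 * ε * (A * ∫ z in win W (2 * ε) x, e z) := by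
  have hm := measurableSet_win h.measW (2 * ε) x
  have h1 := sq_integral_le (μ := volume.restrict (win W (2 * ε) x)) (w := fun _ => 1) (a := r)
    (b := fun z => A * e z) (c := fun x => |c x|) (.of_forall fun _ => zero_le_one)
    (.of_forall h.r_nonneg) (.of_forall fun z => mul_nonneg hA (h.e_nonneg z))
    (by rw [ae_restrict_iff' hm]; simpa only [sq_abs] using hc)
    (by simpa only [one_mul] using h.wdr.int.integrableOn.integrable)
    (by simpa only [one_mul] using (h.e_int.const_mul A).integrableOn.integrable)
  simp only [one_mul, integral_const_mul] at h1
  refine h1.trans (mul_le_mul_of_nonneg_right (h.integral_win_le h0 x)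
    (mul_nonneg hA (integral_nonneg h.e_nonneg)))

/-- The domination of the chain rule in Lagrangian coordinates. -/
lemma sq_mul_lagB_le (hlam : 0 < lam) {ε : ℝ} (h0 : 0 < ε) (h1 : ε ≤ 1 / 8) {β1 : ℝ → ℝ} {L : ℝ}
    (hL : 0 ≤ L) (hβ : ∀ s t, |β1 s - β1 t| ≤ L * |s - t|) :
    ∀ᵐ x, ((r x * j x - J x * q x) * lagB (K ε) (K1 ε) β1 W q x) ^ 2 ≤
      640 * (L * kapC) ^ 2 / lam * e x * (r x * (ε⁻¹ * ∫ z in win W (2 * ε) x, e z)) := by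
  obtain ⟨rc, hrc, hrae, hrinc⟩ := h.wdr.exists_rep
  obtain ⟨qc, hqc, hqae, hqinc⟩ := h.wdq.exists_rep
  have hk := one_le_kapC
  have hρ : 2 * ε < 1 / 2 := by linarith
  filter_upwards [h.sqN, hrae, hqae] with x hN hrx hqx
  set N := r x * j x - J x * q x with hNdef
  set B := lagB (K ε) (K1 ε) β1 W q x with hB
  set E := ∫ z in win W (2 * ε) x, e z with hE
  have hE0 : 0 ≤ E := integral_nonneg h.e_nonneg
  have he0 := h.e_nonneg x
  rcases (h.r_nonneg x).eq_or_lt with hr0 | hr0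
  · have hN0 : N = 0 := by
      rw [← hr0] at hN
      simp only [add_zero, ne_eq, OfNat.ofNat_ne_zero, not_false_eq_true, zero_pow, zero_mul] at hN
      have : N ^ 2 = 0 := le_antisymm (by
        by_contra hcon
        nlinarith [mul_pos (not_le.1 hcon) hlam]) (sq_nonneg _)
      exact pow_eq_zero_iff (two_ne_zero) |>.1 this
    rw [hN0, zero_mul, ← hr0]
    simp
  set IV := ∫ z in win W (2 * ε) x, |V z| with hIV
  set Iw := ∫ z in win W (2 * ε) x, |w z| with hIw
  have hIV0 : 0 ≤ IV := integral_nonneg fun _ => abs_nonneg _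
  have hIw0 : 0 ≤ Iw := integral_nonneg fun _ => abs_nonneg _
  have hVb : IV ^ 2 ≤ 8 * ε * (1 * E) := h.integral_win_mul_le h0 x zero_le_one
    (by filter_upwards [h.sqV] with z hz _; rwa [one_mul])
  have oscr : ∀ z ∈ win W (2 * ε) x, |rc z - rc x| ≤ IV := fun z hz =>
    abs_sub_le_integral_win h.wdr.int h.r_nonneg h.disp h.measW h.wdr.int' hrinc hρ hz
  have oscq : ∀ z ∈ win W (2 * ε) x, |qc z - qc x| ≤ Iw := fun z hz =>
    abs_sub_le_integral_win h.wdr.int h.r_nonneg h.disp h.measW h.wdq.int' hqinc hρ hz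
  have hpos : 0 < lam + r x := by linarith
  -- It remains to find `η` that bounds the relative oscillation of the color on the window and
  -- whose weighted square is controlled by the energy in the window. The constant `640` is `4 *
  -- 160`.
  have key : ∀ η, |B| ≤ 2 * L * kapC / ε * η → (lam + r x)⁻¹ * r x ^ 2 * η ^ 2 ≤ 160 / lam * (ε * E) →
      (N * B) ^ 2 ≤ 640 * (L * kapC) ^ 2 / lam * e x * (r x * (ε⁻¹ * E)) := by
    intro η hη hη2
    have hB2 : B ^ 2 ≤ (2 * L * kapC / ε * η) ^ 2 := by
      rw [← sq_abs B]
      exact pow_le_pow_left₀ (abs_nonneg _) hη 2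
    have hN2 : N ^ 2 ≤ (lam + r x)⁻¹ * (r x ^ 3 * e x) := by
      rw [inv_mul_eq_div, le_div_iff₀ hpos]
      exact hN
    calc (N * B) ^ 2 = N ^ 2 * B ^ 2 := mul_pow _ _ _
      _ ≤ ((lam + r x)⁻¹ * (r x ^ 3 * e x)) * (2 * L * kapC / ε * η) ^ 2 :=
        mul_le_mul hN2 hB2 (sq_nonneg _) (by positivity)
      _ = (4 * (L * kapC) ^ 2 * e x * r x * (ε⁻¹ * ε⁻¹)) * ((lam + r x)⁻¹ * r x ^ 2 * η ^ 2) := by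
        field_simp
        ring
      _ ≤ (4 * (L * kapC) ^ 2 * e x * r x * (ε⁻¹ * ε⁻¹)) * (160 / lam * (ε * E)) :=
        mul_le_mul_of_nonneg_left hη2 (by positivity)
      _ = 640 * (L * kapC) ^ 2 / lam * e x * (r x * (ε⁻¹ * E)) := by
        field_simp
        ring
  -- If the total density varies by more than half of its value at `x`, then `r x ≤ 2 IV` and the
  -- trivial choice `η = 1`, from `0 ≤ q ≤ r`, suffices. Otherwise `r` is comparable to `r x` on the
  -- window, and `q` is close to `p r` with an error of at most `IV + Iw`.
  by_cases hcase : ∃ z ∈ win W (2 * ε) x, rc x / 2 < |rc z - rc x|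
  · obtain ⟨z, hz, hz2⟩ := hcase
    have hrI : r x ≤ 2 * IV := by
      rw [hrx]
      linarith [oscr z hz]
    refine key 1 (h.abs_lagB_le h0 h1 hL hβ x (c := 0) zero_le_one ?_) ?_
    · refine .of_forall fun u _ => ?_
      rw [zero_mul, sub_zero, one_mul, abs_of_nonneg (h.nonneg u)]
      exact h.le u
    · have : (lam + r x)⁻¹ ≤ lam⁻¹ := inv_anti₀ hlam (by linarith)
      have h3 : r x ^ 2 ≤ 160 * (ε * E) := by nlinarith
      calc (lam + r x)⁻¹ * r x ^ 2 * 1 ^ 2 ≤ lam⁻¹ * (160 * (ε * E)) := by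
            rw [one_pow, mul_one]
            exact mul_le_mul this h3 (sq_nonneg _) (by positivity)
        _ = 160 / lam * (ε * E) := by ring
  · push Not at hcase
    have hrz : ∀ z ∈ win W (2 * ε) x, r x / 2 ≤ rc z ∧ rc z ≤ 3 / 2 * r x := by
      intro z hz
      have := abs_le.1 (hcase z hz)
      rw [hrx]
      constructor <;> linarith [this.1, this.2]
    have hwb : Iw ^ 2 ≤ 8 * ε * (3 / 2 * ((lam + r x) / lam) * E) := by
      refine h.integral_win_mul_le h0 x (by positivity) ?_
      filter_upwards [h.sqw, hrae] with z hz hrz2 hmem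
      have h3 := (hrz z hmem).2
      rw [← hrz2] at h3
      have h4 : lam + r z ≤ 3 / 2 * (lam + r x) := by linarith
      have h5 : (lam + r z) * (r z * e z) ≤ 3 / 2 * (lam + r x) * (r z * e z) :=
        mul_le_mul_of_nonneg_right h4 (mul_nonneg (h.r_nonneg z) (h.e_nonneg z))
      have h6 : w z ^ 2 ≤ (3 / 2 * (lam + r x) * (r z * e z)) / lam := by
        rw [le_div_iff₀ hlam]
        linarith
      refine h6.trans (le_of_eq ?_)
      field_simp
    set p := q x / r x with hp
    have hp0 : 0 ≤ p := div_nonneg (h.nonneg x) hr0.le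
    have hp1 : p ≤ 1 := (div_le_one hr0).2 (h.le x)
    have hpr : p * r x = q x := div_mul_cancel₀ _ hr0.ne'
    refine key (2 * (IV + Iw) / r x) (h.abs_lagB_le h0 h1 hL hβ x (c := p) (by positivity) ?_) ?_
    · filter_upwards [hrae, hqae] with z hz1 hz2 hmem
      have h3 := oscr z hmem
      have h4 := oscq z hmem
      have h5 := (hrz z hmem).1
      rw [hz1, hz2]
      have h6 : qc z - p * rc z = (qc z - qc x) - p * (rc z - rc x) := by
        rw [← hqx, ← hrx]
        linarith
      have h7 : |qc z - p * rc z| ≤ IV + Iw := by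
        rw [h6]
        refine (abs_sub _ _).trans ?_
        rw [abs_mul, abs_of_nonneg hp0]
        have h8 := mul_le_mul hp1 h3 (abs_nonneg _) zero_le_one
        linarith
      refine h7.trans ?_
      rw [div_mul_eq_mul_div, le_div_iff₀ hr0]
      have h8 := mul_le_mul_of_nonneg_left h5 (add_nonneg hIV0 hIw0)
      linarith
    · have h3 : (lam + r x)⁻¹ * r x ^ 2 * (2 * (IV + Iw) / r x) ^ 2 =
          4 * (lam + r x)⁻¹ * (IV + Iw) ^ 2 := by
        field_simp
        ring
      have h4 : (IV + Iw) ^ 2 ≤ 2 * IV ^ 2 + 2 * Iw ^ 2 := by nlinarith [sq_nonneg (IV - Iw)]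
      have h5 : (1 : ℝ) ≤ (lam + r x) / lam := by
        rw [le_div_iff₀ hlam]
        linarith
      have h6 : (IV + Iw) ^ 2 ≤ (lam + r x) / lam * (40 * (ε * E)) := by
        have h7 := mul_le_mul_of_nonneg_right h5 (mul_nonneg h0.le hE0)
        have h8 : 8 * ε * (3 / 2 * ((lam + r x) / lam) * E) = 12 * ((lam + r x) / lam * (ε * E)) := by
          ring
        have h9 : 8 * ε * (1 * E) = 8 * (ε * E) := by ring
        rw [h8] at hwb
        rw [h9] at hVb
        linarith
      rw [h3]
      calc 4 * (lam + r x)⁻¹ * (IV + Iw) ^ 2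
          ≤ 4 * (lam + r x)⁻¹ * ((lam + r x) / lam * (40 * (ε * E))) :=
            mul_le_mul_of_nonneg_left h6 (by positivity)
        _ = 160 / lam * (ε * E) := by
          field_simp
          ring

end Slice

/-! ### First-order expansion and the pointwise limit -/

lemma ae_rep {p : ℝ → Prop} (h : ∀ᵐ s : ℝ, s ∈ uIcc (-1 : ℝ) 1 → p s) : ∀ᵐ x, p (rep x) := by
  have h1 : MeasurePreserving rep volume (volume.restrict (Ioc (-1 / 2 : ℝ) (-1 / 2 + 1))) :=
    (measurePreserving_subtype_coe measurableSet_Ioc).comp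
      (AddCircle.measurePreserving_equivIoc (1 : ℝ) (a := -1 / 2))
  have h2 : ∀ᵐ s ∂(volume.restrict (Ioc (-1 / 2 : ℝ) (-1 / 2 + 1))), p s := by
    rw [ae_restrict_iff' measurableSet_Ioc]
    filter_upwards [h] with s hs hmem
    refine hs ?_
    rw [uIcc_of_le (by norm_num)]
    constructor <;> linarith [hmem.1, hmem.2]
  exact h1.quasiMeasurePreserving.ae h2

lemma ae_hasDerivAt_rep {f g : 𝕊} (hg : Integrable g)
    (hf : ∀ a b : ℝ, f b - f a = ∫ s in a..b, g (s : Torus)) :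
    ∀ᵐ x, HasDerivAt (fun s : ℝ => f (s : Torus)) (g x) (rep x) := by
  have h1 := (lift_intervalIntegrable hg (-1) 1).ae_hasDerivAt_integral
  have h2 : ∀ᵐ s : ℝ, s ∈ uIcc (-1 : ℝ) 1 →
      HasDerivAt (fun s : ℝ => f (s : Torus)) (g (s : Torus)) s := by
    filter_upwards [h1] with s hs hmem
    have h3 := (hs hmem 0 (by rw [uIcc_of_le (by norm_num)]; norm_num)).const_add
      (f ((0 : ℝ) : Torus))
    refine h3.congr_of_eventuallyEq (.of_forall fun b => ?_)
    simp only
    rw [← hf]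
    ring
  filter_upwards [ae_rep h2] with x hx
  rwa [coe_rep] at hx

/-- The function `sin(2πx)/(2π)` on the torus. -/
noncomputable def sn (z : Torus) : ℝ := Real.sin (2 * Real.pi * rep z) / (2 * Real.pi)

/-- The function `cos(2πx)` on the torus. -/
noncomputable def cn (z : Torus) : ℝ := Real.cos (2 * Real.pi * rep z)

lemma sn_coe (s : ℝ) : sn (s : Torus) = Real.sin (2 * Real.pi * s) / (2 * Real.pi) := by
  obtain ⟨n, hn⟩ := exists_int_sub_rep s
  rw [sn, hn, mul_sub, show 2 * Real.pi * s - 2 * Real.pi * (n : ℝ) = 2 * Real.pi * s -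
    n * (2 * Real.pi) by ring, Real.sin_sub_int_mul_two_pi]

lemma cn_coe (s : ℝ) : cn (s : Torus) = Real.cos (2 * Real.pi * s) := by
  obtain ⟨n, hn⟩ := exists_int_sub_rep s
  rw [cn, hn, mul_sub, show 2 * Real.pi * s - 2 * Real.pi * (n : ℝ) = 2 * Real.pi * s -
    n * (2 * Real.pi) by ring, Real.cos_sub_int_mul_two_pi]

/-- On the torus there is no global coordinate function; `sn` replaces it, as it vanishes at `0`
with slope one, which is all that a first-order expansion uses. -/
lemma sn_hasTD : HasTD sn cn := by
  intro s
  rw [funext sn_coe, cn_coe]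
  have h1 : HasDerivAt (fun s : ℝ => 2 * Real.pi * s) (2 * Real.pi) s := by
    simpa using (hasDerivAt_id s).const_mul (2 * Real.pi)
  have h2 := (h1.sin).div_const (2 * Real.pi)
  have hpi := Real.pi_ne_zero
  rw [mul_div_assoc, div_self (by positivity), mul_one] at h2
  exact h2

lemma cn_continuous : Continuous cn := by
  refine continuous_of_comp_coe ?_
  rw [funext cn_coe]
  fun_prop

lemma abs_sn_le (z : Torus) : |sn z| ≤ ‖z‖ := by
  have hpi := Real.pi_pos
  rw [sn, abs_div, abs_of_pos (show 0 < 2 * Real.pi by positivity), div_le_iff₀ (by positivity),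
    ← abs_rep]
  refine Real.abs_sin_le_abs.trans (le_of_eq ?_)
  rw [abs_mul, abs_of_pos (show 0 < 2 * Real.pi by positivity), mul_comm]

lemma abs_cv_K_sn_le {ε : ℝ} (h0 : 0 < ε) (h1 : ε ≤ 1 / 8) {u : Torus} (hu : ‖u‖ < ε) :
    |cv (K ε) sn u| ≤ 2 * ε := by
  have h := abs_cv_K_sub_le h0 h1 (torus_integrable sn_hasTD.continuous) u 0 (2 * ε) fun z hz => ?_
  · rwa [sub_zero] at h
  · rw [sub_zero]
    refine (abs_sn_le z).trans ?_
    have h3 : z = u - (u - z) := by abel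
    rw [h3]
    refine (norm_sub_le _ _).trans ?_
    linarith

lemma integral_K1_mul_cv_sn {ε : ℝ} (h0 : 0 < ε) (h1 : ε ≤ 1 / 8) :
    ∫ u, K1 ε u * cv (K ε) sn u = -cv (K ε) (cv (K ε) cn) 0 := by
  have hsn : WD sn cn := by
    refine ⟨torus_integrable sn_hasTD.continuous, torus_integrable cn_continuous, fun n x => ?_⟩
    have h2 := ((Kw_hasTD n).comp_sub_left x).integral_mul_deriv sn_hasTD
      (K1w_continuous n |>.comp (continuous_const.sub continuous_id)).neg
      cn_continuous
    simp only [neg_mul, integral_neg, neg_neg] at h2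
    exact h2.symm
  have h2 : HasTD (cv (K ε) sn) (cv (K ε) cn) := by
    have h3 := cv_hasTD (K_hasTD h0 h1) (K1_continuous h0 h1) (torus_integrable sn_hasTD.continuous)
    have h4 : cv (K1 ε) sn = cv (K ε) cn := by
      ext x
      have h5 := ((K_hasTD h0 h1).comp_sub_left x).integral_mul_deriv sn_hasTD
        (K1_continuous h0 h1 |>.comp (continuous_const.sub continuous_id)).neg cn_continuous
      simp only [neg_mul, integral_neg, neg_neg] at h5
      exact h5.symm
    rwa [h4] at h3
  have hcc := cv_continuous (K_continuous h0 h1) (torus_integrable cn_continuous)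
  have h3 := (K_hasTD h0 h1).integral_mul_deriv h2 (K1_continuous h0 h1) hcc
  have h4 : cv (K ε) (cv (K ε) cn) 0 = ∫ x, K ε x * cv (K ε) cn x := by
    refine integral_congr_ae (.of_forall fun z => ?_)
    simp only [zero_sub, K_neg]
  rw [h4, h3, neg_neg]

/-- Integration by parts leaves minus a double mollification of `cn`, evaluated at `0`, where `cn`
equals one. This is the constant in the limit of `lagB`. -/
lemma tendsto_integral_K1_mul_cv_sn :
    Tendsto (fun n => ∫ u, K1 (wid n) u * cw n sn u) atTop (𝓝 (-1)) := by
  have hcn := torus_integrable cn_continuous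
  have hcn0 : cn 0 = 1 := by
    have := cn_coe 0
    simpa using this
  rw [Metric.tendsto_nhds]
  intro η hη
  filter_upwards [cv_K_tendstoUniformly cn_continuous (η / 4) (by linarith)] with n hn
  rw [integral_K1_mul_cv_sn (wid_pos n) (wid_le n), Real.dist_eq]
  have h1 : |cw n (cw n cn) 0 - cw n cn 0| ≤ η / 4 := by
    rw [← cv_sub (Kw_continuous n) (cv_wid_integrable hcn n) hcn]
    have h2 := abs_cv_K_sub_le (wid_pos n) (wid_le n) ((cv_wid_integrable hcn n).sub hcn) 0 0
      (η / 4) fun z _ => by rw [sub_zero]; exact hn z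
    rwa [sub_zero] at h2
  have h2 := hn 0
  rw [hcn0] at h2
  have h3 : -cw n (cw n cn) 0 - -1 = -((cw n (cw n cn) 0 - cw n cn 0) + (cw n cn 0 - 1)) := by ring
  rw [h3, abs_neg]
  refine (abs_add_le _ _).trans_lt ?_
  linarith

/-- First-order expansion of a ratio in another variable. -/
lemma eventually_abs_sub_le {Φ R Q S : ℝ → ℝ} {a p d v u : ℝ} (hΦ : HasDerivAt Φ (R a) a)
    (hR : HasDerivAt R v a) (hQ : HasDerivAt Q u a) (hRa : 0 < R a) (hS : HasDerivAt S 1 0)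
    (hS0 : S 0 = 0) (hp : Q a = p * R a) (hd : d * R a ^ 2 = u - p * v) {η : ℝ} (hη : 0 < η) :
    ∀ᶠ b in 𝓝 a, |Q b - (p + d * S (Φ b - Φ a)) * R b| ≤ η * |Φ b - Φ a| * R b := by
  have h1 : HasDerivAt (fun b => S (Φ b - Φ a)) (R a) a := by
    have h2 := (hΦ.sub_const (Φ a))
    have h3 : HasDerivAt S 1 (Φ a - Φ a) := by rwa [sub_self]
    have h4 := HasDerivAt.comp a h3 h2
    rwa [one_mul] at h4
  -- The constants `p` and `d` are such that the value and the derivative at `a` both vanish. The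
  -- expression is thus `o(|b - a|)`, and `|b - a|` is comparable to `|Φ b - Φ a|` because `Φ` has
  -- positive derivative `R a`.
  have h2 : HasDerivAt (fun b => Q b - (p + d * S (Φ b - Φ a)) * R b) 0 a := by
    have h3 := hQ.sub (((h1.const_mul d).const_add p).mul hR)
    have h4 : u - (d * R a * R a + (p + d * S (Φ a - Φ a)) * v) = 0 := by grind
    rw [h4] at h3
    exact h3
  have h3 := h2.isLittleO
  have e0 : Q a - (p + d * S (Φ a - Φ a)) * R a = 0 := by
    rw [sub_self, hS0, hp]
    ring
  simp only [e0, sub_zero, smul_zero] at h3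
  have h4 := hΦ.isLittleO
  have f1 := h3.def (show 0 < η * (R a / 2) * (R a / 2) by positivity)
  have f2 := h4.def (show 0 < R a / 2 by positivity)
  have f3 : ∀ᶠ b in 𝓝 a, R a / 2 < R b := hR.continuousAt.eventually (lt_mem_nhds (by linarith))
  filter_upwards [f1, f2, f3] with b g1 g2 g3
  rw [norm_eq_abs, norm_eq_abs] at g1 g2
  have g4 : R a / 2 * |b - a| ≤ |Φ b - Φ a| := by
    have : R a * |b - a| = |(b - a) • R a| := by rw [smul_eq_mul, abs_mul, abs_of_pos hRa, mul_comm]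
    have g5 := abs_sub_abs_le_abs_sub ((b - a) • R a) (Φ b - Φ a)
    rw [abs_sub_comm ((b - a) • R a)] at g5
    linarith
  refine g1.trans ?_
  have g6 : η * (R a / 2) * (R a / 2) * |b - a| = η * (R a / 2 * |b - a|) * (R a / 2) := by ring
  rw [g6]
  exact mul_le_mul (mul_le_mul_of_nonneg_left g4 hη.le) g3.le (by linarith) (by positivity)

namespace Slice
variable {lam : ℝ} {r J q j V w e W : 𝕊} (h : Slice lam r J q j V w e W)
include h

/-- If `q` is close to an affine function of the Lagrangian coordinate times `r` near `x`, then so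
is the mollified Lagrangian density. -/
lemma abs_lagDens_sub_le {ε : ℝ} (h0 : 0 < ε) (h1 : ε ≤ 1 / 8) (x : Torus) {p d η : ℝ}
    (hc : ∀ᵐ z, z ∈ win W (2 * ε) x →
      |q z - (p + d * sn (shift W z - shift W x)) * r z| ≤ η * r z) {y : Torus}
    (hy : ‖y - shift W x‖ < ε) :
    |lagDens (K ε) W q y - (p + d * cv (K ε) sn (y - shift W x))| ≤ η := by
  have hKc := K_continuous h0 h1
  have hsc := sn_hasTD.continuous
  set F : 𝕊 := fun u => K ε (y - u) * (p + d * sn (u - shift W x)) with hF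
  have hF1 : Continuous fun u => K ε (y - u) := hKc.comp (continuous_const.sub continuous_id)
  have hF2 : Continuous fun u => sn (u - shift W x) := hsc.comp (continuous_id.sub continuous_const)
  have hFc : Continuous F := hF1.mul (continuous_const.add (continuous_const.mul hF2))
  have e0 : ∫ z, F (shift W z) * r z = p + d * cv (K ε) sn (y - shift W x) := by
    rw [h.push F hFc]
    have i1 : Integrable fun u => K ε (y - u) * p :=
      torus_integrable (hF1.mul continuous_const)
    have i2 : Integrable fun u => d * (K ε (y - u) * sn (u - shift W x)) :=
      torus_integrable (continuous_const.mul (hF1.mul hF2))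
    have e1 : ∀ u, F u = K ε (y - u) * p + d * (K ε (y - u) * sn (u - shift W x)) := fun u => by
      simp only [hF]
      ring
    simp_rw [e1]
    rw [integral_add i1 i2, integral_mul_const, integral_K_sub h0 h1, one_mul, integral_const_mul]
    congr 2
    rw [cv, ← integral_sub_right_eq_self (fun z => K ε (y - shift W x - z) * sn z) (shift W x)]
    congr 1 with u
    rw [show y - shift W x - (u - shift W x) = y - u by abel]
  have iF : Integrable fun z => F (shift W z) * r z := by
    obtain ⟨D, _, hD⟩ := torus_bound hFc
    exact h.wdr.int.bdd_mul (c := D) (hFc.measurable.comp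
      (shift_measurable h.measW)).aestronglyMeasurable (.of_forall fun z => hD _)
  have e1 : lagDens (K ε) W q y - (p + d * cv (K ε) sn (y - shift W x)) =
      ∫ z, K ε (y - shift W z) * (q z - (p + d * sn (shift W z - shift W x)) * r z) := by
    rw [← e0, lagDens, ← integral_sub (h.integrable_K_shift hKc h.wdq.int y) iF]
    congr 1 with z
    simp only [hF]
    ring
  have e3 : ∫ z, η * (K ε (y - shift W z) * r z) = η := by
    rw [integral_const_mul]
    change η * lagDens (K ε) W r y = η
    rw [h.lagDens_r h0 h1, mul_one]
  rw [e1, ← norm_eq_abs]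
  refine (norm_integral_le_of_norm_le
    ((h.integrable_K_shift hKc h.wdr.int y).const_mul η) ?_).trans e3.le
  filter_upwards [hc] with z hz
  rw [norm_eq_abs, abs_mul, abs_of_nonneg (K_nonneg h0 _)]
  by_cases hz2 : ε ≤ ‖y - shift W z‖
  · rw [K_eq_zero h0 hz2]
    simp
  · have hzw : z ∈ win W (2 * ε) x := by
      change ‖shift W z - shift W x‖ ≤ 2 * ε
      have : shift W z - shift W x = (y - shift W x) - (y - shift W z) := by abel
      rw [this]
      refine (norm_sub_le _ _).trans ?_
      linarith [not_le.1 hz2]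
    have := mul_le_mul_of_nonneg_left (hz hzw) (K_nonneg h0 (y - shift W z))
    linarith

/-- The displacement is a primitive, for which `r` may be replaced by its continuous version;
differentiability then holds at every point. -/
lemma disp_hasDerivAt {rc : 𝕊} (hrc : Continuous rc) (hae : ∀ᵐ x, r x = rc x) (a : ℝ) :
    HasDerivAt (fun s : ℝ => s + W (s : Torus)) (rc a) a := by
  have hc : Continuous fun s : ℝ => rc (s : Torus) := hrc.comp (AddCircle.continuous_mk' 1)
  have h1 : HasDerivAt (fun b => (a + W (a : Torus)) + ∫ s in a..b, rc (s : Torus)) (rc a) a :=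
    (integral_hasDerivAt_right (hc.intervalIntegrable _ _)
      (hc.stronglyMeasurableAtFilter _ _) hc.continuousAt).const_add _
  refine h1.congr_of_eventuallyEq ?_
  filter_upwards [Metric.ball_mem_nhds a one_pos] with b hb
  have hrci := torus_integrable hrc
  have h2 := abs_intervalIntegral_le_torus (h.wdr.int.sub hrci) (a := a) (b := b)
    (by rw [← Real.dist_eq]; exact (Metric.mem_ball.1 hb).le)
  have h3 : ∫ x, |(r - rc) x| = 0 := by
    refine integral_eq_zero_of_ae ?_
    filter_upwards [hae] with x hx
    simp [hx]
  rw [h3, abs_nonpos_iff] at h2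
  simp only [Pi.sub_apply] at h2
  rw [intervalIntegral.integral_sub (lift_intervalIntegrable h.wdr.int _ _)
    (hc.intervalIntegrable _ _)] at h2
  have h4 := h.disp a b
  linarith

/-- Points with nearby Lagrangian coordinate have nearby lifts. -/
lemma exists_lift_of_win {rc : 𝕊} (hrc : Continuous rc) (hae : ∀ᵐ x, r x = rc x) {a : ℝ}
    (ha : 0 < rc a) {δ : ℝ} (hδ : 0 < δ) : ∃ ρ > 0, ∀ z, z ∈ win W ρ (a : Torus) →
      ∃ b : ℝ, (b : Torus) = z ∧ |b - a| < δ ∧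
        |(b + W b) - (a + W a)| = ‖shift W z - shift W (a : Torus)‖ := by
  set Φ : ℝ → ℝ := fun s => s + W (s : Torus) with hΦ
  have hinc : ∀ s t, Φ t - Φ s = ∫ u in s..t, r (u : Torus) := fun s t => by
    have h1 := h.disp s t
    simp only [hΦ]
    linarith
  have hmono : ∀ s t, s ≤ t → Φ s ≤ Φ t := fun s t hst => by
    rw [← sub_nonneg, hinc]
    exact intervalIntegral.integral_nonneg hst fun u _ => h.r_nonneg _
  have hd := (h.disp_hasDerivAt hrc hae a).isLittleO.def (show 0 < rc a / 2 by positivity)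
  obtain ⟨δ1, hδ1, hball⟩ := Metric.eventually_nhds_iff.1 hd
  set δ2 := min δ δ1 / 2 with hδ2
  have hm : 0 < min δ δ1 := lt_min hδ hδ1
  have hδ2pos : 0 < δ2 := by positivity
  have hlt1 : δ2 < δ1 := by linarith [min_le_right δ δ1]
  have hlt : δ2 < δ := by linarith [min_le_left δ δ1]
  have r1 := hball (y := a + δ2) (by rw [Real.dist_eq, add_sub_cancel_left, abs_of_pos hδ2pos]; exact hlt1)
  have r2 := hball (y := a - δ2) (by rw [Real.dist_eq, sub_sub_cancel_left, abs_neg, abs_of_pos hδ2pos]; exact hlt1)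
  rw [add_sub_cancel_left, smul_eq_mul, norm_eq_abs, norm_eq_abs, abs_of_pos hδ2pos] at r1
  rw [sub_sub_cancel_left, smul_eq_mul, norm_eq_abs, norm_eq_abs, abs_neg, abs_of_pos hδ2pos] at r2
  have s1 := abs_le.1 r1
  have s2 := abs_le.1 r2
  have hpos : 0 < rc a / 2 * δ2 := by positivity
  -- The derivative of `Φ` at `a` is `rc a`, and the error is at most half of it within distance
  -- `δ1`. So `Φ` moves by at least `rc a / 2 * δ2` over the distance `δ2`; monotonicity extends
  -- this to all points farther away.
  refine ⟨rc a / 4 * δ2, by positivity, fun z hz => ?_⟩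
  obtain ⟨b', rfl⟩ := mk_surjective z
  change ‖shift W (b' : Torus) - shift W (a : Torus)‖ ≤ _ at hz
  have hnorm : |Φ (b' - round (Φ b' - Φ a)) - Φ a| =
      ‖shift W (b' : Torus) - shift W (a : Torus)‖ := by
    rw [shift_coe, shift_coe, ← AddCircle.coe_sub, UnitAddCircle.norm_eq]
    congr 1
    simp only [hΦ, coe_sub_int]
    ring
  refine ⟨b' - round (Φ b' - Φ a), coe_sub_int _ _, ?_, hnorm⟩
  set b := b' - round (Φ b' - Φ a) with hb
  rw [← hnorm, abs_le] at hz
  rw [abs_lt]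
  constructor
  · by_contra hcon
    have := hmono b (a - δ2) (by linarith)
    simp only [hΦ] at this hz
    linarith [s2.2, hz.1]
  · by_contra hcon
    have := hmono (a + δ2) b (by linarith)
    simp only [hΦ] at this hz
    linarith [s1.1, hz.2]

/-- The pointwise limit in the chain rule in Lagrangian coordinates. -/
lemma lagB_tendsto {β1 : ℝ → ℝ} (hβc : Continuous β1) {b2 : ℝ → ℝ}
    (hβ : ∀ s, HasDerivAt β1 (b2 s) s) :
    ∀ᵐ x, 0 < r x → Tendsto (fun n => lagB (K (wid n)) (K1 (wid n)) β1 W q x) atTop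
      (𝓝 (-(b2 (q x / r x) * ((w x - q x / r x * V x) / r x ^ 2)))) := by
  obtain ⟨rc, hrc, hrae, hrinc⟩ := h.wdr.exists_rep
  obtain ⟨qc, hqc, hqae, hqinc⟩ := h.wdq.exists_rep
  have hk := one_le_kapC
  filter_upwards [hrae, hqae, ae_hasDerivAt_rep h.wdr.int' hrinc,
    ae_hasDerivAt_rep h.wdq.int' hqinc] with x hrx hqx hdr hdq hr0
  set p := q x / r x with hp
  set d := (w x - p * V x) / r x ^ 2 with hd
  set a := rep x with ha
  have hax : (a : Torus) = x := coe_rep x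
  have hS : HasDerivAt (fun s : ℝ => sn (s : Torus)) 1 0 := by
    have h1 := sn_hasTD 0
    rw [cn_coe, mul_zero, Real.cos_zero] at h1
    exact h1
  have hS0 : sn ((0 : ℝ) : Torus) = 0 := by rw [sn_coe, mul_zero, Real.sin_zero, zero_div]
  have hΦ := h.disp_hasDerivAt hrc hrae a
  -- Here `d` is the derivative of `q / r` with respect to the Lagrangian coordinate: one power of
  -- `r` in its denominator comes from the quotient rule, the other from the change of variable.
  have hev : ∀ η > 0, ∀ᶠ b : ℝ in 𝓝 a, |qc (b : Torus) -
      (p + d * sn (((b + W (b : Torus)) - (a + W (a : Torus)) : ℝ) : Torus)) * rc (b : Torus)| ≤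
        η * |(b + W (b : Torus)) - (a + W (a : Torus))| * rc (b : Torus) := fun η hη => by
    refine eventually_abs_sub_le (Φ := fun s : ℝ => s + W (s : Torus))
      (R := fun s : ℝ => rc (s : Torus)) (Q := fun s : ℝ => qc (s : Torus))
      (S := fun s : ℝ => sn (s : Torus)) hΦ hdr hdq ?_ hS hS0 ?_ ?_ hη
    · rw [hax, ← hrx]
      exact hr0
    · rw [hax, ← hrx, ← hqx, hp, div_mul_cancel₀ _ hr0.ne']
    · rw [hax, ← hrx, hd, div_mul_cancel₀ _ (pow_ne_zero 2 hr0.ne')]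
  have hwin : ∀ η > 0, ∃ ρ > 0, ∀ᵐ z, z ∈ win W ρ x →
      |q z - (p + d * sn (shift W z - shift W x)) * r z| ≤ η * ‖shift W z - shift W x‖ * r z := by
    intro η hη
    obtain ⟨δ, hδ, hball⟩ := Metric.eventually_nhds_iff.1 (hev η hη)
    obtain ⟨ρ, hρ, hlift⟩ := h.exists_lift_of_win hrc hrae (a := a)
      (by rw [hax, ← hrx]; exact hr0) hδ
    refine ⟨ρ, hρ, ?_⟩
    filter_upwards [hrae, hqae] with z hz1 hz2 hmem
    rw [← hax] at hmem
    obtain ⟨b, hb, hba, hnorm⟩ := hlift z hmem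
    have h1 := hball (y := b) (by rw [Real.dist_eq]; exact hba)
    rw [AddCircle.coe_sub, ← shift_coe, ← shift_coe, hnorm, hb, hax] at h1
    rw [hz1, hz2]
    exact h1
  set A := 2 * |d| + 2 + 2 * |b2 p| with hA
  have hA0 : 0 < A := by positivity
  -- The main term: the mollified color fraction is replaced by its affine model and `β1` by its
  -- tangent at `p`.
  set X : ℕ → ℝ := fun n => b2 p * d * ∫ u, K1 (wid n) u * cw n sn u with hX
  have hXt : Tendsto X atTop (𝓝 (-(b2 p * d))) := by
    have h1 := tendsto_integral_K1_mul_cv_sn.const_mul (b2 p * d)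
    rwa [mul_neg_one] at h1
  -- The Taylor remainder of `β1` and the error of the affine model are together at most `η * ε *
  -- A`. The derivative of the kernel has norm at most `2 * kapC / ε`, so the powers of `ε` cancel.
  have key : ∀ η, 0 < η → η ≤ 1 → ∀ᶠ n in atTop,
      |lagB (K (wid n)) (K1 (wid n)) β1 W q x - X n| ≤ 2 * kapC * A * η := by
    intro η hη hη1
    obtain ⟨ρ, hρ, hρb⟩ := hwin (η / 2) (by linarith)
    obtain ⟨δ, hδ, hTay⟩ := Metric.eventually_nhds_iff.1 ((hβ p).isLittleO.def hη)
    have hB : 0 < 2 * |d| + 2 := by positivity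
    filter_upwards [(tendsto_order.1 wid_tendsto).2 (ρ / 2) (by linarith),
      (tendsto_order.1 wid_tendsto).2 (δ / (2 * |d| + 2)) (by positivity)] with n hn1 hn2
    have h0 := wid_pos n
    have h1 := wid_le n
    set ε := wid n with hε
    rw [lt_div_iff₀ hB] at hn2
    have hsc : Continuous (cv (K ε) sn) :=
      cv_continuous (K_continuous h0 h1) (torus_integrable sn_hasTD.continuous)
    have hPc := lagDens_continuous (K_continuous h0 h1) h.measW h.wdq.int
    have hK1c : Continuous fun y => K1 ε (y - shift W x) :=
      (K1_continuous h0 h1).comp (continuous_id.sub continuous_const)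
    have hscc : Continuous fun y => cv (K ε) sn (y - shift W x) :=
      hsc.comp (continuous_id.sub continuous_const)
    have hP : ∀ y, ‖y - shift W x‖ < ε →
        |lagDens (K ε) W q y - (p + d * cv (K ε) sn (y - shift W x))| ≤ η * ε := by
      intro y hy
      refine h.abs_lagDens_sub_le h0 h1 x ?_ hy
      filter_upwards [hρb] with z hz hmem
      have h2 : ‖shift W z - shift W x‖ ≤ 2 * ε := hmem
      refine (hz (h2.trans (by linarith) : z ∈ win W ρ x)).trans ?_
      refine mul_le_mul_of_nonneg_right ?_ (h.r_nonneg z)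
      nlinarith
    have hX2 : X n = ∫ y, (b2 p * d * cv (K ε) sn (y - shift W x)) * K1 ε (y - shift W x) := by
      have h2 : ∀ y, (b2 p * d * cv (K ε) sn (y - shift W x)) * K1 ε (y - shift W x) =
        b2 p * d * (K1 ε (y - shift W x) * cv (K ε) sn (y - shift W x)) := fun y => by ring
      simp_rw [h2]
      rw [integral_const_mul,
        integral_sub_right_eq_self (fun u => K1 ε u * cv (K ε) sn u) (shift W x)]
    have i1 : Integrable fun y => (β1 (lagDens (K ε) W q y) - β1 p) * K1 ε (y - shift W x) :=
      torus_integrable (((hβc.comp hPc).sub continuous_const).mul hK1c)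
    have i2 : Integrable fun y => (b2 p * d * cv (K ε) sn (y - shift W x)) * K1 ε (y - shift W x) :=
      torus_integrable ((continuous_const.mul hscc).mul hK1c)
    have hK1i : Integrable fun y => |K1 ε (y - shift W x)| :=
      (torus_integrable hK1c).abs
    rw [lagB_eq h0 h1 hβc h.measW h.wdq.int x p, hX2, ← integral_sub i1 i2, ← norm_eq_abs]
    refine (norm_integral_le_of_norm_le (hK1i.const_mul (η * ε * A))
      (.of_forall fun y => ?_)).trans ?_
    · rw [← sub_mul, norm_eq_abs, abs_mul]
      by_cases hy : ‖y - shift W x‖ < ε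
      · refine mul_le_mul_of_nonneg_right ?_ (abs_nonneg _)
        have g1 := hP y hy
        have g2 := abs_cv_K_sn_le h0 h1 hy
        set P := lagDens (K ε) W q y with hPdef
        set s := cv (K ε) sn (y - shift W x) with hs
        have g3 : |P - p| ≤ (2 * |d| + 2) * ε := by
          have e1 : P - p = (P - (p + d * s)) + d * s := by ring
          rw [e1]
          refine (abs_add_le _ _).trans ?_
          rw [abs_mul]
          have := mul_le_mul_of_nonneg_left g2 (abs_nonneg d)
          nlinarith
        have g4 := hTay (y := P) (by
          rw [Real.dist_eq]
          refine g3.trans_lt ?_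
          linarith)
        rw [smul_eq_mul, norm_eq_abs, norm_eq_abs] at g4
        have e2 : β1 P - β1 p - b2 p * d * s =
          (β1 P - β1 p - (P - p) * b2 p) + b2 p * (P - (p + d * s)) := by ring
        rw [e2]
        refine (abs_add_le _ _).trans ?_
        rw [abs_mul]
        have g5 := mul_le_mul_of_nonneg_left g1 (abs_nonneg (b2 p))
        have g6 := mul_le_mul_of_nonneg_left g3 hη.le
        have g7 : 0 ≤ |b2 p| * (η * ε) := by positivity
        calc _ ≤ η * ((2 * |d| + 2) * ε) + |b2 p| * (η * ε) := by linarith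
          _ ≤ η * ε * A := by
            rw [hA]
            linarith
      · rw [K1_eq_zero h0 (not_lt.1 hy)]
        simp
    · rw [integral_const_mul]
      refine (mul_le_mul_of_nonneg_left (integral_abs_K1_le h0 h1 _) (by positivity)).trans
        (le_of_eq ?_)
      field_simp
  have hdiff : Tendsto (fun n => lagB (K (wid n)) (K1 (wid n)) β1 W q x - X n) atTop (𝓝 0) := by
    rw [Metric.tendsto_nhds]
    intro τ hτ
    have hk0 : 0 < 2 * kapC * A := by positivity
    have hη : 0 < min 1 (τ / 2 / (2 * kapC * A)) := lt_min one_pos (by positivity)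
    filter_upwards [key _ hη (min_le_left _ _)] with n hn
    rw [dist_zero_right, norm_eq_abs]
    refine hn.trans_lt ?_
    have h1 := mul_le_mul_of_nonneg_left (min_le_right 1 (τ / 2 / (2 * kapC * A))) hk0.le
    rw [mul_div_cancel₀ _ hk0.ne'] at h1
    linarith
  have h1 := hdiff.add hXt
  simp only [sub_add_cancel, zero_add] at h1
  exact h1

end Slice


/-! ### Removal of the mollification in the chain rule -/

lemma integral_abs_le_of_sq_le {α : Type*} [MeasurableSpace α] {μ : Measure α} {f e S : α → ℝ}
    (he : Integrable e μ) (he0 : ∀ᵐ x ∂μ, 0 ≤ e x) (hS : Integrable S μ) (hS0 : ∀ᵐ x ∂μ, 0 ≤ S x)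
    (hsq : ∀ᵐ x ∂μ, f x ^ 2 ≤ e x * S x) :
    (∫ x, |f x| ∂μ) ^ 2 ≤ (∫ x, e x ∂μ) * ∫ x, S x ∂μ := by
  have := sq_integral_le (μ := μ) (w := fun _ => 1) (a := e) (b := S) (c := fun x => |f x|)
    (.of_forall fun _ => zero_le_one) he0 hS0 (by simpa only [sq_abs] using hsq)
    (by simpa only [one_mul] using he) (by simpa only [one_mul] using hS)
  simpa only [one_mul] using this

lemma integrable_of_sq_le {α : Type*} [MeasurableSpace α] {μ : Measure α} {f e S : α → ℝ}
    (hf : AEStronglyMeasurable f μ) (he : Integrable e μ) (hS : Integrable S μ)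
    (he0 : ∀ᵐ x ∂μ, 0 ≤ e x) (hS0 : ∀ᵐ x ∂μ, 0 ≤ S x)
    (hsq : ∀ᵐ x ∂μ, f x ^ 2 ≤ e x * S x) : Integrable f μ := by
  refine (he.add hS).mono' hf ?_
  filter_upwards [hsq, he0, hS0] with x h1 h2 h3
  rw [norm_eq_abs, Pi.add_apply]
  refine abs_le_of_sq_le_sq (h1.trans ?_) (add_nonneg h2 h3)
  nlinarith [mul_nonneg h2 h3]

/-- A version of the Vitali convergence theorem. -/
lemma tendsto_integral_of_sq_le {α : Type*} [MeasurableSpace α] {μ : Measure α} [IsFiniteMeasure μ]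
    {f S : ℕ → α → ℝ} {g e : α → ℝ} {M : ℝ} (hf : ∀ n, AEStronglyMeasurable (f n) μ)
    (hfg : ∀ᵐ x ∂μ, Tendsto (fun n => f n x) atTop (𝓝 (g x)))
    (he : Integrable e μ) (he0 : ∀ᵐ x ∂μ, 0 ≤ e x) (hS : ∀ n, Integrable (S n) μ)
    (hS0 : ∀ n, ∀ᵐ x ∂μ, 0 ≤ S n x) (hM : ∀ n, ∫ x, S n x ∂μ ≤ M)
    (hsq : ∀ n, ∀ᵐ x ∂μ, f n x ^ 2 ≤ e x * S n x) :
    Integrable g μ ∧ Tendsto (fun n => ∫ x, f n x ∂μ) atTop (𝓝 (∫ x, g x ∂μ)) := by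
  have hgm : AEStronglyMeasurable g μ := aestronglyMeasurable_of_tendsto_ae atTop hf hfg
  have hfi : ∀ n, Integrable (f n) μ := fun n =>
    integrable_of_sq_le (hf n) he (hS n) he0 (hS0 n) (hsq n)
  have hM0 : 0 ≤ M := (integral_nonneg_of_ae (hS0 0)).trans (hM 0)
  have hEpos : 0 ≤ ∫ x, e x ∂μ := integral_nonneg_of_ae he0
  -- By Cauchy-Schwarz the mass of `f n` on a set is controlled by that of the fixed function `e`
  -- there, which gives uniform integrability. The functions `S n` need bounded integrals but no
  -- convergence.
  have hfb : ∀ n, ∀ s, MeasurableSet s → (∫ x in s, |f n x| ∂μ) ^ 2 ≤ (∫ x in s, e x ∂μ) * M := by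
    intro n s _
    refine (integral_abs_le_of_sq_le he.integrableOn (ae_restrict_of_ae he0) (hS n).integrableOn
      (ae_restrict_of_ae (hS0 n)) (ae_restrict_of_ae (hsq n))).trans ?_
    refine mul_le_mul_of_nonneg_left ?_ (integral_nonneg_of_ae (ae_restrict_of_ae he0))
    exact (setIntegral_le_integral (hS n) (hS0 n)).trans (hM n)
  have hnorm : ∀ n s, MeasurableSet s →
      eLpNorm (s.indicator (f n)) 1 μ = ofReal (∫ x in s, |f n x| ∂μ) := fun n s hs => by
    rw [eLpNorm_indicator_eq_eLpNorm_restrict hs, eLpNorm_one_eq_lintegral_enorm,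
      ← ofReal_integral_norm_eq_lintegral_enorm (hfi n).integrableOn]
    rfl
  have hgi : MemLp g 1 μ := by
    refine ⟨hgm, (Lp.eLpNorm_lim_le_liminf_eLpNorm hf g hfg).trans_lt ?_⟩
    refine lt_of_le_of_lt (b := ofReal (√((∫ x, e x ∂μ) * M))) ?_ ofReal_lt_top
    refine liminf_le_of_le (by isBoundedDefault) fun b hb => ?_
    obtain ⟨n, hn⟩ := hb.exists
    refine hn.trans ?_
    have h1 := hnorm n Set.univ MeasurableSet.univ
    rw [Set.indicator_univ] at h1
    rw [h1]
    refine ofReal_le_ofReal (le_sqrt_of_sq_le ?_)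
    have := hfb n Set.univ MeasurableSet.univ
    simpa only [Measure.restrict_univ] using this
  have hui : UnifIntegrable f 1 μ := by
    intro η hη
    have heL : MemLp e 1 μ := memLp_one_iff_integrable.2 he
    obtain ⟨δ, hδ, hδ2⟩ := heL.eLpNorm_indicator_le le_rfl (by simp)
      (show 0 < η ^ 2 / (M + 1) by positivity)
    refine ⟨δ, hδ, fun n s hs hμ => ?_⟩
    have h1 := hδ2 s hs hμ
    rw [eLpNorm_indicator_eq_eLpNorm_restrict hs, eLpNorm_one_eq_lintegral_enorm,
      ← ofReal_integral_norm_eq_lintegral_enorm he.integrableOn,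
      ENNReal.ofReal_le_ofReal_iff (by positivity)] at h1
    rw [hnorm n s hs]
    refine ofReal_le_ofReal (abs_le_of_sq_le_sq' ((hfb n s hs).trans ?_) hη.le).2
    have h2 : ∫ x in s, e x ∂μ ≤ ∫ x in s, ‖e x‖ ∂μ :=
      integral_mono he.integrableOn he.norm.integrableOn fun x => le_abs_self _
    have h3 := mul_le_mul_of_nonneg_right (h2.trans h1) hM0
    refine h3.trans ?_
    rw [div_mul_eq_mul_div, div_le_iff₀ (by linarith)]
    nlinarith [sq_nonneg η]
  have hconv := tendsto_Lp_finite_of_tendsto_ae le_rfl (by simp) hf hgi hui hfg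
  refine ⟨memLp_one_iff_integrable.1 hgi, ?_⟩
  refine tendsto_integral_of_L1' g hgm (.of_forall hfi) hconv

lemma integrable_spaceTime_of_slices {T : ℝ} {f : 𝕏 → ℝ} (hf : Measurable f)
    {G : ℝ → ℝ} (hG : Integrable G 𝓛 T)
    (h0 : ∀ᵐ t ∂𝓛 T, ∀ x, 0 ≤ f (t, x))
    (h : ∀ᵐ t ∂𝓛 T, Integrable (fun x => f (t, x)) ∧ ∫ x, f (t, x) ≤ G t) :
    Integrable f (Ω T) ∧ ∫ p, f p ∂Ω T ≤ ∫ t in Icc 0 T, G t := by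
  have hi : Integrable f (Ω T) := by
    refine (integrable_prod_iff hf.aestronglyMeasurable).2 ⟨?_, ?_⟩
    · filter_upwards [h] with t ht using ht.1
    · refine hG.mono' ?_ ?_
      · exact (StronglyMeasurable.integral_prod_right
          (hf.norm.stronglyMeasurable)).aestronglyMeasurable
      · filter_upwards [h, h0] with t ht h0t
        rw [norm_of_nonneg (integral_nonneg fun _ => norm_nonneg _)]
        refine le_trans (le_of_eq ?_) ht.2
        exact integral_congr_ae (.of_forall fun x => norm_of_nonneg (h0t x))
  refine ⟨hi, ?_⟩
  rw [integral_spaceTime hi]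
  refine integral_mono_ae (slice_integral hi) hG ?_
  filter_upwards [h] with t ht using ht.2

/-- The average of the energy over nearby Lagrangian coordinates, times the density. -/
noncomputable def winAvg (ε : ℝ) (r e W : 𝕊) (x : Torus) : ℝ :=
  r x * (ε⁻¹ * ∫ z in win W (2 * ε) x, e z)

lemma measurable_winAvg (ε : ℝ) {r e W : 𝔽} (hr : Measurable fun p : 𝕏 => r p.1 p.2)
    (he : Measurable fun p : 𝕏 => e p.1 p.2)
    (hW : Measurable fun p : 𝕏 => W p.1 p.2) :
    Measurable fun p : 𝕏 => winAvg ε (r p.1) (e p.1) (W p.1) p.2 := by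
  have m1 : Measurable fun z : (𝕏) × Torus => (z.1.1, z.2) := by fun_prop
  have hsh : Measurable fun p : 𝕏 => shift (W p.1) p.2 :=
    measurable_snd.add (AddCircle.measurable_mk'.comp hW)
  have hs : MeasurableSet {z : (𝕏) × Torus |
      ‖shift (W z.1.1) z.2 - shift (W z.1.1) z.1.2‖ ≤ 2 * ε} :=
    measurableSet_le ((hsh.comp m1).sub (hsh.comp measurable_fst)).norm measurable_const
  have h : StronglyMeasurable ({z : (𝕏) × Torus |
      ‖shift (W z.1.1) z.2 - shift (W z.1.1) z.1.2‖ ≤ 2 * ε}.indicator fun z => e z.1.1 z.2) := by fun_prop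
  have h2 := (StronglyMeasurable.integral_prod_right' (ν := (volume : Measure Torus)) h).measurable
  have h3 : ∀ p : 𝕏, ∫ z in win (W p.1) (2 * ε) p.2, e p.1 z = ∫ z, {z : (𝕏) × Torus |
      ‖shift (W z.1.1) z.2 - shift (W z.1.1) z.1.2‖ ≤ 2 * ε}.indicator (fun z => e z.1.1 z.2) (p, z) := by
    intro p
    have hWp : Measurable (W p.1) := by fun_prop
    rw [← integral_indicator (measurableSet_win hWp _ _)]
    rfl
  unfold winAvg
  simp only [h3]
  exact hr.mul (h2.const_mul _)

namespace Slice
variable {lam : ℝ} {r J q j V w e W : 𝕊} (h : Slice lam r J q j V w e W)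
include h

lemma winAvg_nonneg {ε : ℝ} (h0 : 0 < ε) (x : Torus) : 0 ≤ winAvg ε r e W x :=
  mul_nonneg (h.r_nonneg x) (mul_nonneg (inv_pos.2 h0).le (integral_nonneg h.e_nonneg))

/-- Membership in a window is symmetric, so Fubini exchanges the energy in the window for its
`r`-mass, which is at most `8 ε` and cancels `ε⁻¹`. The bound is uniform in `ε`, as the Vitali
theorem requires. -/
lemma integral_winAvg_le {ε : ℝ} (h0 : 0 < ε) :
    Integrable (winAvg ε r e W) ∧ ∫ x, winAvg ε r e W x ≤ 8 * ∫ x, e x := by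
  have hs : MeasurableSet {p : Torus × Torus | ‖shift W p.2 - shift W p.1‖ ≤ 2 * ε} :=
    measurableSet_le (((shift_measurable h.measW).comp measurable_snd).sub
      ((shift_measurable h.measW).comp measurable_fst)).norm measurable_const
  have hi : Integrable ({p : Torus × Torus | ‖shift W p.2 - shift W p.1‖ ≤ 2 * ε}.indicator
      fun p => r p.1 * e p.2) (volume.prod volume) := (h.wdr.int.mul_prod h.e_int).indicator hs
  have e1 : ∀ x, ∫ z, {p : Torus × Torus | ‖shift W p.2 - shift W p.1‖ ≤ 2 * ε}.indicator
      (fun p => r p.1 * e p.2) (x, z) = r x * ∫ z in win W (2 * ε) x, e z := fun x => by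
    rw [← integral_const_mul, ← integral_indicator (measurableSet_win h.measW _ _)]
    rfl
  have e2 : ∀ z, ∫ x, {p : Torus × Torus | ‖shift W p.2 - shift W p.1‖ ≤ 2 * ε}.indicator
      (fun p => r p.1 * e p.2) (x, z) = e z * ∫ x in win W (2 * ε) z, r x := fun z => by
    rw [← integral_const_mul, ← integral_indicator (measurableSet_win h.measW _ _)]
    congr 1 with x
    by_cases hx : x ∈ win W (2 * ε) z
    · have hx2 : (x, z) ∈ {p : Torus × Torus | ‖shift W p.2 - shift W p.1‖ ≤ 2 * ε} :=
        mem_win_comm.1 hx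
      rw [indicator_of_mem hx, indicator_of_mem hx2, mul_comm]
    · have hx2 : (x, z) ∉ {p : Torus × Torus | ‖shift W p.2 - shift W p.1‖ ≤ 2 * ε} := fun hc =>
        hx (mem_win_comm.1 hc)
      rw [indicator_of_notMem hx, indicator_of_notMem hx2]
  have hl := hi.integral_prod_left
  have hr := hi.integral_prod_right
  have hsw := integral_integral_swap (f := fun x z =>
    {p : Torus × Torus | ‖shift W p.2 - shift W p.1‖ ≤ 2 * ε}.indicator
      (fun p => r p.1 * e p.2) (x, z)) hi
  simp only [e1, e2] at hl hr hsw
  have e3 : ∀ x, winAvg ε r e W x = ε⁻¹ * (r x * ∫ z in win W (2 * ε) x, e z) := fun x => by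
    rw [winAvg]
    ring
  have e4 : winAvg ε r e W = fun x => ε⁻¹ * (r x * ∫ z in win W (2 * ε) x, e z) := funext e3
  refine ⟨by rw [e4]; exact hl.const_mul _, ?_⟩
  simp_rw [e3]
  rw [integral_const_mul, hsw]
  have h1 : ∫ z, e z * ∫ x in win W (2 * ε) z, r x ≤ ∫ z, e z * (8 * ε) :=
    integral_mono hr (h.e_int.mul_const _) fun z =>
      mul_le_mul_of_nonneg_left (h.integral_win_le h0 z) (h.e_nonneg z)
  rw [integral_mul_const] at h1
  refine (mul_le_mul_of_nonneg_left h1 (inv_pos.2 h0).le).trans (le_of_eq ?_)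
  field_simp

end Slice

namespace Pair
variable {T lam : ℝ} {r J q j V w e : 𝔽} (h : Pair T lam r J q j V w e)
include h

/-- From `0 ≤ q ≤ r`, since the mollified Lagrangian density of `r` itself is one. Hence the entropy
function is evaluated on `[0, 1]` only. -/
lemma lagDens_mem {ε : ℝ} (h0 : 0 < ε) (h1 : ε ≤ 1 / 8) {t : ℝ} (ht : t ∈ Icc 0 T) (y : Torus) :
    lagDens (K ε) (disp T r J t) (q t) y ∈ Icc 0 1 := by
  have hKc := K_continuous h0 h1
  have hWm : Measurable (disp T r J t) := by
    have := (disp_measurable h.hr).comp (measurable_prodMk_left (x := t))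
    exact this
  obtain ⟨D, _, hD⟩ := torus_bound hKc
  have hi : ∀ f : 𝕊, Integrable f →
      Integrable fun z => K ε (y - shift (disp T r J t) z) * f z := fun f hf =>
    hf.bdd_mul (c := D) (hKc.measurable.comp (measurable_const.sub
      (shift_measurable hWm))).aestronglyMeasurable (.of_forall fun z => hD _)
  refine ⟨integral_nonneg fun z => mul_nonneg (K_nonneg h0 _) (h.nonneg t z), ?_⟩
  rw [← integral_K_sub h0 h1 y, ← disp_push h.hr h.mass ht (F := fun u => K ε (y - u))
    (hKc.comp (continuous_const.sub continuous_id))]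
  exact integral_mono (hi _ (h.hq.int t ht)) (hi _ (h.hr.int t ht))
    fun z => mul_le_mul_of_nonneg_left (h.le t z) (K_nonneg h0 _)

lemma disp_measurable : Measurable fun p : 𝕏 => disp T r J p.1 p.2 :=
  ColorLDP.disp_measurable h.hr

lemma flux_eq_zero (hlam : 0 < lam) : ∀ᵐ p ∂Ω T, r p.1 p.2 = 0 → 𝔯 r j J q p = 0 := by
  filter_upwards [h.sqN] with p hN hr
  rw [hr] at hN ⊢
  simp only [add_zero, ne_eq, OfNat.ofNat_ne_zero, not_false_eq_true, zero_pow, zero_mul] at hN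
  have h1 : (0 * j p.1 p.2 - J p.1 p.2 * q p.1 p.2) ^ 2 = 0 := by nlinarith
  exact pow_eq_zero_iff two_ne_zero |>.1 h1

/-- The limit of the chain rule in Lagrangian coordinates. -/
lemma abs_integral_le (hT : 0 < T) (hlam : 0 < lam) {β β1 b2 : ℝ → ℝ} {L M : ℝ}
    (hb2 : Continuous b2) (hβ : ∀ s, HasDerivAt β (β1 s) s) (hβ1 : ∀ s, HasDerivAt β1 (b2 s) s) (hL : ∀ s, |b2 s| ≤ L)
    (hM : ∀ s ∈ Icc (0 : ℝ) 1, |β s| ≤ M) :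
    Integrable (fun p : 𝕏 => (𝔯 r j J q p) * (b2 (q p.1 p.2 / r p.1 p.2) *
        ((w p.1 p.2 - q p.1 p.2 / r p.1 p.2 * V p.1 p.2) / r p.1 p.2 ^ 2))) (Ω T) ∧
    |∫ p, (𝔯 r j J q p) * (b2 (q p.1 p.2 / r p.1 p.2) *
        ((w p.1 p.2 - q p.1 p.2 / r p.1 p.2 * V p.1 p.2) / r p.1 p.2 ^ 2)) ∂Ω T| ≤
      2 * M := by
  have hL0 : 0 ≤ L := (abs_nonneg _).trans (hL 0)
  have hβ1c : Continuous β1 := continuous_iff_continuousAt.2 fun s => (hβ1 s).continuousAt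
  have hβc : Continuous β := continuous_iff_continuousAt.2 fun s => (hβ s).continuousAt
  have hLip : ∀ s t, |β1 s - β1 t| ≤ L * |s - t| := fun s t =>
    convex_univ.norm_image_sub_le_of_norm_hasDerivWithin_le
      (fun z _ => (hβ1 z).hasDerivWithinAt) (fun z _ => hL z) (Set.mem_univ t) (Set.mem_univ s)
  set C := 640 * (L * kapC) ^ 2 / lam with hC
  have hC0 : 0 ≤ C := by positivity
  set f : ℕ → 𝕏 → ℝ := fun n p => (𝔯 r j J q p) *
    lagB (K (wid n)) (K1 (wid n)) β1 (disp T r J p.1) (q p.1) p.2 with hf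
  set g : 𝕏 → ℝ := fun p => (𝔯 r j J q p) * (b2 (q p.1 p.2 / r p.1 p.2) *
        ((w p.1 p.2 - q p.1 p.2 / r p.1 p.2 * V p.1 p.2) / r p.1 p.2 ^ 2)) with hg
  set S : ℕ → 𝕏 → ℝ := fun n p => winAvg (wid n) (r p.1) (e p.1) (disp T r J p.1) p.2 with hS
  have hNm : Measurable fun p : 𝕏 =>
      𝔯 r j J q p :=
    (h.hr.meas.mul h.hq.meas').sub (h.hr.meas'.mul h.hq.meas)
  have hfm : ∀ n, Measurable (f n) := fun n => hNm.mul (measurable_lagB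
    (Kw_continuous n).measurable (K1w_continuous n).measurable
    hβ1c.measurable h.disp_measurable h.hq.meas)
  have hpm : Measurable fun p : 𝕏 => q p.1 p.2 / r p.1 p.2 := h.hq.meas.div h.hr.meas
  have hgm : Measurable g := hNm.mul ((hb2.measurable.comp hpm).mul
    ((h.measw.sub (hpm.mul h.measV)).div (h.hr.meas.pow_const 2)))
  have hSm : ∀ n, Measurable (S n) := fun n =>
    measurable_winAvg (wid n) h.hr.meas h.mease h.disp_measurable
  have hSi : ∀ n, Integrable (S n) (Ω T) ∧ ∫ p, S n p ∂Ω T ≤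
      ∫ t in Icc 0 T, 8 * ∫ x, e t x := fun n => by
    refine integrable_spaceTime_of_slices (hSm n) ((slice_integral h.e_int).const_mul 8) ?_ ?_
    · filter_upwards [h.slice] with t ht x using ht.winAvg_nonneg (wid_pos n) x
    · filter_upwards [h.slice] with t ht using ht.integral_winAvg_le (wid_pos n)
  have hS0 : ∀ n, ∀ᵐ p ∂Ω T, 0 ≤ S n p := fun n => by
    unfold spaceTime
    refine (Measure.ae_prod_iff_ae_ae (measurableSet_le measurable_const (hSm n))).2 ?_
    filter_upwards [h.slice] with t ht using .of_forall fun x => ht.winAvg_nonneg (wid_pos n) x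
  have hsq : ∀ n, ∀ᵐ p ∂Ω T, f n p ^ 2 ≤ C * e p.1 p.2 * S n p := fun n => by
    unfold spaceTime
    refine (Measure.ae_prod_iff_ae_ae (measurableSet_le ((hfm n).pow_const 2)
      ((h.mease.const_mul C).mul (hSm n)))).2 ?_
    filter_upwards [h.slice] with t ht using ht.sq_mul_lagB_le hlam (wid_pos n) (wid_le n) hL0 hLip
  -- Where `r` vanishes so does the relative flux, and both sides are zero; elsewhere the pointwise
  -- limit of `lagB` applies.
  have hlim : ∀ᵐ p ∂Ω T, Tendsto (fun n => f n p) atTop (𝓝 (-g p)) := by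
    have h1 : ∀ᵐ p ∂Ω T, r p.1 p.2 = 0 ∨ Tendsto (fun n => f n p) atTop (𝓝 (-g p)) := by
      unfold spaceTime
      refine (Measure.ae_prod_iff_ae_ae ((h.hr.meas (measurableSet_singleton 0)).union
        (measurableSet_tendsto_fun hfm hgm.neg))).2 ?_
      filter_upwards [h.slice] with t ht
      filter_upwards [ht.lagB_tendsto hβ1c hβ1] with x hx
      rcases (ht.r_nonneg x).eq_or_lt with h0 | h0
      · exact Or.inl h0.symm
      · refine Or.inr ?_
        have h2 := (hx h0).const_mul (r t x * j t x - J t x * q t x)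
        rw [mul_neg] at h2
        exact h2
    filter_upwards [h1, h.flux_eq_zero hlam] with p hp h0
    rcases hp with hp | hp
    · simp only [hf, hg, h0 hp, zero_mul, neg_zero]
      exact tendsto_const_nhds
    · exact hp
  obtain ⟨hgi, hconv⟩ := tendsto_integral_of_sq_le (fun n => (hfm n).aestronglyMeasurable) hlim
    (h.e_int.const_mul C) (.of_forall fun p => mul_nonneg hC0 (h.e_nonneg _ _))
    (fun n => (hSi n).1) hS0 (fun n => (hSi n).2) hsq
  have hgi2 : Integrable g (Ω T) := by simpa using hgi.neg
  refine ⟨hgi2, ?_⟩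
  rw [integral_neg] at hconv
  rw [← abs_neg]
  refine le_of_tendsto hconv.abs (.of_forall fun n => ?_)
  -- For each width the chain rule equates the integral to a difference of two entropies, each at
  -- most `M` in absolute value. The bound `2 M` is thus independent of the energy, which enters
  -- only through integrability.
  have h1 := (h.star hT (Kw_hasTD n) (K1w_continuous n) hβ hβ1c).2
  rw [← abs_neg]
  change |-∫ p, f n p ∂Ω T| ≤ 2 * M
  rw [← h1]
  have hb : ∀ t ∈ Icc 0 T,
      |∫ y, β (lagDens (K (wid n)) (disp T r J t) (q t) y)| ≤ M := fun t ht => by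
    have h2 := norm_integral_le_of_norm_le_const (μ := (volume : Measure Torus)) (C := M)
      (f := fun y => β (lagDens (K (wid n)) (disp T r J t) (q t) y))
      (.of_forall fun y => hM _ (h.lagDens_mem (wid_pos n) (wid_le n) ht y))
    rw [probReal_univ, mul_one] at h2
    exact h2
  refine (abs_sub _ _).trans ?_
  linarith [hb T ⟨hT.le, le_rfl⟩, hb 0 ⟨le_rfl, hT.le⟩]

end Pair


/-! ### The entropy of one color relative to the total density -/

section
variable {η : ℝ} (hη : 0 < η)
include hη

lemma sqrt_sq_add_pos (s : ℝ) : 0 < √(s ^ 2 + η ^ 2) := Real.sqrt_pos.2 (by positivity)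

lemma add_sqrt_pos (s : ℝ) : 0 < s + √(s ^ 2 + η ^ 2) := by
  have : |s| < √(s ^ 2 + η ^ 2) := by
    rw [← Real.sqrt_sq_eq_abs]
    exact Real.sqrt_lt_sqrt (sq_nonneg _) (by linarith [sq_pos_of_pos hη])
  linarith [neg_abs_le s]

lemma hasDerivAt_sqrt_sq_add (s : ℝ) : HasDerivAt (fun s => √(s ^ 2 + η ^ 2))
    (s / √(s ^ 2 + η ^ 2)) s := by
  have h1 : HasDerivAt (fun s : ℝ => s ^ 2 + η ^ 2) (2 * s) s := by
    simpa using ((hasDerivAt_id s).pow 2).add_const (η ^ 2)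
  have h2 := h1.sqrt (by positivity)
  convert h2 using 1
  rw [mul_div_mul_left _ _ two_ne_zero]

lemma hasDerivAt_log_add_sqrt (s : ℝ) : HasDerivAt (fun s => log (s + √(s ^ 2 + η ^ 2)))
      (1 / √(s ^ 2 + η ^ 2)) s := by
  have h1 := ((hasDerivAt_id s).add (hasDerivAt_sqrt_sq_add hη s)).log (add_sqrt_pos hη s).ne'
  have h2 := sqrt_sq_add_pos hη s
  have h3 := add_sqrt_pos hη s
  refine h1.congr_deriv ?_
  change (1 + s / √(s ^ 2 + η ^ 2)) / (s + √(s ^ 2 + η ^ 2)) = _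
  field_simp
  ring

/-- This is a smooth substitute for the entropy: its second derivative is `1 / √(s² + η²)`, bounded
for fixed `η` and increasing to `1 / s` as `η` decreases to `0`. -/
lemma hasDerivAt_entropy (s : ℝ) :
    HasDerivAt (fun s => s * log (s + √(s ^ 2 + η ^ 2)) - √(s ^ 2 + η ^ 2))
      (log (s + √(s ^ 2 + η ^ 2))) s := by
  have h1 := ((hasDerivAt_id s).mul (hasDerivAt_log_add_sqrt hη s)).sub
    (hasDerivAt_sqrt_sq_add hη s)
  refine h1.congr_deriv ?_
  simp only [id]
  ring

/-- The elementary bounds `1 - 1/x ≤ log x ≤ x - 1` suffice, because `s / (s + √(s² + η²)) ≤ 1`.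
What matters is that the constant does not depend on `η`. -/
lemma abs_entropy_le (hη1 : η ≤ 1) {s : ℝ} (hs : s ∈ Icc (0 : ℝ) 1) :
    |s * log (s + √(s ^ 2 + η ^ 2)) - √(s ^ 2 + η ^ 2)| ≤ 4 := by
  have h1 := sqrt_sq_add_pos hη s
  have h2 := add_sqrt_pos hη s
  have h3 : √(s ^ 2 + η ^ 2) ≤ 2 := by
    rw [Real.sqrt_le_left (by norm_num)]
    nlinarith [hs.1, hs.2]
  have h4 := Real.log_le_sub_one_of_pos h2
  have h5 := Real.one_sub_inv_le_log_of_pos h2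
  have h6 : s * (s + √(s ^ 2 + η ^ 2))⁻¹ ≤ 1 := by bound
  have h7 := mul_le_mul_of_nonneg_left h5 hs.1
  have h8 : s * log (s + √(s ^ 2 + η ^ 2)) ≤ 2 := by
    by_cases hl : 0 ≤ log (s + √(s ^ 2 + η ^ 2))
    · nlinarith [hs.1, hs.2]
    · nlinarith [hs.1, hs.2]
  rw [abs_le]
  constructor <;> nlinarith [hs.1, hs.2]

end

namespace Pair
variable {T lam : ℝ} {r J q j V w e : 𝔽} (h : Pair T lam r J q j V w e)
include h

/-- By `hN`, the relative flux divided by `r` is minus half of `lam * D / (lam + r)` plus a control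
term. Inserted into the chain rule, the first part produces minus half of the integrand and the
second is absorbed by Young's inequality. The chain rule is bounded by `8`, and `4 * 8 = 32`.
Fatou's lemma then removes `η`. -/
lemma lintegral_color_le (hT : 0 < T) (hlam : 0 < lam) {H : 𝕏 → ℝ}
    (hH : Integrable H (Ω T)) (hH0 : ∀ p, 0 ≤ H p)
    (hN : ∀ᵐ p ∂Ω T, 0 < r p.1 p.2 → ((𝔯 r j J q p) / r p.1 p.2 + 1 / 2 * (lam *
        (w p.1 p.2 - q p.1 p.2 / r p.1 p.2 * V p.1 p.2) / (lam + r p.1 p.2))) ^ 2 ≤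
        4 * (lam * q p.1 p.2 / (lam + r p.1 p.2)) * H p)
    (hw0 : ∀ᵐ p ∂Ω T, q p.1 p.2 = 0 → w p.1 p.2 = 0) :
    ∫⁻ p, ofReal (lam * (w p.1 p.2 - q p.1 p.2 / r p.1 p.2 * V p.1 p.2) ^ 2 /
      ((lam + r p.1 p.2) * q p.1 p.2)) ∂Ω T ≤
      ofReal (32 + 16 * ∫ p, H p ∂Ω T) := by
  set D : 𝕏 → ℝ := fun p => w p.1 p.2 - q p.1 p.2 / r p.1 p.2 * V p.1 p.2 with hD
  have hDm : Measurable D := h.measw.sub ((h.hq.meas.div h.hr.meas).mul h.measV)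
  have hr0 : ∀ p : 𝕏, 0 ≤ r p.1 p.2 := fun p => (h.nonneg _ _).trans (h.le _ _)
  set X : ℝ → 𝕏 → ℝ := fun η p => lam * D p ^ 2 /
    ((lam + r p.1 p.2) * √(q p.1 p.2 ^ 2 + η ^ 2 * r p.1 p.2 ^ 2)) with hX
  have hXm : ∀ η, Measurable (X η) := fun η => ((hDm.pow_const 2).const_mul lam).div
    ((h.hr.meas.const_add lam).mul ((h.hq.meas.pow_const 2).add
      ((h.hr.meas.pow_const 2).const_mul (η ^ 2))).sqrt)
  have hX0 : ∀ η p, 0 ≤ X η p := fun η p => by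
    have := hr0 p
    positivity
  have key : ∀ η, 0 < η → η ≤ 1 → ∫⁻ p, ofReal (X η p) ∂Ω T ≤ ofReal (32 + 16 * ∫ p, H p ∂Ω T) := by
    intro η hη hη1
    have hb2 : Continuous fun s : ℝ => 1 / √(s ^ 2 + η ^ 2) :=
      continuous_const.div (by fun_prop) fun s => (sqrt_sq_add_pos hη s).ne'
    obtain ⟨hgi, hg⟩ := h.abs_integral_le hT hlam hb2 (L := 1 / η) (M := 4)
      (hasDerivAt_entropy hη) (hasDerivAt_log_add_sqrt hη) (fun s => by
        rw [abs_of_pos (by have := sqrt_sq_add_pos hη s; positivity)]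
        refine one_div_le_one_div_of_le hη (le_sqrt_of_sq_le ?_)
        linarith [sq_nonneg s]) (fun s hs => abs_entropy_le hη hη1 hs)
    set g : 𝕏 → ℝ := fun p => (𝔯 r j J q p) * (1 / √((q p.1 p.2 / r p.1 p.2) ^ 2 + η ^ 2) *
        ((w p.1 p.2 - q p.1 p.2 / r p.1 p.2 * V p.1 p.2) / r p.1 p.2 ^ 2)) with hgdef
    have hle : ∀ᵐ p ∂Ω T, X η p ≤ 16 * H p - 4 * g p := by
      filter_upwards [hN, h.flux_eq_zero hlam] with p hp h0
      rcases (hr0 p).eq_or_lt with hr | hr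
      · have : X η p = 0 := by
          have hq : q p.1 p.2 = 0 := le_antisymm ((h.le _ _).trans hr.symm.le) (h.nonneg _ _)
          simp only [hX, ← hr, hq]
          simp
        rw [this]
        simp only [hgdef, h0 hr.symm, zero_mul, mul_zero, sub_zero]
        linarith [hH0 p]
      · have hp := hp hr
        set N := 𝔯 r j J q p with hNdef
        set R := r p.1 p.2 with hR
        set Q := q p.1 p.2 with hQ
        have hQ0 : 0 ≤ Q := h.nonneg _ _
        set s := √(Q ^ 2 + η ^ 2 * R ^ 2) with hs
        have hs0 : 0 < s := Real.sqrt_pos.2 (by positivity)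
        have hs1 : Q ≤ s := le_sqrt_of_sq_le (by nlinarith [sq_nonneg (η * R)])
        have hs2 : R * √((Q / R) ^ 2 + η ^ 2) = s := by
          rw [hs, ← Real.sqrt_sq hr.le, ← Real.sqrt_mul (sq_nonneg _), Real.sqrt_sq hr.le]
          congr 1
          field_simp
        have hlr : 0 < lam + R := by linarith
        set ν := N / R + 1 / 2 * (lam * D p / (lam + R)) with hν
        have hg1 : g p = (ν - 1 / 2 * (lam * D p / (lam + R))) * (D p / s) := by
          have hsq := sqrt_sq_add_pos hη (Q / R)
          have h1 : ν - 1 / 2 * (lam * D p / (lam + R)) = N / R := by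
            rw [hν]
            ring
          change N * (1 / √((Q / R) ^ 2 + η ^ 2) * (D p / R ^ 2)) = _
          rw [h1, ← hs2]
          field_simp
        have hXe : X η p = lam * D p ^ 2 / ((lam + R) * s) := rfl
        have hg2 : g p = ν * (D p / s) - 1 / 2 * X η p := by
          rw [hg1, hXe]
          field_simp
        have hsq : (ν * (D p / s)) ^ 2 ≤ 4 * H p * X η p := by
          have h1 : (ν * (D p / s)) ^ 2 = ν ^ 2 * (D p ^ 2 / s ^ 2) := by ring
          rw [h1]
          refine (mul_le_mul_of_nonneg_right hp (by positivity)).trans ?_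
          have h2 : 4 * (lam * Q / (lam + R)) * H p * (D p ^ 2 / s ^ 2) =
            (4 * H p * X η p) * (Q / s) := by
            rw [hXe]
            field_simp
          rw [h2]
          have := hH0 p
          have := hX0 η p
          exact mul_le_of_le_one_right (by positivity) ((div_le_one hs0).2 hs1)
        -- Young's inequality with weights that leave a quarter of `X`; multiplication by `4` gives
        -- the constants `4` and `16` above.
        have h3 : |ν * (D p / s)| ≤ 1 / 4 * X η p + 4 * H p := by
          refine abs_le_of_sq_le_sq (hsq.trans ?_) (by linarith [hH0 p, hX0 η p])
          nlinarith [sq_nonneg (1 / 4 * X η p - 4 * H p)]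
        have h4 := (abs_le.1 h3).1
        have h5 := (abs_le.1 h3).2
        rw [hg2]
        linarith
    have hI : Integrable (fun p => 16 * H p - 4 * g p) (Ω T) :=
      (hH.const_mul 16).sub (hgi.const_mul 4)
    refine (lintegral_mono_ae (hle.mono fun p hp => ofReal_le_ofReal hp)).trans ?_
    rw [← ofReal_integral_eq_lintegral_ofReal hI (hle.mono fun p hp => (hX0 η p).trans hp)]
    refine ofReal_le_ofReal ?_
    rw [integral_sub (hH.const_mul 16) (hgi.const_mul 4), integral_const_mul, integral_const_mul]
    have := (abs_le.1 hg).1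
    linarith
  have hη : ∀ n : ℕ, 0 < 1 / ((n : ℝ) + 1) := fun n => by positivity
  -- Where the color vanishes so does its gradient, hence also `D`, and the convention for division
  -- by zero gives zero on both sides.
  have hlim : ∀ᵐ p ∂Ω T, Tendsto (fun n : ℕ => ofReal (X (1 / ((n : ℝ) + 1)) p))
      atTop (𝓝 (ofReal (lam * D p ^ 2 / ((lam + r p.1 p.2) * q p.1 p.2)))) := by
    filter_upwards [hw0] with p hp
    refine tendsto_ofReal ?_
    rcases (h.nonneg p.1 p.2).eq_or_lt with hq | hq
    · have hD0 : D p = 0 := by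
        simp only [hD, hp hq.symm, ← hq]
        simp
      simp only [hX, hD0]
      simp
    · have h1 : Tendsto (fun n : ℕ => √(q p.1 p.2 ^ 2 + (1 / ((n : ℝ) + 1)) ^ 2 *
          r p.1 p.2 ^ 2)) atTop (𝓝 (q p.1 p.2)) := by
        have h2 : Tendsto (fun n : ℕ => q p.1 p.2 ^ 2 + (1 / ((n : ℝ) + 1)) ^ 2 * r p.1 p.2 ^ 2)
            atTop (𝓝 (q p.1 p.2 ^ 2 + 0 ^ 2 * r p.1 p.2 ^ 2)) :=
          ((tendsto_one_div_add_atTop_nhds_zero_nat.pow 2).mul_const _).const_add _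
        have h3 := h2.sqrt
        rwa [zero_pow two_ne_zero, zero_mul, add_zero, Real.sqrt_sq hq.le] at h3
      refine tendsto_const_nhds.div (h1.const_mul _) ?_
      have := hr0 p
      positivity
  have h1 : ∫⁻ p, liminf (fun n : ℕ => ofReal (X (1 / ((n : ℝ) + 1)) p)) atTop
      ∂Ω T ≤ ofReal (32 + 16 * ∫ p, H p ∂Ω T) := by
    refine (lintegral_liminf_le fun n => (hXm _).ennreal_ofReal).trans ?_
    refine liminf_le_of_le (by isBoundedDefault) fun b hb => ?_
    obtain ⟨n, hn⟩ := hb.exists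
    refine hn.trans (key _ (hη n) ?_)
    rw [div_le_one (by positivity)]
    linarith [(Nat.cast_nonneg n : (0 : ℝ) ≤ n)]
  refine le_trans (lintegral_mono_ae ?_) h1
  filter_upwards [hlim] with p hp
  exact hp.liminf_eq.ge

end Pair


/-! ### Riesz representation -/

/-- The bound says that `l` vanishes on the kernel of `Φ` and descends to a bounded functional on
its range. Hahn-Banach extends it without increasing the norm, and Riesz represents it. -/
lemma exists_riesz {E H : Type*} [AddCommGroup E] [Module ℝ E] [NormedAddCommGroup H]
    [InnerProductSpace ℝ H] [CompleteSpace H] (Φ : E →ₗ[ℝ] H) (l : E →ₗ[ℝ] ℝ) {C : ℝ} (hC : 0 ≤ C)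
    (hb : ∀ x, l x ^ 2 ≤ C * ‖Φ x‖ ^ 2) :
    ∃ h : H, ‖h‖ ^ 2 ≤ C ∧ ∀ x, l x = inner ℝ h (Φ x) := by
  obtain ⟨g, hg⟩ := Φ.rangeRestrict.exists_rightInverse_of_surjective
    (LinearMap.range_eq_top.2 Φ.surjective_rangeRestrict)
  have hg2 : ∀ y, Φ (g y) = y := fun y => by
    have := LinearMap.congr_fun hg y
    exact congrArg Subtype.val this
  have hb' : ∀ x, |l x| ≤ √C * ‖Φ x‖ := fun x => by
    refine abs_le_of_sq_le_sq ?_ (by positivity)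
    rw [mul_pow, sq_sqrt hC]
    exact hb x
  let f : LinearMap.range Φ →L[ℝ] ℝ := (l.comp g).mkContinuous (√C) fun y => by
    have := hb' (g y)
    rwa [hg2] at this
  obtain ⟨F, hF, hFn⟩ := exists_extension_norm_eq _ f
  refine ⟨(InnerProductSpace.toDual ℝ H).symm F, ?_, fun x => ?_⟩
  · rw [LinearIsometryEquiv.norm_map, hFn]
    have h1 := (l.comp g).mkContinuous_norm_le (sqrt_nonneg C) fun y => by
      have := hb' (g y)
      rwa [hg2] at this
    calc ‖f‖ ^ 2 ≤ √C ^ 2 := pow_le_pow_left₀ (norm_nonneg _) h1 2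
      _ = C := sq_sqrt hC
  · rw [InnerProductSpace.toDual_symm_apply]
    have h1 := hF ⟨Φ x, LinearMap.mem_range_self Φ x⟩
    rw [h1]
    change l x = l (g ⟨Φ x, LinearMap.mem_range_self Φ x⟩)
    have h2 := hb (x - g ⟨Φ x, LinearMap.mem_range_self Φ x⟩)
    rw [map_sub, map_sub, hg2, sub_self, norm_zero] at h2
    have h3 : (l x - l (g ⟨Φ x, LinearMap.mem_range_self Φ x⟩)) ^ 2 = 0 := by nlinarith
    exact sub_eq_zero.1 (pow_eq_zero_iff two_ne_zero |>.1 h3)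

lemma exists_riesz_L2 {E α ι : Type*} [AddCommGroup E] [Module ℝ E] [MeasurableSpace α]
    {μ : Measure α} [Fintype ι] (L : E →ₗ[ℝ] (ι → α → ℝ)) (hL : ∀ x k, MemLp (L x k) 2 μ)
    (l : E →ₗ[ℝ] ℝ) {C : ℝ} (hC : 0 ≤ C) (hb : ∀ x, l x ^ 2 ≤ C * ∑ k, ∫ a, L x k a ^ 2 ∂μ) :
    ∃ h : ι → α → ℝ, (∀ k, Measurable (h k)) ∧ (∀ k, MemLp (h k) 2 μ) ∧
      ∑ k, ∫ a, h k a ^ 2 ∂μ ≤ C ∧ ∀ x, l x = ∑ k, ∫ a, L x k a * h k a ∂μ := by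
  have hinner : ∀ f g : Lp ℝ 2 μ, inner ℝ f g = ∫ a, g a * f a ∂μ := fun f g => by
    rw [L2.inner_def]
    rfl
  have hnorm : ∀ f : Lp ℝ 2 μ, ‖f‖ ^ 2 = ∫ a, f a ^ 2 ∂μ := fun f => by
    rw [← real_inner_self_eq_norm_sq, hinner]
    simp only [sq]
  let Φ : E →ₗ[ℝ] PiLp 2 (fun _ : ι => Lp ℝ 2 μ) :=
    { toFun := fun x => WithLp.toLp 2 fun k => (hL x k).toLp
      map_add' := fun x y => by measurability
      map_smul' := fun c x => by
        ext1 k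
        simp only [PiLp.smul_apply, RingHom.id_apply]
        rw [← MemLp.toLp_const_smul]
        congr 1
        rw [map_smul, Pi.smul_apply] }
  have hΦ : ∀ x k, (Φ x k : α → ℝ) =ᵐ[μ] L x k := fun x k => (hL x k).coeFn_toLp
  have hΦn : ∀ x, ‖Φ x‖ ^ 2 = ∑ k, ∫ a, L x k a ^ 2 ∂μ := fun x => by
    rw [PiLp.norm_sq_eq_of_L2]
    refine sum_congr rfl fun k _ => ?_
    rw [hnorm]
    refine integral_congr_ae ?_
    filter_upwards [hΦ x k] with a ha
    rw [ha]
  obtain ⟨h, hh, hl⟩ := exists_riesz Φ l hC fun x => by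
    rw [hΦn]
    exact hb x
  refine ⟨fun k => h k, fun k => (Lp.stronglyMeasurable (h k)).measurable, fun k => Lp.memLp (h k),
    ?_, fun x => ?_⟩
  · rw [PiLp.norm_sq_eq_of_L2] at hh
    simpa only [hnorm] using hh
  · rw [hl, PiLp.inner_apply]
    refine sum_congr rfl fun k _ => ?_
    rw [hinner]
    refine integral_congr_ae ?_
    filter_upwards [hΦ x k] with a ha
    rw [ha]

/-- A bound on `l - Q/2` for a linear `l` and a quadratic `Q`, in homogeneous form. -/
lemma sq_le_of_forall_sub_le {a b c : ℝ} (h : ∀ s : ℝ, s * a - 1 / 2 * (s ^ 2 * c) ≤ b) :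
    a ^ 2 ≤ 2 * b * c := by
  have h1 : ∀ s : ℝ, 0 ≤ c / 2 * (s * s) + -a * s + b := fun s => by nlinarith [h s]
  have h2 := discrim_le_zero h1
  rw [discrim] at h2
  nlinarith

/-! ### The space of test functions -/

/-- The vector space of test functions. -/
def testSpace : Submodule ℝ (𝔽) where
  carrier := {f | ContDiff ℝ (⊤ : ℕ∞) fun p : ℝ × ℝ => f p.1 (p.2 : Torus)}
  add_mem' := fun hf hg => by
    rw [mem_ofPred_eq] at *
    exact hf.add hg
  zero_mem' := by
    rw [mem_ofPred_eq]
    exact contDiff_const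
  smul_mem' := fun c f hf => by
    rw [mem_ofPred_eq] at *
    exact contDiff_const.mul hf

/-- The test function given by an element of `testSpace`. -/
def toTest (f : testSpace) : TestFunction := ⟨f.1, f.2⟩

lemma toTest_toFun (f : testSpace) (t : ℝ) (x : Torus) : (toTest f).toFun t x = f.1 t x := rfl

lemma toTest_dx_add (f g : testSpace) (t : ℝ) (x : Torus) :
    (toTest (f + g)).dx t x = (toTest f).dx t x + (toTest g).dx t x :=
  ((toTest (f + g)).hasTD_dx t).unique (((toTest f).hasTD_dx t).add ((toTest g).hasTD_dx t)) x

lemma toTest_dx_smul (c : ℝ) (f : testSpace) (t : ℝ) (x : Torus) :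
    (toTest (c • f)).dx t x = c * (toTest f).dx t x :=
  ((toTest (c • f)).hasTD_dx t).unique (((toTest f).hasTD_dx t).const_mul c) x

lemma toTest_dt_add (f g : testSpace) (t : ℝ) (x : Torus) :
    (toTest (f + g)).dt t x = (toTest f).dt t x + (toTest g).dt t x :=
  ((toTest (f + g)).hasDerivAt_dt t x).unique
    (((toTest f).hasDerivAt_dt t x).add ((toTest g).hasDerivAt_dt t x))

lemma toTest_dt_smul (c : ℝ) (f : testSpace) (t : ℝ) (x : Torus) :
    (toTest (c • f)).dt t x = c * (toTest f).dt t x :=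
  ((toTest (c • f)).hasDerivAt_dt t x).unique (((toTest f).hasDerivAt_dt t x).const_mul c)


/-! ### Pointwise algebra of the coefficients -/

section
variable {m : ℕ} {lam : ℝ}

/-- The energy density as a real number. -/
noncomputable def energyR (lam : ℝ) (r v : Fin m → ℝ) : ℝ :=
  (∑ c, v c) ^ 2 / (lam + ∑ c, r c) + ∑ c, lam * v c ^ 2 / ((lam + ∑ c', r c') * r c)

/-- The square root of the mobility. -/
noncomputable def mobCoef (lam : ℝ) (r : Fin m → ℝ) (i : Fin m) : ℝ :=
  √(lam * r i / (lam + ∑ c, r c))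

/-- The components of the square root of the mobility applied to `w`. -/
noncomputable def mobRoot (lam : ℝ) (r w : Fin m → ℝ) : Option (Fin m) → ℝ
  | none => (∑ c, r c * w c) / √(lam + ∑ c, r c)
  | some i => mobCoef lam r i * w i

/-- The flux of color `i` generated by the gradients `v` and the controls `h`. -/
noncomputable def fluxJ (lam : ℝ) (r v : Fin m → ℝ) (h : Option (Fin m) → ℝ) (i : Fin m) : ℝ :=
  -(1 / 2) * ((lam * v i + r i * ∑ c, v c) / (lam + ∑ c, r c)) +
    (mobCoef lam r i * h (some i) + r i / √(lam + ∑ c, r c) * h none)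

lemma diffusion_mulVec (r v : Fin m → ℝ) (i : Fin m) :
    (diffusionMatrix lam r *ᵥ v) i = (lam * v i + r i * ∑ c, v c) / (lam + ∑ c, r c) := by
  simp only [Matrix.mulVec, dotProduct, diffusionMatrix, Matrix.of_apply]
  have h1 : ∀ j, ((if i = j then lam else 0) + r i) / (lam + ∑ c, r c) * v j =
      ((if i = j then lam * v j else 0) + r i * v j) / (lam + ∑ c, r c) := fun j => by
    split_ifs <;> ring
  simp_rw [h1]
  rw [← sum_div, sum_add_distrib, Finset.sum_ite_eq, ← mul_sum]
  simp

variable (hlam : 0 < lam) {r : Fin m → ℝ} (hr : ∀ c, 0 ≤ r c)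
include hlam hr

lemma tot_nonneg : 0 ≤ ∑ c, r c := sum_nonneg fun c _ => hr c

lemma le_tot (i : Fin m) : r i ≤ ∑ c, r c :=
  single_le_sum (fun c _ => hr c) (mem_univ i)

lemma lam_tot_pos : 0 < lam + ∑ c, r c :=
  add_pos_of_pos_of_nonneg hlam (sum_nonneg fun c _ => hr c)

lemma mobCoef_sq (i : Fin m) : mobCoef lam r i ^ 2 = lam * r i / (lam + ∑ c, r c) :=
  sq_sqrt (div_nonneg (mul_nonneg hlam.le (hr i)) (lam_tot_pos hlam hr).le)

/-- The mobility is a diagonal matrix plus one matrix of rank one. Its quadratic form is a sum of `m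
+ 1` squares, indexed by `Option (Fin m)`; the index `none` carries a control shared by all colors.
-/
lemma mobility_dotProduct (w : Fin m → ℝ) :
    w ⬝ᵥ (mobilityMatrix lam r *ᵥ w) = ∑ k, mobRoot lam r w k ^ 2 := by
  have hp := lam_tot_pos hlam hr
  rw [Fintype.sum_option]
  simp only [mobRoot, mul_pow, div_pow, mobCoef_sq hlam hr, sq_sqrt hp.le]
  simp only [Matrix.mulVec, dotProduct, mobilityMatrix, Matrix.of_apply]
  have h1 : ∀ i, w i * ∑ j, ((if i = j then lam * r j else 0) + r i * r j) / (lam + ∑ c, r c) * w j =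
      (lam * r i / (lam + ∑ c, r c)) * w i ^ 2 + r i * w i * (∑ c, r c * w c) / (lam + ∑ c, r c) := by
    intro i
    have h2 : ∀ j, ((if i = j then lam * r j else 0) + r i * r j) / (lam + ∑ c, r c) * w j =
        ((if i = j then lam * r j * w j else 0) + r i * (r j * w j)) / (lam + ∑ c, r c) := fun j => by
      split_ifs <;> ring
    simp_rw [h2]
    rw [← sum_div, sum_add_distrib, Finset.sum_ite_eq, ← mul_sum]
    simp only [mem_univ, if_true]
    ring
  simp_rw [h1]
  rw [sum_add_distrib, ← sum_div, ← sum_mul, add_comm, sq]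

lemma sum_mobRoot_mul (w : Fin m → ℝ) (h : Option (Fin m) → ℝ) :
    ∑ k, mobRoot lam r w k * h k = ∑ i, w i * (mobCoef lam r i * h (some i) +
      r i / √(lam + ∑ c, r c) * h none) := by
  rw [Fintype.sum_option]
  simp only [mobRoot, mul_add, sum_add_distrib]
  rw [sum_div, sum_mul, add_comm]
  congr 1
  · exact sum_congr rfl fun i _ => by ring
  · exact sum_congr rfl fun i _ => by ring

lemma sum_diffusion (v : Fin m → ℝ) :
    ∑ i, (lam * v i + r i * ∑ c, v c) / (lam + ∑ c, r c) = ∑ c, v c := by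
  have hp := lam_tot_pos hlam hr
  rw [← sum_div, sum_add_distrib, ← mul_sum, ← sum_mul, ← add_mul, mul_div_cancel_left₀ _ hp.ne']

/-- The part of the total flux generated by the controls. -/
lemma sq_sum_control_le (h : Option (Fin m) → ℝ) :
    (∑ i, (mobCoef lam r i * h (some i) + r i / √(lam + ∑ c, r c) * h none)) ^ 2 ≤
      (∑ c, r c) * ∑ k, h k ^ 2 := by
  have hp := lam_tot_pos hlam hr
  have h1 := sum_mobRoot_mul hlam hr (fun _ => 1) h
  simp only [one_mul] at h1
  rw [← h1]
  refine (Finset.sum_mul_sq_le_sq_mul_sq _ _ _).trans (le_of_eq ?_)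
  congr 1
  rw [Fintype.sum_option]
  simp only [mobRoot, mul_one, mobCoef_sq hlam hr, div_pow, sq_sqrt hp.le]
  rw [← sum_div, ← mul_sum]
  field_simp
  ring

lemma sq_control_le (h : Option (Fin m) → ℝ) (i : Fin m) :
    (mobCoef lam r i * h (some i) + r i / √(lam + ∑ c, r c) * h none) ^ 2 ≤ r i * ∑ k, h k ^ 2 := by
  have hp := lam_tot_pos hlam hr
  have h1 : h (some i) ^ 2 + h none ^ 2 ≤ ∑ k, h k ^ 2 := by
    rw [Fintype.sum_option, add_comm]
    gcongr
    exact single_le_sum (f := fun i => h (some i) ^ 2) (fun c _ => sq_nonneg _) (mem_univ i)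
  have h2 : (mobCoef lam r i * h (some i) + r i / √(lam + ∑ c, r c) * h none) ^ 2 ≤
      (mobCoef lam r i ^ 2 + (r i / √(lam + ∑ c, r c)) ^ 2) * (h (some i) ^ 2 + h none ^ 2) := by
    nlinarith [sq_nonneg (mobCoef lam r i * h none - r i / √(lam + ∑ c, r c) * h (some i))]
  have h3 : mobCoef lam r i ^ 2 + (r i / √(lam + ∑ c, r c)) ^ 2 ≤ r i := by
    rw [mobCoef_sq hlam hr, div_pow, sq_sqrt hp.le, ← add_div, div_le_iff₀ hp]
    nlinarith [le_tot hlam hr i, hr i]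
  exact h2.trans (mul_le_mul h3 h1 (by positivity) (hr i))

lemma energyR_nonneg (v : Fin m → ℝ) : 0 ≤ energyR lam r v := by
  have hp := lam_tot_pos hlam hr
  refine add_nonneg (by positivity) (sum_nonneg fun c _ => ?_)
  have := hr c
  positivity

lemma le_energyR (v : Fin m → ℝ) (i : Fin m) :
    (∑ c, v c) ^ 2 / (lam + ∑ c, r c) + lam * v i ^ 2 / ((lam + ∑ c, r c) * r i) ≤ energyR lam r v := by
  have hp := lam_tot_pos hlam hr
  refine add_le_add le_rfl (single_le_sum
    (f := fun c => lam * v c ^ 2 / ((lam + ∑ c', r c') * r c)) (fun c _ => ?_) (mem_univ i))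
  have := hr c
  positivity

variable {v : Fin m → ℝ} (hv : ∀ c, r c = 0 → v c = 0)
include hv

/-- Cauchy-Schwarz gives `(∑ v_c)² ≤ (∑ r_c) * ∑ v_c² / r_c`. The energy is the combination of `(∑
v_c)²` and `∑ v_c² / r_c` for which the weights `lam` and `∑ r_c` then add up to the denominator. -/
lemma sq_sum_le_energyR : (∑ c, v c) ^ 2 ≤ (∑ c, r c) * energyR lam r v := by
  have hp := lam_tot_pos hlam hr
  have h1 : (∑ c, v c) ^ 2 ≤ (∑ c, r c) * ∑ c, v c ^ 2 / r c := by
    refine Finset.sum_sq_le_sum_mul_sum_of_sq_eq_mul _ (fun i _ => hr i)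
      (fun i _ => div_nonneg (sq_nonneg _) (hr i)) fun i _ => ?_
    by_cases hi : r i = 0
    · rw [hv i hi, hi]
      simp
    · field_simp
  have h2 : ∑ c, lam * v c ^ 2 / ((lam + ∑ c', r c') * r c) =
      lam / (lam + ∑ c, r c) * ∑ c, v c ^ 2 / r c := by
    rw [mul_sum]
    refine sum_congr rfl fun c _ => ?_
    rw [mul_div_mul_comm]
  rw [energyR, h2]
  have h3 : (∑ c, r c) * ((∑ c, v c) ^ 2 / (lam + ∑ c, r c) +
      lam / (lam + ∑ c, r c) * ∑ c, v c ^ 2 / r c) =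
      ((∑ c, r c) * (∑ c, v c) ^ 2 + lam * ((∑ c, r c) * ∑ c, v c ^ 2 / r c)) /
        (lam + ∑ c, r c) := by field_simp
  rw [h3, le_div_iff₀ hp]
  nlinarith

lemma sq_le_energyR (i : Fin m) : lam * v i ^ 2 ≤ (lam + ∑ c, r c) * (r i * energyR lam r v) := by
  have hp := lam_tot_pos hlam hr
  rcases (hr i).eq_or_lt with hi | hi
  · rw [hv i hi.symm, ← hi]
    simp
  · have h1 := le_energyR hlam hr v i
    have h2 : lam * v i ^ 2 / ((lam + ∑ c, r c) * r i) ≤ energyR lam r v :=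
      le_trans (le_add_of_nonneg_left (by positivity)) h1
    rw [div_le_iff₀ (by positivity)] at h2
    linarith

/-- Cauchy-Schwarz with the weights `lam * r i` and `r i ^ 2`; its defect is `lam * r i * (∑ v_c -
v_i)²`. -/
lemma sq_diffusion_le (i : Fin m) :
    ((lam * v i + r i * ∑ c, v c) / (lam + ∑ c, r c)) ^ 2 ≤ r i * energyR lam r v := by
  have hp := lam_tot_pos hlam hr
  have h1 := le_energyR hlam hr v i
  have hle := le_tot hlam hr i
  rcases (hr i).eq_or_lt with hi | hi
  · rw [hv i hi.symm, ← hi]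
    simp
  · have h2 : (∑ c, v c) ^ 2 + lam * v i ^ 2 / r i ≤ (lam + ∑ c, r c) * energyR lam r v := by
      refine le_trans (le_of_eq ?_) (mul_le_mul_of_nonneg_left h1 hp.le)
      field_simp
    have h3 : (lam * v i + r i * ∑ c, v c) ^ 2 ≤
        (lam * r i + r i ^ 2) * ((∑ c, v c) ^ 2 + lam * v i ^ 2 / r i) := by
      have h4 : (lam * r i + r i ^ 2) * ((∑ c, v c) ^ 2 + lam * v i ^ 2 / r i) -
          (lam * v i + r i * ∑ c, v c) ^ 2 = lam * r i * ((∑ c, v c) - v i) ^ 2 := by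
        field_simp
        ring
      have h5 : 0 ≤ lam * r i * ((∑ c, v c) - v i) ^ 2 := by positivity
      linarith
    rw [div_pow, div_le_iff₀ (by positivity)]
    have h6 : lam * r i + r i ^ 2 ≤ r i * (lam + ∑ c, r c) := by nlinarith
    have h7 := energyR_nonneg hlam hr v
    calc _ ≤ _ := h3
      _ ≤ (r i * (lam + ∑ c, r c)) * ((lam + ∑ c, r c) * energyR lam r v) := by bound
      _ = _ := by ring

lemma sq_fluxJ_le (h : Option (Fin m) → ℝ) (i : Fin m) :
    fluxJ lam r v h i ^ 2 ≤ (∑ c, r c) * (2 * (energyR lam r v + ∑ k, h k ^ 2)) := by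
  have h1 := sq_diffusion_le hlam hr hv i
  have h2 := sq_control_le hlam hr h i
  have hle := le_tot hlam hr i
  have he := energyR_nonneg hlam hr v
  have hh : 0 ≤ ∑ k, h k ^ 2 := sum_nonneg fun k _ => sq_nonneg _
  set D := (lam * v i + r i * ∑ c, v c) / (lam + ∑ c, r c)
  set a := mobCoef lam r i * h (some i) + r i / √(lam + ∑ c, r c) * h none
  have h3 : fluxJ lam r v h i = -(1 / 2) * D + a := rfl
  rw [h3]
  have h4 : (-(1 / 2) * D + a) ^ 2 ≤ 1 / 2 * D ^ 2 + 2 * a ^ 2 := by nlinarith [sq_nonneg (1 / 2 * D + a)]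
  have h5 := mul_le_mul_of_nonneg_right hle he
  have h6 := mul_le_mul_of_nonneg_right hle hh
  have h7 := mul_nonneg (tot_nonneg hlam hr) he
  linarith

lemma sum_fluxJ (h : Option (Fin m) → ℝ) : ∑ i, fluxJ lam r v h i = -(1 / 2) * (∑ c, v c) +
    ∑ i, (mobCoef lam r i * h (some i) + r i / √(lam + ∑ c, r c) * h none) := by
  simp only [fluxJ]
  rw [sum_add_distrib, ← mul_sum, sum_diffusion hlam hr]

lemma sq_sum_fluxJ_le (h : Option (Fin m) → ℝ) :
    (∑ i, fluxJ lam r v h i) ^ 2 ≤ (∑ c, r c) * (2 * (energyR lam r v + ∑ k, h k ^ 2)) := by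
  have h1 := sq_sum_le_energyR hlam hr hv
  have h2 := sq_sum_control_le hlam hr h
  have he := energyR_nonneg hlam hr v
  rw [sum_fluxJ hlam hr hv]
  set G := ∑ i, (mobCoef lam r i * h (some i) + r i / √(lam + ∑ c, r c) * h none)
  have h4 : (-(1 / 2) * (∑ c, v c) + G) ^ 2 ≤ 1 / 2 * (∑ c, v c) ^ 2 + 2 * G ^ 2 := by
    nlinarith [sq_nonneg (1 / 2 * (∑ c, v c) + G)]
  have h7 := mul_nonneg (tot_nonneg hlam hr) he
  linarith

/-- The deviation of the flux of color `i` from the total flux. -/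
lemma relative_flux (hpos : 0 < ∑ c, r c) (h : Option (Fin m) → ℝ) (i : Fin m) :
    (((∑ c, r c) * fluxJ lam r v h i - (∑ c, fluxJ lam r v h c) * r i) / (∑ c, r c) + 1 / 2 * (lam *
        (v i - r i / (∑ c, r c) * ∑ c, v c) / (lam + ∑ c, r c))) ^ 2 ≤
        4 * (lam * r i / (lam + ∑ c, r c)) * ∑ k, h k ^ 2 := by
  have hp := lam_tot_pos hlam hr
  have hle := le_tot hlam hr i
  have hsq := Real.sqrt_pos.2 hp
  have hh : 0 ≤ ∑ k, h k ^ 2 := sum_nonneg fun k _ => sq_nonneg _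
  rw [sum_fluxJ hlam hr hv, sum_add_distrib]
  set S := ∑ c, mobCoef lam r c * h (some c) with hS
  have e0 : ∑ c, r c / √(lam + ∑ c, r c) * h none =
      (∑ c, r c) / √(lam + ∑ c, r c) * h none := by rw [← sum_mul, ← sum_div]
  rw [e0]
  -- The gradient terms cancel against the added correction and the shared control `h none` drops
  -- out, since it moves all colors in proportion to their densities. Only the individual controls
  -- remain.
  have e1 : ((∑ c, r c) * fluxJ lam r v h i - (-(1 / 2) * (∑ c, v c) + (S +
      (∑ c, r c) / √(lam + ∑ c, r c) * h none)) * r i) / (∑ c, r c) + 1 / 2 * (lam *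
        (v i - r i / (∑ c, r c) * ∑ c, v c) / (lam + ∑ c, r c)) =
      mobCoef lam r i * h (some i) - r i / (∑ c, r c) * S := by
    rw [fluxJ]
    field_simp
    ring
  rw [e1]
  have hS2 : S ^ 2 ≤ lam * (∑ c, r c) / (lam + ∑ c, r c) * ∑ k, h k ^ 2 := by
    refine (Finset.sum_mul_sq_le_sq_mul_sq _ _ _).trans ?_
    simp only [mobCoef_sq hlam hr]
    rw [← sum_div, ← mul_sum]
    refine mul_le_mul_of_nonneg_left ?_ (by positivity)
    rw [Fintype.sum_option]
    linarith [sq_nonneg (h none)]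
  have hi : h (some i) ^ 2 ≤ ∑ k, h k ^ 2 :=
    single_le_sum (f := fun k => h k ^ 2) (fun c _ => sq_nonneg _) (mem_univ _)
  have hri := hr i
  have h1 : (mobCoef lam r i * h (some i)) ^ 2 ≤ lam * r i / (lam + ∑ c, r c) * ∑ k, h k ^ 2 := by
    rw [mul_pow, mobCoef_sq hlam hr]
    exact mul_le_mul_of_nonneg_left hi (by positivity)
  have h2 : (r i / (∑ c, r c) * S) ^ 2 ≤ lam * r i / (lam + ∑ c, r c) * ∑ k, h k ^ 2 := by
    rw [mul_pow]
    refine (mul_le_mul_of_nonneg_left hS2 (by positivity)).trans ?_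
    have h3 : (r i / ∑ c, r c) ^ 2 * (lam * (∑ c, r c) / (lam + ∑ c, r c) * ∑ k, h k ^ 2) =
        (r i / ∑ c, r c) * (lam * r i / (lam + ∑ c, r c) * ∑ k, h k ^ 2) := by field_simp
    rw [h3]
    exact mul_le_of_le_one_left (by positivity) ((div_le_one hpos).2 hle)
  nlinarith [sq_nonneg (mobCoef lam r i * h (some i) + r i / (∑ c, r c) * S)]

/-- The relative flux is the control part bounded in `relative_flux` minus a multiple of the
gradient of the color fraction; the latter is bounded by the energy. Both carry an additional power
of the total density. -/
lemma sq_relative_flux_le (h : Option (Fin m) → ℝ) (i : Fin m) :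
    ((∑ c, r c) * fluxJ lam r v h i - (∑ c, fluxJ lam r v h c) * r i) ^ 2 * (lam + ∑ c, r c) ≤
      (∑ c, r c) ^ 3 * (8 * lam * (energyR lam r v + ∑ k, h k ^ 2)) := by
  have hp := lam_tot_pos hlam hr
  have hle := le_tot hlam hr i
  have hri := hr i
  have he := energyR_nonneg hlam hr v
  have hh : 0 ≤ ∑ k, h k ^ 2 := sum_nonneg fun k _ => sq_nonneg _
  rcases (tot_nonneg hlam hr).eq_or_lt with h0 | hpos
  · have : r i = 0 := by linarith
    rw [← h0, this]
    simp
  have h1 := relative_flux hlam hr hv hpos h i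
  set R := ∑ c, r c with hR
  set N := R * fluxJ lam r v h i - (∑ c, fluxJ lam r v h c) * r i with hN
  set E := energyR lam r v with hE
  set H := ∑ k, h k ^ 2 with hH
  set V := ∑ c, v c with hV
  set y := 1 / 2 * (lam * (v i - r i / R * V) / (lam + R)) with hy
  have h2 : N ^ 2 * (lam + R) = R ^ 2 * (lam + R) * ((N / R + y) - y) ^ 2 := by
    rw [add_sub_cancel_right]
    field_simp
  have h3 : ((N / R + y) - y) ^ 2 ≤ 2 * (N / R + y) ^ 2 + 2 * y ^ 2 := by
    nlinarith [sq_nonneg ((N / R + y) + y)]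
  have hV2 : V ^ 2 ≤ R * E := sq_sum_le_energyR hlam hr hv
  have hv2 : lam * v i ^ 2 ≤ (lam + R) * (r i * E) := sq_le_energyR hlam hr hv i
  have h4 : lam * (v i - r i / R * V) ^ 2 ≤ 4 * (lam + R) * (R * E) := by
    have h5 : (v i - r i / R * V) ^ 2 ≤ 2 * v i ^ 2 + 2 * (r i / R * V) ^ 2 := by
      nlinarith [sq_nonneg (v i + r i / R * V)]
    have h6 : (r i / R * V) ^ 2 ≤ R * E := by
      rw [mul_pow]
      have : (r i / R) ^ 2 ≤ 1 := by
        rw [sq_le_one_iff₀ (by positivity), div_le_one hpos]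
        exact hle
      exact (mul_le_of_le_one_left (sq_nonneg _) this).trans hV2
    have h7 : (lam + R) * (r i * E) ≤ (lam + R) * (R * E) := by gcongr
    have h8 : lam * (R * E) ≤ (lam + R) * (R * E) := by gcongr; linarith
    nlinarith
  have h5 : y ^ 2 * (lam + R) ≤ lam * (R * E) := by
    have h6 : y ^ 2 * (lam + R) = lam / (4 * (lam + R)) * (lam * (v i - r i / R * V) ^ 2) := by
      rw [hy]
      field_simp
      ring
    rw [h6]
    refine (mul_le_mul_of_nonneg_left h4 (by positivity)).trans (le_of_eq ?_)
    field_simp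
  have h6 : (N / R + y) ^ 2 * (lam + R) ≤ 4 * lam * (R * H) := by
    refine (mul_le_mul_of_nonneg_right h1 hp.le).trans ?_
    have h7 : 4 * (lam * r i / (lam + R)) * H * (lam + R) = 4 * lam * (r i * H) := by field_simp
    rw [h7]
    gcongr
  rw [h2]
  have h7 : (N / R + y - y) ^ 2 * (lam + R) ≤ R * (8 * lam * (E + H)) := by
    have h8 := mul_le_mul_of_nonneg_right h3 hp.le
    have h9 : 0 ≤ lam * (R * E) := by positivity
    nlinarith
  have h8 := mul_le_mul_of_nonneg_left h7 (sq_nonneg R)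
  linarith

/-- Expanding the squares, the cross terms sum to multiples of `(∑ v_c)²`. The energy thus separates
into the Fisher information of the total density and the gradients of the color fractions, and each
part is dissipated by an entropy of its own. -/
lemma energyR_eq (hpos : 0 < ∑ c, r c) : energyR lam r v = (∑ c, v c) ^ 2 / (∑ c, r c) +
    ∑ i, lam * (v i - r i / (∑ c, r c) * ∑ c, v c) ^ 2 / ((lam + ∑ c, r c) * r i) := by
  have hp := lam_tot_pos hlam hr
  rw [energyR]
  set R := ∑ c, r c with hR
  set V := ∑ c, v c with hV
  have h1 : ∀ i, lam * (v i - r i / R * V) ^ 2 / ((lam + R) * r i) =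
      lam * v i ^ 2 / ((lam + R) * r i) + (lam * V ^ 2 / ((lam + R) * R ^ 2) * r i -
        2 * lam * V / ((lam + R) * R) * v i) := by grind
  simp_rw [h1]
  rw [sum_add_distrib, sum_sub_distrib, ← mul_sum, ← mul_sum, ← hR, ← hV]
  field_simp
  ring

lemma energyDensity_eq : energyDensity lam r v = ofReal (energyR lam r v) := by
  have hp := lam_tot_pos hlam hr
  have hnn : ∀ c, 0 ≤ lam * v c ^ 2 / ((lam + ∑ c', r c') * r c) := fun c => by
    have := hr c
    positivity
  rw [energyDensity, energyR, ofReal_add (by positivity)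
    (sum_nonneg fun c _ => hnn c), ENNReal.ofReal_div_of_pos hp,
    ENNReal.ofReal_sum_of_nonneg fun c _ => hnn c]
  congr 1
  refine sum_congr rfl fun c _ => ?_
  rcases (hr c).eq_or_lt with hc | hc
  · rw [hv c hc.symm, ← hc]
    simp
  · rw [ENNReal.ofReal_div_of_pos (by positivity)]

omit hv in
lemma eq_zero_of_energyDensity_lt_top (h : energyDensity lam r v < ∞) (c : Fin m) (hc : r c = 0) :
    v c = 0 := by
  by_contra hcon
  have h1 : ofReal (lam * v c ^ 2) / ofReal ((lam + ∑ c', r c') * r c) = ∞ := by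
    rw [hc, mul_zero, ENNReal.ofReal_zero, ENNReal.div_zero]
    exact (ENNReal.ofReal_pos.2 (by positivity)).ne'
  have h2 : energyDensity lam r v = ∞ := by
    rw [energyDensity, ENNReal.add_eq_top]
    right
    exact ENNReal.sum_eq_top.2 ⟨c, mem_univ c, h1⟩
  exact h.ne h2

end


/-! ### Regular densities -/

/-- Densities with weak gradients of finite energy, given by everywhere defined functions for which
the pointwise relations hold at all points. -/
structure Reg {m : ℕ} (T lam : ℝ) (ρ v : Fin m → 𝔽) : Prop where
  meas : ∀ c, Measurable fun p : 𝕏 => ρ c p.1 p.2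
  meas' : ∀ c, Measurable fun p : 𝕏 => v c p.1 p.2
  nonneg : ∀ c t x, 0 ≤ ρ c t x
  zero : ∀ c t x, ρ c t x = 0 → v c t x = 0
  int : ∀ c, ∀ t ∈ Icc 0 T, Integrable (ρ c t)
  mass : ∀ t ∈ Icc 0 T, ∫ x, ∑ c, ρ c t x = 1
  wg : ∀ c, IsWeakGradient T (ρ c) (v c)
  cont : ∀ c, ∀ ξ : 𝕊, Continuous ξ → ContinuousOn (fun t => ∫ x, ξ x * ρ c t x) (Icc 0 T)
  energy : Integrable (fun p : 𝕏 => energyR lam ρ⟪p⟫ v⟪p⟫) (Ω T)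

lemma integral_withDensity_ofReal {f g : 𝕊} (hf : Measurable f) (h0 : ∀ x, 0 ≤ f x) :
    ∫ x, g x ∂(volume.withDensity fun x => ofReal (f x)) = ∫ x, g x * f x := by
  rw [integral_withDensity_eq_integral_toReal_smul hf.ennreal_ofReal
    (.of_forall fun x => ofReal_lt_top)]
  refine integral_congr_ae (.of_forall fun x => ?_)
  simp only [toReal_ofReal (h0 x), smul_eq_mul, mul_comm]

lemma integrable_of_withDensity_finite {f : 𝕊} (hf : Measurable f) (h0 : ∀ x, 0 ≤ f x)
    [IsFiniteMeasure (volume.withDensity fun x => ofReal (f x))] : Integrable f := by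
  refine ⟨hf.aestronglyMeasurable, ?_⟩
  have h := measure_lt_top (volume.withDensity fun x => ofReal (f x)) Set.univ
  rw [withDensity_apply _ MeasurableSet.univ, Measure.restrict_univ] at h
  rw [hasFiniteIntegral_iff_norm]
  simpa only [norm_eq_abs, abs_of_nonneg (h0 _)] using h

lemma energyR_measurable {m : ℕ} {lam : ℝ} {ρ v : Fin m → 𝔽}
    (hm : ∀ c, Measurable fun p : 𝕏 => ρ c p.1 p.2)
    (hm' : ∀ c, Measurable fun p : 𝕏 => v c p.1 p.2) :
    Measurable fun p : 𝕏 => energyR lam ρ⟪p⟫ fun c => v c p.1 p.2 := by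
  unfold energyR
  have hS : Measurable fun p : 𝕏 => lam + ∑ c, ρ c p.1 p.2 := by fun_prop
  refine (((measurable_usum hm').pow_const 2).div hS).add (measurable_fun_sum _ fun c _ => ?_)
  exact (((hm' c).pow_const 2).const_mul lam).div (hS.mul (hm c))

namespace IsRegularDensity
variable {m : ℕ} {T lam : ℝ} {rbar : Fin m → ℝ} {μ : ColorPath m T} {ρ v : Fin m → 𝔽}
  (h : IsRegularDensity lam rbar μ ρ v)
include h

lemma integrable_slice (c : Fin m) {t : ℝ} (ht : t ∈ Icc 0 T) : Integrable (ρ c t) := by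
  have hm : Measurable (ρ c t) := (h.measurable c).comp measurable_prodMk_left
  have hf : IsFiniteMeasure (volume.withDensity fun x => ofReal (ρ c t x)) := by
    rw [← h.density ⟨t, ht⟩ c]
    infer_instance
  exact integrable_of_withDensity_finite hm (h.nonneg c t)

lemma integral_eq (c : Fin m) {t : ℝ} (ht : t ∈ Icc 0 T) (ξ : 𝕊) :
    ∫ x, ξ x ∂(μ ⟨t, ht⟩ c : Measure Torus) = ∫ x, ξ x * ρ c t x := by
  have hm : Measurable (ρ c t) := (h.measurable c).comp measurable_prodMk_left
  rw [h.density ⟨t, ht⟩ c]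
  exact integral_withDensity_ofReal hm (h.nonneg c t)

lemma integral_slice (c : Fin m) {t : ℝ} (ht : t ∈ Icc 0 T) : ∫ x, ρ c t x = rbar c := by
  rw [← h.mass ⟨t, ht⟩ c]
  have h1 := h.integral_eq c ht fun _ => 1
  simp only [one_mul] at h1
  rw [← h1, integral_const, smul_eq_mul, mul_one]
  rfl

lemma continuousOn (c : Fin m) {ξ : 𝕊} (hξ : Continuous ξ) :
    ContinuousOn (fun t => ∫ x, ξ x * ρ c t x) (Icc 0 T) := by
  rw [continuousOn_iff_continuous_restrict]
  have h1 : Continuous fun t : Icc 0 T => μ t c := (continuous_apply c).comp μ.continuous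
  have h2 : Continuous fun t : Icc 0 T => ∫ x, ξ x ∂(μ t c : Measure Torus) := by
    rw [continuous_iff_continuousAt]
    intro t
    have h3 := (FiniteMeasure.tendsto_iff_forall_integral_tendsto.1 (h1.tendsto t))
      (BoundedContinuousFunction.mkOfCompact ⟨ξ, hξ⟩)
    exact h3
  convert h2 using 1
  ext t
  rw [Set.restrict_apply]
  exact (h.integral_eq c t.2 ξ).symm

/-- A version of the gradient which vanishes wherever the density does. -/
lemma exists_reg (hlam : 0 < lam) (hsum : ∑ c, rbar c = 1) :
    ∃ v', Reg T lam ρ v' ∧ (∀ c, ∀ᵐ p ∂Ω T, v' c p.1 p.2 = v c p.1 p.2) ∧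
      ∀ φ, dynFunctional T lam ρ v' φ = dynFunctional T lam ρ v φ := by
  have hmk := fun c => (h.weak_gradient c).integrable_gradient.aestronglyMeasurable
  -- A measurable version of the gradient, set to zero where the density vanishes. Finite energy
  -- forces the original gradient to vanish there almost everywhere, because a nonzero number
  -- divided by zero counts as infinite.
  let v' : Fin m → 𝔽 := fun c t x => if ρ c t x = 0 then 0 else (hmk c).mk _ (t, x)
  have hm' : ∀ c, Measurable fun p : 𝕏 => v' c p.1 p.2 := fun c =>
    Measurable.ite ((h.measurable c) (measurableSet_singleton 0)) measurable_const
      (hmk c).stronglyMeasurable_mk.measurable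
  have hfin : ∀ᵐ p ∂Ω T, energyDensity lam ρ⟪p⟫ v⟪p⟫ < ∞ := by
    have hmk' : AEMeasurable (fun p : 𝕏 =>
        energyDensity lam ρ⟪p⟫ v⟪p⟫) (Ω T) := by
      unfold energyDensity
      have hS : AEMeasurable (fun p : 𝕏 => lam + ∑ c, ρ c p.1 p.2) (Ω T) :=
        (measurable_const.add (measurable_usum h.measurable)).aemeasurable
      refine AEMeasurable.add ?_ (Finset.aemeasurable_fun_sum _ fun c _ => ?_)
      · exact (((Finset.aemeasurable_fun_sum _ fun c _ => (hmk c).aemeasurable).pow_const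
          2).ennreal_ofReal).div hS.ennreal_ofReal
      · exact ((((hmk c).aemeasurable.pow_const 2).const_mul lam).ennreal_ofReal).div
          (hS.mul (h.measurable c).aemeasurable).ennreal_ofReal
    exact ae_lt_top' hmk' h.energy_lt_top.ne
  have hae : ∀ c, ∀ᵐ p ∂Ω T, v' c p.1 p.2 = v c p.1 p.2 := fun c => by
    filter_upwards [hfin, (hmk c).ae_eq_mk] with p h1 h2
    change (if ρ c p.1 p.2 = 0 then 0 else (hmk c).mk _ (p.1, p.2)) = _
    split_ifs with h0
    · exact (eq_zero_of_energyDensity_lt_top hlam (fun c => h.nonneg c p.1 p.2) h1 c h0).symm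
    · exact h2.symm
  have hall : ∀ᵐ p ∂Ω T, ∀ c, v' c p.1 p.2 = v c p.1 p.2 := ae_all_iff.2 hae
  have hzero : ∀ c t x, ρ c t x = 0 → v' c t x = 0 := fun c t x h0 => if_pos h0
  refine ⟨v', ⟨h.measurable, hm', h.nonneg, hzero, fun c t ht => h.integrable_slice c ht,
    fun t ht => ?_, fun c => ?_, fun c ξ hξ => h.continuousOn c hξ, ?_⟩, hae, fun φ => ?_⟩
  · rw [integral_finsetSum _ fun c _ => h.integrable_slice c ht]
    exact (sum_congr rfl fun c _ => h.integral_slice c ht).trans hsum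
  · refine ⟨(h.weak_gradient c).integrable,
      (h.weak_gradient c).integrable_gradient.congr ((hae c).mono fun p hp => hp.symm), fun φ => ?_⟩
    rw [(h.weak_gradient c).integral_by_parts φ]
    congr 1
    refine integral_congr_ae ?_
    filter_upwards [hae c] with p hp
    rw [hp]
  · refine ⟨(energyR_measurable h.measurable hm').aestronglyMeasurable, ?_⟩
    rw [hasFiniteIntegral_iff_norm]
    refine lt_of_le_of_lt (le_of_eq (lintegral_congr_ae ?_)) h.energy_lt_top
    filter_upwards [hall] with p hp
    rw [norm_eq_abs, abs_of_nonneg (energyR_nonneg hlam (fun c => h.nonneg c p.1 p.2) _),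
      ← energyDensity_eq hlam (fun c => h.nonneg c p.1 p.2) fun c => hzero c p.1 p.2]
    congr 1
    ext c
    exact hp c
  · unfold dynFunctional
    congr 1
    refine integral_congr_ae ?_
    filter_upwards [hall] with p hp
    simp only [hp]

end IsRegularDensity

/-! ### Control representation of the dynamic functional -/

namespace Reg
variable {m : ℕ} {T lam : ℝ} {ρ v : Fin m → 𝔽} (h : Reg T lam ρ v)
include h

lemma tot_int {t : ℝ} (ht : t ∈ Icc 0 T) : Integrable fun x => ∑ c, ρ c t x :=
  integrable_finsetSum _ fun c _ => h.int c t ht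

lemma tot_int_spaceTime : Integrable (fun p : 𝕏 => ∑ c, ρ c p.1 p.2) (Ω T) :=
  integrable_finsetSum _ fun c _ => (h.wg c).integrable

lemma diffusion_measurable (i : Fin m) : Measurable (fun p : 𝕏 => (diffusionMatrix lam ρ⟪p⟫ *ᵥ
      v⟪p⟫) i) := by
  simp only [diffusion_mulVec]
  exact (((h.meas' i).const_mul lam).add ((h.meas i).mul (measurable_usum h.meas'))).div
    (measurable_const.add (measurable_usum h.meas))

lemma diffusion_integrable (hlam : 0 < lam) (i : Fin m) :
    Integrable (fun p : 𝕏 => (diffusionMatrix lam ρ⟪p⟫ *ᵥ v⟪p⟫) i) (Ω T) := by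
  refine integrable_of_sq_le (h.diffusion_measurable i).aestronglyMeasurable (h.wg i).integrable
    h.energy (.of_forall fun p => h.nonneg _ _ _) (.of_forall fun p =>
      energyR_nonneg hlam (fun c => h.nonneg c _ _) _) (.of_forall fun p => ?_)
  rw [diffusion_mulVec]
  exact sq_diffusion_le hlam (fun c => h.nonneg c _ _) (fun c => h.zero c _ _) i

lemma mobRoot_measurable {w : Fin m → 𝕏 → ℝ} (hw : ∀ c, Measurable (w c)) (k : Option (Fin m)) :
    Measurable fun p : 𝕏 => mobRoot lam ρ⟪p⟫ (fun c => w c p) k := by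
  have hS : Measurable fun p : 𝕏 => lam + ∑ c, ρ c p.1 p.2 :=
    measurable_const.add (measurable_usum h.meas)
  cases k with
  | none =>
    simp only [mobRoot]
    exact (measurable_fun_sum _ fun c _ => (h.meas c).mul (hw c)).div hS.sqrt
  | some i =>
    simp only [mobRoot, mobCoef]
    exact (((h.meas i).const_mul lam).div hS).sqrt.mul (hw i)

lemma mobRoot_memLp (hlam : 0 < lam) {w : Fin m → 𝕏 → ℝ} (hw : ∀ c, Measurable (w c)) {B : ℝ}
    (hB : ∀ᵐ p ∂Ω T, ∀ c, |w c p| ≤ B) (k : Option (Fin m)) :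
    MemLp (fun p : 𝕏 => mobRoot lam ρ⟪p⟫ (fun c => w c p) k) 2 (Ω T) := by
  have hm := h.mobRoot_measurable hw k
  rw [memLp_two_iff_integrable_sq hm.aestronglyMeasurable]
  refine (h.tot_int_spaceTime.mul_const (B ^ 2)).mono' (hm.pow_const 2).aestronglyMeasurable ?_
  filter_upwards [hB] with p hp
  rw [norm_eq_abs, abs_of_nonneg (sq_nonneg _)]
  have hr : ∀ c, 0 ≤ ρ c p.1 p.2 := fun c => h.nonneg c _ _
  have hpos := lam_tot_pos hlam hr
  have hR := tot_nonneg hlam hr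
  cases k with
  | none =>
    simp only [mobRoot, div_pow, sq_sqrt hpos.le]
    have h1 : |∑ c, ρ c p.1 p.2 * w c p| ≤ (∑ c, ρ c p.1 p.2) * B := by
      refine (Finset.abs_sum_le_sum_abs _ _).trans ?_
      rw [sum_mul]
      refine sum_le_sum fun c _ => ?_
      rw [abs_mul, abs_of_nonneg (hr c)]
      exact mul_le_mul_of_nonneg_left (hp c) (hr c)
    have h2 : (∑ c, ρ c p.1 p.2 * w c p) ^ 2 ≤ ((∑ c, ρ c p.1 p.2) * B) ^ 2 :=
      sq_le_sq' (abs_le.1 h1).1 (abs_le.1 h1).2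
    rw [div_le_iff₀ hpos]
    refine h2.trans ?_
    rw [mul_pow, sq (∑ c, ρ c p.1 p.2), mul_assoc, mul_assoc, mul_comm (B ^ 2)]
    refine mul_le_mul_of_nonneg_left (mul_le_mul_of_nonneg_right ?_ (sq_nonneg B)) hR
    linarith
  | some i =>
    simp only [mobRoot, mul_pow, mobCoef_sq hlam hr]
    have h2 : w i p ^ 2 ≤ B ^ 2 := sq_le_sq' (abs_le.1 (hp i)).1 (abs_le.1 (hp i)).2
    have h3 : lam * ρ i p.1 p.2 / (lam + ∑ c, ρ c p.1 p.2) ≤ ∑ c, ρ c p.1 p.2 := by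
      rw [div_le_iff₀ hpos]
      nlinarith [le_tot hlam hr i]
    exact mul_le_mul h3 h2 (sq_nonneg _) hR

omit h in
lemma exists_bound_dx (T : ℝ) (φ : Fin m → TestFunction) :
    ∃ B, ∀ᵐ p ∂Ω T, ∀ c, |(φ c).dx p.1 p.2| ≤ B := by
  choose B hB0 hB1 hB using fun c => spaceTime_bound (φ c).continuous_dx T
  refine ⟨∑ c, B c, ae_all_iff.2 fun c => ?_⟩
  filter_upwards [hB c] with p hp
  exact hp.trans (single_le_sum (fun c _ => hB0 c) (mem_univ c))

lemma drift_integrable (hlam : 0 < lam) (φ : TestFunction) (i : Fin m) :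
    Integrable (fun p : 𝕏 => -(φ.dt p.1 p.2 * ρ i p.1 p.2) + (1 / 2 : ℝ) * (φ.dx p.1 p.2 *
      (diffusionMatrix lam ρ⟪p⟫ *ᵥ v⟪p⟫) i)) (Ω T) := by
  obtain ⟨B, _, _, hB⟩ := spaceTime_bound φ.continuous_dx T
  obtain ⟨B', _, _, hB'⟩ := spaceTime_bound φ.continuous_dt T
  exact (((h.wg i).integrable.bdd_mul φ.continuous_dt.aestronglyMeasurable hB').neg).add
    (((h.diffusion_integrable hlam i).bdd_mul φ.continuous_dx.aestronglyMeasurable hB).const_mul _)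

lemma test_integrable (φ : TestFunction) (i : Fin m) {t : ℝ} (ht : t ∈ Icc 0 T) :
    Integrable fun x => φ.toFun t x * ρ i t x := by
  have hc : Continuous (φ.toFun t) := (φ.hasTD_dx t).continuous
  obtain ⟨C, _, hb⟩ := torus_bound hc
  exact (h.int i t ht).bdd_mul hc.aestronglyMeasurable (.of_forall hb)

/-- The linear part of the dynamic functional, for one color. -/
noncomputable def linPart (h : Reg T lam ρ v) (hlam : 0 < lam) (hT : 0 ≤ T) (i : Fin m) :
    testSpace →ₗ[ℝ] ℝ where
  toFun f := (∫ x, (toTest f).toFun T x * ρ i T x) - (∫ x, (toTest f).toFun 0 x * ρ i 0 x) +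
    ∫ p : 𝕏, (-((toTest f).dt p.1 p.2 * ρ i p.1 p.2) + (1 / 2 : ℝ) *
      ((toTest f).dx p.1 p.2 * (diffusionMatrix lam ρ⟪p⟫ *ᵥ v⟪p⟫) i)) ∂Ω T
  map_add' f g := by
    have e1 : ∀ t ∈ Icc 0 T, ∫ x, (toTest (f + g)).toFun t x * ρ i t x =
        (∫ x, (toTest f).toFun t x * ρ i t x) + ∫ x, (toTest g).toFun t x * ρ i t x :=
      fun t ht => by
      rw [← integral_add (h.test_integrable _ i ht) (h.test_integrable _ i ht)]
      refine integral_congr_ae (.of_forall fun x => ?_)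
      simp only [toTest_toFun, Submodule.coe_add, Pi.add_apply, add_mul]
    rw [e1 T ⟨hT, le_rfl⟩, e1 0 ⟨le_rfl, hT⟩]
    have e2 := integral_add (h.drift_integrable hlam (toTest f) i)
      (h.drift_integrable hlam (toTest g) i)
    simp only [toTest_dt_add, toTest_dx_add]
    have e3 : ∀ p : 𝕏, -(((toTest f).dt p.1 p.2 + (toTest g).dt p.1 p.2) * ρ i p.1 p.2) +
        1 / 2 * (((toTest f).dx p.1 p.2 + (toTest g).dx p.1 p.2) *
          (diffusionMatrix lam ρ⟪p⟫ *ᵥ v⟪p⟫) i) =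
        (-((toTest f).dt p.1 p.2 * ρ i p.1 p.2) + 1 / 2 * ((toTest f).dx p.1 p.2 *
          (diffusionMatrix lam ρ⟪p⟫ *ᵥ v⟪p⟫) i)) +
        (-((toTest g).dt p.1 p.2 * ρ i p.1 p.2) + 1 / 2 * ((toTest g).dx p.1 p.2 *
          (diffusionMatrix lam ρ⟪p⟫ *ᵥ v⟪p⟫) i)) := fun p => by ring
    simp only [e3]
    rw [e2]
    ring
  map_smul' a f := by
    have e1 : ∀ t, ∫ x, (toTest (a • f)).toFun t x * ρ i t x =
        a * ∫ x, (toTest f).toFun t x * ρ i t x := fun t => by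
      rw [← integral_const_mul]
      refine integral_congr_ae (.of_forall fun x => ?_)
      simp only [toTest_toFun, Submodule.coe_smul, Pi.smul_apply, smul_eq_mul, mul_assoc]
    simp only [e1, toTest_dt_smul, toTest_dx_smul, RingHom.id_apply, smul_eq_mul]
    have e3 : ∀ p : 𝕏, -(a * (toTest f).dt p.1 p.2 * ρ i p.1 p.2) +
        1 / 2 * (a * (toTest f).dx p.1 p.2 * (diffusionMatrix lam ρ⟪p⟫ *ᵥ v⟪p⟫) i) =
        a * (-((toTest f).dt p.1 p.2 * ρ i p.1 p.2) + 1 / 2 * ((toTest f).dx p.1 p.2 *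
          (diffusionMatrix lam ρ⟪p⟫ *ᵥ v⟪p⟫) i)) := fun p => by ring
    simp only [e3]
    rw [integral_const_mul]
    ring

/-- The mobility term becomes a squared `L²` norm, so that the functional is a linear form minus
half a quadratic one, as the Riesz argument requires. -/
lemma dynFunctional_eq (hlam : 0 < lam) (hT : 0 ≤ T) (f : Fin m → testSpace) :
    dynFunctional T lam ρ v (fun c => toTest (f c)) = ∑ i, h.linPart hlam hT i (f i) -
      1 / 2 * ∑ k, ∫ p, mobRoot lam ρ⟪p⟫ (fun c => (toTest (f c)).dx p.1 p.2) k ^ 2 ∂Ω T := by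
  obtain ⟨B, hB⟩ := exists_bound_dx T fun c => toTest (f c)
  have hL := h.mobRoot_memLp hlam (w := fun c p => (toTest (f c)).dx p.1 p.2)
    (fun c => (toTest (f c)).continuous_dx.measurable) hB
  have hL2 := fun k => (hL k).integrable_sq
  rw [← integral_finsetSum _ fun k _ => hL2 k, ← integral_const_mul]
  simp only [linPart, LinearMap.coe_mk, AddHom.coe_mk]
  have i1 : Integrable (fun p : 𝕏 => ∑ i, (-((toTest (f i)).dt p.1 p.2 * ρ i p.1 p.2) +
      (1 / 2 : ℝ) * ((toTest (f i)).dx p.1 p.2 * (diffusionMatrix lam ρ⟪p⟫ *ᵥ v⟪p⟫) i))) (Ω T) :=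
    integrable_finsetSum _ fun i _ => h.drift_integrable hlam (toTest (f i)) i
  have i2 : Integrable (fun p : 𝕏 => (1 / 2 : ℝ) * ∑ k, mobRoot lam ρ⟪p⟫
      (fun c => (toTest (f c)).dx p.1 p.2) k ^ 2) (Ω T) := by fun_prop
  rw [sum_add_distrib, sum_sub_distrib,
    ← integral_finsetSum _ fun i _ => h.test_integrable (toTest (f i)) i ⟨hT, le_rfl⟩,
    ← integral_finsetSum _ fun i _ => h.test_integrable (toTest (f i)) i ⟨le_rfl, hT⟩,
    ← integral_finsetSum _ fun i _ => h.drift_integrable hlam (toTest (f i)) i,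
    add_sub_assoc, ← integral_sub i1 i2]
  unfold dynFunctional
  congr 1
  refine integral_congr_ae (.of_forall fun p => ?_)
  simp only
  rw [mobility_dotProduct hlam fun c => h.nonneg c _ _, sum_add_distrib,
    Finset.sum_neg_distrib, ← mul_sum]
  rfl

/-- Controls of finite cost for densities with finite dynamic rate. -/
lemma exists_control (hlam : 0 < lam) (hT : 0 ≤ T) {b : ℝ} (hb0 : 0 ≤ b)
    (hb : ∀ φ, dynFunctional T lam ρ v φ ≤ b) :
    ∃ g : Option (Fin m) → 𝕏 → ℝ, (∀ k, Measurable (g k)) ∧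
      (∀ k, MemLp (g k) 2 (Ω T)) ∧ ∑ k, ∫ p, g k p ^ 2 ∂Ω T ≤ 2 * b ∧
      ∀ f : Fin m → testSpace, ∑ i, h.linPart hlam hT i (f i) =
        ∑ k, ∫ p, mobRoot lam ρ⟪p⟫ (fun c => (toTest (f c)).dx p.1 p.2) k * g k p ∂Ω T := by
  let L : (Fin m → testSpace) →ₗ[ℝ] (Option (Fin m) → 𝕏 → ℝ) :=
    { toFun := fun f k p => mobRoot lam ρ⟪p⟫ (fun c => (toTest (f c)).dx p.1 p.2) k
      map_add' := fun f g => by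
        ext k p
        cases k with
        | none =>
          simp only [mobRoot, Pi.add_apply, toTest_dx_add, mul_add, sum_add_distrib, add_div]
        | some i => simp only [mobRoot, Pi.add_apply, toTest_dx_add, mul_add]
      map_smul' := fun a f => by
        ext k p
        cases k with
        | none =>
          simp only [mobRoot, Pi.smul_apply, toTest_dx_smul, RingHom.id_apply, smul_eq_mul]
          rw [← mul_div_assoc, mul_sum]
          congr 1
          exact sum_congr rfl fun i _ => by ring
        | some i =>
          simp only [mobRoot, Pi.smul_apply, toTest_dx_smul, RingHom.id_apply, smul_eq_mul]
          ring }
  let l : (Fin m → testSpace) →ₗ[ℝ] ℝ := ∑ i, (h.linPart hlam hT i).comp (LinearMap.proj i)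
  have hl : ∀ f, l f = ∑ i, h.linPart hlam hT i (f i) := fun f => by measurability
  have hdyn : ∀ f, l f - 1 / 2 * ∑ k, ∫ p, L f k p ^ 2 ∂Ω T ≤ b := fun f => by
    rw [hl]
    exact (h.dynFunctional_eq hlam hT f).symm.trans_le (hb _)
  obtain ⟨g, h1, h2, h3, h4⟩ := exists_riesz_L2 (μ := Ω T) L (fun f k => by
      obtain ⟨B, hB⟩ := exists_bound_dx T fun c => toTest (f c)
      exact h.mobRoot_memLp hlam (w := fun c p => (toTest (f c)).dx p.1 p.2)
        (fun c => (toTest (f c)).continuous_dx.measurable) hB k) l (C := 2 * b) (by positivity)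
    -- Scaling the test functions by `s` and using the bound for all `s` makes it homogeneous; the
    -- discriminant yields the constant `2 * b`.
    fun f => sq_le_of_forall_sub_le fun s => by
      refine le_trans (le_of_eq ?_) (hdyn (s • f))
      rw [map_smul, map_smul, smul_eq_mul]
      congr 2
      rw [mul_sum]
      refine sum_congr rfl fun k _ => ?_
      rw [← integral_const_mul]
      refine integral_congr_ae (.of_forall fun p => ?_)
      simp only [Pi.smul_apply, smul_eq_mul, mul_pow]
  exact ⟨g, h1, h2, h3, fun f => (hl f).symm.trans (h4 f)⟩

end Reg


/-- A continuous function with an integrable distributional derivative is its primitive. -/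
lemma eq_primitive_of_forall_test {T : ℝ} (hT : 0 ≤ T) {P G : ℝ → ℝ}
    (hP : ContinuousOn P (Icc 0 T)) (hG : IntervalIntegrable G volume 0 T)
    (h : ∀ θ : ℝ → ℝ, ContDiff ℝ (⊤ : ℕ∞) θ → θ T * P T - θ 0 * P 0 =
      (∫ t in (0 : ℝ)..T, deriv θ t * P t) + ∫ t in (0 : ℝ)..T, θ t * G t) :
    ∀ t ∈ Icc 0 T, P t = P 0 + ∫ s in (0 : ℝ)..t, G s := by
  let Q : ℝ → ℝ := fun t => P 0 + ∫ s in (0 : ℝ)..t, G s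
  have hQ0 : Q 0 = P 0 := by simp [Q]
  have hQ : ACD T Q G := ACD.of_primitive hT hG fun t _ => by rw [hQ0]
  have hQc : ContinuousOn Q (Icc 0 T) := by
    have := hQ.ac.continuousOn
    rwa [uIcc_of_le hT] at this
  have hD : ∀ θ : ℝ → ℝ, ContDiff ℝ (⊤ : ℕ∞) θ →
      θ T * (P T - Q T) = ∫ t in (0 : ℝ)..T, deriv θ t * (P t - Q t) := by
    intro θ hθ
    have hθ' : Continuous (deriv θ) := ((contDiff_infty_iff_deriv (𝕜 := ℝ)).1 hθ).2.continuous
    have hd : ∀ t, HasDerivAt θ (deriv θ t) t := fun t =>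
      ((hθ.differentiable (by simp)) t).hasDerivAt
    have h1 : ACD T θ (deriv θ) := ACD.of_primitive hT (hθ'.intervalIntegrable _ _) fun t _ => by
      rw [integral_eq_sub_of_hasDerivAt (fun s _ => hd s) (hθ'.intervalIntegrable _ _)]
      ring
    have h2 := (h1.mul hQ).sub_eq
    have i1 : IntervalIntegrable (fun t => deriv θ t * Q t) volume 0 T :=
      (hθ'.continuousOn.mul (by rwa [uIcc_of_le hT])).intervalIntegrable
    have i2 : IntervalIntegrable (fun t => deriv θ t * P t) volume 0 T :=
      (hθ'.continuousOn.mul (by rwa [uIcc_of_le hT])).intervalIntegrable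
    have i3 : IntervalIntegrable (fun t => θ t * G t) volume 0 T :=
      hG.continuousOn_mul hθ.continuous.continuousOn
    rw [intervalIntegral.integral_add i1 i3, hQ0] at h2
    have h3 := h θ hθ
    simp only [mul_sub]
    rw [intervalIntegral.integral_sub i2 i1]
    linarith
  -- The constant test function settles the end point, so that no boundary term remains afterwards.
  have hDT : P T - Q T = 0 := by
    have h1 := hD (fun _ => 1) contDiff_const
    simpa using h1
  rcases hT.eq_or_lt with rfl | hT'
  · intro t ht
    have : t = 0 := le_antisymm ht.2 ht.1
    subst this
    simp
  have hDc : ContinuousOn (fun t => P t - Q t) (Icc 0 T) := hP.sub hQc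
  have hDi : IntegrableOn (fun t => P t - Q t) (Icc 0 T) := hDc.integrableOn_Icc
  have hz : ∀ᵐ t ∂𝓛 T, P t - Q t = 0 := by
    refine ae_eq_zero_of_integral_contDiff_smul_eq_zero hDi.locallyIntegrable fun η hη _ => ?_
    -- Using a primitive of `η` as test function turns the identity into orthogonality of `P - Q` to
    -- `η` itself.
    have hd : ∀ t, HasDerivAt (fun t => ∫ s in (0 : ℝ)..t, η s) (η t) t := fun t =>
      integral_hasDerivAt_right (hη.continuous.intervalIntegrable _ _)
        (hη.continuous.stronglyMeasurableAtFilter _ _) hη.continuous.continuousAt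
    have hde : deriv (fun t => ∫ s in (0 : ℝ)..t, η s) = η := funext fun t => (hd t).deriv
    have h1 := hD (fun t => ∫ s in (0 : ℝ)..t, η s) ((contDiff_infty_iff_deriv (𝕜 := ℝ)).2
      ⟨fun t => (hd t).differentiableAt, by rw [hde]; exact hη⟩)
    rw [hDT, mul_zero, hde] at h1
    simp only [smul_eq_mul]
    rw [integral_Icc_eq hT, ← h1]
  intro t ht
  have h1 : Set.EqOn (fun t => P t - Q t) (fun _ => 0) (Icc 0 T) :=
    Measure.eqOn_Icc_of_ae_eq (μ := volume) hT'.ne hz hDc continuousOn_const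
  exact sub_eq_zero.1 (h1 ht)

/-- The controls associated with densities of finite dynamic rate. -/
structure Controlled {m : ℕ} (T lam : ℝ) (ρ v : Fin m → 𝔽)
    (g : Option (Fin m) → 𝕏 → ℝ) : Prop extends Reg T lam ρ v where
  measg : ∀ k, Measurable (g k)
  intg : ∀ k, Integrable (fun p => g k p ^ 2) (Ω T)
  transport : ∀ i, Transport T (ρ i) fun t x => fluxJ lam (fun c => ρ c t x) (fun c => v c t x)
    (fun k => g k (t, x)) i

namespace Reg
variable {m : ℕ} {T lam : ℝ} {ρ v : Fin m → 𝔽} (h : Reg T lam ρ v)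
include h

omit h in
lemma smooth_mem {θ : ℝ → ℝ} {ξ : 𝕊} (hθ : ContDiff ℝ (⊤ : ℕ∞) θ) (hξ : SmoothT ξ) :
    (fun t x => θ t * ξ x) ∈ testSpace := (sepTest θ ξ hθ hξ).smooth

lemma control_measurable {g : Option (Fin m) → 𝕏 → ℝ} (hg : ∀ k, Measurable (g k))
    (i : Fin m) : Measurable fun p : 𝕏 => mobCoef lam ρ⟪p⟫ i * g (some i) p +
      ρ i p.1 p.2 / √(lam + ∑ c, ρ c p.1 p.2) * g none p := by
  have hS : Measurable fun p : 𝕏 => lam + ∑ c, ρ c p.1 p.2 :=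
    measurable_const.add (measurable_usum h.meas)
  unfold mobCoef
  exact ((((h.meas i).const_mul lam).div hS).sqrt.mul (hg _)).add
    (((h.meas i).div hS.sqrt).mul (hg _))

lemma control_integrable (hlam : 0 < lam) {g : Option (Fin m) → 𝕏 → ℝ}
    (hg : ∀ k, Measurable (g k)) (hgi : ∀ k, Integrable (fun p => g k p ^ 2) (Ω T))
    (i : Fin m) : Integrable (fun p : 𝕏 => mobCoef lam ρ⟪p⟫ i * g (some i) p +
      ρ i p.1 p.2 / √(lam + ∑ c, ρ c p.1 p.2) * g none p) (Ω T) :=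
  integrable_of_sq_le (h.control_measurable hg i).aestronglyMeasurable (h.wg i).integrable
    (integrable_finsetSum _ fun k _ => hgi k) (.of_forall fun p => h.nonneg _ _ _)
    (.of_forall fun p => sum_nonneg fun k _ => sq_nonneg _)
    (.of_forall fun p => sq_control_le hlam (fun c => h.nonneg c _ _) (fun k => g k p) i)

lemma fluxJ_measurable {g : Option (Fin m) → 𝕏 → ℝ} (hg : ∀ k, Measurable (g k))
    (i : Fin m) : Measurable fun p : 𝕏 => fluxJ lam ρ⟪p⟫ v⟪p⟫ (fun k => g k p) i := by
  have h1 := h.diffusion_measurable (lam := lam) i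
  simp only [diffusion_mulVec] at h1
  exact (h1.const_mul _).add (h.control_measurable hg i)

lemma fluxJ_integrable (hlam : 0 < lam) {g : Option (Fin m) → 𝕏 → ℝ}
    (hg : ∀ k, Measurable (g k)) (hgi : ∀ k, Integrable (fun p => g k p ^ 2) (Ω T))
    (i : Fin m) : Integrable (fun p : 𝕏 => fluxJ lam ρ⟪p⟫ v⟪p⟫ (fun k => g k p) i) (Ω T) := by
  have h1 := h.diffusion_integrable hlam i
  simp only [diffusion_mulVec] at h1
  exact (h1.const_mul _).add (h.control_integrable hlam hg hgi i)

/-- Product test functions `θ(t) ξ(x)` in a single color turn the Riesz representation into the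
distributional continuity equation with flux `fluxJ`. Weak continuity in time then upgrades it to an
identity at every time. -/
lemma exists_controlled (hlam : 0 < lam) (hT : 0 ≤ T) {b : ℝ} (hb0 : 0 ≤ b)
    (hb : ∀ φ, dynFunctional T lam ρ v φ ≤ b) :
    ∃ g, Controlled T lam ρ v g ∧ ∫ p, ∑ k, g k p ^ 2 ∂Ω T ≤ 2 * b := by
  obtain ⟨g, hg, hg2, hgb, hgl⟩ := h.exists_control hlam hT hb0 hb
  have hgi := fun k => (hg2 k).integrable_sq
  refine ⟨g, ⟨h, hg, hgi, fun i => ⟨h.meas i, h.fluxJ_measurable hg i, h.int i,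
    h.fluxJ_integrable hlam hg hgi i, fun ξ ξ' hξ hξ' => ?_⟩⟩, ?_⟩
  swap
  · rw [integral_finsetSum _ fun k _ => hgi k]
    exact hgb
  have hξc := hξ'.continuous
  have hξ'c := hξ.continuous_deriv hξ'
  have hji := integrable_mul_slice (j := fun t x => fluxJ lam (fun c => ρ c t x)
    (fun c => v c t x) (fun k => g k (t, x)) i) (h.fluxJ_integrable hlam hg hgi i) hξ'c
  refine eq_primitive_of_forall_test hT (h.cont i ξ hξc)
    (intervalIntegrable_slice hT hji) fun θ hθ => ?_
  have hd : ∀ t, HasDerivAt θ (deriv θ t) t := fun t => ((hθ.differentiable (by simp)) t).hasDerivAt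
  let f : Fin m → testSpace := Pi.single i ⟨fun t x => θ t * ξ x, smooth_mem hθ hξ⟩
  have hfi : f i = ⟨fun t x => θ t * ξ x, smooth_mem hθ hξ⟩ := Pi.single_eq_same i _
  have hfj : ∀ j, j ≠ i → f j = 0 := fun j hj => Pi.single_eq_of_ne hj _
  have hdx : ∀ t x, (toTest (f i)).dx t x = θ t * ξ' x := fun t x => by
    rw [hfi]
    exact sepTest_dx hθ hξ hξ' t x
  have hdt : ∀ t x, (toTest (f i)).dt t x = deriv θ t * ξ x := fun t x => by
    rw [hfi]
    exact sepTest_dt hθ hξ hd t x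
  have hdx0 : ∀ j, j ≠ i → ∀ t x, (toTest (f j)).dx t x = 0 := fun j hj t x => by
    rw [hfj j hj]
    have := toTest_dx_smul 0 0 t x
    simpa using this
  have h1 := hgl f
  rw [Finset.sum_eq_single i (fun j _ hj => by rw [hfj j hj, map_zero]) (by simp)] at h1
  have hmr : ∀ k, Integrable (fun p : 𝕏 => mobRoot lam ρ⟪p⟫
      (fun c => (toTest (f c)).dx p.1 p.2) k * g k p) (Ω T) := fun k => by
    obtain ⟨B, hB⟩ := exists_bound_dx T fun c => toTest (f c)
    exact (h.mobRoot_memLp hlam (w := fun c p => (toTest (f c)).dx p.1 p.2)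
      (fun c => (toTest (f c)).continuous_dx.measurable) hB k).integrable_mul (hg2 k)
  rw [← integral_finsetSum _ fun k _ => hmr k] at h1
  have e1 : ∀ p : 𝕏, ∑ k, mobRoot lam ρ⟪p⟫
      (fun c => (toTest (f c)).dx p.1 p.2) k * g k p = θ p.1 * ξ' p.2 *
        (mobCoef lam ρ⟪p⟫ i * g (some i) p +
          ρ i p.1 p.2 / √(lam + ∑ c, ρ c p.1 p.2) * g none p) := fun p => by
    rw [sum_mobRoot_mul hlam (fun c => h.nonneg c _ _) _ fun k => g k p,
      Finset.sum_eq_single i (fun j _ hj => by rw [hdx0 j hj, zero_mul]) (by simp), hdx]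
  simp only [e1, linPart, LinearMap.coe_mk, AddHom.coe_mk] at h1
  simp only [hdx, hdt] at h1
  have e2 : ∀ t, ∫ x, (toTest (f i)).toFun t x * ρ i t x = θ t * ∫ x, ξ x * ρ i t x := fun t => by
    rw [hfi, ← integral_const_mul]
    refine integral_congr_ae (.of_forall fun x => ?_)
    simp only [toTest_toFun]
    ring
  rw [e2, e2] at h1
  obtain ⟨B, _, _, hB⟩ := spaceTime_bound (f := fun p : 𝕏 => θ p.1)
    (hθ.continuous.comp continuous_fst) T
  obtain ⟨B', _, _, hB'⟩ := spaceTime_bound (f := fun p : 𝕏 => deriv θ p.1)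
    ((((contDiff_infty_iff_deriv (𝕜 := ℝ)).1 hθ).2.continuous).comp continuous_fst) T
  have i1 : Integrable (fun p : 𝕏 => deriv θ p.1 * (ξ p.2 * ρ i p.1 p.2)) (Ω T) :=
    (integrable_mul_slice (h.wg i).integrable hξc).bdd_mul
      ((((contDiff_infty_iff_deriv (𝕜 := ℝ)).1 hθ).2.continuous).comp
        continuous_fst).aestronglyMeasurable hB'
  have i2 : Integrable (fun p : 𝕏 => θ p.1 * (ξ' p.2 * fluxJ lam ρ⟪p⟫
      v⟪p⟫ (fun k => g k p) i)) (Ω T) :=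
    hji.bdd_mul (hθ.continuous.comp continuous_fst).aestronglyMeasurable hB
  have i3 : Integrable (fun p : 𝕏 => θ p.1 * ξ' p.2 * (mobCoef lam ρ⟪p⟫ i * g (some i) p +
          ρ i p.1 p.2 / √(lam + ∑ c, ρ c p.1 p.2) * g none p)) (Ω T) := by
    exact (integrable_finsetSum univ fun k _ => hmr k).congr (.of_forall fun p => e1 p)
  have i4 : Integrable (fun p : 𝕏 => -(deriv θ p.1 * ξ p.2 * ρ i p.1 p.2) + 1 / 2 *
      (θ p.1 * ξ' p.2 * (diffusionMatrix lam ρ⟪p⟫ *ᵥ v⟪p⟫) i))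
      (Ω T) := by
    have := h.drift_integrable hlam (toTest (f i)) i
    simpa only [hdx, hdt] using this
  have e3 : (∫ t in (0 : ℝ)..T, deriv θ t * ∫ x, ξ x * ρ i t x) =
      ∫ p, deriv θ p.1 * (ξ p.2 * ρ i p.1 p.2) ∂Ω T := by
    rw [integral_spaceTime i1, ← integral_Icc_eq hT]
    simp only [integral_const_mul]
  have e4 : (∫ t in (0 : ℝ)..T, θ t * ∫ x, ξ' x * fluxJ lam (fun c => ρ c t x)
      (fun c => v c t x) (fun k => g k (t, x)) i) =
      ∫ p, θ p.1 * (ξ' p.2 * fluxJ lam ρ⟪p⟫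
      v⟪p⟫ (fun k => g k p) i) ∂Ω T := by
    rw [integral_spaceTime i2, ← integral_Icc_eq hT]
    simp only [integral_const_mul]
  rw [e3, e4, ← integral_add i1 i2]
  have e5 : θ T * (∫ x, ξ x * ρ i T x) - θ 0 * ∫ x, ξ x * ρ i 0 x =
      (∫ p : 𝕏, θ p.1 * ξ' p.2 * (mobCoef lam ρ⟪p⟫ i * g (some i) p +
          ρ i p.1 p.2 / √(lam + ∑ c, ρ c p.1 p.2) * g none p) ∂Ω T) -
      ∫ p : 𝕏, (-(deriv θ p.1 * ξ p.2 * ρ i p.1 p.2) + 1 / 2 *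
      (θ p.1 * ξ' p.2 * (diffusionMatrix lam ρ⟪p⟫ *ᵥ v⟪p⟫) i)) ∂Ω T := by linarith
  rw [e5, ← integral_sub i3 i4]
  refine integral_congr_ae (.of_forall fun p => ?_)
  simp only [diffusion_mulVec, fluxJ]
  ring

end Reg


/-! ### Controlled densities and the energy of the color fractions -/

lemma IsWeakGradient.ae_all_WD {m : ℕ} {T : ℝ} {ρ v : Fin m → 𝔽}
    (h : ∀ c, IsWeakGradient T (ρ c) (v c)) :
    ∀ᵐ t ∂𝓛 T, ∀ c, WD (ρ c t) (v c t) := ae_all_iff.2 fun c => (h c).ae_WD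

namespace Controlled
variable {m : ℕ} {T lam : ℝ} {ρ v : Fin m → 𝔽} {g : Option (Fin m) → 𝕏 → ℝ}
  (h : Controlled T lam ρ v g)
include h

lemma wd_tot : ∀ᵐ t ∂𝓛 T, WD (fun x => ∑ c, ρ c t x) (fun x => ∑ c, v c t x) := by
  filter_upwards [IsWeakGradient.ae_all_WD h.wg] with t ht using WD.sum _ ht

lemma cost_int : Integrable (fun p => ∑ k, g k p ^ 2) (Ω T) :=
  integrable_finsetSum _ fun k _ => h.intg k

omit h in
lemma cost_nonneg (g : Option (Fin m) → 𝕏 → ℝ) (p : 𝕏) : 0 ≤ ∑ k, g k p ^ 2 :=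
  sum_nonneg fun k _ => sq_nonneg _

lemma transport_tot (hT : 0 ≤ T) : Transport T (fun t x => ∑ c, ρ c t x)
    fun t x => ∑ i, fluxJ lam (fun c => ρ c t x) (fun c => v c t x) (fun k => g k (t, x)) i := by
  refine ⟨measurable_usum h.meas,
    measurable_fun_sum _ fun i _ => (h.transport i).meas', fun t ht => h.tot_int ht,
    integrable_finsetSum _ fun i _ => (h.transport i).int', fun ξ ξ' hs hξ t ht => ?_⟩
  obtain ⟨C, _, hC⟩ := torus_bound hξ.continuous
  have hi : ∀ s ∈ Icc 0 T, ∀ i, Integrable fun x => ξ x * ρ i s x := fun s hs' i =>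
    (h.int i s hs').bdd_mul hξ.continuous.aestronglyMeasurable (.of_forall hC)
  have e1 : ∀ s ∈ Icc 0 T, ∫ x, ξ x * ∑ c, ρ c s x = ∑ c, ∫ x, ξ x * ρ c s x := fun s hs' => by
    simp only [mul_sum]
    exact integral_finsetSum _ fun i _ => hi s hs' i
  have hj := fun i => integrable_mul_slice (j := fun t x => fluxJ lam (fun c => ρ c t x)
    (fun c => v c t x) (fun k => g k (t, x)) i) (h.transport i).int' (hs.continuous_deriv hξ)
  have e2 : ∀ᵐ s ∂𝓛 T, ∫ x, ξ' x * ∑ i, fluxJ lam (fun c => ρ c s x)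
      (fun c => v c s x) (fun k => g k (s, x)) i = ∑ i, ∫ x, ξ' x * fluxJ lam (fun c => ρ c s x)
      (fun c => v c s x) (fun k => g k (s, x)) i := by
    filter_upwards [ae_all_iff.2 fun i => spaceTime_slices (hj i)] with s hs'
    simp only [mul_sum]
    exact integral_finsetSum _ fun i _ => hs' i
  have e3 : ∫ s in (0 : ℝ)..t, ∫ x, ξ' x * ∑ i, fluxJ lam (fun c => ρ c s x)
      (fun c => v c s x) (fun k => g k (s, x)) i = ∑ i, ∫ s in (0 : ℝ)..t, ∫ x, ξ' x *
      fluxJ lam (fun c => ρ c s x) (fun c => v c s x) (fun k => g k (s, x)) i := by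
    rw [← intervalIntegral.integral_finsetSum fun i _ =>
      (intervalIntegrable_slice hT (hj i)).mono_set (by
        rw [uIcc_of_le ht.1, uIcc_of_le hT]
        exact Icc_subset_Icc_right ht.2)]
    refine intervalIntegral.integral_congr_ae ?_
    rw [ae_restrict_iff' measurableSet_Icc] at e2
    filter_upwards [e2] with s h1 h2
    rw [uIoc_of_le ht.1] at h2
    exact h1 ⟨h2.1.le, h2.2.trans ht.2⟩
  rw [e1 t ht, e1 0 ⟨le_rfl, hT⟩, e3, ← sum_add_distrib]
  exact sum_congr rfl fun i _ => (h.transport i).eq ξ ξ' hs hξ t ht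

/-- The pair formed by the total density and the density of one color. -/
lemma pair (hlam : 0 < lam) (hT : 0 ≤ T) (i : Fin m) : Pair T lam (fun t x => ∑ c, ρ c t x)
    (fun t x => ∑ i, fluxJ lam (fun c => ρ c t x) (fun c => v c t x) (fun k => g k (t, x)) i)
    (ρ i) (fun t x => fluxJ lam (fun c => ρ c t x) (fun c => v c t x) (fun k => g k (t, x)) i)
    (fun t x => ∑ c, v c t x) (v i)
    -- The factor covers both the constant `2` of the flux bounds and the constant `8 * lam` of the
    -- relative flux bound.
    (fun t x => (2 + 8 * lam) * (energyR lam (fun c => ρ c t x) (fun c => v c t x) +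
      ∑ k, g k (t, x) ^ 2)) := by
  have hr := fun (p : 𝕏) c => h.nonneg c p.1 p.2
  have hv := fun (p : 𝕏) c => h.zero c p.1 p.2
  have hE := fun p : 𝕏 => energyR_nonneg hlam (hr p) fun c => v c p.1 p.2
  have hR := fun p : 𝕏 => tot_nonneg hlam (hr p)
  have hH := cost_nonneg g
  have hEH := fun p : 𝕏 => add_nonneg (hE p) (hH p)
  refine ⟨h.transport_tot hT, h.transport i, h.mass, h.nonneg i,
    fun t x => le_tot hlam (fun c => h.nonneg c t x) i,
    measurable_usum h.meas', h.meas' i, h.wd_tot, (h.wg i).ae_WD, ?_,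
    fun t x => mul_nonneg (by positivity) (hEH (t, x)), (h.energy.add h.cost_int).const_mul _,
    .of_forall fun p => ?_, .of_forall fun p => ?_,
    .of_forall fun p => ?_, .of_forall fun p => ?_,
    .of_forall fun p => ?_⟩
  · exact ((energyR_measurable h.meas h.meas').add
      (measurable_fun_sum _ fun k _ => (h.measg k).pow_const 2)).const_mul _
  · refine (sq_sum_le_energyR hlam (hr p) (hv p)).trans (mul_le_mul_of_nonneg_left ?_ (hR p))
    nlinarith [hE p, hH p, mul_nonneg hlam.le (hEH p)]
  · refine (sq_le_energyR hlam (hr p) (hv p) i).trans (mul_le_mul_of_nonneg_left ?_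
      (lam_tot_pos hlam (hr p)).le)
    refine mul_le_mul (le_tot hlam (hr p) i) ?_ (hE p) (hR p)
    nlinarith [hE p, hH p, mul_nonneg hlam.le (hEH p)]
  · refine (sq_sum_fluxJ_le hlam (hr p) (hv p) fun k => g k p).trans
      (mul_le_mul_of_nonneg_left ?_ (hR p))
    nlinarith [mul_nonneg hlam.le (hEH p)]
  · refine (sq_fluxJ_le hlam (hr p) (hv p) (fun k => g k p) i).trans
      (mul_le_mul_of_nonneg_left ?_ (hR p))
    nlinarith [mul_nonneg hlam.le (hEH p)]
  · refine (sq_relative_flux_le hlam (hr p) (hv p) (fun k => g k p) i).trans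
      (mul_le_mul_of_nonneg_left ?_ (pow_nonneg (hR p) 3))
    nlinarith [hEH p]

lemma lintegral_colors_le (hlam : 0 < lam) (hT : 0 < T) :
    ∫⁻ p, ofReal (∑ i, lam * (v i p.1 p.2 - ρ i p.1 p.2 / (∑ c, ρ c p.1 p.2) *
      ∑ c, v c p.1 p.2) ^ 2 / ((lam + ∑ c, ρ c p.1 p.2) * ρ i p.1 p.2)) ∂Ω T ≤
      ofReal (m * (32 + 16 * ∫ p, ∑ k, g k p ^ 2 ∂Ω T)) := by
  have hH : 0 ≤ ∫ p, ∑ k, g k p ^ 2 ∂Ω T := integral_nonneg (cost_nonneg g)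
  have hnn : ∀ (p : 𝕏) i, 0 ≤ lam * (v i p.1 p.2 - ρ i p.1 p.2 / (∑ c, ρ c p.1 p.2) *
      ∑ c, v c p.1 p.2) ^ 2 / ((lam + ∑ c, ρ c p.1 p.2) * ρ i p.1 p.2) := fun p i => by
    have h1 := lam_tot_pos hlam fun c => h.nonneg c p.1 p.2
    have h2 := h.nonneg i p.1 p.2
    positivity
  have hS : Measurable fun p : 𝕏 => ∑ c, ρ c p.1 p.2 := measurable_usum h.meas
  have hm : ∀ i, Measurable fun p : 𝕏 => ofReal (lam * (v i p.1 p.2 -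
      ρ i p.1 p.2 / (∑ c, ρ c p.1 p.2) * ∑ c, v c p.1 p.2) ^ 2 /
      ((lam + ∑ c, ρ c p.1 p.2) * ρ i p.1 p.2)) := fun i =>
    (((((h.meas' i).sub (((h.meas i).div hS).mul (measurable_fun_sum _ fun c _ =>
      h.meas' c))).pow_const 2).const_mul lam).div
        ((measurable_const.add hS).mul (h.meas i))).ennreal_ofReal
  calc _ = ∫⁻ p, ∑ i, ofReal (lam * (v i p.1 p.2 - ρ i p.1 p.2 / (∑ c, ρ c p.1 p.2) *
      ∑ c, v c p.1 p.2) ^ 2 / ((lam + ∑ c, ρ c p.1 p.2) * ρ i p.1 p.2)) ∂Ω T := by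
        refine lintegral_congr fun p => ?_
        rw [ENNReal.ofReal_sum_of_nonneg fun i _ => hnn p i]
    _ = ∑ i, ∫⁻ p, ofReal (lam * (v i p.1 p.2 - ρ i p.1 p.2 / (∑ c, ρ c p.1 p.2) *
      ∑ c, v c p.1 p.2) ^ 2 / ((lam + ∑ c, ρ c p.1 p.2) * ρ i p.1 p.2)) ∂Ω T :=
        lintegral_finsetSum _ fun i _ => hm i
    _ ≤ ∑ _i : Fin m, ofReal (32 + 16 * ∫ p, ∑ k, g k p ^ 2 ∂Ω T) := by
        refine sum_le_sum fun i _ => ?_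
        refine (h.pair hlam hT.le i).lintegral_color_le hT hlam h.cost_int (cost_nonneg g)
          (.of_forall fun p hp => ?_) (.of_forall fun p => h.zero i _ _)
        exact relative_flux hlam (fun c => h.nonneg c p.1 p.2) (fun c => h.zero c p.1 p.2) hp
          (fun k => g k p) i
    _ = _ := by simp

end Controlled


/-! ### The entropy of the total density -/

/-- The function `(s + κ) log (s + κ) - κ log κ` on `s ≥ 0`, extended linearly. -/
noncomputable def entPrim (κ s : ℝ) : ℝ := ∫ τ in (0 : ℝ)..s, (log (max τ 0 + κ) + 1)

section
variable {κ : ℝ} (hκ : 0 < κ)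
include hκ

lemma entPrim_cont : Continuous fun τ : ℝ => log (max τ 0 + κ) + 1 := by
  refine (Continuous.log (by fun_prop) fun τ => ?_).add continuous_const
  exact (add_pos_of_nonneg_of_pos (le_max_right _ _) hκ).ne'

lemma entPrim_hasDerivAt (s : ℝ) : HasDerivAt (entPrim κ) (log (max s 0 + κ) + 1) s :=
  integral_hasDerivAt_right ((entPrim_cont hκ).intervalIntegrable _ _)
    ((entPrim_cont hκ).stronglyMeasurableAtFilter _ _) (entPrim_cont hκ).continuousAt

lemma entPrim_eq {s : ℝ} (hs : 0 ≤ s) : entPrim κ s = (s + κ) * log (s + κ) - κ * log κ := by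
  have h1 : ∀ τ ∈ uIcc 0 s, HasDerivAt (fun τ => (τ + κ) * log (τ + κ))
      (log (max τ 0 + κ) + 1) τ := fun τ hτ => by
    rw [uIcc_of_le hs] at hτ
    have hpos : τ + κ ≠ 0 := by linarith [hτ.1]
    have h2 := (Real.hasDerivAt_mul_log hpos).comp_add_const τ κ
    rwa [max_eq_left hτ.1]
  rw [entPrim, integral_eq_sub_of_hasDerivAt h1
    ((entPrim_cont hκ).intervalIntegrable _ _), zero_add]

end

/-- A total density with its flux and its weak gradient; `H` is a density of the control cost. -/
structure Tot (T : ℝ) (R J V H : 𝔽) : Prop where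
  hr : Transport T R J
  nonneg : ∀ t x, 0 ≤ R t x
  mass : ∀ t ∈ Icc 0 T, ∫ x, R t x = 1
  measV : Measurable fun p : 𝕏 => V p.1 p.2
  intV : Integrable (fun p : 𝕏 => V p.1 p.2) (Ω T)
  wd : ∀ᵐ t ∂𝓛 T, WD (R t) (V t)
  H_nonneg : ∀ t x, 0 ≤ H t x
  H_int : Integrable (fun p : 𝕏 => H p.1 p.2) (Ω T)
  sq_le : ∀ t x, (J t x + 1 / 2 * V t x) ^ 2 ≤ R t x * H t x

namespace Tot
variable {T : ℝ} {R J V H : 𝔽} (h : Tot T R J V H)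
include h

lemma abs_integral {t : ℝ} (ht : t ∈ Icc 0 T) : ∫ x, |R t x| = 1 := by
  simp only [abs_of_nonneg (h.nonneg t _)]
  exact h.mass t ht

/-- The mollified total density is bounded. -/
lemma exists_cv_bound {f : 𝕊} (hf : Continuous f) :
    ∃ C, 0 ≤ C ∧ ∀ t ∈ Icc 0 T, ∀ x, |cv f (R t) x| ≤ C := by
  obtain ⟨C, hC, hb⟩ := torus_bound hf
  refine ⟨C, hC, fun t ht x => ?_⟩
  have := abs_cv_le hf hb (h.hr.int t ht) x
  rwa [h.abs_integral ht, mul_one] at this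

lemma entropy_acd (hT : 0 < T) {κ : ℝ} (hκ : 0 < κ) (n : ℕ) :
    ACD T (fun t => ∫ x, entPrim κ (cw n (R t) x)) (fun t => ∫ x,
      (log (max (cw n (R t) x) 0 + κ) + 1) * -cv (K1 (wid n)) (J t) x) := by
  obtain ⟨h0, h1, hKc, hK1c⟩ := wid_props n
  obtain ⟨D, hD, hDb⟩ := h.exists_cv_bound hKc
  obtain ⟨D1, hD1, hDb1⟩ := torus_bound hK1c
  obtain ⟨M, hM, hMb⟩ := exists_bound_comp (entPrim_cont hκ) D
  have hFc : Continuous (entPrim κ) :=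
    continuous_iff_continuousAt.2 fun s => (entPrim_hasDerivAt hκ s).continuousAt
  refine ACD.integral hT.le (fun t ht => torus_integrable
    (hFc.comp (cv_continuous hKc (h.hr.int t ht))))
    (fun x => (h.hr.acd hT.le (K_smooth h0 h1) (K_hasTD h0 h1) x).comp
      (entPrim_hasDerivAt hκ) (entPrim_cont hκ)) ?_
  refine integrable_spaceTime_of_le (G := fun t => M * (D1 * ∫ x, |J t x|)) ?_ ?_ ?_
  · exact ((entPrim_cont hκ).measurable.comp (cv_measurable hKc.measurable h.hr.meas)).mul
      (cv_measurable hK1c.measurable h.hr.meas').neg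
  · exact ((slice_integral h.hr.int'.abs).const_mul D1).const_mul M
  · filter_upwards [ae_restrict_mem measurableSet_Icc, spaceTime_slices h.hr.int'] with t ht hJ x
    rw [abs_mul, abs_neg]
    exact mul_le_mul (hMb _ (hDb t ht x)) (abs_cv_le hK1c hDb1 hJ x) (abs_nonneg _) hM

/-- With `u`, `a`, `j`, `c` the mollifications of the density, gradient, flux and cost,
Cauchy-Schwarz for convolutions keeps the relation `(j + a/2)² ≤ u c`. Writing `j` as `-a/2` plus a
control, Young's inequality bounds `a j` by `c (u + κ) - a²/4`; the logarithm supplies `a / (u + κ)`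
after an integration by parts. -/
lemma entropy_deriv_le {κ : ℝ} (hκ : 0 < κ) (n : ℕ) : ∀ᵐ t ∂𝓛 T, (∫ x,
      (log (max (cw n (R t) x) 0 + κ) + 1) * -cv (K1 (wid n)) (J t) x) ≤
      (∫ x, H t x) - 1 / 4 * ∫ x, cv (K1 (wid n)) (R t) x ^ 2 / (cw n (R t) x + κ) := by
  obtain ⟨h0, h1, hKc, hK1c⟩ := wid_props n
  filter_upwards [ae_restrict_mem measurableSet_Icc, spaceTime_slices h.hr.int', h.wd,
    spaceTime_slices h.H_int] with t ht hJ hwd hH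
  have hRi := h.hr.int t ht
  have hu0 : ∀ x, 0 ≤ cw n (R t) x := cv_nonneg (K_nonneg h0) (h.nonneg t)
  have huκ : ∀ x, cw n (R t) x + κ ≠ 0 := fun x => by linarith [hu0 x]
  have huc := cv_continuous hKc hRi
  have hu1c := cv_continuous hK1c hRi
  have hTDu : HasTD (fun x => log (cw n (R t) x + κ) + 1)
      (fun x => (cw n (R t) x + κ)⁻¹ * cv (K1 (wid n)) (R t) x) :=
    (cv_hasTD (K_hasTD h0 h1) hK1c hRi).comp_real (F := fun s => log (s + κ) + 1)
      (F' := fun s => (s + κ)⁻¹) fun x =>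
        ((Real.hasDerivAt_log (huκ x)).comp_add_const _ κ).add_const 1
  have hibp := hTDu.integral_mul_deriv (cv_hasTD (K_hasTD h0 h1) hK1c hJ)
    ((huc.add continuous_const).inv₀ huκ |>.mul hu1c) (cv_continuous hK1c hJ)
  have e1 : ∫ x, (log (max (cw n (R t) x) 0 + κ) + 1) * -cv (K1 (wid n)) (J t) x =
      ∫ x, (cw n (R t) x + κ)⁻¹ * cv (K1 (wid n)) (R t) x * cw n (J t) x := by
    simp only [max_eq_left (hu0 _), mul_neg]
    rw [integral_neg, hibp, neg_neg]
  have hJc := cv_continuous hKc hJ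
  have hcH : ∫ x, cw n (H t) x = ∫ x, H t x := by rw [integral_cv hKc hH, integral_K h0 h1, one_mul]
  have i1 : Integrable fun x => cv (K1 (wid n)) (R t) x ^ 2 / (cw n (R t) x + κ) :=
    torus_integrable ((hu1c.pow 2).div₀ (huc.add continuous_const) huκ)
  have i2 : Integrable fun x => cw n (H t) x :=
    torus_integrable (cv_continuous hKc hH)
  rw [e1, ← hcH, ← integral_const_mul, ← integral_sub i2 (i1.const_mul _)]
  refine integral_mono (torus_integrable (((huc.add continuous_const).inv₀
    huκ |>.mul hu1c).mul hJc)) (i2.sub (i1.const_mul _)) fun x => ?_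
  simp only
  have hG2 := cv_sq_le (f := K (wid n)) (c := fun x => J t x + 1 / 2 * V t x) hKc (K_nonneg h0) hRi hH
    (h.nonneg t) (h.H_nonneg t) (.of_forall (h.sq_le t)) x
  rw [cv_add hKc hJ (hwd.int'.const_mul _), cv_const_mul, ← hwd.eq] at hG2
  set u := cw n (R t) x with hu
  set a := cv (K1 (wid n)) (R t) x with ha
  set j := cw n (J t) x with hj
  set c := cw n (H t) x with hc
  have hu' : 0 < u + κ := by linarith [hu0 x]
  have hc0 : 0 ≤ c := cv_nonneg (K_nonneg h0) (h.H_nonneg t) x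
  have h3 : (j + 1 / 2 * a) ^ 2 ≤ (u + κ) * c := hG2.trans (by nlinarith)
  have h4 : (u + κ)⁻¹ * a * j = (a * j) / (u + κ) := by field_simp
  have h5 : c - 1 / 4 * (a ^ 2 / (u + κ)) = (c * (u + κ) - 1 / 4 * a ^ 2) / (u + κ) := by field_simp
  rw [h4, h5]
  refine div_le_div_of_nonneg_right ?_ hu'.le
  nlinarith [sq_nonneg (j + 1 / 2 * a - 1 / 2 * a)]

end Tot


/-- The relative entropy of the density `f` is at most `A`, in dual form. -/
def DV (A : ℝ) (f : 𝕊) : Prop :=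
  ∀ ξ : 𝕊, Continuous ξ → ∫ x, ξ x * f x ≤ A + log (∫ x, exp (ξ x))

/-- Legendre duality between `s log s - s` and the exponential. -/
lemma mul_le_entropy {s : ℝ} (hs : 0 < s) (a : ℝ) : s * a ≤ s * log s - s + exp a := by
  have h1 := Real.add_one_le_exp (a - log s)
  rw [Real.exp_sub, exp_log hs, le_div_iff₀ hs] at h1
  linarith

lemma torus_integral_exp_pos {ξ : 𝕊} (hξ : Continuous ξ) : 0 < ∫ x, exp (ξ x) :=
  integral_exp_pos (torus_integrable (Real.continuous_exp.comp hξ))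

/-- Jensen's inequality for mollification. -/
lemma exp_cv_le {ξ : 𝕊} (hξ : Continuous ξ) {ε : ℝ} (h0 : 0 < ε) (h1 : ε ≤ 1 / 8)
    (x : Torus) : exp (cv (K ε) ξ x) ≤ cv (K ε) (fun z => exp (ξ z)) x := by
  have hKc := K_continuous h0 h1
  have hi := torus_integrable hξ
  have he := torus_integrable (Real.continuous_exp.comp hξ)
  set M := cv (K ε) ξ x with hM
  have h2 : cv (K ε) (fun z => exp M * (1 - M) + exp M * ξ z) x ≤
      cv (K ε) (fun z => exp (ξ z)) x := by
    refine cv_mono hKc (K_nonneg h0) ((integrable_const _).add (hi.const_mul _)) he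
      (.of_forall fun z => ?_) x
    -- The tangent line of the exponential at the mollified value `M` lies below its graph.
    have := Real.add_one_le_exp (ξ z - M)
    rw [Real.exp_sub, le_div_iff₀ (exp_pos M)] at this
    simp only [Pi.add_apply, Function.comp_apply]
    linarith
  rw [cv_add hKc (integrable_const _) (hi.const_mul _), cv_const_mul (exp M) (K ε) ξ, ← hM] at h2
  have h3 : cv (K ε) (fun _ => exp M * (1 - M)) x = exp M * (1 - M) := by
    rw [cv, integral_mul_const, integral_K_sub h0 h1, one_mul]
  rw [h3] at h2
  linarith

/-- The even kernel is moved onto the test function, and Jensen's inequality shows that this does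
not increase its exponential integral. -/
lemma DV.mollify {A : ℝ} {f : 𝕊} (h : DV A f) (hf : Integrable f) {ε : ℝ} (h0 : 0 < ε)
    (h1 : ε ≤ 1 / 8) : DV A (cv (K ε) f) := fun ξ hξ => by
  have hKc := K_continuous h0 h1
  have hi := torus_integrable hξ
  have hec : Continuous fun x => exp (ξ x) := Real.continuous_exp.comp hξ
  rw [integral_mul_cv_even hKc K_neg hf hi]
  refine (h _ (cv_continuous hKc hi)).trans (add_le_add le_rfl
    (Real.log_le_log (torus_integral_exp_pos (cv_continuous hKc hi)) ?_))
  have h2 := integral_mono (torus_integrable (Real.continuous_exp.comp (cv_continuous hKc hi)))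
    (torus_integrable (cv_continuous hKc (torus_integrable hec)))
    fun x => exp_cv_le hξ h0 h1 x
  rwa [integral_cv hKc (torus_integrable hec), integral_K h0 h1, one_mul] at h2

lemma cv_wid_tendsto_L1_spaceTime {T : ℝ} {f : 𝔽} (hf : Measurable fun p : 𝕏 => f p.1 p.2)
    (hi : Integrable (fun p : 𝕏 => f p.1 p.2) (Ω T)) :
    (∀ n, Integrable (fun p : 𝕏 => cw n (f p.1) p.2) (Ω T)) ∧
    Tendsto (fun n => ∫ p, |cw n (f p.1) p.2 - f p.1 p.2| ∂Ω T) atTop (𝓝 0) := by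
  have hint : ∀ n, Integrable (fun p : 𝕏 => cw n (f p.1) p.2) (Ω T) := by
    intro n
    obtain ⟨C, _, hb⟩ := torus_bound (Kw_continuous n)
    refine integrable_spaceTime_of_le (cv_measurable (Kw_continuous n).measurable hf)
      ((slice_integral hi.abs).const_mul C) ?_
    filter_upwards [spaceTime_slices hi] with t ht x
    exact abs_cv_le (Kw_continuous n) hb ht x
  refine ⟨hint, ?_⟩
  have e1 : ∀ n, ∫ p, |cw n (f p.1) p.2 - f p.1 p.2| ∂Ω T =
      ∫ t in Icc 0 T, ∫ x, |cw n (f t) x - f t x| := fun n =>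
    integral_spaceTime ((hint n).sub hi).abs
  simp only [e1]
  have key : Tendsto (fun n => ∫ t in Icc 0 T, ∫ x, |cw n (f t) x - f t x|) atTop
      (𝓝 (∫ _ in Icc 0 T, (0 : ℝ))) := ?_
  · rwa [integral_zero] at key
  refine tendsto_integral_of_dominated_convergence (fun t => 2 * ∫ x, |f t x|)
    (fun n => (slice_integral ((hint n).sub hi).abs).aestronglyMeasurable)
    ((slice_integral hi.abs).const_mul 2) (fun n => ?_) ?_
  · filter_upwards [spaceTime_slices hi] with t ht
    rw [norm_eq_abs, abs_of_nonneg (integral_nonneg fun _ => abs_nonneg _)]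
    have h1 := integral_mono ((cv_wid_integrable ht n).sub ht).abs
      ((cv_wid_integrable ht n).abs.add ht.abs) fun x => abs_sub _ _
    rw [integral_add' (cv_wid_integrable ht n).abs ht.abs] at h1
    have h2 := integral_abs_cv_K_le (wid_pos n) (wid_le n) ht
    simp only [Pi.sub_apply] at h1
    linarith
  · filter_upwards [spaceTime_slices hi] with t ht using cv_K_tendsto_L1 ht

namespace Tot
variable {T : ℝ} {R J V H : 𝔽} (h : Tot T R J V H)
include h

lemma integral_cv_eq_one (n : ℕ) {t : ℝ} (ht : t ∈ Icc 0 T) : ∫ x, cw n (R t) x = 1 := by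
  rw [integral_cv (Kw_continuous n) (h.hr.int t ht), h.mass t ht, integral_Kw n, one_mul]

lemma integral_entPrim {κ : ℝ} (hκ : 0 < κ) (n : ℕ) {t : ℝ} (ht : t ∈ Icc 0 T) :
    ∫ x, entPrim κ (cw n (R t) x) = (∫ x, (cw n (R t) x + κ) *
      log (cw n (R t) x + κ)) - κ * log κ := by
  have hu0 : ∀ x, 0 ≤ cw n (R t) x := cv_nonneg (Kw_nonneg n) (h.nonneg t)
  have huc := cv_continuous (Kw_continuous n) (h.hr.int t ht)
  simp only [entPrim_eq hκ (hu0 _)]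
  rw [integral_sub, integral_const]
  · simp
  · exact torus_integrable ((huc.add continuous_const).mul
      ((huc.add continuous_const).log fun x => (add_pos_of_nonneg_of_pos (hu0 x) hκ).ne'))
  · exact integrable_const _

/-- Duality at `s = u + κ` and `a = ξ - L`, integrated: the normalization `L` makes `exp (ξ - L)` a
probability density. -/
lemma le_integral_entropy {κ : ℝ} (hκ : 0 < κ) (n : ℕ) {t : ℝ} (ht : t ∈ Icc 0 T)
    {ξ : 𝕊} (hξ : Continuous ξ) :
    (∫ x, ξ x * cw n (R t) x) + κ * (∫ x, ξ x) - (1 + κ) * log (∫ x, exp (ξ x)) + κ ≤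
    ∫ x, (cw n (R t) x + κ) * log (cw n (R t) x + κ) := by
  have hu0 : ∀ x, 0 ≤ cw n (R t) x := cv_nonneg (Kw_nonneg n) (h.nonneg t)
  have huc := cv_continuous (Kw_continuous n) (h.hr.int t ht)
  have hm := h.integral_cv_eq_one n ht
  set u := cw n (R t) with hu
  have hpos := torus_integral_exp_pos hξ
  set L := log (∫ x, exp (ξ x)) with hL
  have i1 : Integrable fun x => ξ x * u x := torus_integrable (hξ.mul huc)
  have i2 : Integrable fun x => ξ x := torus_integrable hξ
  have i3 : Integrable u := torus_integrable huc
  have i4 : Integrable fun x => (u x + κ) * log (u x + κ) :=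
    torus_integrable ((huc.add continuous_const).mul
      ((huc.add continuous_const).log fun x => (add_pos_of_nonneg_of_pos (hu0 x) hκ).ne'))
  have i5 : Integrable fun x => exp (ξ x) :=
    torus_integrable (Real.continuous_exp.comp hξ)
  have h1 : ∫ x, ((ξ x * u x + κ * ξ x) + (1 - L) * u x + (1 - L) * κ) ≤
      ∫ x, ((u x + κ) * log (u x + κ) + exp (-L) * exp (ξ x)) := by
    refine integral_mono (((i1.add (i2.const_mul κ)).add (i3.const_mul _)).add (integrable_const _))
      (i4.add (i5.const_mul _)) fun x => ?_
    have h2 := mul_le_entropy (s := u x + κ) (by linarith [hu0 x]) (-L + ξ x)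
    rw [Real.exp_add] at h2
    simp only
    linarith
  have j1 : Integrable fun x => ξ x * u x + κ * ξ x := i1.add (i2.const_mul κ)
  have j2 : Integrable fun x => (ξ x * u x + κ * ξ x) + (1 - L) * u x := j1.add (i3.const_mul _)
  have j3 : Integrable fun x => κ * ξ x := i2.const_mul κ
  have j4 : Integrable fun x => (1 - L) * u x := i3.const_mul _
  have j5 : Integrable fun x => exp (-L) * exp (ξ x) := i5.const_mul _
  rw [integral_add j2 (integrable_const _), integral_add j1 j4, integral_add i1 j3,
    integral_add i4 j5, integral_const_mul, integral_const_mul, integral_const_mul,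
    integral_const_mul, hm, integral_const, Real.exp_neg, hL, exp_log hpos, inv_mul_cancel₀ hpos.ne', ← hL] at h1
  simp only [probReal_univ, one_smul] at h1
  linarith

/-- The dual bound is tested with `log (u + κ)`, whose exponential has integral `1 + κ`. The
mollified density is bounded away from zero by `κ`, so this test function is admissible. -/
lemma integral_entropy_zero_le {A κ : ℝ} (hA : DV A (R 0)) (hT : 0 ≤ T) (hκ : 0 < κ) (n : ℕ) :
    ∫ x, (cw n (R 0) x + κ) * log (cw n (R 0) x + κ) ≤ A + κ + κ ^ 2 := by
  have ht : (0 : ℝ) ∈ Icc 0 T := ⟨le_rfl, hT⟩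
  have hu0 : ∀ x, 0 ≤ cw n (R 0) x := cv_nonneg (Kw_nonneg n) (h.nonneg 0)
  have huc := cv_continuous (Kw_continuous n) (h.hr.int 0 ht)
  have hm := h.integral_cv_eq_one n ht
  have hdv := hA.mollify (h.hr.int 0 ht) (wid_pos n) (wid_le n)
  set u := cw n (R 0) with hu
  have hlc : Continuous fun x => log (u x + κ) :=
    (huc.add continuous_const).log fun x => (add_pos_of_nonneg_of_pos (hu0 x) hκ).ne'
  have h1 := hdv _ hlc
  have i3 : Integrable u := torus_integrable huc
  have e1 : ∫ x, exp (log (u x + κ)) = 1 + κ := by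
    simp only [fun x => exp_log (add_pos_of_nonneg_of_pos (hu0 x) hκ)]
    rw [integral_add i3 (integrable_const _), hm, integral_const]
    simp
  rw [e1] at h1
  have h2 : log (1 + κ) ≤ κ := by
    have := Real.log_le_sub_one_of_pos (show 0 < 1 + κ by linarith)
    linarith
  have h3 : ∫ x, κ * log (u x + κ) ≤ ∫ x, κ * (u x + (κ - 1)) := by
    refine integral_mono ((torus_integrable hlc).const_mul _)
      ((i3.add (integrable_const _)).const_mul _) fun x => ?_
    have := Real.log_le_sub_one_of_pos (show 0 < u x + κ by linarith [hu0 x])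
    exact mul_le_mul_of_nonneg_left (by linarith) hκ.le
  rw [integral_const_mul κ (fun x => u x + (κ - 1)), integral_add i3 (integrable_const _), hm,
    integral_const] at h3
  simp only [probReal_univ, one_smul] at h3
  have e2 : ∫ x, (u x + κ) * log (u x + κ) = (∫ x, log (u x + κ) * u x) +
      ∫ x, κ * log (u x + κ) := by
    have j1 : Integrable fun x => log (u x + κ) * u x :=
      torus_integrable (hlc.mul huc)
    have j2 : Integrable fun x => κ * log (u x + κ) :=
      (torus_integrable hlc).const_mul _
    rw [← integral_add j1 j2]
    refine integral_congr_ae (.of_forall fun x => ?_)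
    simp only
    ring
  rw [e2]
  nlinarith

lemma fisher_integrable {κ : ℝ} (hκ : 0 < κ) (n : ℕ) :
    Integrable (fun p : 𝕏 => cv (K1 (wid n)) (R p.1) p.2 ^ 2 / (cw n (R p.1) p.2 + κ)) (Ω T) := by
  obtain ⟨h0, h1, hKc, hK1c⟩ := wid_props n
  obtain ⟨D1, hD1, hDb1⟩ := h.exists_cv_bound hK1c
  refine integrable_spaceTime_of_le (G := fun _ => D1 ^ 2 / κ) ?_ (integrable_const _) ?_
  · exact ((cv_measurable hK1c.measurable h.hr.meas).pow_const 2).div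
      ((cv_measurable hKc.measurable h.hr.meas).add_const κ)
  · filter_upwards [ae_restrict_mem measurableSet_Icc] with s hs x
    have hu0 : 0 ≤ cw n (R s) x := cv_nonneg (K_nonneg h0) (h.nonneg s) x
    rw [abs_of_nonneg (by positivity)]
    have := sq_le_sq' (abs_le.1 (hDb1 s hs x)).1 (abs_le.1 (hDb1 s hs x)).2
    exact div_le_div₀ (sq_nonneg _) this hκ (by linarith)

lemma entropy_balance (hT : 0 < T) {κ : ℝ} (hκ : 0 < κ) (n : ℕ) {t : ℝ} (ht : t ∈ Icc 0 T) :
    (∫ x, (cw n (R t) x + κ) * log (cw n (R t) x + κ)) +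
      1 / 4 * (∫ s in (0 : ℝ)..t, ∫ x, cv (K1 (wid n)) (R s) x ^ 2 / (cw n (R s) x + κ)) ≤
    (∫ x, (cw n (R 0) x + κ) * log (cw n (R 0) x + κ)) + ∫ p, H p.1 p.2 ∂Ω T := by
  obtain ⟨h0, h1, hKc, hK1c⟩ := wid_props n
  have hacd := h.entropy_acd hT hκ n
  have e1 := (hacd.mono ht).sub_eq
  rw [h.integral_entPrim hκ n ht, h.integral_entPrim hκ n ⟨le_rfl, hT.le⟩] at e1
  have hsub : uIcc 0 t ⊆ uIcc 0 T := by
    rw [uIcc_of_le ht.1, uIcc_of_le hT.le]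
    exact Icc_subset_Icc_right ht.2
  have hiH := intervalIntegrable_slice hT.le h.H_int
  have hq := h.fisher_integrable hκ n
  have hiq := intervalIntegrable_slice hT.le hq
  have h2 : (∫ s in (0 : ℝ)..t, ∫ x, (log (max (cw n (R s) x) 0 + κ) + 1) *
      -cv (K1 (wid n)) (J s) x) ≤ ∫ s in (0 : ℝ)..t, ((∫ x, H s x) - 1 / 4 * ∫ x,
        cv (K1 (wid n)) (R s) x ^ 2 / (cw n (R s) x + κ)) := by
    refine intervalIntegral.integral_mono_ae_restrict ht.1
      (hacd.intervalIntegrable.mono_set hsub) ((hiH.sub (hiq.const_mul _)).mono_set hsub) ?_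
    exact ae_mono (Measure.restrict_mono (Icc_subset_Icc_right ht.2) le_rfl)
      (h.entropy_deriv_le hκ n)
  have hiH' : IntervalIntegrable (fun s => ∫ x, H s x) volume 0 t := hiH.mono_set hsub
  have hiq' : IntervalIntegrable (fun s => 1 / 4 * ∫ x,
        cv (K1 (wid n)) (R s) x ^ 2 / (cw n (R s) x + κ)) volume 0 t :=
    (hiq.const_mul _).mono_set hsub
  rw [intervalIntegral.integral_sub hiH' hiq', intervalIntegral.integral_const_mul] at h2
  have h3 : (∫ s in (0 : ℝ)..t, ∫ x, H s x) ≤ ∫ p, H p.1 p.2 ∂Ω T := by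
    rw [integral_spaceTime h.H_int, integral_Icc_eq hT.le]
    exact integral_mono_interval le_rfl ht.1 ht.2
      (.of_forall fun s => integral_nonneg (h.H_nonneg s)) hiH
  linarith

/-- Propagation of the entropy bound. -/
lemma dv (hT : 0 < T) {A : ℝ} (hA : DV A (R 0)) {t : ℝ} (ht : t ∈ Icc 0 T) :
    DV (A + ∫ p, H p.1 p.2 ∂Ω T) (R t) := fun ξ hξ => by
  obtain ⟨C, _, hC⟩ := torus_bound hξ
  set L := log (∫ x, exp (ξ x)) with hL
  -- The shift `κ` is taken equal to the width of the mollifier, so that both regularizations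
  -- disappear in a single limit. The Fisher term is nonnegative and dropped.
  have h1 : ∀ n, (∫ x, ξ x * cw n (R t) x) + wid n * (∫ x, ξ x) - (1 + wid n) * L ≤
      A + wid n ^ 2 + ∫ p, H p.1 p.2 ∂Ω T := fun n => by
    have h2 := h.le_integral_entropy (wid_pos n) n ht hξ
    have h3 := h.entropy_balance hT (wid_pos n) n ht
    have h4 := h.integral_entropy_zero_le hA hT.le (wid_pos n) n
    have h5 : 0 ≤ ∫ s in (0 : ℝ)..t, ∫ x, cv (K1 (wid n)) (R s) x ^ 2 / (cw n (R s) x + wid n) :=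
      intervalIntegral.integral_nonneg_of_forall ht.1 fun s => integral_nonneg fun x =>
        div_nonneg (sq_nonneg _)
          (add_nonneg (cv_nonneg (Kw_nonneg n) (h.nonneg s) x) (wid_pos n).le)
    linarith
  have hi := h.hr.int t ht
  have t1 := tendsto_integral_mul_of_L1 hξ.aestronglyMeasurable (.of_forall hC)
    (cv_wid_integrable hi) hi (cv_K_tendsto_L1 hi)
  have t2 := (t1.add (wid_tendsto.mul_const (∫ x, ξ x))).sub ((wid_tendsto.const_add 1).mul_const L)
  have t3 := ((wid_tendsto.pow 2).const_add A).add_const (∫ p, H p.1 p.2 ∂Ω T)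
  have h2 := le_of_tendsto_of_tendsto' t2 t3 h1
  simp only [zero_mul, add_zero, one_mul, ne_eq, OfNat.ofNat_ne_zero, not_false_eq_true,
    zero_pow] at h2
  linarith

lemma intR : Integrable (fun p : 𝕏 => R p.1 p.2) (Ω T) := by
  refine (integrable_prod_iff h.hr.meas.aestronglyMeasurable).2 ⟨?_, ?_⟩
  · filter_upwards [ae_restrict_mem measurableSet_Icc] with t ht using h.hr.int t ht
  · refine (integrable_const (1 : ℝ)).congr ?_
    filter_upwards [ae_restrict_mem measurableSet_Icc] with t ht
    exact (h.abs_integral ht).symm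

/-- The Fisher information of the total density. -/
lemma lintegral_fisher_le (hT : 0 < T) {A : ℝ} (hA : DV A (R 0)) :
    ∫⁻ p, ofReal (V p.1 p.2 ^ 2 / R p.1 p.2) ∂Ω T ≤ ofReal (4 * (A + 1 + ∫ p, H p.1 p.2 ∂Ω T)) := by
  have hb : ∀ n, ∫⁻ p, ofReal (cv (K1 (wid n)) (R p.1) p.2 ^ 2 / (cw n (R p.1) p.2 + wid n)) ∂Ω T ≤
      ofReal (4 * (A + 1 + ∫ p, H p.1 p.2 ∂Ω T)) := fun n => by
    have hi := h.fisher_integrable (wid_pos n) n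
    rw [← ofReal_integral_eq_lintegral_ofReal hi (.of_forall fun p =>
      div_nonneg (sq_nonneg _) (add_nonneg (cv_nonneg (Kw_nonneg n) (h.nonneg p.1) p.2)
        (wid_pos n).le))]
    refine ofReal_le_ofReal ?_
    have h2 := h.le_integral_entropy (wid_pos n) n ⟨hT.le, le_rfl⟩ (ξ := fun _ => 0)
      continuous_const
    have h3 := h.entropy_balance hT (wid_pos n) n ⟨hT.le, le_rfl⟩
    have h4 := h.integral_entropy_zero_le hA hT.le (wid_pos n) n
    simp only [zero_mul, integral_zero, Real.exp_zero, integral_const, probReal_univ, one_smul,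
      Real.log_one, mul_zero] at h2
    rw [← integral_Icc_eq hT.le, ← integral_spaceTime hi] at h3
    nlinarith [wid_pos n, wid_le n]
  obtain ⟨iR, tR⟩ := cv_wid_tendsto_L1_spaceTime h.hr.meas h.intR
  obtain ⟨iV, tV⟩ := cv_wid_tendsto_L1_spaceTime h.measV h.intV
  obtain ⟨ns, hns, hR⟩ := exists_subseq_tendsto_ae iR h.intR tR
  obtain ⟨ms, hms, hV⟩ := exists_subseq_tendsto_ae (fun n => iV (ns n)) h.intV
    (tV.comp hns.tendsto_atTop)
  have hwt : Tendsto (fun n => wid (ns (ms n))) atTop (𝓝 0) :=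
    wid_tendsto.comp (hns.comp hms).tendsto_atTop
  have hEq : ∀ᵐ p ∂Ω T, ∀ n x, cv (K1 (wid n)) (R p.1) x = cw n (V p.1) x := by
    unfold spaceTime
    refine Measure.quasiMeasurePreserving_fst.ae
      (p := fun t => ∀ n x, cv (K1 (wid n)) (R t) x = cw n (V t) x) ?_
    filter_upwards [h.wd] with t ht n x using ht.eq n x
  -- Where the density vanishes the left side is zero by the convention for division, so there is
  -- nothing to prove; elsewhere the quotients converge.
  have hlim : ∀ᵐ p ∂Ω T, ofReal (V p.1 p.2 ^ 2 / R p.1 p.2) ≤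
      liminf (fun n => ofReal (cv (K1 (wid (ns (ms n)))) (R p.1) p.2 ^ 2 /
      (cw (ns (ms n)) (R p.1) p.2 + wid (ns (ms n))))) atTop := by
    filter_upwards [hR, hV, hEq] with p h1 h2 h3
    simp only [h3]
    rcases (h.nonneg p.1 p.2).eq_or_lt with h0 | h0
    · rw [← h0]
      simp
    · have t1 := ((h2.pow 2).div ((h1.comp hms.tendsto_atTop).add hwt)
        (by rw [add_zero]; exact h0.ne'))
      rw [add_zero] at t1
      exact ((ENNReal.continuous_ofReal.tendsto _).comp t1).liminf_eq.ge
  have hm : ∀ n, Measurable fun p : 𝕏 => ofReal (cv (K1 (wid (ns (ms n)))) (R p.1) p.2 ^ 2 /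
      (cw (ns (ms n)) (R p.1) p.2 + wid (ns (ms n)))) := fun n =>
    (((cv_measurable (K1_continuous (wid_pos _) (wid_le _)).measurable h.hr.meas).pow_const 2).div
      ((cv_measurable (K_continuous (wid_pos _) (wid_le _)).measurable
        h.hr.meas).add_const _)).ennreal_ofReal
  refine (lintegral_mono_ae hlim).trans ((lintegral_liminf_le hm).trans ?_)
  exact liminf_le_of_le (by isBoundedDefault) fun b hb' => by
    obtain ⟨n, hn⟩ := hb'.exists
    exact hn.trans (hb _)

end Tot


/-! ### The a priori bound on the energy -/

lemma DV.nonneg {A : ℝ} {f : 𝕊} (h : DV A f) : 0 ≤ A := by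
  have := h (fun _ => 0) continuous_const
  simpa using this

namespace Controlled
variable {m : ℕ} {T lam : ℝ} {ρ v : Fin m → 𝔽} {g : Option (Fin m) → 𝕏 → ℝ}
  (h : Controlled T lam ρ v g)
include h

lemma tot (hlam : 0 < lam) (hT : 0 ≤ T) : Tot T (fun t x => ∑ c, ρ c t x)
    (fun t x => ∑ i, fluxJ lam (fun c => ρ c t x) (fun c => v c t x) (fun k => g k (t, x)) i)
    (fun t x => ∑ c, v c t x) (fun t x => ∑ k, g k (t, x) ^ 2) := by
  refine ⟨h.transport_tot hT, fun t x => tot_nonneg hlam fun c => h.nonneg c t x, h.mass,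
    measurable_usum h.meas',
    integrable_finsetSum _ fun c _ => (h.wg c).integrable_gradient, h.wd_tot,
    fun t x => cost_nonneg g (t, x), h.cost_int, fun t x => ?_⟩
  rw [sum_fluxJ hlam (fun c => h.nonneg c t x) fun c => h.zero c t x]
  refine le_trans (le_of_eq ?_) (sq_sum_control_le hlam (fun c => h.nonneg c t x)
    fun k => g k (t, x))
  congr 1
  ring

/-- The a priori bound on the energy. -/
lemma energy_le (hlam : 0 < lam) (hT : 0 < T) {A : ℝ} (hA : DV A fun x => ∑ c, ρ c 0 x) :
    ∫ p, energyR lam ρ⟪p⟫ v⟪p⟫ ∂Ω T ≤ 4 * (A + 1 + ∫ p, ∑ k, g k p ^ 2 ∂Ω T) +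
        m * (32 + 16 * ∫ p, ∑ k, g k p ^ 2 ∂Ω T) := by
  have hH : 0 ≤ ∫ p, ∑ k, g k p ^ 2 ∂Ω T := integral_nonneg (cost_nonneg g)
  have hA0 := hA.nonneg
  have h1 := (h.tot hlam hT.le).lintegral_fisher_le hT hA
  have h2 := h.lintegral_colors_le hlam hT
  rw [← ENNReal.ofReal_le_ofReal_iff (by positivity), ofReal_add (by positivity)
    (by positivity), ofReal_integral_eq_lintegral_ofReal h.energy (.of_forall fun p =>
      energyR_nonneg hlam (fun c => h.nonneg c _ _) _)]
  refine le_trans ?_ (add_le_add h1 h2)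
  have hm : Measurable fun p : 𝕏 =>
      ofReal ((∑ c, v c p.1 p.2) ^ 2 / ∑ c, ρ c p.1 p.2) :=
    (((measurable_usum h.meas').pow_const 2).div (measurable_usum h.meas)).ennreal_ofReal
  rw [← lintegral_add_left hm]
  refine lintegral_mono fun p => ?_
  have hr := fun c => h.nonneg c p.1 p.2
  have hv := fun c => h.zero c p.1 p.2
  have hpos := lam_tot_pos hlam hr
  rw [← ofReal_add (div_nonneg (sq_nonneg _) (tot_nonneg hlam hr))
    (sum_nonneg fun i _ => by have := hr i; positivity)]
  refine ofReal_le_ofReal ?_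
  rcases (tot_nonneg hlam hr).eq_or_lt with h0 | h0
  · have hv0 : ∀ c, v c p.1 p.2 = 0 := fun c =>
      hv c (le_antisymm ((le_tot hlam hr c).trans h0.ge) (hr c))
    simp [energyR, hv0]
  · exact (energyR_eq hlam hr hv h0).le

end Controlled

/-- The hypothesis `Reg` contains finiteness of the energy, which only serves to justify the chain
rule. The resulting bound depends on the number of colors, the initial entropy and the dynamic rate
alone, hence is uniform along a sequence. -/
lemma Reg.energy_le {m : ℕ} {T lam : ℝ} {ρ v : Fin m → 𝔽} (h : Reg T lam ρ v)
    (hlam : 0 < lam) (hT : 0 < T) {b : ℝ} (hb0 : 0 ≤ b) (hb : ∀ φ, dynFunctional T lam ρ v φ ≤ b)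
    {A : ℝ} (hA : DV A fun x => ∑ c, ρ c 0 x) :
    ∫ p, energyR lam ρ⟪p⟫ v⟪p⟫ ∂Ω T ≤ 4 * (A + 1 + 2 * b) + m * (32 + 32 * b) ∧
    ∀ t ∈ Icc 0 T, DV (A + 2 * b) fun x => ∑ c, ρ c t x := by
  obtain ⟨g, hg, hgb⟩ := h.exists_controlled hlam hT.le hb0 hb
  refine ⟨(hg.energy_le hlam hT hA).trans ?_, fun t ht ξ hξ => ?_⟩
  · have : (0 : ℝ) ≤ m := Nat.cast_nonneg m
    nlinarith
  · have := (hg.tot hlam hT.le).dv hT hA ht ξ hξ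
    linarith

/-! ### The rate function of the initial condition -/

/-- Integral of a function against the total measure of a vector of measures. -/
noncomputable def pairing {m : ℕ} (ξ : 𝕊) (ν : ColorMeasure m) : ℝ :=
  ∑ c, ∫ x, ξ x ∂(ν c : Measure Torus)

lemma continuous_integral_finiteMeasure {ξ : 𝕊} (hξ : Continuous ξ) :
    Continuous fun ν : FiniteMeasure Torus => ∫ x, ξ x ∂(ν : Measure Torus) := by
  rw [continuous_iff_continuousAt]
  intro ν
  exact (FiniteMeasure.tendsto_iff_forall_integral_tendsto.1 tendsto_id)
    (BoundedContinuousFunction.mkOfCompact ⟨ξ, hξ⟩)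

lemma continuous_pairing {m : ℕ} {ξ : 𝕊} (hξ : Continuous ξ) :
    Continuous (pairing ξ : ColorMeasure m → ℝ) :=
  continuous_finsetSum _ fun c _ => (continuous_integral_finiteMeasure hξ).comp (continuous_apply c)

lemma integrable_finiteMeasure {ξ : 𝕊} (hξ : Continuous ξ) (ν : Measure Torus)
    [IsFiniteMeasure ν] : Integrable ξ ν := by
  obtain ⟨C, _, hb⟩ := torus_bound hξ
  exact Integrable.of_bound hξ.aestronglyMeasurable C (.of_forall hb)

lemma pairing_empiricalColor {m N : ℕ} (hN : 0 < N) (color : Fin N → Fin m) {ξ : 𝕊}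
    (hξ : Continuous ξ) (x : Fin N → Torus) :
    N * pairing ξ (empiricalColor color x) = ∑ i, ξ (x i) := by
  have h1 : ∀ c, ∫ z, ξ z ∂(empiricalColor color x c : Measure Torus) =
      (N : ℝ)⁻¹ * ∑ i ∈ univ.filter (fun i => color i = c), ξ (x i) := fun c => by
    have e : (empiricalColor color x c : Measure Torus) = (N : ℝ≥0)⁻¹ •
        ∑ i ∈ univ.filter (fun i => color i = c), Measure.dirac (x i) := by
      rw [empiricalColor, FiniteMeasure.toMeasure_smul, FiniteMeasure.toMeasure_sum]
      rfl
    rw [e, integral_smul_nnreal_measure, integral_finsetSum_measure]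
    · simp only [integral_dirac, NNReal.smul_def, smul_eq_mul]
      push_cast
      rfl
    · exact fun i _ => integrable_finiteMeasure hξ _
  have hN' : (N : ℝ) ≠ 0 := Nat.cast_ne_zero.2 hN.ne'
  simp only [pairing, h1]
  rw [← mul_sum, ← mul_assoc, mul_inv_cancel₀ hN', one_mul, Finset.sum_fiberwise]


section
variable {ρ₀ : 𝕊} (hm : Measurable ρ₀) (h0 : ∀ x, 0 ≤ ρ₀ x) (hprob : ∫ x, ρ₀ x = 1)
include hm h0 hprob

lemma integrable_of_integral_eq_one : Integrable ρ₀ := by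
  by_contra hcon
  rw [integral_undef hcon] at hprob
  exact zero_ne_one hprob

lemma isProbabilityMeasure_density :
    IsProbabilityMeasure (volume.withDensity fun x => ofReal (ρ₀ x)) := by
  constructor
  rw [withDensity_apply _ MeasurableSet.univ, Measure.restrict_univ,
    ← ofReal_integral_eq_lintegral_ofReal (integrable_of_integral_eq_one hm h0 hprob)
      (.of_forall h0), hprob, ENNReal.ofReal_one]

/-- Chernoff's bound for the empirical density of colors. -/
lemma initialLaw_le {C : ℝ} (hC : ∀ x, ρ₀ x ≤ C) {m N : ℕ} (hN : 0 < N) (color : Fin N → Fin m)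
    {ξ : 𝕊} (hξ : Continuous ξ) (s : ℝ) :
    initialLaw ρ₀ N (empiricalColor color ⁻¹' {ν | s < pairing ξ ν}) ≤
      ofReal (exp (N * (-s + log (C * ∫ x, exp (ξ x))))) := by
  have hP := isProbabilityMeasure_density hm h0 hprob
  have hi := integrable_of_integral_eq_one hm h0 hprob
  have hexp := torus_integral_exp_pos hξ
  have hec : Continuous fun x => exp (ξ x) := Real.continuous_exp.comp hξ
  have hCpos : 0 < C := by
    have h1 : ∫ x, ρ₀ x ≤ ∫ _ : Torus, C := integral_mono hi (integrable_const _) hC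
    rw [hprob, integral_const] at h1
    simp only [probReal_univ, one_smul] at h1
    linarith
  have hPi : IsProbabilityMeasure (initialLaw ρ₀ N) := by
    unfold initialLaw
    infer_instance
  have hF : ∫ x, ∏ i, exp (ξ (x i)) ∂(initialLaw ρ₀ N) = (∫ x, exp (ξ x) * ρ₀ x) ^ N := by
    rw [initialLaw, integral_fintype_prod_eq_pow (fun x => exp (ξ x)),
      integral_withDensity_ofReal hm h0, Fintype.card_fin]
  have hFi : Integrable (fun x : Fin N → Torus => ∏ i, exp (ξ (x i))) (initialLaw ρ₀ N) := by
    unfold initialLaw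
    exact Integrable.fintype_prod fun i => integrable_finiteMeasure hec _
  -- Boundedness of the initial density enters here: exponential moments are compared with those of
  -- Lebesgue measure, which is the reference measure of the entropy.
  have hZ : ∫ x, exp (ξ x) * ρ₀ x ≤ C * ∫ x, exp (ξ x) := by
    rw [← integral_const_mul]
    obtain ⟨D, _, hb⟩ := torus_bound hec
    refine integral_mono (hi.bdd_mul hec.aestronglyMeasurable (.of_forall hb))
      ((torus_integrable hec).const_mul _) fun x => ?_
    simp only
    rw [mul_comm C]
    exact mul_le_mul_of_nonneg_left (hC x) (exp_pos _).le
  have hM := mul_meas_ge_le_integral_of_nonneg (.of_forall fun x =>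
    Finset.prod_nonneg fun i _ => (exp_pos _).le) hFi (exp (N * s))
  rw [hF] at hM
  have hsub : empiricalColor color ⁻¹' {ν | s < pairing ξ ν} ⊆
      {x | exp (N * s) ≤ ∏ i, exp (ξ (x i))} := fun x hx => by
    rw [Set.mem_preimage, mem_ofPred_eq] at hx
    rw [mem_ofPred_eq, ← Real.exp_sum, ← pairing_empiricalColor hN color hξ x]
    gcongr
  refine (measure_mono hsub).trans ?_
  rw [← ofReal_measureReal]
  refine ofReal_le_ofReal ?_
  have h1 : (∫ x, exp (ξ x) * ρ₀ x) ^ N ≤ (C * ∫ x, exp (ξ x)) ^ N :=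
    pow_le_pow_left₀ (integral_nonneg fun x => mul_nonneg (exp_pos _).le (h0 x)) hZ N
  rw [mul_add, Real.exp_add, Real.exp_nat_mul (log _), exp_log (by positivity),
    mul_neg, Real.exp_neg, inv_mul_eq_div, le_div_iff₀ (exp_pos _), mul_comm]
  exact hM.trans h1

/-- Finite rate implies a bound on the entropy. -/
lemma pairing_le {C : ℝ} (hC : ∀ x, ρ₀ x ≤ C) {m : ℕ} (color : ∀ N : ℕ, Fin N → Fin m)
    {Iinit : ColorMeasure m → ℝ≥0∞}
    (hLDP : SatisfiesLDP (fun N => initialLaw ρ₀ N) (fun N => empiricalColor (color N)) Iinit)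
    {ν : ColorMeasure m} {k : ℝ≥0} (hν : Iinit ν ≤ k) {ξ : 𝕊} (hξ : Continuous ξ) :
    pairing ξ ν ≤ k + log (C * ∫ x, exp (ξ x)) := by
  -- For `s` below the pairing, the open half-space `{s < pairing ξ}` contains `ν`. The lower bound
  -- of the large deviation principle then gives exponential rate at least `-k`, and Chernoff's
  -- bound gives at most `-s + log (C ∫ exp ξ)`.
  refine le_of_forall_lt_imp_le_of_dense fun s hs => ?_
  have hG : IsOpen {ν : ColorMeasure m | s < pairing ξ ν} :=
    isOpen_lt continuous_const (continuous_pairing hξ)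
  have h1 := hLDP.lower_bound _ hG
  set c := -s + log (C * ∫ x, exp (ξ x)) with hc
  have h2 : ∀ᶠ N : ℕ in atTop, (((N : ℝ)⁻¹ : ℝ) : EReal) * ENNReal.log (initialLaw ρ₀ N
      (empiricalColor (color N) ⁻¹' {ν | s < pairing ξ ν})) ≤ (c : EReal) := by
    filter_upwards [eventually_gt_atTop 0] with N hN
    have h3 := ENNReal.log_le_log (initialLaw_le hm h0 hprob hC hN (color N) hξ s)
    rw [ENNReal.log_ofReal_of_pos (exp_pos _), Real.log_exp] at h3
    have hN' : (N : ℝ) ≠ 0 := Nat.cast_ne_zero.2 hN.ne'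
    have h4 : (((N : ℝ)⁻¹ : ℝ) : EReal) * ((N * c : ℝ) : EReal) = (c : EReal) := by
      rw [← EReal.coe_mul, ← mul_assoc, inv_mul_cancel₀ hN', one_mul]
    rw [← h4]
    exact mul_le_mul_of_nonneg_left h3 (EReal.coe_nonneg.2 (by positivity))
  have h3 : liminf (fun N : ℕ => (((N : ℝ)⁻¹ : ℝ) : EReal) * ENNReal.log (initialLaw ρ₀ N
      (empiricalColor (color N) ⁻¹' {ν | s < pairing ξ ν}))) atTop ≤ (c : EReal) :=
    (liminf_le_liminf h2).trans (liminf_const _).le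
  have h4 : (⨅ x ∈ {ν : ColorMeasure m | s < pairing ξ ν}, (Iinit x : EReal)) ≤ (k : EReal) := by
    refine (iInf₂_le ν hs).trans ?_
    exact_mod_cast hν
  have h5 : -((k : ℝ) : EReal) ≤ (c : EReal) := (EReal.neg_le_neg_iff.2 h4).trans (h1.trans h3)
  rw [← EReal.coe_neg, EReal.coe_le_coe_iff] at h5
  linarith

end


/-! ### Tools for limits -/

lemma testSpace_memLp {T : ℝ} {W : 𝕏 → ℝ} (hWm : Measurable W)
    (hWi : Integrable W (Ω T)) (hW0 : ∀ p, 0 ≤ W p) (φ : TestFunction) :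
    MemLp (fun p : 𝕏 => √(W p) * φ.toFun p.1 p.2) 2 (Ω T) ∧
    (∀ p, (√(W p) * φ.toFun p.1 p.2) ^ 2 = φ.toFun p.1 p.2 ^ 2 * W p) ∧
    Integrable (fun p : 𝕏 => φ.toFun p.1 p.2 ^ 2 * W p) (Ω T) := by
  obtain ⟨B, _, _, hB⟩ := spaceTime_bound (φ.continuous_toFun.pow 2) T
  have e : ∀ p, (√(W p) * φ.toFun p.1 p.2) ^ 2 = φ.toFun p.1 p.2 ^ 2 * W p := fun p => by
    rw [mul_pow, sq_sqrt (hW0 p), mul_comm]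
  have hi : Integrable (fun p : 𝕏 => φ.toFun p.1 p.2 ^ 2 * W p) (Ω T) :=
    hWi.bdd_mul (φ.continuous_toFun.pow 2).aestronglyMeasurable hB
  refine ⟨?_, e, hi⟩
  have hm : Measurable fun p : 𝕏 => √(W p) * φ.toFun p.1 p.2 :=
    hWm.sqrt.mul φ.continuous_toFun.measurable
  rw [memLp_two_iff_integrable_sq hm.aestronglyMeasurable]
  simpa only [e] using hi

/-- A function whose distributional derivative is bounded in a weighted space of square integrable
functions has a weak gradient. -/
lemma exists_weakGradient {T : ℝ} {u : 𝔽}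
    (hu : Integrable (fun p : 𝕏 => u p.1 p.2) (Ω T)) {W : 𝕏 → ℝ}
    (hWm : Measurable W) (hWi : Integrable W (Ω T)) (hW0 : ∀ p, 0 ≤ W p) {C : ℝ} (hC : 0 ≤ C)
    (hb : ∀ φ : TestFunction, (∫ p, u p.1 p.2 * φ.dx p.1 p.2 ∂Ω T) ^ 2 ≤
      C * ∫ p, φ.toFun p.1 p.2 ^ 2 * W p ∂Ω T) :
    ∃ h : 𝕏 → ℝ, Measurable h ∧ Integrable (fun p => h p ^ 2) (Ω T) ∧
      IsWeakGradient T u fun t x => √(W (t, x)) * h (t, x) := by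
  have hud : ∀ φ : TestFunction, Integrable (fun p : 𝕏 => u p.1 p.2 * φ.dx p.1 p.2)
      (Ω T) := fun φ => by
    obtain ⟨B, _, _, hB⟩ := spaceTime_bound φ.continuous_dx T
    exact hu.mul_bdd φ.continuous_dx.aestronglyMeasurable hB
  let L : testSpace →ₗ[ℝ] (Unit → 𝕏 → ℝ) :=
    { toFun := fun f _ p => √(W p) * (toTest f).toFun p.1 p.2
      map_add' := fun f g => by
        ext _ p
        simp only [toTest_toFun, Submodule.coe_add, Pi.add_apply, mul_add]
      map_smul' := fun a f => by
        ext _ p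
        simp only [toTest_toFun, Submodule.coe_smul, Pi.smul_apply, smul_eq_mul, RingHom.id_apply]
        ring }
  let l : testSpace →ₗ[ℝ] ℝ :=
    { toFun := fun f => -∫ p, u p.1 p.2 * (toTest f).dx p.1 p.2 ∂Ω T
      map_add' := fun f g => by
        simp only [toTest_dx_add, mul_add]
        rw [integral_add (hud _) (hud _)]
        ring
      map_smul' := fun a f => by
        simp only [toTest_dx_smul, RingHom.id_apply, smul_eq_mul, mul_left_comm _ a]
        rw [integral_const_mul]
        ring }
  obtain ⟨h, hm, hL, _, hl⟩ := exists_riesz_L2 (μ := Ω T) L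
    (fun f _ => (testSpace_memLp hWm hWi hW0 (toTest f)).1) l hC fun f => by
      rw [Fintype.sum_unique]
      simp only [L, l, LinearMap.coe_mk, AddHom.coe_mk, neg_sq]
      simp only [(testSpace_memLp hWm hWi hW0 (toTest f)).2.1]
      exact hb _
  have hh2 : Integrable (fun p => h () p ^ 2) (Ω T) := (hL ()).integrable_sq
  refine ⟨h (), hm (), hh2, hu, ?_, fun φ => ?_⟩
  · refine integrable_of_sq_le (hWm.sqrt.mul (hm ())).aestronglyMeasurable hWi hh2
      (.of_forall hW0) (.of_forall fun p => sq_nonneg _)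
      (.of_forall fun p => ?_)
    rw [mul_pow, sq_sqrt (hW0 p)]
  · have h1 := hl ⟨φ.toFun, φ.smooth⟩
    simp only [L, l, LinearMap.coe_mk, AddHom.coe_mk, Fintype.sum_unique] at h1
    rw [neg_eq_iff_eq_neg] at h1
    refine h1.trans ?_
    congr 1
    refine integral_congr_ae (.of_forall fun p => ?_)
    simp only [toTest_toFun]
    ring

/-- A uniform bound in space for total densities. -/
lemma exists_sup_bound {T : ℝ} {R V : 𝔽} {a e : 𝕏 → ℝ} {A : ℝ} (hA : 0 ≤ A) (hT : 0 ≤ T)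
    (hR : Measurable fun p : 𝕏 => R p.1 p.2) (hmass : ∀ t ∈ Icc 0 T, ∫ x, R t x = 1)
    (hwd : ∀ᵐ t ∂𝓛 T, WD (R t) (V t))
    (hai : ∀ t ∈ Icc 0 T, Integrable fun x => a (t, x)) (ha0 : ∀ p, 0 ≤ a p)
    (haA : ∀ t ∈ Icc 0 T, ∫ x, a (t, x) ≤ A)
    (hem : Measurable e) (hei : Integrable e (Ω T)) (he0 : ∀ p, 0 ≤ e p)
    (hsq : ∀ᵐ p ∂Ω T, V p.1 p.2 ^ 2 ≤ a p * e p) :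
    ∃ S : ℝ → ℝ, Measurable S ∧ (∀ t, 0 ≤ S t) ∧ Integrable (fun t => S t ^ 2) 𝓛 T ∧
      ∫ t in Icc 0 T, S t ^ 2 ≤ 2 * T + 2 * A * ∫ p, e p ∂Ω T ∧
      ∀ᵐ p ∂Ω T, R p.1 p.2 ≤ S p.1 := by
  have hEm : Measurable fun t => ∫ x : Torus, e (t, x) :=
    (StronglyMeasurable.integral_prod_right' (ν := (volume : Measure Torus))
      hem.stronglyMeasurable).measurable
  have hE0 : ∀ t, 0 ≤ ∫ x : Torus, e (t, x) := fun t => integral_nonneg fun x => he0 _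
  have hEi := slice_integral hei
  -- The total mass one plus a bound on `∫ |V|`, from Cauchy-Schwarz on each time slice, dominates
  -- the density.
  have hSm : Measurable fun t => 1 + √(A * ∫ x : Torus, e (t, x)) :=
    (hEm.const_mul A).sqrt.const_add 1
  have hS2 : ∀ t, (1 + √(A * ∫ x : Torus, e (t, x))) ^ 2 ≤
      2 + 2 * A * ∫ x : Torus, e (t, x) := fun t => by
    have h1 := sq_sqrt (mul_nonneg hA (hE0 t))
    nlinarith [sq_nonneg (1 - √(A * ∫ x : Torus, e (t, x)))]
  have i1 : Integrable (fun t => 2 + 2 * A * ∫ x : Torus, e (t, x)) 𝓛 T :=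
    (integrable_const _).add (hEi.const_mul _)
  have i2 : Integrable (fun t => (1 + √(A * ∫ x : Torus, e (t, x))) ^ 2) 𝓛 T := by
    refine i1.mono' (hSm.pow_const 2).aestronglyMeasurable (.of_forall fun t => ?_)
    rw [norm_eq_abs, abs_of_nonneg (sq_nonneg _)]
    exact hS2 t
  refine ⟨_, hSm, fun t => by positivity, i2, ?_, ?_⟩
  · refine (integral_mono i2 i1 hS2).trans (le_of_eq ?_)
    rw [integral_add (integrable_const _) (hEi.const_mul _), integral_const_mul,
      ← integral_spaceTime hei, integral_const]
    simp [hT, mul_comm]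
  · unfold spaceTime
    have hms : MeasurableSet {p : 𝕏 | R p.1 p.2 ≤
        1 + √(A * ∫ x : Torus, e (p.1, x))} := measurableSet_le hR (hSm.comp measurable_fst)
    rw [Measure.ae_prod_iff_ae_ae hms]
    filter_upwards [hwd, ae_restrict_mem measurableSet_Icc, ae_ae_of_ae_spaceTime hsq,
      spaceTime_slices hei] with t h1 h2 h3 h4
    have h5 := integral_abs_le_of_sq_le (hai t h2) (.of_forall fun x => ha0 _) h4
      (.of_forall fun x => he0 _) h3
    have h6 : ∫ x, |V t x| ≤ √(A * ∫ x : Torus, e (t, x)) :=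
      le_sqrt_of_sq_le (h5.trans (mul_le_mul_of_nonneg_right (haA t h2) (hE0 t)))
    filter_upwards [h1.le] with x hx
    rw [hmass t h2] at hx
    change R t x ≤ _
    linarith

/-- Products of `L¹`-null sequences with sequences bounded by square integrable functions of
time. -/
lemma tendsto_L1_mul {T : ℝ} {f d : ℕ → 𝕏 → ℝ} {S : ℕ → ℝ → ℝ} {C D : ℝ} (hD : 0 ≤ D)
    (hf : ∀ n, AEStronglyMeasurable (f n) (Ω T)) (hdm : ∀ n, Measurable (d n))
    (hd : ∀ n, Integrable (d n) (Ω T)) (hSm : ∀ n, Measurable (S n)) (hS0 : ∀ n t, 0 ≤ S n t)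
    (hSi : ∀ n, Integrable (fun t => S n t ^ 2) 𝓛 T)
    (hSC : ∀ n, ∫ t in Icc 0 T, S n t ^ 2 ≤ C)
    (hfS : ∀ n, ∀ᵐ p ∂Ω T, |f n p| ≤ S n p.1)
    (hdD : ∀ n, ∀ᵐ t ∂𝓛 T, ∫ x, |d n (t, x)| ≤ D)
    (hd0 : Tendsto (fun n => ∫ p, |d n p| ∂Ω T) atTop (𝓝 0)) :
    (∀ n, Integrable (fun p => f n p * d n p) (Ω T)) ∧
    Tendsto (fun n => ∫ p, |f n p * d n p| ∂Ω T) atTop (𝓝 0) := by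
  -- Cauchy-Schwarz with the factors `|d|`, whose integral tends to zero, and `S² |d|`, whose
  -- integral is at most `D * C` since the slices of `d` have bounded norm.
  have hsq : ∀ n, ∀ᵐ p ∂Ω T, (f n p * d n p) ^ 2 ≤ |d n p| * (S n p.1 ^ 2 * |d n p|) := by
    intro n
    filter_upwards [hfS n] with p hp
    have h1 : f n p ^ 2 ≤ S n p.1 ^ 2 := sq_le_sq' (abs_le.1 hp).1 (abs_le.1 hp).2
    rw [mul_pow, ← sq_abs (d n p)]
    nlinarith [sq_nonneg |d n p|]
  have hSd : ∀ n, Integrable (fun p : 𝕏 => S n p.1 ^ 2 * |d n p|) (Ω T) ∧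
      ∫ p, S n p.1 ^ 2 * |d n p| ∂Ω T ≤ D * C := fun n => by
    have h1 := integrable_spaceTime_of_slices (T := T) (f := fun p : 𝕏 => S n p.1 ^ 2 * |d n p|)
      (((hSm n).comp measurable_fst).pow_const 2 |>.mul (hdm n).norm) ((hSi n).const_mul D)
      (.of_forall fun t x => by positivity) (by
        filter_upwards [hdD n, spaceTime_slices (hd n)] with t h1 h2
        refine ⟨h2.abs.const_mul _, ?_⟩
        rw [integral_const_mul, mul_comm]
        exact mul_le_mul_of_nonneg_right h1 (sq_nonneg _))
    refine ⟨h1.1, h1.2.trans ?_⟩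
    rw [integral_const_mul]
    exact mul_le_mul_of_nonneg_left (hSC n) hD
  refine ⟨fun n => integrable_of_sq_le ((hf n).mul (hd n).aestronglyMeasurable) (hd n).abs (hSd n).1
    (.of_forall fun p => abs_nonneg _)
    (.of_forall fun p => by positivity) (hsq n), ?_⟩
  have h1 : ∀ n, ∫ p, |f n p * d n p| ∂Ω T ≤ √((∫ p, |d n p| ∂Ω T) * (D * C)) := fun n =>
    le_sqrt_of_sq_le ((integral_abs_le_of_sq_le (hd n).abs
      (.of_forall fun p => abs_nonneg _) (hSd n).1
      (.of_forall fun p => by positivity) (hsq n)).trans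
      (mul_le_mul_of_nonneg_left (hSd n).2 (integral_nonneg fun p => abs_nonneg _)))
  have h2 : Tendsto (fun n => √((∫ p, |d n p| ∂Ω T) * (D * C))) atTop (𝓝 0) := by
    have := (Real.continuous_sqrt.tendsto _).comp (hd0.mul_const (D * C))
    rwa [zero_mul, Real.sqrt_zero] at this
  exact squeeze_zero (fun n => integral_nonneg fun _ => abs_nonneg _) h1 h2


/-! ### Compactness and limits of regular densities -/

/-- A sequence of regular densities of bounded energy converging weakly at all times. -/
structure LimitData {m : ℕ} (T lam E : ℝ) (ρn vn : ℕ → Fin m → 𝔽)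
    (ρ : Fin m → 𝔽) : Prop where
  reg : ∀ n, Reg T lam (ρn n) (vn n)
  energy : ∀ n, ∫ p, energyR lam (fun c => ρn n c p.1 p.2) (fun c => vn n c p.1 p.2) ∂Ω T ≤ E
  meas : ∀ c, Measurable fun p : 𝕏 => ρ c p.1 p.2
  nonneg : ∀ c t x, 0 ≤ ρ c t x
  int : ∀ c, ∀ t ∈ Icc 0 T, Integrable (ρ c t)
  mass : ∀ t ∈ Icc 0 T, ∫ x, ∑ c, ρ c t x = 1
  conv : ∀ t ∈ Icc 0 T, ∀ c, ∀ ξ : 𝕊, Continuous ξ →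
    Tendsto (fun n => ∫ x, ξ x * ρn n c t x) atTop (𝓝 (∫ x, ξ x * ρ c t x))

section
variable {m : ℕ} {T lam : ℝ} {ρ : Fin m → 𝔽} (meas : ∀ c, Measurable fun p : 𝕏 => ρ c p.1 p.2)
  (nonneg : ∀ c t x, 0 ≤ ρ c t x) (int : ∀ c, ∀ t ∈ Icc 0 T, Integrable (ρ c t))
  (mass : ∀ t ∈ Icc 0 T, ∫ x, ∑ c, ρ c t x = 1)
include nonneg int mass

lemma integral_color_le_one (c : Fin m) {t : ℝ} (ht : t ∈ Icc 0 T) : ∫ x, ρ c t x ≤ 1 := by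
  refine le_of_le_of_eq ?_ (mass t ht)
  refine integral_mono (int c t ht) (integrable_finsetSum _ fun c _ => int c t ht) fun x => ?_
  exact single_le_sum (f := fun c => ρ c t x) (fun c _ => nonneg c t x) (mem_univ c)

include meas

lemma color_integrable (c : Fin m) : Integrable (fun p : 𝕏 => ρ c p.1 p.2) (Ω T) := by
  refine (integrable_spaceTime_of_slices (meas c) (integrable_const (1 : ℝ))
    (.of_forall fun t x => nonneg c t x) ?_).1
  filter_upwards [ae_restrict_mem measurableSet_Icc] with t ht
  exact ⟨int c t ht, integral_color_le_one nonneg int mass c ht⟩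

lemma tot_integrable : Integrable (fun p : 𝕏 => ∑ c, ρ c p.1 p.2) (Ω T) :=
  integrable_finsetSum _ fun c _ => color_integrable meas nonneg int mass c

/-- The weight in the bound for the gradient of one color is integrable. -/
lemma weight_integrable (hlam : 0 < lam) (hT : 0 ≤ T) {S : ℝ → ℝ} {C : ℝ} (hSm : Measurable S)
    (hS0 : ∀ t, 0 ≤ S t)
    (hSi : Integrable (fun t => S t ^ 2) 𝓛 T)
    (hSC : ∫ t in Icc 0 T, S t ^ 2 ≤ C)
    (hRS : ∀ᵐ p ∂Ω T, ∑ c, ρ c p.1 p.2 ≤ S p.1) (c : Fin m) :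
    Integrable (fun p : 𝕏 => (lam + ∑ c, ρ c p.1 p.2) * ρ c p.1 p.2 / lam) (Ω T) ∧
    ∫ p, (lam + ∑ c, ρ c p.1 p.2) * ρ c p.1 p.2 / lam ∂Ω T ≤ (lam * T + (T + C)) / lam := by
  have hR0 := fun (p : 𝕏) => tot_nonneg hlam (r := ρ⟪p⟫) fun c => nonneg c p.1 p.2
  have i0 : Integrable (fun t => 1 + S t ^ 2) 𝓛 T :=
    (integrable_const _).add hSi
  have hSi1 : Integrable S 𝓛 T := by
    refine i0.mono' hSm.aestronglyMeasurable (.of_forall fun t => ?_)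
    rw [norm_eq_abs, abs_of_nonneg (hS0 t)]
    nlinarith [sq_nonneg (S t - 1 / 2)]
  have h1 := integrable_spaceTime_of_slices (T := T) (f := fun p : 𝕏 => (lam + S p.1) * ρ c p.1 p.2)
    ((measurable_const.add (hSm.comp measurable_fst)).mul (meas c))
    (G := fun t => lam + S t) ((integrable_const _).add hSi1)
    (.of_forall fun t x => mul_nonneg (by have := hS0 t; positivity) (nonneg c t x)) (by
      filter_upwards [ae_restrict_mem measurableSet_Icc] with t ht
      refine ⟨(int c t ht).const_mul _, ?_⟩
      rw [integral_const_mul]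
      exact mul_le_of_le_one_right (by have := hS0 t; positivity)
        (integral_color_le_one nonneg int mass c ht))
  have hle : ∀ᵐ p ∂Ω T, (lam + ∑ c, ρ c p.1 p.2) * ρ c p.1 p.2 / lam ≤
      (lam + S p.1) * ρ c p.1 p.2 / lam := by
    filter_upwards [hRS] with p hp
    have := nonneg c p.1 p.2
    gcongr
  have hm : Measurable fun p : 𝕏 => (lam + ∑ c, ρ c p.1 p.2) * ρ c p.1 p.2 / lam := by fun_prop
  have hi : Integrable (fun p : 𝕏 => (lam + ∑ c, ρ c p.1 p.2) * ρ c p.1 p.2 / lam) (Ω T) := by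
    refine (h1.1.div_const lam).mono' hm.aestronglyMeasurable ?_
    filter_upwards [hle] with p hp
    have h3 := nonneg c p.1 p.2
    have h4 := hR0 p
    rwa [norm_eq_abs, abs_of_nonneg (by positivity)]
  refine ⟨hi, (integral_mono_ae hi (h1.1.div_const lam) hle).trans ?_⟩
  rw [integral_div]
  refine div_le_div_of_nonneg_right (h1.2.trans ?_) hlam.le
  rw [integral_add (integrable_const _) hSi1, integral_const]
  have h5 : ∫ t in Icc 0 T, S t ≤ ∫ t in Icc 0 T, (1 + S t ^ 2) :=
    integral_mono hSi1 i0 fun t => by nlinarith [sq_nonneg (S t - 1 / 2)]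
  rw [integral_add (integrable_const _) hSi, integral_const] at h5
  simp only [measureReal_restrict_apply_univ, Real.volume_real_Icc_of_le hT, sub_zero, smul_eq_mul,
    mul_one] at h5 ⊢
  linarith

end

lemma Reg.exists_sup {m : ℕ} {T lam : ℝ} {ρ v : Fin m → 𝔽} (h : Reg T lam ρ v)
    (hlam : 0 < lam) (hT : 0 ≤ T) {E : ℝ}
    (hE : ∫ p, energyR lam ρ⟪p⟫ v⟪p⟫ ∂Ω T ≤ E) :
    ∃ S : ℝ → ℝ, Measurable S ∧ (∀ t, 0 ≤ S t) ∧ Integrable (fun t => S t ^ 2) 𝓛 T ∧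
      ∫ t in Icc 0 T, S t ^ 2 ≤ 2 * T + 2 * E ∧
      ∀ᵐ p ∂Ω T, ∑ c, ρ c p.1 p.2 ≤ S p.1 := by
  have hwd : ∀ᵐ t ∂𝓛 T, WD (fun x => ∑ c, ρ c t x) (fun x => ∑ c, v c t x) := by
    filter_upwards [IsWeakGradient.ae_all_WD h.wg] with t ht using WD.sum _ ht
  obtain ⟨S, h1, h2, h3, h4, h5⟩ := exists_sup_bound (T := T) (R := fun t x => ∑ c, ρ c t x)
    (V := fun t x => ∑ c, v c t x) (a := fun p => ∑ c, ρ c p.1 p.2)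
    (e := fun p => energyR lam ρ⟪p⟫ v⟪p⟫) (A := 1) zero_le_one hT
    (measurable_usum h.meas) h.mass hwd (fun t ht => h.tot_int ht)
    (fun p => tot_nonneg hlam fun c => h.nonneg c _ _) (fun t ht => (h.mass t ht).le)
    (energyR_measurable h.meas h.meas') h.energy
    (fun p => energyR_nonneg hlam (fun c => h.nonneg c _ _) _)
    (.of_forall fun p => sq_sum_le_energyR hlam (fun c => h.nonneg c _ _) fun c => h.zero c _ _)
  exact ⟨S, h1, h2, h3, h4.trans (by linarith), h5⟩

lemma Reg.gradient_sq_le {m : ℕ} {T lam : ℝ} {ρ v : Fin m → 𝔽} (h : Reg T lam ρ v)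
    (hlam : 0 < lam) (c : Fin m) (p : 𝕏) : v c p.1 p.2 ^ 2 ≤
      ((lam + ∑ c, ρ c p.1 p.2) * ρ c p.1 p.2 / lam) * energyR lam ρ⟪p⟫ v⟪p⟫ := by
  have h1 := sq_le_energyR hlam (fun c => h.nonneg c p.1 p.2) (fun c => h.zero c p.1 p.2) c
  rw [div_mul_eq_mul_div, le_div_iff₀ hlam]
  linarith

namespace LimitData
variable {m : ℕ} {T lam E : ℝ} {ρn vn : ℕ → Fin m → 𝔽} {ρ : Fin m → 𝔽}
  (h : LimitData T lam E ρn vn ρ)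
include h

/-- The square of a gradient is at most the weight `(lam + R) ρ_c / lam` times the energy. The
weight has bounded integral because `R` is bounded in space by a function in `L²` of time, while the
slices of `ρ_c` have mass at most one. -/
lemma exists_gradient_bound (hlam : 0 < lam) (hT : 0 ≤ T) :
    ∃ C, 0 ≤ C ∧ ∀ n c, ∫ p, |vn n c p.1 p.2| ∂Ω T ≤ C := by
  refine ⟨√((lam * T + (T + (2 * T + 2 * E))) / lam * E), sqrt_nonneg _, fun n c => ?_⟩
  obtain ⟨S, h1, h2, h3, h4, h5⟩ := (h.reg n).exists_sup hlam hT (h.energy n)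
  have hW := weight_integrable (h.reg n).meas (h.reg n).nonneg (h.reg n).int (h.reg n).mass hlam hT
    h1 h2 h3 h4 h5 c
  have hE0 := fun p : 𝕏 => energyR_nonneg hlam (fun c => (h.reg n).nonneg c p.1 p.2)
    fun c => vn n c p.1 p.2
  have hW0 : ∀ p : 𝕏, 0 ≤ (lam + ∑ c, ρn n c p.1 p.2) * ρn n c p.1 p.2 / lam := fun p => by
    have h6 := lam_tot_pos hlam fun c => (h.reg n).nonneg c p.1 p.2
    have h7 := (h.reg n).nonneg c p.1 p.2
    positivity
  refine le_sqrt_of_sq_le ((integral_abs_le_of_sq_le hW.1 (.of_forall hW0)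
    (h.reg n).energy (.of_forall hE0) (.of_forall fun p =>
      (h.reg n).gradient_sq_le hlam c p)).trans ?_)
  exact mul_le_mul hW.2 (h.energy n) (integral_nonneg hE0) ((integral_nonneg hW0).trans hW.2)

/-- Weak convergence improves to strong convergence. -/
lemma tendsto_L1 (hlam : 0 < lam) (hT : 0 ≤ T) (c : Fin m) :
    Tendsto (fun n => ∫ p, |ρn n c p.1 p.2 - ρ c p.1 p.2| ∂Ω T) atTop (𝓝 0) := by
  obtain ⟨C, hC, hCb⟩ := h.exists_gradient_bound hlam hT
  have hi := color_integrable h.meas h.nonneg h.int h.mass c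
  have hin := fun n => ((h.reg n).wg c).integrable
  obtain ⟨ik, tk⟩ := cv_wid_tendsto_L1_spaceTime (h.meas c) hi
  have ikn := fun n => (cv_wid_tendsto_L1_spaceTime ((h.reg n).meas c) (hin n)).1
  -- For a fixed width, weak convergence at each time gives pointwise convergence of the
  -- mollifications. No regularity in time is needed.
  have h1 : ∀ k, Tendsto (fun n => ∫ p, |cw k (ρn n c p.1) p.2 -
      cw k (ρ c p.1) p.2| ∂Ω T) atTop (𝓝 0) := fun k => by
    have hKc := K_continuous (wid_pos k) (wid_le k)
    obtain ⟨B, hB, hBb⟩ := torus_bound hKc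
    have key : Tendsto (fun n => ∫ p, |cw k (ρn n c p.1) p.2 -
        cw k (ρ c p.1) p.2| ∂Ω T) atTop (𝓝 (∫ _, (0 : ℝ) ∂Ω T)) := ?_
    · rwa [integral_zero] at key
    have hb : ∀ (u : Fin m → 𝔽), (∀ c t x, 0 ≤ u c t x) → (∀ c, ∀ t ∈ Icc 0 T, Integrable (u c t)) →
        (∀ t ∈ Icc 0 T, ∫ x, ∑ c, u c t x = 1) →
        ∀ t ∈ Icc 0 T, ∀ x, |cw k (u c t) x| ≤ B := fun u h0 hu hmass t ht x => by
      refine (abs_cv_le hKc hBb (hu c t ht) x).trans (mul_le_of_le_one_right hB ?_)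
      simp only [abs_of_nonneg (h0 c t _)]
      exact integral_color_le_one h0 hu hmass c ht
    refine tendsto_integral_of_dominated_convergence (fun _ => 2 * B)
      (fun n => ((ikn n k).sub (ik k)).abs.aestronglyMeasurable) (integrable_const _)
      (fun n => ?_) ?_
    · filter_upwards [ae_spaceTime_mem T] with p hp
      rw [norm_eq_abs, abs_abs]
      refine (abs_sub _ _).trans ?_
      linarith [hb _ (h.reg n).nonneg (h.reg n).int (h.reg n).mass p.1 hp p.2,
        hb _ h.nonneg h.int h.mass p.1 hp p.2]
    · filter_upwards [ae_spaceTime_mem T] with p hp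
      have h2 := h.conv p.1 hp c (fun z => K (wid k) (p.2 - z))
        (hKc.comp (continuous_const.sub continuous_id))
      have h3 := (h2.sub_const (cw k (ρ c p.1) p.2)).abs
      have h4 : |(∫ x, K (wid k) (p.2 - x) * ρ c p.1 x) - cw k (ρ c p.1) p.2| = 0 := by
        rw [abs_eq_zero, sub_eq_zero]
        rfl
      rw [h4] at h3
      exact h3
  -- The mollification error is uniform in `n`, through the bound on the gradients.
  have h2 : ∀ n k, ∫ p, |cw k (ρn n c p.1) p.2 - ρn n c p.1 p.2| ∂Ω T ≤
      2 * wid k * C := fun n k => by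
    have id : Integrable (fun p : 𝕏 => |cw k (ρn n c p.1) p.2 - ρn n c p.1 p.2|)
      (Ω T) := ((ikn n k).sub (hin n)).abs
    rw [integral_spaceTime id]
    refine le_trans ?_ (mul_le_mul_of_nonneg_left (hCb n c) (by have := wid_pos k; positivity))
    rw [integral_spaceTime ((h.reg n).wg c).integrable_gradient.abs, ← integral_const_mul]
    refine integral_mono_ae (slice_integral id)
      ((slice_integral ((h.reg n).wg c).integrable_gradient.abs).const_mul _) ?_
    filter_upwards [((h.reg n).wg c).ae_WD] with t ht
    exact ht.integral_abs_cv_sub_le k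
  rw [Metric.tendsto_atTop']
  intro η hη
  have h3 : Tendsto (fun k => 2 * wid k * C +
      ∫ p, |cw k (ρ c p.1) p.2 - ρ c p.1 p.2| ∂Ω T) atTop (𝓝 0) := by
    have := ((wid_tendsto.const_mul 2).mul_const C).add tk
    simpa using this
  obtain ⟨k, hk⟩ := ((tendsto_order.1 h3).2 (η / 2) (by positivity)).exists
  obtain ⟨N, hN⟩ := eventually_atTop.1 ((tendsto_order.1 (h1 k)).2 (η / 2) (by positivity))
  refine ⟨N, fun n hn => ?_⟩
  rw [Real.dist_eq, sub_zero, abs_of_nonneg (integral_nonneg fun _ => abs_nonneg _)]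
  have i1 : Integrable (fun p : 𝕏 => |cw k (ρn n c p.1) p.2 - ρn n c p.1 p.2|)
      (Ω T) := ((ikn n k).sub (hin n)).abs
  have i2 : Integrable (fun p : 𝕏 => |cw k (ρn n c p.1) p.2 -
      cw k (ρ c p.1) p.2|) (Ω T) := ((ikn n k).sub (ik k)).abs
  have i3 : Integrable (fun p : 𝕏 => |cw k (ρ c p.1) p.2 - ρ c p.1 p.2|)
      (Ω T) := ((ik k).sub hi).abs
  have h4 : ∫ p, |ρn n c p.1 p.2 - ρ c p.1 p.2| ∂Ω T ≤
      ∫ p, (|cw k (ρn n c p.1) p.2 - ρn n c p.1 p.2| +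
        |cw k (ρn n c p.1) p.2 - cw k (ρ c p.1) p.2| +
        |cw k (ρ c p.1) p.2 - ρ c p.1 p.2|) ∂Ω T := by
    refine integral_mono ((hin n).sub hi).abs ((i1.add i2).add i3) fun p => ?_
    have e1 := abs_add_le (cw k (ρn n c p.1) p.2 - cw k (ρ c p.1) p.2 -
      (cw k (ρn n c p.1) p.2 - ρn n c p.1 p.2))
      (cw k (ρ c p.1) p.2 - ρ c p.1 p.2)
    have e2 := abs_sub (cw k (ρn n c p.1) p.2 - cw k (ρ c p.1) p.2)
      (cw k (ρn n c p.1) p.2 - ρn n c p.1 p.2)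
    have e3 : cw k (ρn n c p.1) p.2 - cw k (ρ c p.1) p.2 -
      (cw k (ρn n c p.1) p.2 - ρn n c p.1 p.2) +
      (cw k (ρ c p.1) p.2 - ρ c p.1 p.2) = ρn n c p.1 p.2 - ρ c p.1 p.2 := by ring
    rw [e3] at e1
    simp only
    linarith
  have i12 : Integrable (fun p : 𝕏 =>
      |cw k (ρn n c p.1) p.2 - ρn n c p.1 p.2| +
        |cw k (ρn n c p.1) p.2 - cw k (ρ c p.1) p.2|) (Ω T) := i1.add i2
  rw [integral_add i12 i3, integral_add i1 i2] at h4
  linarith [h2 n k, hN n hn.le]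

lemma comp {ns : ℕ → ℕ} (hns : StrictMono ns) :
    LimitData T lam E (fun n => ρn (ns n)) (fun n => vn (ns n)) ρ :=
  ⟨fun n => h.reg _, fun n => h.energy _, h.meas, h.nonneg, h.int, h.mass,
    fun t ht c ξ hξ => (h.conv t ht c ξ hξ).comp hns.tendsto_atTop⟩

lemma exists_subseq_ae (hlam : 0 < lam) (hT : 0 ≤ T) : ∃ ns : ℕ → ℕ, StrictMono ns ∧
    ∀ᵐ p ∂Ω T, ∀ c, Tendsto (fun n => ρn (ns n) c p.1 p.2) atTop (𝓝 (ρ c p.1 p.2)) := by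
  have hi := fun c => color_integrable h.meas h.nonneg h.int h.mass c
  have hin := fun n c => ((h.reg n).wg c).integrable
  have hs : ∀ n, Integrable (fun p : 𝕏 => ∑ c, |ρn n c p.1 p.2 - ρ c p.1 p.2|)
      (Ω T) := fun n => integrable_finsetSum _ fun c _ => ((hin n c).sub (hi c)).abs
  have h1 : Tendsto (fun n => ∫ p, |(∑ c, |ρn n c p.1 p.2 - ρ c p.1 p.2|) - 0| ∂Ω T) atTop
      (𝓝 0) := by
    have h2 : ∀ n, ∫ p, |(∑ c, |ρn n c p.1 p.2 - ρ c p.1 p.2|) - 0| ∂Ω T =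
        ∑ c, ∫ p, |ρn n c p.1 p.2 - ρ c p.1 p.2| ∂Ω T := fun n => by
      have id : ∀ c, Integrable (fun p : 𝕏 => |ρn n c p.1 p.2 - ρ c p.1 p.2|)
        (Ω T) := fun c => ((hin n c).sub (hi c)).abs
      rw [← integral_finsetSum _ fun c _ => id c]
      refine integral_congr_ae (.of_forall fun p => ?_)
      simp only [sub_zero]
      exact abs_of_nonneg (sum_nonneg fun c _ => abs_nonneg _)
    simp only [h2]
    have := tendsto_finsetSum univ fun c _ => h.tendsto_L1 hlam hT c
    simpa using this
  obtain ⟨ns, hns, hae⟩ := exists_subseq_tendsto_ae hs (integrable_zero _ _ _) h1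
  refine ⟨ns, hns, ?_⟩
  filter_upwards [hae] with p hp c
  rw [tendsto_iff_dist_tendsto_zero]
  refine squeeze_zero (fun _ => dist_nonneg) (fun n => ?_) hp
  rw [Real.dist_eq]
  exact single_le_sum (f := fun c => |ρn (ns n) c p.1 p.2 - ρ c p.1 p.2|)
    (fun c _ => abs_nonneg _) (mem_univ c)

end LimitData


/-! ### Weak convergence of gradients -/

/-- A weak gradient is a weak derivative at almost every time, so test functions need smoothness in
space only; mollifying a bounded measurable function in space is enough. -/
lemma IsWeakGradient.integral_mul_cv {T : ℝ} {u v : 𝔽} (h : IsWeakGradient T u v)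
    {ψ : 𝕏 → ℝ} (hψ : Measurable ψ) {B : ℝ} (hB : ∀ p, |ψ p| ≤ B) (n : ℕ) :
    ∫ p, cw n (fun x => ψ (p.1, x)) p.2 * v p.1 p.2 ∂Ω T =
      -∫ p, cv (K1 (wid n)) (fun x => ψ (p.1, x)) p.2 * u p.1 p.2 ∂Ω T := by
  obtain ⟨h0, h1, hKc, hK1c⟩ := wid_props n
  obtain ⟨C, hC, hCb⟩ := torus_bound hKc
  obtain ⟨C1, hC1, hCb1⟩ := torus_bound hK1c
  have hi : ∀ t, Integrable fun x => ψ (t, x) := fun t => by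
    have hm : Measurable fun x => ψ (t, x) := hψ.comp measurable_prodMk_left
    exact Integrable.of_bound hm.aestronglyMeasurable B (.of_forall fun x => hB _)
  have hb : ∀ t, ∫ x, |ψ (t, x)| ≤ B := fun t => by
    have := integral_mono (hi t).abs (integrable_const B) fun x => hB (t, x)
    simpa using this
  have hψ' : Measurable fun p : 𝕏 => (fun t x => ψ (t, x)) p.1 p.2 := hψ
  have hm := cv_measurable (g := fun t x => ψ (t, x)) hKc.measurable hψ'
  have hm1 := cv_measurable (g := fun t x => ψ (t, x)) hK1c.measurable hψ'
  have i1 : Integrable (fun p : 𝕏 => cw n (fun x => ψ (p.1, x)) p.2 * v p.1 p.2)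
      (Ω T) := h.integrable_gradient.bdd_mul hm.aestronglyMeasurable
    (.of_forall fun p => (abs_cv_le hKc hCb (hi p.1) p.2).trans
      (mul_le_mul_of_nonneg_left (hb p.1) hC))
  have i2 : Integrable (fun p : 𝕏 => cv (K1 (wid n)) (fun x => ψ (p.1, x)) p.2 * u p.1 p.2)
      (Ω T) := h.integrable.bdd_mul hm1.aestronglyMeasurable
    (.of_forall fun p => (abs_cv_le hK1c hCb1 (hi p.1) p.2).trans
      (mul_le_mul_of_nonneg_left (hb p.1) hC1))
  rw [integral_spaceTime i1, integral_spaceTime i2, ← integral_neg]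
  refine integral_congr_ae ?_
  filter_upwards [h.ae_WD] with t ht
  have := ht.ibp (cv_hasTD (K_hasTD h0 h1) hK1c (hi t)) (cv_continuous hK1c (hi t))
  beta_reduce
  rw [this, neg_neg]

/-- A sequence with weak gradients `vn`, which converges in mean, where the squares of the gradients
are bounded by products of a converging weight and of functions of bounded integral. -/
structure GradSeq (T E : ℝ) (un vn : ℕ → 𝔽) (u : 𝔽)
    (en Wn : ℕ → 𝕏 → ℝ) (W : 𝕏 → ℝ) : Prop where
  wg : ∀ n, IsWeakGradient T (un n) (vn n)
  int : Integrable (fun p : 𝕏 => u p.1 p.2) (Ω T)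
  conv : Tendsto (fun n => ∫ p, |un n p.1 p.2 - u p.1 p.2| ∂Ω T) atTop (𝓝 0)
  he : ∀ n, Integrable (en n) (Ω T)
  he0 : ∀ n p, 0 ≤ en n p
  heE : ∀ n, ∫ p, en n p ∂Ω T ≤ E
  hW : ∀ n, Integrable (Wn n) (Ω T)
  hW0 : ∀ n p, 0 ≤ Wn n p
  hWi : Integrable W (Ω T)
  hWW : Tendsto (fun n => ∫ p, |Wn n p - W p| ∂Ω T) atTop (𝓝 0)
  hsq : ∀ n p, vn n p.1 p.2 ^ 2 ≤ Wn n p * en n p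

namespace GradSeq
variable {T E : ℝ} {un vn : ℕ → 𝔽} {u v : 𝔽}
  {en Wn : ℕ → 𝕏 → ℝ} {W : 𝕏 → ℝ} (h : GradSeq T E un vn u en Wn W)
include h

lemma E_nonneg : 0 ≤ E := (integral_nonneg (h.he0 0)).trans (h.heE 0)

lemma sq_integral_mul_le {ψ : 𝕏 → ℝ} {C : ℝ} (hψ : AEStronglyMeasurable ψ (Ω T))
    (hC : ∀ᵐ p ∂Ω T, |ψ p ^ 2| ≤ C) (n : ℕ) :
    (∫ p, ψ p * vn n p.1 p.2 ∂Ω T) ^ 2 ≤ E * ∫ p, ψ p ^ 2 * Wn n p ∂Ω T := by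
  rw [← sq_abs]
  refine (pow_le_pow_left₀ (abs_nonneg _) abs_integral_le_integral_abs 2).trans ?_
  have h0 := fun p => mul_nonneg (sq_nonneg (ψ p)) (h.hW0 n p)
  refine (integral_abs_le_of_sq_le (h.he n) (.of_forall (h.he0 n))
    ((h.hW n).bdd_mul (hψ.pow 2) hC) (.of_forall h0)
    (.of_forall fun p => ?_)).trans (mul_le_mul_of_nonneg_right (h.heE n) (integral_nonneg h0))
  rw [mul_pow, Pi.pow_apply]
  have := mul_le_mul_of_nonneg_left (h.hsq n p) (sq_nonneg (ψ p))
  linarith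

/-- Weak convergence of the weak gradients against bounded functions. -/
lemma tendsto_of_bound (hv : IsWeakGradient T u v) {B : ℝ}
    {ψ : 𝕏 → ℝ} (hψ : Measurable ψ) (hB : ∀ p, |ψ p| ≤ B) :
    Tendsto (fun n => ∫ p, ψ p * vn n p.1 p.2 ∂Ω T) atTop (𝓝 (∫ p, ψ p * v p.1 p.2 ∂Ω T)) := by
  have hB0 : 0 ≤ B := (abs_nonneg _).trans (hB (0, 0))
  have hE0 : 0 ≤ E := h.E_nonneg
  have hψi : ∀ t, Integrable fun x => ψ (t, x) := fun t => by
    have hm : Measurable fun x => ψ (t, x) := hψ.comp measurable_prodMk_left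
    exact Integrable.of_bound hm.aestronglyMeasurable B (.of_forall fun x => hB _)
  have hb : ∀ t, ∫ x, |ψ (t, x)| ≤ B := fun t => by
    have := integral_mono (hψi t).abs (integrable_const B) fun x => hB (t, x)
    simpa using this
  have hψ' : Measurable fun p : 𝕏 => (fun t x => ψ (t, x)) p.1 p.2 := hψ
  set ψk : ℕ → 𝕏 → ℝ := fun k p => cw k (fun x => ψ (p.1, x)) p.2 with hψk
  have hm : ∀ k, Measurable (ψk k) := fun k =>
    cv_measurable (g := fun t x => ψ (t, x)) (K_continuous (wid_pos k) (wid_le k)).measurable hψ'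
  have hkB : ∀ k p, |ψk k p| ≤ B := fun k p => by
    have hKc := K_continuous (wid_pos k) (wid_le k)
    have h1 : cw k (fun _ => B) p.2 = B := by
      rw [cv, integral_mul_const, integral_K_sub (wid_pos k) (wid_le k), one_mul]
    have h2 : cw k (fun _ => -B) p.2 = -B := by
      rw [cv, integral_mul_const, integral_K_sub (wid_pos k) (wid_le k), one_mul]
    rw [abs_le]
    constructor
    · rw [← h2]
      exact cv_mono hKc (K_nonneg (wid_pos k)) (integrable_const _) (hψi p.1)
        (.of_forall fun x => (abs_le.1 (hB (p.1, x))).1) p.2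
    · refine le_of_le_of_eq ?_ h1
      exact cv_mono hKc (K_nonneg (wid_pos k)) (hψi p.1) (integrable_const _)
        (.of_forall fun x => (abs_le.1 (hB (p.1, x))).2) p.2
  have hψI : Integrable ψ (Ω T) := Integrable.of_bound hψ.aestronglyMeasurable B (.of_forall hB)
  obtain ⟨ik, tk⟩ := cv_wid_tendsto_L1_spaceTime (T := T) (f := fun t x => ψ (t, x)) hψ' hψI
  obtain ⟨ks, hks, hae⟩ := exists_subseq_tendsto_ae ik hψI tk
  have hdiff : ∀ k p, (ψ p - ψk k p) ^ 2 ≤ (2 * B) ^ 2 := fun k p => by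
    refine sq_le_sq' ?_ ?_ <;> linarith [abs_le.1 (hB p), abs_le.1 (hkB k p), (abs_le.1 (hB p)).1,
      (abs_le.1 (hB p)).2, (abs_le.1 (hkB k p)).1, (abs_le.1 (hkB k p)).2]
  have hd2 : ∀ k p, |(ψ p - ψk k p) ^ 2| ≤ (2 * B) ^ 2 := fun k p => by grind
  have hdm : ∀ k, Measurable fun p => (ψ p - ψk k p) ^ 2 := fun k => (hψ.sub (hm k)).pow_const 2
  -- the mollified functions
  have h1 : ∀ k, Tendsto (fun n => ∫ p, ψk k p * vn n p.1 p.2 ∂Ω T) atTop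
      (𝓝 (∫ p, ψk k p * v p.1 p.2 ∂Ω T)) := fun k => by
    have hK1c := K1_continuous (wid_pos k) (wid_le k)
    obtain ⟨C1, hC1, hCb1⟩ := torus_bound hK1c
    have hm1 := cv_measurable (g := fun t x => ψ (t, x)) hK1c.measurable hψ'
    simp only [hψk]
    rw [hv.integral_mul_cv hψ hB k]
    simp only [fun n => (h.wg n).integral_mul_cv hψ hB k]
    exact (tendsto_integral_mul_of_L1 hm1.aestronglyMeasurable
      (.of_forall fun p => (abs_cv_le hK1c hCb1 (hψi p.1) p.2).trans
        (mul_le_mul_of_nonneg_left (hb p.1) hC1)) (fun n => (h.wg n).integrable) hv.integrable h.conv).neg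
  -- the error along the sequence
  have iv : ∀ n, Integrable (fun p : 𝕏 => ψ p * vn n p.1 p.2) (Ω T) := fun n =>
    (h.wg n).integrable_gradient.bdd_mul hψ.aestronglyMeasurable (.of_forall hB)
  have ivk : ∀ k n, Integrable (fun p : 𝕏 => ψk k p * vn n p.1 p.2) (Ω T) :=
    fun k n => (h.wg n).integrable_gradient.bdd_mul (hm k).aestronglyMeasurable (.of_forall (hkB k))
  have iw : Integrable (fun p : 𝕏 => ψ p * v p.1 p.2) (Ω T) :=
    hv.integrable_gradient.bdd_mul hψ.aestronglyMeasurable (.of_forall hB)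
  have h2 : ∀ k n, |(∫ p, ψ p * vn n p.1 p.2 ∂Ω T) - ∫ p, ψk k p * vn n p.1 p.2 ∂Ω T| ≤
      √(E * ∫ p, (ψ p - ψk k p) ^ 2 * Wn n p ∂Ω T) := fun k n => by
    rw [← integral_sub (iv n) (ivk k n)]
    simp only [← sub_mul]
    exact Real.abs_le_sqrt (h.sq_integral_mul_le (hψ.sub (hm k)).aestronglyMeasurable
      (.of_forall (hd2 k)) n)
  -- The weights converge in `L¹`, so as `n` grows the error is governed by the limiting weight, for
  -- which dominated convergence removes the mollification.
  have h3 : ∀ k, Tendsto (fun n => √(E * ∫ p, (ψ p - ψk k p) ^ 2 * Wn n p ∂Ω T))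
      atTop (𝓝 (√(E * ∫ p, (ψ p - ψk k p) ^ 2 * W p ∂Ω T))) := fun k =>
    (Real.continuous_sqrt.tendsto _).comp ((tendsto_integral_mul_of_L1 (hdm k).aestronglyMeasurable
      (.of_forall (hd2 k)) h.hW h.hWi h.hWW).const_mul E)
  have h4 : Tendsto (fun j => √(E * ∫ p, (ψ p - ψk (ks j) p) ^ 2 * W p ∂Ω T)) atTop (𝓝 0) := by
    have h5 : Tendsto (fun j => ∫ p, (ψ p - ψk (ks j) p) ^ 2 * W p ∂Ω T) atTop
        (𝓝 (∫ _, (0 : ℝ) ∂Ω T)) := by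
      refine tendsto_integral_of_dominated_convergence (fun p => (2 * B) ^ 2 * |W p|)
        (fun j => ((hdm _).aestronglyMeasurable.mul h.hWi.aestronglyMeasurable))
        (h.hWi.abs.const_mul _) (fun j => .of_forall fun p => ?_) ?_
      · rw [norm_mul]
        exact mul_le_mul_of_nonneg_right (hd2 _ p) (abs_nonneg _)
      · filter_upwards [hae] with p hp
        have h6 := ((hp.const_sub (ψ p)).pow 2).mul_const (W p)
        have e : (ψ p - ψ (p.1, p.2)) ^ 2 * W p = 0 := by simp
        rw [e] at h6
        exact h6
    rw [integral_zero] at h5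
    have := (Real.continuous_sqrt.tendsto _).comp (h5.const_mul E)
    rwa [mul_zero, Real.sqrt_zero] at this
  have h5 : Tendsto (fun j => ∫ p, ψk (ks j) p * v p.1 p.2 ∂Ω T) atTop
      (𝓝 (∫ p, ψ p * v p.1 p.2 ∂Ω T)) := by
    refine tendsto_integral_of_dominated_convergence (fun p => B * |v p.1 p.2|)
      (fun j => ((hm _).aestronglyMeasurable.mul hv.integrable_gradient.aestronglyMeasurable))
      (hv.integrable_gradient.abs.const_mul _) (fun j => .of_forall fun p => ?_) ?_
    · rw [norm_mul]
      exact mul_le_mul_of_nonneg_right (hkB _ p) (abs_nonneg _)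
    · filter_upwards [hae] with p hp
      exact hp.mul_const _
  rw [Metric.tendsto_atTop']
  intro η hη
  obtain ⟨j, hj1, hj2⟩ := (((tendsto_order.1 h4).2 (η / 4) (by positivity)).and
    ((Metric.tendsto_nhds.1 h5) (η / 4) (by positivity))).exists
  obtain ⟨N, hN⟩ := eventually_atTop.1 (((tendsto_order.1 (h3 (ks j))).2 (η / 4) hj1).and
    ((Metric.tendsto_nhds.1 (h1 (ks j))) (η / 4) (by positivity)))
  refine ⟨N, fun n hn' => ?_⟩
  obtain ⟨h6, h7⟩ := hN n hn'.le
  have h8 := h2 (ks j) n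
  rw [Real.dist_eq] at hj2 h7 ⊢
  have h9 := abs_lt.1 hj2
  have h10 := abs_lt.1 h7
  have h11 := abs_le.1 (h8.trans h6.le)
  rw [abs_lt]
  constructor <;> linarith [h9.1, h9.2, h10.1, h10.2, h11.1, h11.2]

/-- The limit has a weak gradient. -/
lemma exists_gradient (hWm : Measurable W) (hW0 : ∀ p, 0 ≤ W p) :
    ∃ g : 𝕏 → ℝ, Measurable g ∧ Integrable (fun p => g p ^ 2) (Ω T) ∧
      IsWeakGradient T u fun t x => √(W (t, x)) * g (t, x) := by
  refine exists_weakGradient h.int hWm h.hWi hW0 h.E_nonneg fun φ => ?_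
  obtain ⟨B, _, _, hB⟩ := spaceTime_bound φ.continuous_dx T
  obtain ⟨B', _, _, hB'⟩ := spaceTime_bound (φ.continuous_toFun.pow 2) T
  have t1 := tendsto_integral_mul_of_L1 φ.continuous_dx.aestronglyMeasurable hB
    (fun n => (h.wg n).integrable) h.int h.conv
  have t2 := tendsto_integral_mul_of_L1 (φ.continuous_toFun.pow 2).aestronglyMeasurable hB'
    h.hW h.hWi h.hWW
  simp only [mul_comm (u _ _)]
  refine le_of_tendsto_of_tendsto' (t1.pow 2) (t2.const_mul E) fun n => ?_
  have e1 : ∫ p, φ.dx p.1 p.2 * un n p.1 p.2 ∂Ω T = -∫ p, φ.toFun p.1 p.2 * vn n p.1 p.2 ∂Ω T := by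
    have := (h.wg n).integral_by_parts φ
    simp only [mul_comm] at this ⊢
    exact this
  rw [e1, neg_sq]
  exact h.sq_integral_mul_le φ.continuous_toFun.aestronglyMeasurable hB' n

/-- Weak convergence of the weak gradients against converging bounded functions. -/
lemma tendsto_of_ae (hv : IsWeakGradient T u v) {B : ℝ} (hB : 0 ≤ B) {b : ℕ → 𝕏 → ℝ}
    {ψ : 𝕏 → ℝ} (hb : ∀ n, Measurable (b n)) (hψ : Measurable ψ)
    (hbB : ∀ n, ∀ᵐ p ∂Ω T, |b n p| ≤ B)
    (hlim : ∀ᵐ p ∂Ω T, Tendsto (fun n => b n p) atTop (𝓝 (ψ p))) :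
    Tendsto (fun n => ∫ p, b n p * vn n p.1 p.2 ∂Ω T) atTop (𝓝 (∫ p, ψ p * v p.1 p.2 ∂Ω T)) := by
  have hψB : ∀ᵐ p ∂Ω T, |ψ p| ≤ B := by
    filter_upwards [ae_all_iff.2 hbB, hlim] with p h1 h2
    exact le_of_tendsto' h2.abs h1
  -- The limit function is bounded only almost everywhere; truncation provides a version that is
  -- bounded at every point.
  have hcl : ∀ᵐ p ∂Ω T, max (-B) (min B (ψ p)) = ψ p := by grind
  have h1 := h.tendsto_of_bound hv (B := B) (ψ := fun p => max (-B) (min B (ψ p)))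
    (measurable_const.max (measurable_const.min hψ)) fun p =>
      abs_le.2 ⟨le_max_left _ _, max_le (by linarith) (min_le_left _ _)⟩
  have e1 : ∀ w : 𝕏 → ℝ, ∫ p, max (-B) (min B (ψ p)) * w p ∂Ω T = ∫ p, ψ p * w p ∂Ω T := fun w =>
    integral_congr_ae (by filter_upwards [hcl] with p hp using by rw [hp])
  rw [e1 fun p => v p.1 p.2] at h1
  simp only [fun n => e1 fun p => vn n p.1 p.2] at h1
  have hd2 : ∀ n, ∀ᵐ p ∂Ω T, |(b n p - ψ p) ^ 2| ≤ (2 * B) ^ 2 := fun n => by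
    filter_upwards [hbB n, hψB] with p h3 h4
    have h5 := abs_le.1 h3
    have h6 := abs_le.1 h4
    rw [abs_of_nonneg (sq_nonneg _)]
    refine sq_le_sq' ?_ ?_ <;> linarith [h5.1, h5.2, h6.1, h6.2]
  have h2 : Tendsto (fun n => ∫ p, (b n p - ψ p) ^ 2 * Wn n p ∂Ω T) atTop
      (𝓝 (∫ p, 0 * W p ∂Ω T)) := by
    refine tendsto_integral_mul_of_L1_of_ae
      (fun n => (((hb n).sub hψ).pow_const 2).aestronglyMeasurable) hd2 ?_ h.hW h.hWi h.hWW
    filter_upwards [hlim] with p hp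
    have := (hp.sub_const (ψ p)).pow 2
    rwa [sub_self, zero_pow two_ne_zero] at this
  simp only [zero_mul, integral_zero] at h2
  have h3 : Tendsto (fun n => ∫ p, (b n p - ψ p) * vn n p.1 p.2 ∂Ω T) atTop (𝓝 0) := by
    have h4 := (Real.continuous_sqrt.tendsto _).comp (h2.const_mul E)
    rw [mul_zero, Real.sqrt_zero] at h4
    exact squeeze_zero_norm (fun n => Real.abs_le_sqrt
      (h.sq_integral_mul_le ((hb n).sub hψ).aestronglyMeasurable (hd2 n) n)) h4
  have h5 := h3.add h1
  rw [zero_add] at h5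
  refine h5.congr fun n => ?_
  have i1 : Integrable (fun p : 𝕏 => b n p * vn n p.1 p.2) (Ω T) :=
    (h.wg n).integrable_gradient.bdd_mul (hb n).aestronglyMeasurable (hbB n)
  have i2 : Integrable (fun p : 𝕏 => ψ p * vn n p.1 p.2) (Ω T) :=
    (h.wg n).integrable_gradient.bdd_mul hψ.aestronglyMeasurable hψB
  simp only [sub_mul]
  rw [integral_sub i1 i2, sub_add_cancel]

end GradSeq

lemma IsWeakGradient.sum {m : ℕ} {T : ℝ} {u v : Fin m → 𝔽} (h : ∀ c, IsWeakGradient T (u c) (v c)) :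
    IsWeakGradient T (fun t x => ∑ c, u c t x) (fun t x => ∑ c, v c t x) := by
  refine ⟨integrable_finsetSum _ fun c _ => (h c).integrable,
    integrable_finsetSum _ fun c _ => (h c).integrable_gradient, fun φ => ?_⟩
  obtain ⟨B, _, _, hB⟩ := spaceTime_bound φ.continuous_dx T
  obtain ⟨B', _, _, hB'⟩ := spaceTime_bound φ.continuous_toFun T
  simp only [sum_mul]
  rw [integral_finsetSum _ fun c _ => (h c).integrable.mul_bdd
      φ.continuous_dx.aestronglyMeasurable hB,
    integral_finsetSum _ fun c _ => (h c).integrable_gradient.mul_bdd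
      φ.continuous_toFun.aestronglyMeasurable hB', ← Finset.sum_neg_distrib]
  exact sum_congr rfl fun c _ => (h c).integral_by_parts φ


/-! ### Passage to the limit in the dynamic functional -/

section
variable {m : ℕ} {lam : ℝ} (hlam : 0 < lam) {r : Fin m → ℝ} (hr : ∀ c, 0 ≤ r c)
include hlam

include hr in
lemma abs_diffusionMatrix_le (i j : Fin m) : |diffusionMatrix lam r i j| ≤ 1 := by
  have hp := lam_tot_pos hlam hr
  have h1 := hr i
  have h2 := le_tot hlam hr i
  rw [diffusionMatrix, Matrix.of_apply, abs_of_nonneg (by split_ifs <;> positivity), div_le_one hp]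
  split_ifs <;> linarith

omit hlam in
lemma diffusionMatrix_measurable {ρ : Fin m → 𝔽}
    (hm : ∀ c, Measurable fun p : 𝕏 => ρ c p.1 p.2) (i j : Fin m) :
    Measurable fun p : 𝕏 => diffusionMatrix lam ρ⟪p⟫ i j := by
  simp only [diffusionMatrix, Matrix.of_apply]
  exact ((hm i).const_add _).div ((measurable_usum hm).const_add _)

include hr in
lemma diffusionMatrix_tendsto {rn : ℕ → Fin m → ℝ}
    (h : ∀ c, Tendsto (fun n => rn n c) atTop (𝓝 (r c))) (i j : Fin m) :
    Tendsto (fun n => diffusionMatrix lam (rn n) i j) atTop (𝓝 (diffusionMatrix lam r i j)) := by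
  simp only [diffusionMatrix, Matrix.of_apply]
  exact ((h i).const_add _).div ((tendsto_finsetSum _ fun c _ => h c).const_add _)
    (lam_tot_pos hlam hr).ne'

omit hlam in
-- With `D` bounded by one, the mobility term becomes a bounded coefficient, converging almost
-- everywhere, times a density that converges in `L¹`.
lemma mobilityMatrix_eq (i j : Fin m) :
    mobilityMatrix lam r i j = diffusionMatrix lam r i j * r j := by
  simp only [mobilityMatrix, diffusionMatrix, Matrix.of_apply]
  split_ifs <;> ring

/-- The dynamic functional as a sum of integrals over space and time. -/
lemma dynFunctional_expand {T : ℝ} (hT : 0 ≤ T) {ρ v : Fin m → 𝔽}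
    (hm : ∀ c, Measurable fun p : 𝕏 => ρ c p.1 p.2) (h0 : ∀ c t x, 0 ≤ ρ c t x)
    (hi : ∀ c, ∀ t ∈ Icc 0 T, Integrable (ρ c t)) (hv : ∀ c, IsWeakGradient T (ρ c) (v c))
    (φ : Fin m → TestFunction) :
    dynFunctional T lam ρ v φ = (∑ c, ∫ x, (φ c).toFun T x * ρ c T x) -
      (∑ c, ∫ x, (φ c).toFun 0 x * ρ c 0 x) + (-(∑ c, ∫ p, (φ c).dt p.1 p.2 * ρ c p.1 p.2 ∂Ω T) +
      (1 / 2 : ℝ) * ∑ i, ∑ j, ∫ p, ((φ i).dx p.1 p.2 * diffusionMatrix lam ρ⟪p⟫ i j)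
        * v j p.1 p.2 ∂Ω T -
      (1 / 2 : ℝ) * ∑ i, ∑ j, ∫ p, ((φ i).dx p.1 p.2 * (φ j).dx p.1 p.2 *
        diffusionMatrix lam ρ⟪p⟫ i j) * ρ j p.1 p.2 ∂Ω T) := by
  choose B hB using fun c => spaceTime_bound (φ c).continuous_dx T
  choose B' hB' using fun c => spaceTime_bound (φ c).continuous_dt T
  have hD : ∀ (p : 𝕏) i j, |diffusionMatrix lam ρ⟪p⟫ i j| ≤ 1 :=
    fun p => abs_diffusionMatrix_le hlam fun c => h0 c _ _
  have hDm := diffusionMatrix_measurable (lam := lam) hm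
  have hxm := fun c => (φ c).continuous_dx.measurable
  have t1 : ∀ c, ∀ t ∈ Icc 0 T, Integrable fun x => (φ c).toFun t x * ρ c t x :=
    fun c t ht => by
      have hc : Continuous ((φ c).toFun t) := ((φ c).hasTD_dx t).continuous
      obtain ⟨C, _, hb⟩ := torus_bound hc
      exact (hi c t ht).bdd_mul hc.aestronglyMeasurable (.of_forall hb)
  have i1 : ∀ c, Integrable (fun p : 𝕏 => (φ c).dt p.1 p.2 * ρ c p.1 p.2) (Ω T) :=
    fun c => (hv c).integrable.bdd_mul (φ c).continuous_dt.aestronglyMeasurable (hB' c).2.2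
  have i2 : ∀ i j, Integrable (fun p : 𝕏 => ((φ i).dx p.1 p.2 *
      diffusionMatrix lam ρ⟪p⟫ i j) * v j p.1 p.2) (Ω T) := fun i j => by
    refine (hv j).integrable_gradient.bdd_mul (c := B i)
      ((hxm i).mul (hDm i j)).aestronglyMeasurable ?_
    filter_upwards [(hB i).2.2] with p hp
    rw [norm_eq_abs, abs_mul]
    exact (mul_le_of_le_one_right (abs_nonneg _) (hD p i j)).trans hp
  have i3 : ∀ i j, Integrable (fun p : 𝕏 => ((φ i).dx p.1 p.2 * (φ j).dx p.1 p.2 *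
      diffusionMatrix lam ρ⟪p⟫ i j) * ρ j p.1 p.2) (Ω T) := fun i j => by
    refine (hv j).integrable.bdd_mul (c := B i * B j)
      (((hxm i).mul (hxm j)).mul (hDm i j)).aestronglyMeasurable ?_
    filter_upwards [(hB i).2.2, (hB j).2.2] with p hp hq
    rw [norm_eq_abs, abs_mul, abs_mul]
    exact (mul_le_of_le_one_right (by positivity) (hD p i j)).trans
      (mul_le_mul hp hq (abs_nonneg _) (hB i).1)
  have s1 : Integrable (fun p : 𝕏 => ∑ c, (φ c).dt p.1 p.2 * ρ c p.1 p.2) (Ω T) :=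
    integrable_finsetSum _ fun c _ => i1 c
  have s2' := fun i => integrable_finsetSum univ fun j _ => i2 i j
  have s3' := fun i => integrable_finsetSum univ fun j _ => i3 i j
  have s2 := integrable_finsetSum univ fun i _ => s2' i
  have s3 := integrable_finsetSum univ fun i _ => s3' i
  have e : ∀ p : 𝕏, (-(∑ c, (φ c).dt p.1 p.2 * ρ c p.1 p.2)
        + (1 / 2 : ℝ) * ((fun c => (φ c).dx p.1 p.2) ⬝ᵥ (diffusionMatrix lam ρ⟪p⟫ *ᵥ v⟪p⟫))
        - (1 / 2 : ℝ) * ((fun c => (φ c).dx p.1 p.2) ⬝ᵥ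
            (mobilityMatrix lam ρ⟪p⟫ *ᵥ fun c => (φ c).dx p.1 p.2))) =
      -(∑ c, (φ c).dt p.1 p.2 * ρ c p.1 p.2) + (1 / 2 : ℝ) * (∑ i, ∑ j, ((φ i).dx p.1 p.2 *
      diffusionMatrix lam ρ⟪p⟫ i j) * v j p.1 p.2) -
      (1 / 2 : ℝ) * ∑ i, ∑ j, ((φ i).dx p.1 p.2 * (φ j).dx p.1 p.2 *
      diffusionMatrix lam ρ⟪p⟫ i j) * ρ j p.1 p.2 := fun p => by
    simp only [Matrix.mulVec, dotProduct, mobilityMatrix_eq, mul_sum]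
    refine congrArg₂ _ (congrArg₂ _ rfl ?_) ?_ <;>
      exact sum_congr rfl fun i _ => sum_congr rfl fun j _ => by ring
  rw [dynFunctional]
  simp only [e]
  have s1' : Integrable (fun p : 𝕏 => -∑ c, (φ c).dt p.1 p.2 * ρ c p.1 p.2) (Ω T) := s1.neg
  have s12 : Integrable (fun p : 𝕏 => -(∑ c, (φ c).dt p.1 p.2 * ρ c p.1 p.2) +
    (1 / 2 : ℝ) * (∑ i, ∑ j, ((φ i).dx p.1 p.2 *
      diffusionMatrix lam ρ⟪p⟫ i j) * v j p.1 p.2)) (Ω T) := s1'.add (s2.const_mul _)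
  rw [integral_sub s12 (s3.const_mul _), integral_add s1' (s2.const_mul _), integral_neg,
    integral_const_mul, integral_const_mul, integral_finsetSum _ fun c _ => i1 c,
    integral_finsetSum _ fun i _ => s2' i, integral_finsetSum _ fun i _ => s3' i,
    integral_finsetSum _ fun c _ => t1 c T ⟨hT, le_rfl⟩,
    integral_finsetSum _ fun c _ => t1 c 0 ⟨le_rfl, hT⟩]
  simp only [integral_finsetSum univ fun j _ => i2 _ j, integral_finsetSum univ fun j _ => i3 _ j]

end

lemma integral_abs_sub_le_two {f g : 𝕊} (hf : Integrable f) (hg : Integrable g)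
    (hf0 : ∀ x, 0 ≤ f x) (hg0 : ∀ x, 0 ≤ g x) (hf1 : ∫ x, f x ≤ 1) (hg1 : ∫ x, g x ≤ 1) :
    ∫ x, |f x - g x| ≤ 2 := by
  have h1 : ∫ x, |f x - g x| ≤ ∫ x, (f x + g x) := integral_mono (hf.sub hg).abs (hf.add hg)
    fun x => abs_le.2 ⟨by linarith [hf0 x], by linarith [hg0 x]⟩
  rw [integral_add hf hg] at h1
  linarith

namespace LimitData
variable {m : ℕ} {T lam E : ℝ} {ρn vn : ℕ → Fin m → 𝔽} {ρ : Fin m → 𝔽}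
  (h : LimitData T lam E ρn vn ρ) (hlam : 0 < lam) (hT : 0 ≤ T)
include h hlam hT

/-- The total gradient is treated first because its weight `lam + R` is linear, so that `L¹`
convergence of the densities suffices. It yields the bound in space on the limiting density that the
quadratic weights of the colors require. -/
lemma gradSeq_tot : GradSeq T E (fun n t x => ∑ c, ρn n c t x) (fun n t x => ∑ c, vn n c t x)
    (fun t x => ∑ c, ρ c t x)
    (fun n p => energyR lam (fun c => ρn n c p.1 p.2) fun c => vn n c p.1 p.2)
    (fun n p => lam + ∑ c, ρn n c p.1 p.2) fun p => lam + ∑ c, ρ c p.1 p.2 := by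
  have hi := fun c => color_integrable h.meas h.nonneg h.int h.mass c
  have hin := fun n c => ((h.reg n).wg c).integrable
  have hc : Tendsto (fun n => ∫ p, |∑ c, ρn n c p.1 p.2 - ∑ c, ρ c p.1 p.2| ∂Ω T) atTop (𝓝 0) := by
    have h1 := tendsto_finsetSum univ fun c _ => h.tendsto_L1 hlam hT c
    rw [Finset.sum_const_zero] at h1
    refine squeeze_zero (fun _ => integral_nonneg fun _ => abs_nonneg _) (fun n => ?_) h1
    have id : ∀ c, Integrable (fun p : 𝕏 => |ρn n c p.1 p.2 - ρ c p.1 p.2|)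
      (Ω T) := fun c => ((hin n c).sub (hi c)).abs
    rw [← integral_finsetSum _ fun c _ => id c]
    refine integral_mono (((h.reg n).tot_int_spaceTime.sub
      (tot_integrable h.meas h.nonneg h.int h.mass)).abs)
      (integrable_finsetSum _ fun c _ => id c) fun p => ?_
    rw [← sum_sub_distrib]
    exact Finset.abs_sum_le_sum_abs _ _
  have h0 := fun n (p : 𝕏) c => (h.reg n).nonneg c p.1 p.2
  refine ⟨fun n => .sum (h.reg n).wg, tot_integrable h.meas h.nonneg h.int h.mass, hc,
    fun n => (h.reg n).energy, fun n p => energyR_nonneg hlam (h0 n p) _, h.energy,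
    fun n => (integrable_const _).add (h.reg n).tot_int_spaceTime,
    fun n p => (lam_tot_pos hlam (h0 n p)).le,
    (integrable_const _).add (tot_integrable h.meas h.nonneg h.int h.mass), ?_, fun n p => ?_⟩
  · simpa only [add_sub_add_left_eq_sub] using hc
  · refine (sq_sum_le_energyR hlam (h0 n p) fun c => (h.reg n).zero c _ _).trans ?_
    exact mul_le_mul_of_nonneg_right (by linarith) (energyR_nonneg hlam (h0 n p) _)

lemma exists_sup {g : 𝕏 → ℝ} (hg : Measurable g) (hg2 : Integrable (fun p => g p ^ 2) (Ω T))
    (hw : IsWeakGradient T (fun t x => ∑ c, ρ c t x) fun t x => √(lam + ∑ c, ρ c t x) * g (t, x)) :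
    ∃ S : ℝ → ℝ, Measurable S ∧ (∀ t, 0 ≤ S t) ∧ Integrable (fun t => S t ^ 2) 𝓛 T ∧
      ∀ᵐ p ∂Ω T, ∑ c, ρ c p.1 p.2 ≤ S p.1 := by
  have hp := fun (p : 𝕏) => lam_tot_pos hlam fun c => h.nonneg c p.1 p.2
  have hi : ∀ t ∈ Icc 0 T, Integrable fun x => ∑ c, ρ c t x := fun t ht =>
    integrable_finsetSum _ fun c _ => h.int c t ht
  obtain ⟨S, h1, h2, h3, -, h5⟩ := exists_sup_bound (T := T) (R := fun t x => ∑ c, ρ c t x)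
    (V := fun t x => √(lam + ∑ c, ρ c t x) * g (t, x)) (a := fun p => lam + ∑ c, ρ c p.1 p.2)
    (e := fun p => g p ^ 2) (A := lam + 1) (by linarith) hT
    (measurable_usum h.meas) h.mass hw.ae_WD
    (fun t ht => (integrable_const _).add (hi t ht)) (fun p => (hp p).le)
    (fun t ht => by
      rw [integral_add (integrable_const _) (hi t ht), h.mass t ht, integral_const]
      simp) (hg.pow_const 2) hg2 (fun p => sq_nonneg _)
    (.of_forall fun p => by rw [mul_pow, sq_sqrt (hp p).le])
  exact ⟨S, h1, h2, h3, h5⟩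

/-- The difference of the quadratic weights is `lam (ρ_n - ρ) + R_n (ρ_n - ρ) + ρ (R_n - R)`,
divided by `lam`. Each product pairs an `L¹`-null sequence with a function bounded in space by an
element of `L²` in time. -/
lemma gradSeq_color {S : ℝ → ℝ} (hSm : Measurable S) (hS0 : ∀ t, 0 ≤ S t)
    (hSi : Integrable (fun t => S t ^ 2) 𝓛 T)
    (hS : ∀ᵐ p ∂Ω T, ∑ c, ρ c p.1 p.2 ≤ S p.1) (c : Fin m) :
    GradSeq T E (fun n => ρn n c) (fun n => vn n c) (ρ c)
      (fun n p => energyR lam (fun c => ρn n c p.1 p.2) fun c => vn n c p.1 p.2)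
      (fun n p => (lam + ∑ c, ρn n c p.1 p.2) * ρn n c p.1 p.2 / lam)
      fun p => (lam + ∑ c, ρ c p.1 p.2) * ρ c p.1 p.2 / lam := by
  have h0 := fun n (p : 𝕏) c => (h.reg n).nonneg c p.1 p.2
  have hi := fun c => color_integrable h.meas h.nonneg h.int h.mass c
  have hin := fun n c => ((h.reg n).wg c).integrable
  have ht := h.gradSeq_tot hlam hT
  choose Sn s1 s2 s3 s4 s5 using fun n => (h.reg n).exists_sup hlam hT (h.energy n)
  have hWn := fun n => (weight_integrable (h.reg n).meas (h.reg n).nonneg (h.reg n).int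
    (h.reg n).mass hlam hT (s1 n) (s2 n) (s3 n) (s4 n) (s5 n) c).1
  have hW := (weight_integrable h.meas h.nonneg h.int h.mass hlam hT hSm hS0 hSi le_rfl hS c).1
  refine ⟨fun n => (h.reg n).wg c, hi c, h.tendsto_L1 hlam hT c, ht.he, ht.he0, h.energy, hWn,
    fun n p => ?_, hW, ?_, fun n => (h.reg n).gradient_sq_le hlam c⟩
  · have := lam_tot_pos hlam (h0 n p)
    have := h0 n p c
    positivity
  obtain ⟨j1, l1⟩ := tendsto_L1_mul (D := 2) (f := fun n p => ∑ c, ρn n c p.1 p.2)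
    (d := fun n p => ρn n c p.1 p.2 - ρ c p.1 p.2) zero_le_two
    (fun n => (h.reg n).tot_int_spaceTime.aestronglyMeasurable)
    (fun n => ((h.reg n).meas c).sub (h.meas c)) (fun n => (hin n c).sub (hi c)) s1 s2 s3 s4
    (fun n => by
      filter_upwards [s5 n] with p hp
      rwa [abs_of_nonneg (tot_nonneg hlam (h0 n p))])
    (fun n => by
      filter_upwards [ae_restrict_mem measurableSet_Icc] with t ht
      exact integral_abs_sub_le_two ((h.reg n).int c t ht) (h.int c t ht) ((h.reg n).nonneg c t)
        (h.nonneg c t)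
        (integral_color_le_one (h.reg n).nonneg (h.reg n).int (h.reg n).mass c ht)
        (integral_color_le_one h.nonneg h.int h.mass c ht))
    (h.tendsto_L1 hlam hT c)
  obtain ⟨j2, l2⟩ := tendsto_L1_mul (D := 2) (f := fun _ p => ρ c p.1 p.2) (S := fun _ => S)
    (d := fun n p => (∑ c, ρn n c p.1 p.2) - ∑ c, ρ c p.1 p.2) zero_le_two
    (fun n => (h.meas c).aestronglyMeasurable)
    (fun n => (measurable_fun_sum _ fun c _ => (h.reg n).meas c).sub (measurable_usum h.meas))
    (fun n => (ht.wg n).integrable.sub ht.int)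
    (fun _ => hSm) (fun _ => hS0) (fun _ => hSi) (fun _ => le_rfl)
    (fun n => by
      filter_upwards [hS] with p hp
      rw [abs_of_nonneg (h.nonneg c _ _)]
      exact (le_tot hlam (fun c => h.nonneg c p.1 p.2) c).trans hp)
    (fun n => by
      filter_upwards [ae_restrict_mem measurableSet_Icc] with t ht
      exact integral_abs_sub_le_two ((h.reg n).tot_int ht)
        (integrable_finsetSum _ fun c _ => h.int c t ht) (fun x => tot_nonneg hlam (h0 n (t, x)))
        (fun x => tot_nonneg hlam fun c => h.nonneg c t x) ((h.reg n).mass t ht).le (h.mass t ht).le)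
    ht.conv
  have l3 := (((h.tendsto_L1 hlam hT c).const_mul lam).add (l1.add l2)).div_const lam
  rw [mul_zero, zero_add, zero_add, zero_div] at l3
  refine squeeze_zero (fun _ => integral_nonneg fun _ => abs_nonneg _) (fun n => ?_) l3
  have i1 : Integrable (fun p : 𝕏 => |ρn n c p.1 p.2 - ρ c p.1 p.2|) (Ω T) :=
    ((hin n c).sub (hi c)).abs
  have j12 : Integrable (fun p : 𝕏 => |(∑ c, ρn n c p.1 p.2) * (ρn n c p.1 p.2 - ρ c p.1 p.2)| +
    |ρ c p.1 p.2 * ((∑ c, ρn n c p.1 p.2) - ∑ c, ρ c p.1 p.2)|) (Ω T) := (j1 n).abs.add (j2 n).abs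
  rw [← integral_const_mul, ← integral_add (j1 n).abs (j2 n).abs,
    ← integral_add (i1.const_mul _) j12, ← integral_div]
  refine integral_mono ((hWn n).sub hW).abs (((i1.const_mul _).add j12).div_const _) fun p => ?_
  simp only
  rw [← sub_div, abs_div, abs_of_pos hlam]
  refine div_le_div_of_nonneg_right ?_ hlam.le
  have e : (lam + ∑ c, ρn n c p.1 p.2) * ρn n c p.1 p.2 - (lam + ∑ c, ρ c p.1 p.2) * ρ c p.1 p.2 =
      lam * (ρn n c p.1 p.2 - ρ c p.1 p.2) + ((∑ c, ρn n c p.1 p.2) * (ρn n c p.1 p.2 - ρ c p.1 p.2) +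
        ρ c p.1 p.2 * ((∑ c, ρn n c p.1 p.2) - ∑ c, ρ c p.1 p.2)) := by ring
  rw [e]
  refine (abs_add_le _ _).trans (add_le_add ?_ (abs_add_le _ _))
  rw [abs_mul, abs_of_pos hlam]

/-- The limit has weak gradients of finite energy, and the dynamic functionals converge. -/
lemma exists_gradient : ∃ v : Fin m → 𝔽, (∀ c, IsWeakGradient T (ρ c) (v c)) ∧
    (∀ c t x, ρ c t x = 0 → v c t x = 0) ∧ Integrable (fun p : 𝕏 => energyR lam ρ⟪p⟫ v⟪p⟫) (Ω T) ∧
    ∀ φ b, (∀ n, dynFunctional T lam (ρn n) (vn n) φ ≤ b) → dynFunctional T lam ρ v φ ≤ b := by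
  have h0 := fun (p : 𝕏) c => h.nonneg c p.1 p.2
  have hp := fun (p : 𝕏) => lam_tot_pos hlam (h0 p)
  have hRm : Measurable fun p : 𝕏 => lam + ∑ c, ρ c p.1 p.2 :=
    (measurable_usum h.meas).const_add _
  obtain ⟨g, hg, hg2, hw⟩ := (h.gradSeq_tot hlam hT).exists_gradient hRm fun p => (hp p).le
  obtain ⟨S, hSm, hS0, hSi, hS⟩ := h.exists_sup hlam hT hg hg2 hw
  have hG := h.gradSeq_color hlam hT hSm hS0 hSi hS
  have hW0 : ∀ (p : 𝕏) c, 0 ≤ (lam + ∑ c, ρ c p.1 p.2) * ρ c p.1 p.2 / lam := fun p c =>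
    div_nonneg (mul_nonneg (hp p).le (h0 p c)) hlam.le
  choose k hk hk2 hkw using fun c => (hG c).exists_gradient ((hRm.mul (h.meas c)).div_const _)
    fun p => hW0 p c
  set v : Fin m → 𝔽 := fun c t x =>
    √((lam + ∑ c, ρ c t x) * ρ c t x / lam) * k c (t, x) with hv
  have hvm : ∀ c, Measurable fun p : 𝕏 => v c p.1 p.2 := fun c =>
    ((hRm.mul (h.meas c)).div_const _).sqrt.mul (hk c)
  have hVm : Measurable fun p : 𝕏 => √(lam + ∑ c, ρ c p.1 p.2) * g p := hRm.sqrt.mul hg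
  -- The total gradient and the color gradients come from separate Riesz representations; uniqueness
  -- of weak derivatives ties them together.
  have hae : ∀ᵐ p ∂Ω T, ∑ c, v c p.1 p.2 = √(lam + ∑ c, ρ c p.1 p.2) * g p := by
    unfold spaceTime
    rw [Measure.ae_prod_iff_ae_ae (measurableSet_eq_fun (measurable_usum hvm) hVm)]
    filter_upwards [(IsWeakGradient.sum hkw).ae_WD, hw.ae_WD] with t h1 h2 using h1.unique h2
  refine ⟨v, hkw, fun c t x hc => by simp [hv, hc], ?_, fun φ b hb => ?_⟩
  -- In terms of the representing functions, the energy is at most `g² + ∑ k_c²`, which is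
  -- integrable.
  · refine (hg2.add (integrable_finsetSum univ fun c _ => hk2 c)).mono'
      (energyR_measurable h.meas hvm).aestronglyMeasurable ?_
    filter_upwards [hae] with p hp'
    rw [norm_eq_abs, abs_of_nonneg (energyR_nonneg hlam (h0 p) _), energyR, hp', mul_pow,
      sq_sqrt (hp p).le, mul_div_cancel_left₀ _ (hp p).ne']
    refine add_le_add le_rfl (sum_le_sum fun c _ => ?_)
    simp only [hv]
    rw [mul_pow, sq_sqrt (hW0 p c)]
    rcases (h0 p c).eq_or_lt with h1 | h1
    · rw [← h1, mul_zero, div_zero]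
      exact sq_nonneg _
    · refine le_of_eq ?_
      have := (hp p).ne'
      field_simp
  -- Passing to a subsequence is harmless, since all terms obey the same bound `b`.
  · obtain ⟨ns, hns, hlim⟩ := h.exists_subseq_ae hlam hT
    have h' := h.comp hns
    have hG := h'.gradSeq_color hlam hT hSm hS0 hSi hS
    choose B hB using fun c => spaceTime_bound (φ c).continuous_dx T
    have hD : ∀ᵐ p ∂Ω T, ∀ i j, Tendsto (fun n => diffusionMatrix lam
        (fun c => ρn (ns n) c p.1 p.2) i j) atTop
        (𝓝 (diffusionMatrix lam ρ⟪p⟫ i j)) := by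
      filter_upwards [hlim] with p hp using diffusionMatrix_tendsto hlam (h0 p) hp
    have hD1 := fun n (p : 𝕏) => abs_diffusionMatrix_le hlam fun c => (h'.reg n).nonneg c p.1 p.2
    have hDm := fun n => diffusionMatrix_measurable (lam := lam) (h'.reg n).meas
    have hxm := fun c => (φ c).continuous_dx.measurable
    have hlim : Tendsto (fun n => dynFunctional T lam (ρn (ns n)) (vn (ns n)) φ) atTop
        (𝓝 (dynFunctional T lam ρ v φ)) := by
      rw [dynFunctional_expand hlam hT h.meas h.nonneg h.int hkw]
      simp only [fun n => dynFunctional_expand hlam hT (h'.reg n).meas (h'.reg n).nonneg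
        (h'.reg n).int (h'.reg n).wg φ]
      refine ((tendsto_finsetSum _ fun c _ => h'.conv T ⟨hT, le_rfl⟩ c _
        ((φ c).hasTD_dx T).continuous).sub (tendsto_finsetSum _ fun c _ =>
          h'.conv 0 ⟨le_rfl, hT⟩ c _ ((φ c).hasTD_dx 0).continuous)).add
        (((tendsto_finsetSum _ fun c _ => ?_).neg.add ((tendsto_finsetSum _ fun i _ =>
          tendsto_finsetSum _ fun j _ => ?_).const_mul _)).sub ((tendsto_finsetSum _ fun i _ =>
          tendsto_finsetSum _ fun j _ => ?_).const_mul _))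
      · obtain ⟨B', _, _, hB'⟩ := spaceTime_bound (φ c).continuous_dt T
        exact tendsto_integral_mul_of_L1 (φ c).continuous_dt.aestronglyMeasurable hB'
          (fun n => ((hG c).wg n).integrable) (hG c).int (hG c).conv
      · refine (hG j).tendsto_of_ae (hkw j) (hB i).1 (fun n => (hxm i).mul (hDm n i j))
          ((hxm i).mul (diffusionMatrix_measurable h.meas i j)) (fun n => ?_) ?_
        · filter_upwards [(hB i).2.2] with p hp
          rw [abs_mul]
          exact (mul_le_of_le_one_right (abs_nonneg _) (hD1 n p i j)).trans hp
        · filter_upwards [hD] with p hp using (hp i j).const_mul _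
      · refine tendsto_integral_mul_of_L1_of_ae (C := B i * B j)
          (fun n => (((hxm i).mul (hxm j)).mul (hDm n i j)).aestronglyMeasurable) (fun n => ?_) ?_
          (fun n => ((hG j).wg n).integrable) (hG j).int (hG j).conv
        · filter_upwards [(hB i).2.2, (hB j).2.2] with p hp hq
          rw [abs_mul, abs_mul]
          exact (mul_le_of_le_one_right (by positivity) (hD1 n p i j)).trans
            (mul_le_mul hp hq (abs_nonneg _) (hB i).1)
        · filter_upwards [hD] with p hp using (hp i j).const_mul _
    exact le_of_tendsto' hlim fun n => hb _

end LimitData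


/-! ### Densities from entropy bounds -/

/-- A compact null set `F` of positive mass would have neighbourhoods of volume below `exp (-M)`.
The test function `M` times a cutoff then has exponential integral at most `2`, while its pairing is
at least `M` times the mass of `F`. -/
lemma absolutelyContinuous_of_pairing_le {m : ℕ} {ν : ColorMeasure m} {A : ℝ}
    (h : ∀ ξ, Continuous ξ → pairing ξ ν ≤ A + log (∫ x, exp (ξ x))) (c : Fin m) :
    (ν c : Measure Torus) ≪ volume := by
  refine Measure.AbsolutelyContinuous.mk fun s hs h0 => ?_
  rw [hs.measure_eq_iSup_isCompact_of_ne_top (measure_ne_top _ s)]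
  simp only [ENNReal.iSup_eq_zero]
  intro F hFs hF
  by_contra hpos
  have hpos' : 0 < (ν c : Measure Torus).real F := ENNReal.toReal_pos hpos (measure_ne_top _ F)
  -- Chosen so that `M` times the mass of `F` exceeds `A + log 2`.
  set M := (|A| + log 2 + 1) / (ν c : Measure Torus).real F with hM
  have hM0 : 0 ≤ M := by positivity
  obtain ⟨U, hFU, hU, hUv⟩ := F.exists_isOpen_lt_of_lt (μ := volume) (ofReal (exp (-M))) (by
      rw [measure_mono_null hFs h0]
      exact ENNReal.ofReal_pos.2 (exp_pos _))
  obtain ⟨f, f0, f1, f2⟩ := exists_continuous_zero_one_of_isClosed hU.isClosed_compl hF.isClosed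
    (Set.disjoint_compl_left_iff_subset.2 hFU)
  have hc : Continuous fun x => M * f x := continuous_const.mul f.continuous
  have h1 : M * (ν c : Measure Torus).real F ≤ pairing (fun x => M * f x) ν := by
    refine le_trans ?_ (single_le_sum (f := fun c => ∫ x, M * f x ∂(ν c : Measure Torus))
      (fun c _ => integral_nonneg fun x => mul_nonneg hM0 (f2 x).1) (mem_univ c))
    beta_reduce
    rw [integral_const_mul, ← integral_indicator_one hF.measurableSet]
    refine mul_le_mul_of_nonneg_left (integral_mono
      ((integrable_const (1 : ℝ)).indicator hF.measurableSet)
      (integrable_finiteMeasure f.continuous _) fun x => ?_) hM0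
    refine Set.indicator_le' (fun x hx => (f1 hx).ge) (fun x _ => (f2 x).1) x
  have hi : Integrable (U.indicator fun _ => exp M) :=
    (integrable_const (exp M)).indicator hU.measurableSet
  have h2 : ∫ x, exp (M * f x) ≤ 2 := by
    have h3 : ∫ x, exp (M * f x) ≤ ∫ x, (1 + U.indicator (fun _ => exp M) x) := by
      refine integral_mono (integrable_finiteMeasure hc.rexp _) ((integrable_const _).add hi)
        fun x => ?_
      by_cases hx : x ∈ U
      · simp only [indicator_of_mem hx]
        have := Real.exp_le_exp.2 (mul_le_of_le_one_right hM0 (f2 x).2)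
        linarith
      · simp only [indicator_of_notMem hx]
        rw [f0 hx]
        simp
    rw [integral_add (integrable_const _) hi, integral_indicator_const _ hU.measurableSet,
      integral_const, smul_eq_mul, smul_eq_mul, mul_one, probReal_univ] at h3
    have h4 : volume.real U * exp M ≤ exp (-M) * exp M := by
      refine mul_le_mul_of_nonneg_right ?_ (exp_pos _).le
      exact ENNReal.toReal_le_of_le_ofReal (exp_pos _).le hUv.le
    rw [← Real.exp_add, neg_add_cancel, Real.exp_zero] at h4
    linarith
  have h5 := Real.log_le_log (torus_integral_exp_pos hc) h2
  have h6 := h _ hc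
  rw [hM, div_mul_cancel₀ _ hpos'.ne'] at h1
  linarith [le_abs_self A]

/-- Closed sets form a generating π-system, and their masses are limits of integrals of thickened
indicators, which depend continuously on the time. -/
lemma measurable_of_continuous_finiteMeasure {μ : ℝ → FiniteMeasure Torus} (h : Continuous μ) :
    Measurable fun t => (μ t : Measure Torus) := by
  have hF : ∀ F : Set Torus, IsClosed F → Measurable fun t => (μ t : Measure Torus) F := fun F hF => by
    have hpos : ∀ n : ℕ, (0 : ℝ) < 1 / (n + 1) := fun n => by positivity
    refine measurable_of_tendsto_metrizable (f := fun n t => ∫⁻ x,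
      (thickenedIndicator (hpos n) F x : ℝ≥0∞) ∂(μ t : Measure Torus)) (fun n => ?_)
      (tendsto_pi_nhds.2 fun t => tendsto_lintegral_thickenedIndicator_of_isClosed _ hF hpos
        tendsto_one_div_add_atTop_nhds_zero_nat)
    have h1 := ENNReal.continuous_coe.comp
      ((FiniteMeasure.continuous_testAgainstNN_eval (thickenedIndicator (hpos n) F)).comp h)
    convert h1.measurable using 2 with t
    exact (FiniteMeasure.testAgainstNN_coe_eq).symm
  exact Measurable.measure_of_isPiSystem (S := {s | IsClosed s})
    (BorelSpace.measurable_eq.trans borel_eq_generateFrom_isClosed) isPiSystem_isClosed hF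
    (hF _ isClosed_univ)

/-- Absolute continuity at each time gives densities one at a time; the Radon-Nikodym derivative of
kernels supplies versions that are jointly measurable in time and space. -/
lemma exists_density {m : ℕ} {T A : ℝ} (hT : 0 ≤ T) {rbar : Fin m → ℝ} {μ : ColorPath m T}
    (h : ∀ t ξ, Continuous ξ → pairing ξ (μ t) ≤ A + log (∫ x, exp (ξ x)))
    (hmass : ∀ t c, ((μ t c).mass : ℝ) = rbar c) :
    ∃ ρ : Fin m → 𝔽, (∀ c, Measurable fun p : 𝕏 => ρ c p.1 p.2) ∧
      (∀ c t x, 0 ≤ ρ c t x) ∧ ∀ (t : Icc (0 : ℝ) T) c,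
      (μ t c : Measure Torus) = volume.withDensity fun x => ofReal (ρ c t x) := by
  have hcont : ∀ c, Continuous fun t => μ (Set.projIcc 0 T hT t) c := fun c =>
    (continuous_apply c).comp (μ.continuous.comp continuous_projIcc)
  let κ : Fin m → ProbabilityTheory.Kernel ℝ Torus := fun c =>
    ⟨fun t => (μ (Set.projIcc 0 T hT t) c : Measure Torus),
      measurable_of_continuous_finiteMeasure (hcont c)⟩
  let η : ProbabilityTheory.Kernel ℝ Torus := ProbabilityTheory.Kernel.const ℝ volume
  have hκ : ∀ c, ProbabilityTheory.IsFiniteKernel (κ c) := fun c =>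
    ⟨⟨ofReal (rbar c), ofReal_lt_top, fun t => by
      rw [← hmass (Set.projIcc 0 T hT t) c, ENNReal.ofReal_coe_nnreal]
      exact FiniteMeasure.ennreal_mass.symm.le⟩⟩
  have hm := fun c => ProbabilityTheory.Kernel.measurable_rnDeriv (κ c) η
  refine ⟨fun c t x => ((κ c).rnDeriv η t x).toReal, fun c => (hm c).ennreal_toReal,
    fun c t x => ENNReal.toReal_nonneg, fun t c => ?_⟩
  have hac : κ c t ≪ η t := absolutelyContinuous_of_pairing_le (h _) c
  have h1 := ProbabilityTheory.Kernel.withDensity_rnDeriv_eq hac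
  rw [ProbabilityTheory.Kernel.withDensity_apply _ (hm c)] at h1
  have h2 : κ c t = (μ t c : Measure Torus) := by
    change (μ (Set.projIcc 0 T hT t) c : Measure Torus) = _
    rw [Set.projIcc_val]
  rw [← h2, ← h1]
  refine withDensity_congr_ae ?_
  filter_upwards [ProbabilityTheory.Kernel.rnDeriv_lt_top (κ c) η (a := (t : ℝ))] with x hx
  exact (ENNReal.ofReal_toReal hx.ne).symm

/-- The test functions `log (f_n + 1)`, with `f_n` the mollifications, are nonnegative and their
exponentials have integral `2`. Fatou's lemma bounds `∫ f log (f + 1)`, which controls `f log f` up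
to a constant because `s |log s| ≤ 1` on `[0, 1]`. -/
lemma DV.integrable_entropy {A : ℝ} {f : 𝕊} (h : DV A f) (hf : Measurable f)
    (hfi : Integrable f) (h0 : ∀ x, 0 ≤ f x) (h1 : ∫ x, f x = 1) :
    Integrable fun x => f x * log (f x) := by
  have hu0 : ∀ n x, 0 ≤ cw n f x := fun n => cv_nonneg (Kw_nonneg n) h0
  have hcu := fun n => cv_wid_continuous hfi n
  obtain ⟨ns, -, hae⟩ := exists_subseq_tendsto_ae (cv_wid_integrable hfi) hfi (cv_K_tendsto_L1 hfi)
  have hpos : ∀ n x, 0 < cw n f x + 1 := fun n x => by linarith [hu0 n x]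
  have hlc : ∀ n, Continuous fun x => log (cw n f x + 1) := fun n =>
    ((hcu n).add continuous_const).log fun x => (hpos n x).ne'
  have hl0 : ∀ n x, 0 ≤ log (cw n f x + 1) := fun n x => log_nonneg (by linarith [hu0 n x])
  have hb : ∀ n, ∫⁻ x, ofReal (log (cw n f x + 1) * f x) ≤ ofReal (A + log 2) := fun n => by
    obtain ⟨C, _, hC⟩ := torus_bound (hlc n)
    rw [← ofReal_integral_eq_lintegral_ofReal (hfi.bdd_mul (hlc n).aestronglyMeasurable
      (.of_forall hC)) (.of_forall fun x => mul_nonneg (hl0 n x) (h0 x))]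
    refine ofReal_le_ofReal ((h _ (hlc n)).trans_eq ?_)
    simp only [exp_log (hpos n _)]
    rw [integral_add (cv_wid_integrable hfi n) (integrable_const _),
      integral_cv (Kw_continuous n) hfi,
      integral_Kw n, h1, integral_const, probReal_univ, one_smul, one_mul,
      one_add_one_eq_two]
  have hlim : ∫⁻ x, ofReal (log (f x + 1) * f x) ≤ ofReal (A + log 2) := by
    have h2 := lintegral_liminf_le (μ := (volume : Measure Torus)) (u := atTop)
      (f := fun i x => ofReal (log (cw (ns i) f x + 1) * f x))
      fun i => ((hlc _).measurable.mul hf).ennreal_ofReal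
    refine le_trans (lintegral_mono_ae ?_) (h2.trans (liminf_le_of_frequently_le'
      (Frequently.of_forall fun i => hb _)))
    filter_upwards [hae] with x hx
    refine (Tendsto.liminf_eq (tendsto_ofReal (((hx.add_const 1).log ?_).mul_const _))).ge
    linarith [h0 x]
  have hi : Integrable fun x => log (f x + 1) * f x := by
    refine ⟨(((hf.add_const 1).log).mul hf).aestronglyMeasurable, ?_⟩
    rw [hasFiniteIntegral_iff_ofReal (.of_forall fun x =>
      mul_nonneg (log_nonneg (by linarith [h0 x])) (h0 x))]
    exact hlim.trans_lt ofReal_lt_top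
  refine (hi.add (integrable_const (1 : ℝ))).mono' (hf.mul hf.log).aestronglyMeasurable
    (.of_forall fun x => ?_)
  have h3 : 0 ≤ log (f x + 1) * f x := by bound
  simp only [Pi.add_apply, norm_eq_abs]
  rcases le_total (f x) 1 with h4 | h4
  · rcases (h0 x).eq_or_lt with h5 | h5
    · rw [← h5]
      simp
    · have := Real.abs_log_mul_self_lt (f x) h5 h4
      rw [mul_comm]
      linarith
  · have h5 := log_nonneg h4
    rw [abs_of_nonneg (mul_nonneg (h0 x) h5)]
    have := Real.log_le_log (by linarith) (show f x ≤ f x + 1 by linarith)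
    nlinarith [mul_le_mul_of_nonneg_right this (h0 x)]


/-! ### Lower semicontinuity -/

lemma integral_eq_of_density {ν : Measure Torus} {f : 𝕊} (hf : Measurable f)
    (h0 : ∀ x, 0 ≤ f x) (h : ν = volume.withDensity fun x => ofReal (f x)) (ξ : 𝕊) :
    ∫ x, ξ x ∂ν = ∫ x, ξ x * f x := by
  rw [h]
  exact integral_withDensity_ofReal hf h0

lemma sum_integral_mul {m : ℕ} {u : Fin m → 𝕊} (hu : ∀ c, Integrable (u c)) {ξ : 𝕊}
    (hξ : Continuous ξ) : ∑ c, ∫ x, ξ x * u c x = ∫ x, ξ x * ∑ c, u c x := by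
  obtain ⟨B, _, hB⟩ := torus_bound hξ
  simp only [mul_sum]
  rw [integral_finsetSum _ fun c _ => (hu c).bdd_mul hξ.aestronglyMeasurable (.of_forall hB)]

/-- Sublevel sets of the dynamic rate function are closed under weak convergence. -/
lemma dynRate_le_of_tendsto {m : ℕ} {T lam A b : ℝ} (hT : 0 < T) (hlam : 0 < lam)
    {rbar : Fin m → ℝ} (hsum : ∑ c, rbar c = 1) (hb0 : 0 ≤ b) {μn : ℕ → ColorPath m T}
    {μ : ColorPath m T} (hreg : ∀ n, ∃ ρ v, IsRegularDensity lam rbar (μn n) ρ v ∧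
      ∀ φ, dynFunctional T lam ρ v φ ≤ b)
    (hA : ∀ n ξ, Continuous ξ →
      pairing ξ (μn n ⟨0, left_mem_Icc.2 hT.le⟩) ≤ A + log (∫ x, exp (ξ x)))
    (hlim : ∀ t c (ξ : 𝕊), Continuous ξ → Tendsto (fun n => ∫ x, ξ x ∂(μn n t c : Measure Torus)) atTop
      (𝓝 (∫ x, ξ x ∂(μ t c : Measure Torus)))) :
    dynRate lam rbar μ ≤ (b : EReal) := by
  choose ρn wn hρn hwn using hreg
  choose vn hvn _ hvw using fun n => (hρn n).exists_reg hlam hsum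
  have hpair : ∀ n (t : Icc 0 T) ξ, Continuous ξ →
      pairing ξ (μn n t) = ∫ x, ξ x * ∑ c, ρn n c t x := fun n t ξ hξ =>
    (sum_congr rfl fun c _ => (hρn n).integral_eq c t.2 ξ).trans
      (sum_integral_mul (fun c => (hρn n).integrable_slice c t.2) hξ)
  -- The uniform energy bound, together with the propagation of the entropy bound to all times.
  have hle := fun n => (hvn n).energy_le hlam hT hb0 (fun φ => (hvw n φ).trans_le (hwn n φ))
    (A := A) fun ξ hξ => (hpair n ⟨0, left_mem_Icc.2 hT.le⟩ ξ hξ).symm.trans_le (hA n ξ hξ)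
  -- In dual form the entropy bound is closed under weak convergence. It is the only source of
  -- densities for the limit path.
  have hDV : ∀ t ξ, Continuous ξ →
      pairing ξ (μ t) ≤ A + 2 * b + log (∫ x, exp (ξ x)) := fun t ξ hξ =>
    le_of_tendsto' (tendsto_finsetSum _ fun c _ => hlim t c ξ hξ) fun n =>
      (hpair n t ξ hξ).trans_le ((hle n).2 t t.2 ξ hξ)
  have hmass : ∀ t c, ((μ t c).mass : ℝ) = rbar c := fun t c => by
    have e : ∀ ν : FiniteMeasure Torus, ∫ _, (1 : ℝ) ∂(ν : Measure Torus) = ν.mass := fun ν => by simp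
    have h1 := hlim t c (fun _ => 1) continuous_const
    simp only [e, (hρn _).mass] at h1
    exact tendsto_nhds_unique h1 tendsto_const_nhds
  obtain ⟨ρ, hm, h0, hd⟩ := exists_density hT.le hDV hmass
  have hms : ∀ c t, Measurable (ρ c t) := fun c t => (hm c).comp measurable_prodMk_left
  have hint : ∀ c, ∀ t ∈ Icc 0 T, Integrable (ρ c t) := fun c t ht => by
    have : IsFiniteMeasure (volume.withDensity fun x => ofReal (ρ c t x)) := by
      rw [← hd ⟨t, ht⟩ c]
      infer_instance
    exact integrable_of_withDensity_finite (hms c t) (h0 c t)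
  have hI : ∀ (t : Icc 0 T) c (ξ : 𝕊), ∫ x, ξ x ∂(μ t c : Measure Torus) = ∫ x, ξ x * ρ c t x :=
    fun t c ξ => integral_eq_of_density (hms c t) (h0 c t) (hd t c) ξ
  have hpair' : ∀ (t : Icc 0 T) ξ, Continuous ξ →
      pairing ξ (μ t) = ∫ x, ξ x * ∑ c, ρ c t x := fun t ξ hξ =>
    (sum_congr rfl fun c _ => hI t c ξ).trans (sum_integral_mul (fun c => hint c t t.2) hξ)
  have hone : ∀ t ∈ Icc 0 T, ∫ x, ∑ c, ρ c t x = 1 := fun t ht => by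
    rw [integral_finsetSum _ fun c _ => hint c t ht]
    refine Eq.trans (sum_congr rfl fun c _ => ?_) hsum
    have h1 := hI ⟨t, ht⟩ c fun _ => 1
    simp only [one_mul] at h1
    rw [← hmass ⟨t, ht⟩ c, ← h1, integral_const, smul_eq_mul, mul_one]
    rfl
  have hL : LimitData T lam (4 * (A + 1 + 2 * b) + m * (32 + 32 * b)) ρn vn ρ :=
    ⟨hvn, fun n => (hle n).1, hm, h0, hint, hone, fun t ht c ξ hξ => by
      have h1 := hlim ⟨t, ht⟩ c ξ hξ
      rw [hI] at h1
      simpa only [(hρn _).integral_eq c ht ξ] using h1⟩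
  obtain ⟨v, hwg, hz, hen, hdyn⟩ := hL.exists_gradient hlam hT.le
  have hR : IsRegularDensity lam rbar μ ρ v := by
    refine ⟨hm, h0, hd, hmass, hwg, ?_, ?_⟩
    · simp only [energyDensity_eq hlam (fun c => h0 c _ _) (fun c => hz c _ _)]
      exact hen.lintegral_lt_top
    · have hD0 : DV (A + 2 * b) fun x => ∑ c, ρ c 0 x := fun ξ hξ =>
        (hpair' ⟨0, left_mem_Icc.2 hT.le⟩ ξ hξ).symm.trans_le (hDV _ ξ hξ)
      exact hD0.integrable_entropy (measurable_fun_sum _ fun c _ => hms c 0)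
        (integrable_finsetSum _ fun c _ => hint c 0 (left_mem_Icc.2 hT.le))
        (fun x => sum_nonneg fun c _ => h0 c 0 x) (hone 0 (left_mem_Icc.2 hT.le))
  refine (iInf₂_le_of_le ρ v (iInf_le _ hR)).trans (iSup_le fun φ => ?_)
  exact EReal.coe_le_coe_iff.2 (hdyn φ b fun n => (hvw n φ).trans_le (hwn n φ))

/-- The zero test function; outside the domain the infimum is empty. -/
lemma dynRate_nonneg {m : ℕ} {T lam : ℝ} {rbar : Fin m → ℝ} (μ : ColorPath m T) :
    0 ≤ dynRate lam rbar μ := by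
  refine le_iInf fun ρ => le_iInf fun v => le_iInf fun _ =>
    le_trans (le_of_eq ?_) (le_iSup _ fun _ => ⟨fun _ _ => 0, contDiff_const⟩)
  simp [dynFunctional, TestFunction.dt, TestFunction.dx, dotProduct]

/-- Weak convergence along a sequence, from convergence in the space of paths. -/
lemma exists_seq_of_frequently {m : ℕ} {T : ℝ} {μ : ColorPath m T} {P : ColorPath m T → Prop}
    (h : ∃ᶠ ν in 𝓝 μ, P ν) {M : ℝ} (hM : ∀ ν, P ν → ∀ t c, ((ν t c).mass : ℝ) ≤ M) :
    ∃ μn : ℕ → ColorPath m T, (∀ n, P (μn n)) ∧ ∀ t c (ξ : 𝕊), Continuous ξ →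
      Tendsto (fun n => ∫ x, ξ x ∂(μn n t c : Measure Torus)) atTop
        (𝓝 (∫ x, ξ x ∂(μ t c : Measure Torus))) := by
  let G : C(Torus, ℝ) → Fin m → C(ColorMeasure m, ℝ) := fun ξ c =>
    ⟨fun ν => ∫ x, ξ x ∂(ν c : Measure Torus),
      (continuous_integral_finiteMeasure ξ.continuous).comp (continuous_apply c)⟩
  let ξs := TopologicalSpace.denseSeq C(Torus, ℝ)
  -- A sequence is extracted from the neighbourhood filter with countably many test functions: the
  -- `n`-th path is close to `μ`, uniformly in time, on the first `n + 1` members of a dense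
  -- sequence. Bounded masses extend the convergence to all continuous functions.
  have hev : ∀ n : ℕ, ∀ᶠ ν in 𝓝 μ, ∀ j ∈ Finset.range (n + 1), ∀ c,
      dist ((G (ξs j) c).comp ν) ((G (ξs j) c).comp μ) < 1 / (n + 1) := fun n => by
    rw [Finset.eventually_all]
    intro j _
    rw [eventually_all]
    intro c
    exact Metric.tendsto_nhds.1 ((ContinuousMap.continuous_postcomp (G (ξs j) c)).tendsto μ) _
      (by positivity)
  choose μn hP hd using fun n => (h.and_eventually (hev n)).exists
  refine ⟨μn, hP, fun t c ξ hξ => ?_⟩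
  have hj : ∀ j, Tendsto (fun n => ∫ x, ξs j x ∂(μn n t c : Measure Torus)) atTop
      (𝓝 (∫ x, ξs j x ∂(μ t c : Measure Torus))) := fun j => by
    rw [tendsto_iff_dist_tendsto_zero]
    refine squeeze_zero' (.of_forall fun _ => dist_nonneg) ?_
      tendsto_one_div_add_atTop_nhds_zero_nat
    filter_upwards [eventually_ge_atTop j] with n hn
    exact (ContinuousMap.dist_apply_le_dist t).trans
      (hd n j (Finset.mem_range.2 (Nat.lt_succ_of_le hn)) c).le
  have happ : ∀ (ν : FiniteMeasure Torus) (j : ℕ), |(∫ x, ξ x ∂(ν : Measure Torus)) -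
      ∫ x, ξs j x ∂(ν : Measure Torus)| ≤ dist ⟨ξ, hξ⟩ (ξs j) * ν.mass := fun ν j => by
    rw [← integral_sub (integrable_finiteMeasure hξ _)
      (integrable_finiteMeasure (ξs j).continuous _)]
    have := norm_integral_le_of_norm_le_const (μ := (ν : Measure Torus))
      (f := fun x => ξ x - ξs j x) (.of_forall fun x => by
        rw [← dist_eq_norm]
        exact ContinuousMap.dist_apply_le_dist (f := ⟨ξ, hξ⟩) x)
    exact this
  set M' := max M (μ t c).mass with hM'
  have hM0 : 0 ≤ M' := (NNReal.coe_nonneg _).trans (le_max_right _ _)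
  rw [Metric.tendsto_atTop']
  intro η hη
  obtain ⟨j, hj'⟩ := (TopologicalSpace.denseRange_denseSeq C(Torus, ℝ)).exists_dist_lt ⟨ξ, hξ⟩
    (show 0 < η / (4 * (M' + 1)) by positivity)
  have hs : dist ⟨ξ, hξ⟩ (ξs j) * M' ≤ η / 4 := by
    refine (mul_le_mul hj'.le (by linarith : M' ≤ M' + 1) hM0 (by positivity)).trans_eq ?_
    field_simp
  obtain ⟨N, hN⟩ := eventually_atTop.1 (Metric.tendsto_nhds.1 (hj j) (η / 4) (by positivity))
  refine ⟨N, fun n hn => ?_⟩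
  have h1 := (happ (μn n t c) j).trans ((mul_le_mul_of_nonneg_left
    ((hM _ (hP n) t c).trans (le_max_left _ _)) dist_nonneg).trans hs)
  have h2 := (happ (μ t c) j).trans ((mul_le_mul_of_nonneg_left (le_max_right _ _)
    dist_nonneg).trans hs)
  have h3 := hN n hn.le
  rw [Real.dist_eq] at h3 ⊢
  have h4 := abs_le.1 h1
  have h5 := abs_le.1 h2
  have h6 := abs_lt.1 h3
  rw [abs_lt]
  constructor <;> linarith [h4.1, h4.2, h5.1, h5.2, h6.1, h6.2]

lemma sum_rbar_eq_one {m : ℕ} {color : ∀ N : ℕ, Fin N → Fin m} {rbar : Fin m → ℝ}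
    (hcolor : ∀ c, Tendsto (fun N : ℕ => ((univ.filter fun i => color N i = c).card : ℝ) / (N : ℝ))
      atTop (𝓝 (rbar c))) : ∑ c, rbar c = 1 := by
  refine tendsto_nhds_unique (tendsto_finsetSum _ fun c _ => hcolor c)
    (tendsto_const_nhds.congr' ?_)
  filter_upwards [eventually_gt_atTop 0] with N hN
  have h1 := Finset.card_eq_sum_card_fiberwise (f := color N) (s := univ)
    (t := univ) fun _ _ => Finset.mem_coe.2 (mem_univ _)
  rw [Finset.card_univ, Fintype.card_fin] at h1
  rw [← sum_div, ← Nat.cast_sum, ← h1, div_self (Nat.cast_ne_zero.2 hN.ne')]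

/-- If the rate were at most `y` frequently near `μ` but larger at `μ`, then `y` could be split as
`(y - w) + w` with each part below the respective rate at `μ`. Semicontinuity of the initial rate
forces dynamic rates below `w` frequently near `μ`, and closedness of the sublevel sets of the
dynamic rate gives a contradiction. -/
lemma colorRate_lowerSemicontinuous {m : ℕ} {T lam : ℝ} (hT : 0 < T) (hlam : 0 < lam)
    {rbar : Fin m → ℝ} (hr : ∀ c, 0 ≤ rbar c) (hsum : ∑ c, rbar c = 1)
    {Iinit : ColorMeasure m → ℝ≥0∞} (hI : LowerSemicontinuous Iinit)
    (hA : ∀ k : ℝ≥0, ∃ A : ℝ, ∀ ν, Iinit ν ≤ k → ∀ ξ, Continuous ξ →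
      pairing ξ ν ≤ A + log (∫ x, exp (ξ x))) :
    LowerSemicontinuous (colorRate hT lam rbar Iinit) := by
  intro μ y hy
  by_contra hcon
  rw [not_eventually] at hcon
  simp only [not_lt] at hcon
  set z : Icc 0 T := ⟨0, left_mem_Icc.2 hT.le⟩ with hz
  have hsplit : ∀ ν : ColorPath m T, colorRate hT lam rbar Iinit ν ≤ y →
      (Iinit (ν z) : EReal) ≤ y ∧ dynRate lam rbar ν ≤ y := fun ν hν =>
    ⟨(le_add_of_nonneg_right (dynRate_nonneg ν)).trans hν,
      (le_add_of_nonneg_left (EReal.coe_ennreal_nonneg _)).trans hν⟩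
  have hy0 : 0 ≤ y := by
    obtain ⟨ν, hν⟩ := hcon.exists
    exact (dynRate_nonneg ν).trans (hsplit ν hν).2
  lift y to ℝ using ⟨(hy.trans_le le_top).ne, (EReal.bot_lt_zero.trans_le hy0).ne'⟩
  rw [EReal.coe_nonneg] at hy0
  have hev : Continuous fun ν : ColorPath m T => ν z := continuous_eval_const z
  have hle : ∀ x : ℝ≥0∞, (x : EReal) ≤ y → x ≤ y.toNNReal := fun x hx => by
    have e : (y : EReal) = ((y.toNNReal : ℝ≥0∞) : EReal) :=
      ((EReal.coe_ennreal_ofReal (x := y)).trans (by rw [max_eq_left hy0])).symm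
    rwa [e, EReal.coe_ennreal_le_coe_ennreal_iff] at hx
  have hi0 : Iinit (μ z) ≤ y.toNNReal := by
    by_contra hlt
    rw [not_le] at hlt
    obtain ⟨ν, h1, h2⟩ := (hcon.and_eventually
      (hev.continuousAt.eventually (hI (μ z) _ hlt))).exists
    exact absurd (hle _ (hsplit ν h1).1) (not_le.2 h2)
  have hitop : Iinit (μ z) ≠ ∞ := (hi0.trans_lt ENNReal.coe_lt_top).ne
  have hie : (Iinit (μ z) : EReal) = ((Iinit (μ z)).toReal : EReal) := by
    conv_lhs => rw [← ENNReal.ofReal_toReal hitop]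
    rw [EReal.coe_ennreal_ofReal, max_eq_left ENNReal.toReal_nonneg]
  have hlt : ((y - (Iinit (μ z)).toReal : ℝ) : EReal) < dynRate lam rbar μ := by
    by_contra hge
    refine hy.not_ge ((add_le_add hie.le (not_lt.1 hge)).trans_eq ?_)
    rw [← EReal.coe_add, add_sub_cancel]
  -- The real number `w` lies strictly below the dynamic rate of `μ`, which may be infinite, while
  -- `y - w` lies strictly below the initial rate.
  obtain ⟨w, hw1, hw2⟩ := EReal.lt_iff_exists_real_btwn.1 hlt
  rw [EReal.coe_lt_coe_iff] at hw1
  have hev2 : ∀ᶠ ν : ColorPath m T in 𝓝 μ, ((y - w : ℝ) : EReal) < (Iinit (ν z) : EReal) := by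
    rcases lt_or_ge (y - w) 0 with h1 | h1
    · exact .of_forall fun ν => (EReal.coe_lt_coe_iff.2 h1).trans_le (EReal.coe_ennreal_nonneg _)
    · have h2 : ofReal (y - w) < Iinit (μ z) := by
        rw [ENNReal.ofReal_lt_iff_lt_toReal h1 hitop]
        linarith
      filter_upwards [hev.continuousAt.eventually (hI (μ z) _ h2)] with ν hν
      rw [gt_iff_lt, ← EReal.coe_ennreal_lt_coe_ennreal_iff, EReal.coe_ennreal_ofReal, max_eq_left h1] at hν
      exact hν
  have hP : ∃ᶠ ν in 𝓝 μ, (∃ ρ v, IsRegularDensity lam rbar ν ρ v ∧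
      ∀ φ, dynFunctional T lam ρ v φ ≤ w) ∧ 0 ≤ w ∧ Iinit (ν z) ≤ y.toNNReal := by
    refine (hcon.and_eventually hev2).mono fun ν ⟨h1, h2⟩ => ?_
    have h3 := hsplit ν h1
    have h4 : dynRate lam rbar ν < w := by
      by_contra hge
      have h5 := EReal.add_lt_add_of_lt_of_le h2 (not_lt.1 hge) (EReal.coe_ne_bot _)
        (h3.2.trans_lt (EReal.coe_lt_top y)).ne
      rw [← EReal.coe_add, sub_add_cancel] at h5
      exact h5.not_ge h1
    have h5 := h4
    simp only [dynRate, iInf_lt_iff] at h4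
    obtain ⟨ρ, v, hρ, hs⟩ := h4
    exact ⟨⟨ρ, v, hρ, fun φ => EReal.coe_le_coe_iff.1 ((le_iSup _ φ).trans hs.le)⟩,
      EReal.coe_nonneg.1 ((dynRate_nonneg ν).trans h5.le), hle _ h3.1⟩
  obtain ⟨A, hA⟩ := hA y.toNNReal
  obtain ⟨μn, hμn, hlim⟩ := exists_seq_of_frequently hP (M := 1) fun ν hν t c => by
    obtain ⟨⟨ρ, v, hρ, -⟩, -⟩ := hν
    rw [hρ.mass t c, ← hsum]
    exact single_le_sum (fun c _ => hr c) (mem_univ c)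
  exact hw2.not_ge (dynRate_le_of_tendsto hT hlam hsum (hμn 0).2.1 (fun n => (hμn n).1)
    (fun n => hA _ (hμn n).2.2) hlim)

end ColorLDP

theorem mainTheorem8 {m : ℕ} (T lam : ℝ) (hT : 0 < T) (hlam : 0 < lam)
    (color : ∀ N : ℕ, Fin N → Fin m) (rbar : Fin m → ℝ) (hrbar : ∀ c, 0 < rbar c)
    (hcolor : ∀ c, Tendsto
      (fun N : ℕ => ((Finset.univ.filter fun i => color N i = c).card : ℝ) / (N : ℝ))
      atTop (𝓝 (rbar c)))
    (ρ₀ : ColorLDP.Torus → ℝ) (hρ₀_meas : Measurable ρ₀) (hρ₀_nonneg : ∀ x, 0 ≤ ρ₀ x)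
    (hρ₀_bdd : ∃ C : ℝ, ∀ x, ρ₀ x ≤ C) (hρ₀_prob : ∫ x, ρ₀ x = 1)
    (Iinit : ColorLDP.ColorMeasure m → ℝ≥0∞)
    (hLDP : ColorLDP.SatisfiesLDP (fun N => ColorLDP.initialLaw ρ₀ N)
      (fun N => ColorLDP.empiricalColor (color N)) Iinit) :
    LowerSemicontinuous (ColorLDP.colorRate hT lam rbar Iinit) := by
  obtain ⟨C, hC⟩ := hρ₀_bdd
  have hC1 : 1 ≤ C := by
    have h1 := integral_mono (ColorLDP.integrable_of_integral_eq_one hρ₀_meas hρ₀_nonneg hρ₀_prob)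
      (integrable_const C) hC
    rwa [hρ₀_prob, integral_const, probReal_univ, one_smul] at h1
  refine ColorLDP.colorRate_lowerSemicontinuous hT hlam (fun c => (hrbar c).le)
    (ColorLDP.sum_rbar_eq_one hcolor) hLDP.lowerSemicontinuous fun k =>
      ⟨k + Real.log C, fun ν hν ξ hξ => ?_⟩
  -- The entropy constant is `k + log C`; the two logarithms combine into the form in which
  -- Chernoff's bound was stated.
  rw [add_assoc, ← Real.log_mul (by linarith) (ColorLDP.torus_integral_exp_pos hξ).ne']
  exact ColorLDP.pairing_le hρ₀_meas hρ₀_nonneg hρ₀_prob hC color hLDP hν hξ
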